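/- **Setting.** A *triangulation* $T$ is a finite connected closed oriented 4-dimensional complex glued from simplices: its vertices are linearly ordered, the vertices of each simplex are distinct (several simplices may have the same vertices), each simplex lies in a pentachoron (4-simplex), and each tetrahedron $t$ lies in exactly two pentachora, which are consistently oriented, i.e. induce opposite orientations on $t$. Triangulated closed connected oriented 4-manifolds are of this kind. Let $\omega$ be a $\mathbb C$-valued simplicial 2-cocycle on $T$ with all values $\omega_s\ne 0$, let $q_s$ be chosen square roots, $q_s^2=\omega_s$, and let $K_t=\prod_{s\subset t}q_s$ for each tetrahedron $t$. Cochain values are taken on simplices oriented by the vertex order. *Edge operators.* For a tetrahedron $t$ let $s_0,\dots,s_3$ be its faces opposite to its vertices in increasing order, and $w_a=(-1)^a\omega_{s_a}$. Choose linear functionals $\beta_t,\gamma_t$ on the simplicial 2-cocycles $c$ of $t$, say $\beta_t(c)=\sum_a b_a(-1)^ac_{s_a}$, such that $$2\beta_t(c)\gamma_t(c)=\sum_{a=0}^3(-1)^a\frac{c_{s_a}^2}{\omega_{s_a}},$$ $$K_t(b_0-b_1)=-w_2w_3(b_2-b_3),\quad K_t(b_1-b_2)=-w_0w_3(b_0-b_3),\quad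 K_t(b_2-b_0)=-w_1w_3(b_1-b_3).$$ Such $\beta_t,\gamma_t$ exist, and are unique up to $\beta_t\mapsto\lambda_t\beta_t$, $\gamma_t\mapsto\lambda_t^{-1}\gamma_t$, i.e. up to rescaling the Grassmann generators $\vartheta_t$. Write $\beta_{bt}=\beta_t(\delta b)$ for the coboundary of an edge $b\subset t$ (more exactly, of the 1-cochain equal to $1$ on $b$, oriented by the vertex order, and to $0$ on the other edges). Assume that for each pentachoron $u$ there is a skew-symmetric matrix $F^{(u)}$, with rows and columns corresponding to the 3-faces of $u$, such that $\varepsilon_{u,t'}\gamma_{t'}(c)=\sum_{t\subset u}\beta_t(c)F^{(u)}_{tt'}$ for all 2-cocycles $c$ on $u$ and all 3-faces $t'\subset u$, where $\varepsilon_{u,t'}=\pm1$ tells whether the orientation of $t'$ induced from $u$ agrees with its vertex order. (Equivalently, the Grassmann--Gaussian weight $\exp(-\frac12\sum F^{(u)}_{tt'}\vartheta_t\vartheta_{t'})$ is annihilated by the operators $\sum_t(\beta_t(c)\partial_t+\varepsilon_{u,t}\gamma_t(c)\vartheta_t)$.) *Factors $\eta_u$.* $\eta_u=\sqrt{\mathrm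 H_u}$ (any square root), where $$\mathrm H_u=\frac{\beta_{bt}\,q_{\{ijk\}}q_{\{ijl\}}q_{\{ijm\}}q_{\{klm\}}}{F_{iklm,ijkm}F_{jklm,ijlm}-F_{iklm,ijlm}F_{jklm,ijkm}},\qquad F=F^{(u)},\quad b=ij,\quad t=ijkl;$$ here $i,j,k,l,m$ are the vertices of $u$ written in any order that is an even permutation of their increasing order, with $i<j$ and $\beta_{bt}\ne0$. *Complex and torsion.* Consider $$0\to\mathbb C\xrightarrow{f_1}Z^2(T,\mathbb C)\xrightarrow{f_2}\mathbb C^{N_3}\xrightarrow{f_3}\mathbb C^{N_3}\xrightarrow{f_4}Z^2(T,\mathbb C)^*\xrightarrow{f_5}\mathbb C\to0,$$ where $N_3$ is the number of tetrahedra, $f_1(1)=\omega$, $f_2(c)=(\beta_t(c))_t$, $f_3=\sum_uF^{(u)}$, $f_4=f_2^{\mathrm T}$, $f_5=f_1^{\mathrm T}$. Given a basis of $H^2(T,\mathbb C)$, a distinguished basis of $Z^2(T,\mathbb C)$ consists of the coboundaries $\delta b$ of the edges $b$ outside a maximal tree of the 1-skeleton and of cocycles representing the basis of $H^2$. In such a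 basis, $$\sqrt\tau=\frac{\operatorname{minor}f_1\cdot\operatorname{Pf}(\text{submatrix of }f_3)}{\operatorname{minor}f_2},$$ where $\operatorname{minor}f_1$ is one entry of the column $f_1$, in a row $j$; $\operatorname{minor}f_2$ uses all columns except $j$ and the rows in a set $R$ of tetrahedra; the submatrix of $f_3$ has the rows and columns not in $R$; and all three submatrices are nondegenerate. Finally, $$I=\prod_{\text{2-faces }s}q_s^{-1}\prod_{\text{pentachora }u}\eta_u\cdot\sqrt\tau .$$ *First move 0--2.* Two tetrahedra $1456$ and $2456$ of $T$ with common 2-face $456$ are inflated into a pillow of two oppositely oriented pentachora with vertices $1,2,4,5,6$ (in any relative order), glued along the three tetrahedra $1245,1246,1256$. So in the new triangulation $T'$ there are two copies of $1456$, of $2456$ and of $456$, and new simplices inside the pillow: the edge $12$, the 2-faces $124,125,126$, the tetrahedra $1245,1246,1256$, and the two pentachora. All other simplices, the vertex order and the orientations of the other pentachora remain the same. **Theorem.** Let $T'$ be obtained from $T$ by a first move 0--2. Let $T$ and $T'$ be equipped with the structures described above (the choices of $\beta,\gamma$ being independent), such that $\omega$ and $q$ on $T'$ have the same values as on $T$ on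 all 2-faces of $T'$ not lying inside the pillow (both copies of $456$ carrying the old values), and let the bases of $H^2(T,\mathbb C)$ and $H^2(T',\mathbb C)$ correspond to each other under restriction of cocycles to the 2-faces not lying inside the pillow. Then: 1. the complex for $T'$ is acyclic if and only if the complex for $T$ is; 2. expression $I$, considered up to a sign, remains the same under the move: $I$ has for $T'$ the same set of values (for all permitted choices of maximal tree, representing cocycles, minors, orders of rows and columns, and square roots $\eta_u$) as for $T$, and any two of its values differ at most by a sign; 3. if the complex is acyclic and $H^1(T,\mathbb C)=0$ (so that the distinguished bases exist), then $I$ has a value, and it is non-zero. -/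

import Mathlib

open scoped BigOperators

noncomputable section

namespace FreeFermion

/-- A finite complex glued from simplices whose vertices are linearly ordered, in the broad sense:
the vertices of each simplex are distinct, but several simplices may have the same vertices.
`S n` is the set of `n`-simplices; the `n + 1` vertices of an `n`-simplex are numbered by
`Fin (n + 1)` in increasing order, and `res g x` is the face of `x` spanned by the vertices whose
numbers lie in the range of `g`. -/
structure OrderedComplex where
  S : ℕ → Type
  fintypeS : ∀ n, Fintype (S n)
  vertexOrder : LinearOrder (S 0)
  res : ∀ {m n : ℕ}, (Fin (m + 1) ↪o Fin (n + 1)) → S n → S m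
  res_id : ∀ {n : ℕ} (x : S n), res (RelEmbedding.refl (· ≤ ·)) x = x
  res_comp : ∀ {k m n : ℕ} (f : Fin (k + 1) ↪o Fin (m + 1)) (g : Fin (m + 1) ↪o Fin (n + 1))
    (x : S n), res f (res g x) = res (f.trans g) x
  vertices_increasing : ∀ {n : ℕ} (x : S n) (f g : Fin (0 + 1) ↪o Fin (n + 1)),
    f 0 < g 0 → res f x < res g x

attribute [instance] OrderedComplex.fintypeS OrderedComplex.vertexOrder

namespace OrderedComplex

variable (X : OrderedComplex)

/-- The face of `x` opposite to its vertex number `i`. -/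
def d {n : ℕ} (i : Fin (n + 2)) (x : X.S (n + 1)) : X.S n :=
  X.res (Fin.succAboveOrderEmb i) x

/-- The face of `x` spanned by the vertices with numbers in `s`. -/
def face {m n : ℕ} (x : X.S n) (s : Finset (Fin (n + 1))) (h : s.card = m + 1) : X.S m :=
  X.res (s.orderEmbOfFin h) x

/-- The simplicial coboundary of complex cochains. -/
def cob (n : ℕ) : (X.S n → ℂ) →ₗ[ℂ] (X.S (n + 1) → ℂ) where
  toFun c x := ∑ i : Fin (n + 2), (-1 : ℂ) ^ (i : ℕ) * c (X.d i x)
  map_add' c c' := by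
    funext x
    simp [mul_add, Finset.sum_add_distrib]
  map_smul' a c := by
    funext x
    simp only [Pi.smul_apply, smul_eq_mul, RingHom.id_apply, Finset.mul_sum]
    exact Finset.sum_congr rfl fun i _ => by ring

/-- The space of 2-cocycles. -/
def Z2 : Submodule ℂ (X.S 2 → ℂ) := LinearMap.ker (X.cob 2)

/-- The 2-coboundaries, as a subspace of the 2-cocycles. -/
def B2 : Submodule ℂ X.Z2 := (LinearMap.range (X.cob 1)).submoduleOf X.Z2

/-- The second cohomology space. -/
abbrev H2 : Type := X.Z2 ⧸ X.B2

/-- The first complex cohomology vanishes. -/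
def H1Vanishes : Prop := LinearMap.ker (X.cob 1) = LinearMap.range (X.cob 0)

open Classical in
/-- The coboundary of the 1-cochain equal to 1 on the edge `b` (oriented from its smaller to its
larger vertex) and to 0 on all other edges. -/
def edgeCob (b : X.S 1) : X.S 2 → ℂ := X.cob 1 (Pi.single b 1)

/-- Two vertices are joined by an edge belonging to `A`. -/
def Joined (A : Finset (X.S 1)) (v w : X.S 0) : Prop := ∃ e ∈ A, X.d 1 e = v ∧ X.d 0 e = w

/-- The set of edges `A` is a maximal tree of the 1-skeleton: it connects all the vertices, and the
number of its edges is the number of vertices minus one. -/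
def IsMaximalTree (A : Finset (X.S 1)) : Prop :=
  (∀ v w, Relation.EqvGen (X.Joined A) v w) ∧ A.card + 1 = Fintype.card (X.S 0)

end OrderedComplex

/-- A connected closed 4-dimensional ordered complex with consistently oriented pentachora:
each tetrahedron is a face of exactly two pentachora, which induce opposite orientations on it.
`orient u = 1` means that the orientation of `u` is given by the order of its vertices. -/
structure Triangulation extends OrderedComplex where
  dim_le : ∀ n, 4 < n → IsEmpty (S n)
  pure : ∀ n, n < 4 → ∀ x : S n, ∃ (y : S (n + 1)) (i : Fin (n + 2)),
    toOrderedComplex.d i y = x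
  connected : ∀ v w, Relation.EqvGen (toOrderedComplex.Joined Finset.univ) v w
  orient : S 4 → ℤˣ
  closed : ∀ t : S 3, ∃ (u v : S 4) (i j : Fin 5), (u, i) ≠ (v, j) ∧
    toOrderedComplex.d i u = t ∧ toOrderedComplex.d j v = t ∧
    (∀ (w : S 4) (k : Fin 5), toOrderedComplex.d k w = t → (w, k) = (u, i) ∨ (w, k) = (v, j)) ∧
    orient u * (-1) ^ (i : ℕ) = -(orient v * (-1) ^ (j : ℕ))

/-- A 2-cocycle `ω` with non-zero values, with chosen square roots `q` of its values. -/
structure Coloring (X : OrderedComplex) where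
  ω : X.S 2 → ℂ
  q : X.S 2 → ℂ
  cocycle : ω ∈ X.Z2
  ne_zero : ∀ s, ω s ≠ 0
  sq : ∀ s, q s ^ 2 = ω s

namespace Coloring

variable {X : OrderedComplex} (C : Coloring X)

/-- The value of `ω` on the face of the tetrahedron `t` opposite to its vertex number `a`, this face
being oriented as a part of the boundary of `t`. -/
def w (t : X.S 3) (a : Fin 4) : ℂ := (-1) ^ (a : ℕ) * C.ω (X.d a t)

/-- The square root `K_t` of the product of the four values of `ω` on the faces of `t`. -/
def K (t : X.S 3) : ℂ := ∏ a : Fin 4, C.q (X.d a t)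

end Coloring

/-- The linear functional on 2-cochains with coefficients `b` in the values of the cochain on the
faces of `t`, oriented as the boundary of `t`. -/
def tetEval {X : OrderedComplex} (t : X.S 3) (b : Fin 4 → ℂ) (c : X.S 2 → ℂ) : ℂ :=
  ∑ a : Fin 4, b a * ((-1) ^ (a : ℕ) * c (X.d a t))

/-- The edge operators. To each 2-cocycle `c`, in particular to each coboundary `c = δb` of an edge,
correspond in each tetrahedron `t` the coefficient `β_t(c)` of the differentiation `∂_t` and the
coefficient `γ_t(c)` of the multiplication by `ϑ_t`, both depending linearly on the values of `c` on
the faces of `t`, so that `β_{bt} = β_t(δb)` and `γ_{bt} = γ_t(δb)`. The anticommutator of two such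
operators is the polarization of the quadratic form `2 β_t γ_t`. It vanishes for two opposite edges
of `t`, it is `± 1/ω_s` for two edges contained in the common 2-face `s`, and the operator of `ω`
itself vanishes: all this is said by `anticomm`. The two linear factors of the quadratic form are
distinguished by the square root `K_t` in the three relations `root`.
The remaining freedom is the rescaling `ϑ_t ↦ const · ϑ_t` of Grassmann generators, one for each
`t`. The coefficients `γ` correspond to the orientation of `t` given by the order of vertices; they
change sign with the orientation of `t`. -/
structure EdgeOperators {X : OrderedComplex} (C : Coloring X) where
  bcoef : X.S 3 → Fin 4 → ℂ
  gcoef : X.S 3 → Fin 4 → ℂ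
  anticomm : ∀ (t : X.S 3) (c : X.S 2 → ℂ), X.cob 2 c t = 0 →
    2 * tetEval t (bcoef t) c * tetEval t (gcoef t) c =
      ∑ a : Fin 4, (-1) ^ (a : ℕ) * c (X.d a t) ^ 2 / C.ω (X.d a t)
  root : ∀ t : X.S 3,
    C.K t * (bcoef t 0 - bcoef t 1) = -(C.w t 2 * C.w t 3 * (bcoef t 2 - bcoef t 3)) ∧
    C.K t * (bcoef t 1 - bcoef t 2) = -(C.w t 0 * C.w t 3 * (bcoef t 0 - bcoef t 3)) ∧
    C.K t * (bcoef t 2 - bcoef t 0) = -(C.w t 1 * C.w t 3 * (bcoef t 1 - bcoef t 3))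

namespace EdgeOperators

variable {X : OrderedComplex} {C : Coloring X} (D : EdgeOperators C)

/-- The coefficient of `∂_t` in the operator corresponding to the cocycle `c`. -/
def β (t : X.S 3) (c : X.S 2 → ℂ) : ℂ := tetEval t (D.bcoef t) c

/-- The coefficient of `ϑ_t` in the operator corresponding to the cocycle `c`, for `t` oriented by
the order of its vertices. -/
def γ (t : X.S 3) (c : X.S 2 → ℂ) : ℂ := tetEval t (D.gcoef t) c

end EdgeOperators

/-- Factorization of the quadratic form of a tetrahedron, generic case. -/
theorem factor_aux (w0 w1 w2 w3 K : ℂ) (h0 : w0 ≠ 0) (h1 : w1 ≠ 0) (h2 : w2 ≠ 0) (h3 : w3 ≠ 0)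
    (hs : w0 + w1 + w2 + w3 = 0) (hK : K ^ 2 = w0 * w1 * w2 * w3) (h13 : w1 + w3 ≠ 0) :
    ∃ b0 b1 b2 g0 g1 g2 : ℂ,
      (∀ z0 z1 z2 z3 : ℂ, z0 + z1 + z2 + z3 = 0 →
        2 * (b0 * z0 + b1 * z1 + b2 * z2) * (g0 * z0 + g1 * z1 + g2 * z2) =
          z0 ^ 2 / w0 + z1 ^ 2 / w1 + z2 ^ 2 / w2 + z3 ^ 2 / w3) ∧
      K * (b0 - b1) = -(w2 * w3 * b2) ∧ K * (b1 - b2) = -(w0 * w3 * b0) ∧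
      K * (b2 - b0) = -(w1 * w3 * b1) := by
  set N : ℂ := 2 * w0 * w1 ^ 2 * w2 * w3 ^ 2 * (w1 + w3) with hN
  have hN0 : N ≠ 0 := by
    rw [hN]
    simp [h0, h1, h2, h3, h13]
  refine ⟨w1 * (K - w2 * w3), K * (w1 + w3), w1 * (K + w0 * w3),
    w1 * (K + w2 * w3) / N, K * (w1 + w3) / N, w1 * (K - w0 * w3) / N, ?_, ?_, ?_, ?_⟩
  · intro z0 z1 z2 z3 hz
    have key : (w0 * w1 * w2 * w3) * (w1 * z0 + (w1 + w3) * z1 + w1 * z2) ^ 2 -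
        (w1 * w3 * (w0 * z2 - w2 * z0)) ^ 2 = w1 * w3 * (w1 + w3) *
        (z0 ^ 2 * (w1 * w2 * w3) + z1 ^ 2 * (w0 * w2 * w3) + z2 ^ 2 * (w0 * w1 * w3) +
          z3 ^ 2 * (w0 * w1 * w2)) := by
      have e3 : z3 = -(z0 + z1 + z2) := by linear_combination hz
      have e2 : w2 = -(w0 + w1 + w3) := by linear_combination hs
      subst e3 e2
      ring
    have hQ : z0 ^ 2 / w0 + z1 ^ 2 / w1 + z2 ^ 2 / w2 + z3 ^ 2 / w3 =
        (z0 ^ 2 * (w1 * w2 * w3) + z1 ^ 2 * (w0 * w2 * w3) + z2 ^ 2 * (w0 * w1 * w3) +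
          z3 ^ 2 * (w0 * w1 * w2)) / (w0 * w1 * w2 * w3) := by
      field_simp
    have hL : 2 * (w1 * (K - w2 * w3) * z0 + K * (w1 + w3) * z1 + w1 * (K + w0 * w3) * z2) *
        (w1 * (K + w2 * w3) / N * z0 + K * (w1 + w3) / N * z1 + w1 * (K - w0 * w3) / N * z2) =
        2 * (K ^ 2 * (w1 * z0 + (w1 + w3) * z1 + w1 * z2) ^ 2 -
        (w1 * w3 * (w0 * z2 - w2 * z0)) ^ 2) / N := by
      field_simp
      ring
    rw [hL, hQ, hK, key, hN, div_eq_div_iff (hN ▸ hN0) (by simp [h0, h1, h2, h3])]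
    ring
  · linear_combination (-w3) * hK
  · linear_combination w3 * hK
  · linear_combination K * w1 * w3 * hs

/-- Factorization of the quadratic form of a tetrahedron. -/
theorem factor_exists (w0 w1 w2 w3 K : ℂ) (h0 : w0 ≠ 0) (h1 : w1 ≠ 0) (h2 : w2 ≠ 0)
    (h3 : w3 ≠ 0) (hs : w0 + w1 + w2 + w3 = 0) (hK : K ^ 2 = w0 * w1 * w2 * w3) :
    ∃ b0 b1 b2 g0 g1 g2 : ℂ,
      (∀ z0 z1 z2 z3 : ℂ, z0 + z1 + z2 + z3 = 0 →
        2 * (b0 * z0 + b1 * z1 + b2 * z2) * (g0 * z0 + g1 * z1 + g2 * z2) =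
          z0 ^ 2 / w0 + z1 ^ 2 / w1 + z2 ^ 2 / w2 + z3 ^ 2 / w3) ∧
      K * (b0 - b1) = -(w2 * w3 * b2) ∧ K * (b1 - b2) = -(w0 * w3 * b0) ∧
      K * (b2 - b0) = -(w1 * w3 * b1) := by
  by_cases h13 : w1 + w3 = 0
  · by_cases h23 : w2 + w3 = 0
    · have h03 : w0 + w3 ≠ 0 := by
        intro h03
        apply h3
        linear_combination (1 / 2 : ℂ) * (h13 + h23 + h03 - hs)
      obtain ⟨b2, b0, b1, g2, g0, g1, hq, r1, r2, r3⟩ := factor_aux w2 w0 w1 w3 K h2 h0 h1 h3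
        (by linear_combination hs) (by rw [hK]; ring) h03
      refine ⟨b0, b1, b2, g0, g1, g2, fun z0 z1 z2 z3 hz => ?_, r2, r3, r1⟩
      have := hq z2 z0 z1 z3 (by linear_combination hz)
      linear_combination this
    · obtain ⟨b1, b2, b0, g1, g2, g0, hq, r1, r2, r3⟩ := factor_aux w1 w2 w0 w3 K h1 h2 h0 h3
        (by linear_combination hs) (by rw [hK]; ring) h23
      refine ⟨b0, b1, b2, g0, g1, g2, fun z0 z1 z2 z3 hz => ?_, r3, r1, r2⟩
      have := hq z1 z2 z0 z3 (by linear_combination hz)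
      linear_combination this
  · exact factor_aux w0 w1 w2 w3 K h0 h1 h2 h3 hs hK h13

/-- Edge operators exist for every coloring. -/
theorem EdgeOperators.nonempty {X : OrderedComplex} (C : Coloring X) :
    Nonempty (EdgeOperators C) := by
  have hx : ∀ t : X.S 3, ∃ b g : Fin 4 → ℂ, (∀ c : X.S 2 → ℂ, X.cob 2 c t = 0 →
      2 * tetEval t b c * tetEval t g c =
        ∑ a : Fin 4, (-1) ^ (a : ℕ) * c (X.d a t) ^ 2 / C.ω (X.d a t)) ∧
      C.K t * (b 0 - b 1) = -(C.w t 2 * C.w t 3 * (b 2 - b 3)) ∧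
      C.K t * (b 1 - b 2) = -(C.w t 0 * C.w t 3 * (b 0 - b 3)) ∧
      C.K t * (b 2 - b 0) = -(C.w t 1 * C.w t 3 * (b 1 - b 3)) := by
    intro t
    have hw : ∀ a, C.w t a ≠ 0 := fun a => by simp [Coloring.w, C.ne_zero]
    have hc : X.cob 2 C.ω t = 0 := congrFun (LinearMap.mem_ker.1 C.cocycle) t
    have hs : C.w t 0 + C.w t 1 + C.w t 2 + C.w t 3 = 0 := by
      rw [← hc]
      exact (Fin.sum_univ_four fun i : Fin 4 => (-1 : ℂ) ^ (i : ℕ) * C.ω (X.d i t)).symm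
    have hK : C.K t ^ 2 = C.w t 0 * C.w t 1 * C.w t 2 * C.w t 3 := by
      simp only [Coloring.K, Coloring.w, Fin.prod_univ_four, mul_pow, C.sq]
      norm_num
    obtain ⟨b0, b1, b2, g0, g1, g2, hq, r1, r2, r3⟩ :=
      factor_exists _ _ _ _ _ (hw 0) (hw 1) (hw 2) (hw 3) hs hK
    refine ⟨![b0, b1, b2, 0], ![g0, g1, g2, 0], fun c hcc => ?_, ?_, ?_, ?_⟩
    · have hz : (-1) ^ ((0 : Fin 4) : ℕ) * c (X.d 0 t) + (-1) ^ ((1 : Fin 4) : ℕ) * c (X.d 1 t) +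
          (-1) ^ ((2 : Fin 4) : ℕ) * c (X.d 2 t) + (-1) ^ ((3 : Fin 4) : ℕ) * c (X.d 3 t) = 0 := by
        rw [← hcc]
        exact (Fin.sum_univ_four fun i : Fin 4 => (-1 : ℂ) ^ (i : ℕ) * c (X.d i t)).symm
      have := hq _ _ _ _ hz
      simp [tetEval, Fin.sum_univ_four, Coloring.w] at this ⊢
      linear_combination this
    · simpa using r1
    · simpa using r2
    · simpa using r3
  choose b g h1 h2 using hx
  exact ⟨⟨b, g, h1, h2⟩⟩

/-- The Pfaffian of a skew-symmetric matrix whose rows and columns are numbered by `Fin r × Fin 2`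
(in the lexicographic order). -/
def pfaffian {r : ℕ} (A : Matrix (Fin r × Fin 2) (Fin r × Fin 2) ℂ) : ℂ :=
  ((2 : ℂ) ^ r * (r.factorial : ℂ))⁻¹ *
    ∑ σ : Equiv.Perm (Fin r × Fin 2),
      ((Equiv.Perm.sign σ : ℤ) : ℂ) * ∏ i : Fin r, A (σ (i, 0)) (σ (i, 1))

/-- A triangulation with a coloring, edge operators, and for each pentachoron `u` the skew-symmetric
matrix `F u` of its Grassmann--Gaussian weight `exp(-1/2 · ∑ F_{tt'} ϑ_t ϑ_{t'})`. The rows and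
columns of `F u` with number `i` correspond to the 3-face opposite to the vertex number `i`. -/
structure System where
  T : Triangulation
  C : Coloring T.toOrderedComplex
  D : EdgeOperators C
  F : T.S 4 → Matrix (Fin 5) (Fin 5) ℂ
  skew : ∀ u, (F u).transpose = -F u
  /-- The weight of `u` is annihilated by the operators `∑_t (β_t(c) ∂_t + γ_t(c) ϑ_t)` of all
  cocycles `c` on `u`, where each 3-face `t` of `u` has the orientation induced from `u`. -/
  annihilate : ∀ (u : T.S 4) (c : T.S 2 → ℂ),
    (∀ i, T.cob 2 c (T.d i u) = 0) → ∀ j : Fin 5,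
      ((T.orient u * (-1) ^ (j : ℕ) : ℤˣ) : ℤ) * D.γ (T.d j u) c =
        ∑ i : Fin 5, D.β (T.d i u) c * F u i j

namespace System

variable (Y : System)

/-- The face of the pentachoron `u` spanned by its vertices with numbers `σ i`, `i ∈ s`. -/
def labFace {m : ℕ} (u : Y.T.S 4) (σ : Equiv.Perm (Fin 5)) (s : Finset (Fin 5))
    (h : s.card = m + 1) : Y.T.S m :=
  Y.T.face u (s.map σ.toEmbedding) (by rw [Finset.card_map, h])

/-- The coefficient `β_{bt}` for the edge `b = ij` and the tetrahedron `t = ijkl` of the pentachoron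
`u` with vertices `i, j, k, l, m = σ 0, σ 1, σ 2, σ 3, σ 4`, where `i < j`. -/
def betaEdge (u : Y.T.S 4) (σ : Equiv.Perm (Fin 5)) : ℂ :=
  Y.D.β (Y.T.d (σ 4) u) (Y.T.edgeCob (Y.labFace u σ {0, 1} rfl))

/-- The quantity `H_u` calculated for the vertices `i, j, k, l, m = σ 0, …, σ 4`:
`β_{bt} q_{ijk} q_{ijl} q_{ijm} q_{klm}` divided by
`F_{iklm,ijkm} F_{jklm,ijlm} - F_{iklm,ijlm} F_{jklm,ijkm}`. -/
def H (u : Y.T.S 4) (σ : Equiv.Perm (Fin 5)) : ℂ :=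
  Y.betaEdge u σ * Y.C.q (Y.labFace u σ {0, 1, 2} rfl) * Y.C.q (Y.labFace u σ {0, 1, 3} rfl) *
      Y.C.q (Y.labFace u σ {0, 1, 4} rfl) * Y.C.q (Y.labFace u σ {2, 3, 4} rfl) /
    (Y.F u (σ 1) (σ 3) * Y.F u (σ 0) (σ 2) - Y.F u (σ 1) (σ 2) * Y.F u (σ 0) (σ 3))

/-- `η` is a value of `η_u = √H_u`. Here `H_u` may be calculated for any pair of an edge `b = ij` and
a tetrahedron `t = ijkl` in `u = ijklm` for which its expression is not the fraction `0/0`;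
`i < j`, and the permutation `ijklm` of the vertices of `u` is even. -/
def IsEta (u : Y.T.S 4) (η : ℂ) : Prop :=
  ∃ σ : Equiv.Perm (Fin 5), Equiv.Perm.sign σ = 1 ∧ σ 0 < σ 1 ∧ Y.betaEdge u σ ≠ 0 ∧
    η ^ 2 = Y.H u σ

/-! The chain complex `0 → ℂ → Z² → ℂ^{N₃} → ℂ^{N₃} → (Z²)^* → ℂ → 0`. -/

/-- The first mapping sends `1` to `ω`. -/
def f1 : ℂ →ₗ[ℂ] Y.T.Z2 := LinearMap.toSpanSingleton ℂ Y.T.Z2 ⟨Y.C.ω, Y.C.cocycle⟩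

/-- The second mapping sends a cocycle to the coefficients of its global operator
`∑_t β_t(c) ∂_t`. -/
def f2 : Y.T.Z2 →ₗ[ℂ] (Y.T.S 3 → ℂ) where
  toFun c t := Y.D.β t c
  map_add' c c' := by
    funext t
    simp [EdgeOperators.β, tetEval, mul_add, Finset.sum_add_distrib]
  map_smul' a c := by
    funext t
    simp only [EdgeOperators.β, tetEval, Submodule.coe_smul, Pi.smul_apply, smul_eq_mul,
      RingHom.id_apply, Finset.mul_sum]
    exact Finset.sum_congr rfl fun i _ => by ring

open Classical in
/-- The skew-symmetric matrix of the third mapping: the sum of the matrices `F u` over all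
pentachora, so that the product of all weights is `exp(-1/2 · ∑ (f₃)_{tt'} ϑ_t ϑ_{t'})`. -/
def f3Matrix : Matrix (Y.T.S 3) (Y.T.S 3) ℂ := fun t t' =>
  ∑ u : Y.T.S 4, ∑ i : Fin 5, ∑ j : Fin 5,
    if Y.T.d i u = t ∧ Y.T.d j u = t' then Y.F u i j else 0

/-- The third mapping. -/
def f3 : (Y.T.S 3 → ℂ) →ₗ[ℂ] (Y.T.S 3 → ℂ) := Y.f3Matrix.mulVecLin

/-- The fourth mapping is the transpose of the second one. -/
def f4 : (Y.T.S 3 → ℂ) →ₗ[ℂ] Module.Dual ℂ Y.T.Z2 where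
  toFun y := (dotProductBilin ℂ ℂ y).comp Y.f2
  map_add' y y' := by
    ext c
    simp
  map_smul' a y := by
    ext c
    simp

/-- The fifth mapping is the transpose of the first one. -/
def f5 : Module.Dual ℂ Y.T.Z2 →ₗ[ℂ] ℂ :=
  Module.Dual.eval ℂ Y.T.Z2 ⟨Y.C.ω, Y.C.cocycle⟩

/-- The chain complex is acyclic. -/
def Acyclic : Prop :=
  Function.Injective Y.f1 ∧ Function.Exact Y.f1 Y.f2 ∧ Function.Exact Y.f2 Y.f3 ∧
    Function.Exact Y.f3 Y.f4 ∧ Function.Exact Y.f4 Y.f5 ∧ Function.Surjective Y.f5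

/-- A distinguished basis of the space of 2-cocycles: the coboundaries of the edges not belonging
to a maximal tree `A`, and cocycles representing the elements of the given basis `h` of `H²`. -/
def IsDistinguished {κ : Type} (h : Module.Basis κ ℂ Y.T.H2) (A : Finset (Y.T.S 1))
    (e : Module.Basis ({b : Y.T.S 1 // b ∉ A} ⊕ κ) ℂ Y.T.Z2) : Prop :=
  Y.T.IsMaximalTree A ∧ (∀ b, ((e (Sum.inl b) : Y.T.Z2) : Y.T.S 2 → ℂ) = Y.T.edgeCob b.1) ∧
    ∀ k, Y.T.B2.mkQ (e (Sum.inr k)) = h k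

open Classical in
/-- `x` is a value of the square root of the torsion,
`(minor f₁) · Pf(submatrix of f₃) / (minor f₂)`. The mappings are written as matrices in a
distinguished basis of `Z²` and the standard basis of `ℂ^{N₃}`. The row `j` is used in the minor of
`f₁`; the columns other than `j` and the rows in the set of tetrahedra `R` are used in the minor of
`f₂`; the rows and columns not in `R` are used in the submatrix of `f₃`. All these submatrices are
nondegenerate. The numberings `r` and `p` specify the orders of rows and columns. -/
def IsSqrtTorsion {κ : Type} [Fintype κ] (h : Module.Basis κ ℂ Y.T.H2) (x : ℂ) : Prop :=
  ∃ (A : Finset (Y.T.S 1)) (e : Module.Basis ({b : Y.T.S 1 // b ∉ A} ⊕ κ) ℂ Y.T.Z2)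
    (j : {b : Y.T.S 1 // b ∉ A} ⊕ κ) (R : Finset (Y.T.S 3))
    (r : {i : {b : Y.T.S 1 // b ∉ A} ⊕ κ // i ≠ j} ≃ {t : Y.T.S 3 // t ∈ R})
    (n : ℕ) (p : Fin n × Fin 2 ≃ {t : Y.T.S 3 // t ∉ R}),
    Y.IsDistinguished h A e ∧
    let m1 : ℂ := e.repr (Y.f1 1) j
    let m2 : ℂ := Matrix.det (Matrix.of fun i i' : {i : {b : Y.T.S 1 // b ∉ A} ⊕ κ // i ≠ j} =>
      Y.f2 (e i'.1) (r i).1)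
    let pf : ℂ := pfaffian (Y.f3Matrix.submatrix (fun i => (p i).1) (fun i => (p i).1))
    m1 ≠ 0 ∧ m2 ≠ 0 ∧ pf ≠ 0 ∧ x = m1 * pf / m2

/-- `x` is a value of the quantity `I = ∏_s q_s⁻¹ · ∏_u η_u · √τ`. -/
def IsInvariantValue {κ : Type} [Fintype κ] (h : Module.Basis κ ℂ Y.T.H2) (x : ℂ) : Prop :=
  ∃ (η : Y.T.S 4 → ℂ) (rt : ℂ), (∀ u, Y.IsEta u (η u)) ∧ Y.IsSqrtTorsion h rt ∧
    x = (∏ s, (Y.C.q s)⁻¹) * (∏ u, η u) * rt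

end System

/-- The `n`-simplices of the pillow made of `u` and `v` which contain both the vertex number `a` and
the vertex number `b`. -/
def pillowInner (X : OrderedComplex) (u v : X.S 4) (a b : Fin 5) (n : ℕ) : Set (X.S n) :=
  {x | ∃ g : Fin (n + 1) ↪o Fin (4 + 1),
    a ∈ Set.range g ∧ b ∈ Set.range g ∧ (x = X.res g u ∨ x = X.res g v)}

/-- The triangulation `T'` is obtained from `T` by the first move 0--2: two tetrahedra `1456` and
`2456` of `T` with the common 2-face `456` are inflated into a pillow of two oppositely oriented
pentachora `u` and `v` of `T'` with vertices `1, 2, 4, 5, 6`. The vertices `1` and `2` are the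
vertices number `a` and `b` of `u` and of `v`. The new simplices inside the pillow are those which
contain both `1` and `2`. The remaining simplices of `T'` are mapped by `collapse` onto the
simplices of `T`; the simplices of `u` and `v` with the same vertices are identified by this
mapping, and otherwise it is bijective. -/
structure FirstMove (T T' : Triangulation) where
  u : T'.S 4
  v : T'.S 4
  a : Fin 5
  b : Fin 5
  lt : a < b
  opposite : T'.orient v = -T'.orient u
  /-- `u` and `v` are glued along the three tetrahedra containing both `1` and `2`. -/
  glued : ∀ c : Fin 5, c ≠ a → c ≠ b → T'.d c u = T'.d c v
  /-- There are two copies of the tetrahedron `2456`. -/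
  doubled_a : T'.d a u ≠ T'.d a v
  /-- There are two copies of the tetrahedron `1456`. -/
  doubled_b : T'.d b u ≠ T'.d b v
  /-- There are two copies of the 2-face `456`. -/
  doubled_face : ∀ g : Fin (2 + 1) ↪o Fin (4 + 1), a ∉ Set.range g → b ∉ Set.range g →
    T'.res g u ≠ T'.res g v
  collapse : ∀ n, {x : T'.S n // x ∉ pillowInner T'.toOrderedComplex u v a b n} → T.S n
  /-- The simplices not inside the pillow form a subcomplex, and `collapse` respects faces. -/
  collapse_res : ∀ {m n : ℕ} (g : Fin (m + 1) ↪o Fin (n + 1)) (x : T'.S n)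
    (hx : x ∉ pillowInner T'.toOrderedComplex u v a b n),
    ∃ hy : T'.res g x ∉ pillowInner T'.toOrderedComplex u v a b m,
      collapse m ⟨T'.res g x, hy⟩ = T.res g (collapse n ⟨x, hx⟩)
  collapse_surjective : ∀ n, Function.Surjective (collapse n)
  collapse_eq_iff : ∀ n (x y : {x : T'.S n // x ∉ pillowInner T'.toOrderedComplex u v a b n}),
    collapse n x = collapse n y ↔ x = y ∨ ∃ g : Fin (n + 1) ↪o Fin (4 + 1),
      (x.1 = T'.res g u ∧ y.1 = T'.res g v) ∨ (x.1 = T'.res g v ∧ y.1 = T'.res g u)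
  collapse_lt_iff : ∀ x y : {x : T'.S 0 // x ∉ pillowInner T'.toOrderedComplex u v a b 0},
    collapse 0 x < collapse 0 y ↔ x.1 < y.1
  collapse_orient : ∀ x : {x : T'.S 4 // x ∉ pillowInner T'.toOrderedComplex u v a b 4},
    T.orient (collapse 4 x) = T'.orient x.1

namespace FirstMove

variable {T T' : Triangulation} (M : FirstMove T T')

/-- The 2-cochain `c'` on `T'` extends the 2-cochain `c` on `T`: their values agree on all 2-faces
not lying inside the pillow. -/
def Extends (c : T.S 2 → ℂ) (c' : T'.S 2 → ℂ) : Prop :=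
  ∀ x : {x : T'.S 2 // x ∉ pillowInner T'.toOrderedComplex M.u M.v M.a M.b 2},
    c' x.1 = c (M.collapse 2 x)

/-- The bases `h` and `h'` of the second cohomology of `T` and `T'` correspond to each other: each
cocycle on `T` and each of its extensions to `T'` have the same coordinates. -/
def SameBasis {κ : Type} (h : Module.Basis κ ℂ T.H2) (h' : Module.Basis κ ℂ T'.H2) : Prop :=
  ∀ (c : T.Z2) (c' : T'.Z2), M.Extends c c' → h.repr (T.B2.mkQ c) = h'.repr (T'.B2.mkQ c')

end FirstMove

end FreeFermion

end

open scoped BigOperators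

noncomputable section

namespace FreeFermion

/-! ### Pfaffians of skew-symmetric matrices -/

section

open Matrix

/-! All signs and square roots disappear on squaring: `x` is a value of `I` exactly when `x ^ 2`
equals one number, a product of a local factor and a squared torsion. The theorem is a computation
of how these two change under the move; the changes are mutually inverse powers of one ratio.

Local factor. In a pentachoron a 2-cocycle is an antisymmetric 5×5 matrix with zero column sums, and
the common kernel of the five functionals β is the line of ω (`PentData.kernel`). So β has a
determinant `vol` on the quotient by ω. Multiplying the matrix of β by two columns of F turns them
into values of γ, and the minor of F in `H_u` comes out as a product of tetrahedral quantities
divided by `vol` (`PentData.minor_formula`). Since `vol` is invariant under even renumberings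
(`PentData.vol_perm`), `H_u` is `vol` times the product of all ten q (`System.H_eq`): it is non-zero
and independent of the edge and the tetrahedron used.

Torsion. The square of a Pfaffian is a determinant (`pfaffian_sq`). The minors of f₁ and f₂ are
merged into one bordered determinant `frame`, which admits arbitrary columns instead of coordinate
subsets; `frame_exchange` gives independence of the minors. Two distinguished bases differ by a
transition matrix of determinant ±1, because its essential block is an invertible integer matrix
(`IsDistinguished.det_sq`).

Move. Different choices of β and γ are a rescaling of the Grassmann generators. Under it the squared
torsion and the product of the `H_u` scale inversely, since each tetrahedron lies in two pentachora;
hence β and γ may be assumed equal outside the pillow (`exists_matched_gauge`). As β and γ determine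
F, the two pillow pentachora have opposite F. The space of cocycles grows by the coboundary of the
new edge alone. Let β be the non-zero coefficient of this edge on a suitable inner tetrahedron and D
the minor of F in `H_u`. The bordered determinant is multiplied by β and the middle determinant by
D², so the squared torsion is multiplied by (D/β)² (`Matched.isTorsionSq`). Both `H_u` of the pillow
equal β times four q divided by D, and the four additional q⁻¹ cancel these q, so the local factor
is multiplied by (β/D)² (`Matched.factorSq`). Since D ≠ 0, the same determinants compare acyclicity.
-/

theorem pfaffian_congr {r : ℕ} (A B : Matrix (Fin r × Fin 2) (Fin r × Fin 2) ℂ) :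
    pfaffian (B * A * B.transpose) = B.det * pfaffian A := by
  have expand : ∀ σ : Equiv.Perm (Fin r × Fin 2),
      ∏ i : Fin r, (B * A * B.transpose) (σ (i, 0)) (σ (i, 1)) =
        ∑ φ : Fin r → (Fin r × Fin 2) × (Fin r × Fin 2),
          ∏ i, (B (σ (i, 0)) (φ i).1 * A (φ i).1 (φ i).2 * B (σ (i, 1)) (φ i).2) := by
    intro σ
    have : ∀ x y, (B * A * B.transpose) x y =
        ∑ kl : (Fin r × Fin 2) × (Fin r × Fin 2), B x kl.1 * A kl.1 kl.2 * B y kl.2 := by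
      intro x y
      simp only [Matrix.mul_apply, Matrix.transpose_apply, Finset.sum_mul]
      rw [Finset.sum_comm, ← Fintype.sum_prod_type']
    simp only [this]
    rw [Finset.prod_univ_sum, Fintype.piFinset_univ]
  -- The two summation indices chosen for each pair `i` are regrouped as one function on `Fin r ×
  -- Fin 2`.
  let F : (Fin r → (Fin r × Fin 2) × (Fin r × Fin 2)) ≃ (Fin r × Fin 2 → Fin r × Fin 2) :=
    { toFun := fun φ x => if x.2 = 0 then (φ x.1).1 else (φ x.1).2
      invFun := fun f i => (f (i, 0), f (i, 1))
      left_inv := fun φ => by ext i <;> simp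
      right_inv := fun f => by
        funext x
        obtain ⟨i, s⟩ := x
        fin_cases s <;> simp }
  -- For a fixed choice `f` of inner indices, the alternating sum over `σ` is the determinant of `B`
  -- with columns selected by `f`.
  have key : ∑ σ : Equiv.Perm (Fin r × Fin 2), ((Equiv.Perm.sign σ : ℤ) : ℂ) *
      ∏ i : Fin r, (B * A * B.transpose) (σ (i, 0)) (σ (i, 1)) =
      ∑ f : Fin r × Fin 2 → Fin r × Fin 2,
        (∏ i, A (f (i, 0)) (f (i, 1))) * (B.submatrix id f).det := by
    simp only [expand, Finset.mul_sum]
    rw [Finset.sum_comm]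
    refine Fintype.sum_equiv F _ _ fun φ => ?_
    rw [Matrix.det_apply', Finset.mul_sum]
    refine Finset.sum_congr rfl fun σ _ => ?_
    simp only [Matrix.submatrix_apply, id_eq, Fintype.prod_prod_type, Fin.prod_univ_two,
      Finset.prod_mul_distrib]
    simp [F]
    ring
  unfold pfaffian
  rw [key]
  have : ∑ f : Fin r × Fin 2 → Fin r × Fin 2,
      (∏ i, A (f (i, 0)) (f (i, 1))) * (B.submatrix id f).det =
      ∑ τ : Equiv.Perm (Fin r × Fin 2), ((Equiv.Perm.sign τ : ℤ) : ℂ) *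
        (∏ i, A (τ (i, 0)) (τ (i, 1))) * B.det := by
    symm
    refine Finset.sum_of_injOn (fun τ => (τ : Fin r × Fin 2 → Fin r × Fin 2))
      (fun a _ b _ h => DFunLike.coe_injective h) (fun _ _ => Finset.mem_coe.2 (Finset.mem_univ _))
      ?_ ?_
    -- A non-injective `f` repeats a column, so only permutations survive.
    · intro f _ hf
      have hni : ¬ Function.Injective f := by
        intro hinj
        exact hf ⟨Equiv.ofBijective f (Finite.injective_iff_bijective.1 hinj), by simp, rfl⟩
      simp only [Function.Injective, not_forall] at hni
      obtain ⟨x, y, hxy, hne⟩ := hni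
      rw [Matrix.det_zero_of_column_eq hne (fun k => by simp [hxy]), mul_zero]
    · intro τ _
      rw [Matrix.det_permute' τ B]
      ring
  rw [this, Finset.mul_sum, Finset.mul_sum, Finset.mul_sum]
  exact Finset.sum_congr rfl fun τ _ => by ring

/-- The standard symplectic matrix. -/
def stdSymplectic (r : ℕ) : Matrix (Fin r × Fin 2) (Fin r × Fin 2) ℂ := fun x y =>
  if x.1 = y.1 then (if x.2 = 0 ∧ y.2 = 1 then 1 else if x.2 = 1 ∧ y.2 = 0 then -1 else 0) else 0

theorem det_stdSymplectic (r : ℕ) : (stdSymplectic r).det = 1 := by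
  have : stdSymplectic r = (Matrix.blockDiagonal (fun _ : Fin r => !![(0 : ℂ), 1; -1, 0])).submatrix
      (Equiv.prodComm _ _) (Equiv.prodComm _ _) := by
    ext ⟨i, s⟩ ⟨j, t⟩
    by_cases h : i = j
    · subst h
      fin_cases s <;> fin_cases t <;> simp [stdSymplectic, Matrix.blockDiagonal_apply]
    · simp [stdSymplectic, Matrix.blockDiagonal_apply, h]
  rw [this, Matrix.det_submatrix_equiv_self, Matrix.det_blockDiagonal]
  simp [Matrix.det_fin_two]

/-- Only permutations carrying pairs to pairs contribute. There are `2 ^ r * r!` of them and each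
contributes 1: permuting whole pairs is even, and a swap inside a pair is compensated by the entry
-1. -/
theorem pfaffian_stdSymplectic (r : ℕ) : pfaffian (stdSymplectic r) = 1 := by
  let G : Equiv.Perm (Fin r) × (Fin r → Equiv.Perm (Fin 2)) → Equiv.Perm (Fin r × Fin 2) :=
    fun p => Equiv.prodCongrLeft (fun _ => p.1) * Equiv.prodCongrRight p.2
  have hG : ∀ p i s, G p (i, s) = (p.1 i, p.2 i s) := fun p i s => rfl
  have hsign : ∀ p, Equiv.Perm.sign (G p) = ∏ i, Equiv.Perm.sign (p.2 i) := by
    intro p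
    simp only [G, Equiv.Perm.sign_mul]
    rw [show Equiv.Perm.sign (Equiv.prodCongrLeft fun _ : Fin 2 => p.1) = 1 from ?_, one_mul]
    · exact Equiv.Perm.sign_prodCongrRight p.2
    · erw [Equiv.Perm.sign_prodCongrLeft]
      simp
  have hperm : ∀ τ : Equiv.Perm (Fin 2), ((Equiv.Perm.sign τ : ℤ) : ℂ) *
      (if τ 0 = 0 ∧ τ 1 = 1 then 1 else if τ 0 = 1 ∧ τ 1 = 0 then -1 else 0) = 1 := by
    intro τ
    have : τ = 1 ∨ τ = Equiv.swap 0 1 := by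
      revert τ
      decide
    rcases this with rfl | rfl
    · simp
    · simp
  have hsum : ∑ σ : Equiv.Perm (Fin r × Fin 2), ((Equiv.Perm.sign σ : ℤ) : ℂ) *
      ∏ i : Fin r, stdSymplectic r (σ (i, 0)) (σ (i, 1)) =
      ∑ p : Equiv.Perm (Fin r) × (Fin r → Equiv.Perm (Fin 2)), (1 : ℂ) := by
    symm
    refine Finset.sum_of_injOn G ?_ (fun _ _ => Finset.mem_coe.2 (Finset.mem_univ _)) ?_ ?_
    · intro p _ p' _ h
      have h' : ∀ i s, (p.1 i, p.2 i s) = (p'.1 i, p'.2 i s) := fun i s => by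
        rw [← hG, ← hG, h]
      ext i
      · exact congrArg Fin.val (Prod.ext_iff.1 (h' i 0)).1
      · exact congrArg Fin.val (Prod.ext_iff.1 (h' i _)).2
    · intro σ _ hσ
      rw [mul_eq_zero]
      right
      by_contra hne
      apply hσ
      have hne' : ∀ i, stdSymplectic r (σ (i, 0)) (σ (i, 1)) ≠ 0 := fun i =>
        Finset.prod_ne_zero_iff.1 hne i (Finset.mem_univ _)
      have h1 : ∀ i, (σ (i, 0)).1 = (σ (i, 1)).1 := fun i => by
        by_contra h
        exact hne' i (by simp [stdSymplectic, h])
      have h2 : ∀ i s, (σ (i, s)).1 = (σ (i, 0)).1 := fun i s => by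
        fin_cases s
        · rfl
        · exact (h1 i).symm
      have inj2 : ∀ i, Function.Injective (fun s => (σ (i, s)).2) := by
        intro i s t hst
        have : σ (i, s) = σ (i, t) := Prod.ext ((h2 i s).trans (h2 i t).symm) hst
        simpa using σ.injective this
      have inj1 : Function.Surjective (fun i => (σ (i, 0)).1) := by
        intro j
        obtain ⟨⟨i, s⟩, hi⟩ := σ.surjective (j, 0)
        exact ⟨i, by simp only [← h2 i s, hi]⟩
      refine ⟨(Equiv.ofBijective _ (Finite.surjective_iff_bijective.1 inj1),
        fun i => Equiv.ofBijective _ (Finite.injective_iff_bijective.1 (inj2 i))), by simp, ?_⟩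
      ext x
      · obtain ⟨i, s⟩ := x
        rw [hG]
        simp [h2 i s]
      · obtain ⟨i, s⟩ := x
        rw [hG]
        simp
    · intro p _
      rw [hsign]
      simp only [hG, stdSymplectic, if_true]
      push_cast
      rw [← Finset.prod_mul_distrib]
      exact (Finset.prod_eq_one fun i _ => hperm (p.2 i)).symm
  rw [pfaffian, hsum]
  simp only [Finset.sum_const, Finset.card_univ, Fintype.card_prod, Fintype.card_perm,
    Fintype.card_fin, Fintype.card_pi, Finset.prod_const, Nat.factorial_two]
  have : ((r.factorial : ℕ) : ℂ) ≠ 0 := by exact_mod_cast Nat.factorial_ne_zero r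
  simp
  field_simp

theorem dotProduct_mulVec_skew {ι : Type*} [Fintype ι] {A : Matrix ι ι ℂ} (hA : A.transpose = -A)
    (x y : ι → ℂ) : x ⬝ᵥ A *ᵥ y = -(y ⬝ᵥ A *ᵥ x) := by
  rw [Matrix.dotProduct_mulVec, ← Matrix.mulVec_transpose, hA, Matrix.neg_mulVec,
    neg_dotProduct, dotProduct_comm]

/-- A nondegenerate skew-symmetric matrix is congruent to the standard symplectic one. -/
theorem exists_symplectic {r : ℕ} (A : Matrix (Fin r × Fin 2) (Fin r × Fin 2) ℂ)
    (hA : A.transpose = -A) (hdet : A.det ≠ 0) :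
    ∃ B : Matrix (Fin r × Fin 2) (Fin r × Fin 2) ℂ, B * A * B.transpose = stdSymplectic r := by
  set V := Fin r × Fin 2 → ℂ
  let w : V → V → ℂ := fun x y => x ⬝ᵥ A *ᵥ y
  have wskew : ∀ x y, w x y = -w y x := dotProduct_mulVec_skew hA
  have wself : ∀ x, w x x = 0 := fun x => by
    have := wskew x x
    linear_combination (1 / 2 : ℂ) * this
  have wsubl : ∀ x y z, w (x - y) z = w x z - w y z := fun x y z => sub_dotProduct _ _ _
  have wsmull : ∀ (a : ℂ) x z, w (a • x) z = a * w x z := fun a x z => smul_dotProduct _ _ _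
  have wsuml : ∀ {n : ℕ} (f : Fin n → V) z, w (∑ i, f i) z = ∑ i, w (f i) z := fun f z =>
    sum_dotProduct _ _ _
  have wnd : ∀ x, x ≠ 0 → ∃ y, w x y = 1 := by
    intro x hx
    have : x ᵥ* A ≠ 0 := fun h => hx (Matrix.eq_zero_of_vecMul_eq_zero hdet h)
    obtain ⟨k, hk⟩ := Function.ne_iff.1 this
    refine ⟨Pi.single k ((x ᵥ* A) k)⁻¹, ?_⟩
    simp only [w]
    rw [Matrix.dotProduct_mulVec, dotProduct_single, mul_inv_cancel₀ hk]
  have step : ∀ n, n ≤ r → ∃ b : Fin n × Fin 2 → V, ∀ x y, w (b x) (b y) = stdSymplectic n x y := by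
    intro n
    induction n with
    | zero => exact fun _ => ⟨fun x => x.1.elim0, fun x => x.1.elim0⟩
    | succ n ih =>
      intro hn
      obtain ⟨b, hb⟩ := ih (by omega)
      -- The symplectic analogue of the Gram–Schmidt projection onto the span of the vectors already
      -- found; `v - pr v` is orthogonal to all of them.
      let pr : V → V := fun v => ∑ i, (w v (b (i, 1)) • b (i, 0) - w v (b (i, 0)) • b (i, 1))
      have hpr : ∀ v x, w (v - pr v) (b x) = 0 := by
        intro v x
        obtain ⟨j, t⟩ := x
        rw [wsubl, wsuml]
        simp only [wsubl, wsmull, hb, stdSymplectic]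
        rw [Finset.sum_eq_single j (fun i _ hij => by simp [hij]) (by simp)]
        fin_cases t <;> simp
      -- The `2 * n` vectors cannot span a space of dimension `2 * r`, because `n < r`.
      have hspan : ∃ v, v ∉ Submodule.span ℂ (Set.range b) := by
        by_contra hall
        push Not at hall
        have htop : Submodule.span ℂ (Set.range b) = ⊤ := by
          rw [Submodule.eq_top_iff']
          exact hall
        have h1 := finrank_range_le_card (R := ℂ) (b := b)
        rw [Set.finrank, htop, finrank_top] at h1
        simp [V] at h1
        omega
      obtain ⟨v, hv⟩ := hspan
      have hprs : ∀ v, pr v ∈ Submodule.span ℂ (Set.range b) := fun v =>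
        Submodule.sum_mem _ fun i _ => Submodule.sub_mem _
          (Submodule.smul_mem _ _ (Submodule.subset_span ⟨_, rfl⟩))
          (Submodule.smul_mem _ _ (Submodule.subset_span ⟨_, rfl⟩))
      set v0 := v - pr v with hv0
      have hv0ne : v0 ≠ 0 := fun h => hv (by
        have h' : v = pr v := sub_eq_zero.1 h
        rw [h']
        exact hprs v)
      obtain ⟨y, hy⟩ := wnd v0 hv0ne
      set y0 := y - pr y with hy0
      have hv0b : ∀ x, w v0 (b x) = 0 := hpr v
      have hy0b : ∀ x, w y0 (b x) = 0 := hpr y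
      have hbv0 : ∀ x, w (b x) v0 = 0 := fun x => by rw [wskew, hv0b, neg_zero]
      have hby0 : ∀ x, w (b x) y0 = 0 := fun x => by rw [wskew, hy0b, neg_zero]
      have hyv : w y0 v0 = -1 := by
        rw [hy0, wsubl, wsuml]
        simp only [wsubl, wsmull, hbv0]
        rw [wskew, hy]
        simp
      have hvy : w v0 y0 = 1 := by rw [wskew, hyv, neg_neg]
      refine ⟨fun x => Fin.cases (if x.2 = 0 then v0 else y0) (fun i => b (i, x.2)) x.1, ?_⟩
      rintro ⟨i, s⟩ ⟨j, t⟩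
      refine Fin.cases ?_ (fun i => ?_) i <;> refine Fin.cases ?_ (fun j => ?_) j
      · fin_cases s <;> fin_cases t <;> simp [stdSymplectic, wself, hyv, hvy]
      · fin_cases s <;> simp [stdSymplectic, hv0b, hy0b, (Fin.succ_ne_zero j).symm]
      · fin_cases t <;> simp [stdSymplectic, hbv0, hby0, Fin.succ_ne_zero i]
      · simp [hb, stdSymplectic]
  obtain ⟨b, hb⟩ := step r le_rfl
  refine ⟨Matrix.of b, ?_⟩
  ext x y
  rw [← hb, Matrix.mul_assoc]
  simp only [w, Matrix.mul_apply, dotProduct, Matrix.mulVec, Matrix.transpose_apply, Matrix.of_apply]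

/-- Congruence multiplies the Pfaffian by `det B` and the determinant by its square, so the
nondegenerate case reduces to the standard form. In the degenerate case a congruence with a kernel
vector as a row of `B` creates a zero row and a zero column, which kill every term of the Pfaffian.
-/
theorem pfaffian_sq {r : ℕ} (A : Matrix (Fin r × Fin 2) (Fin r × Fin 2) ℂ)
    (hA : A.transpose = -A) : pfaffian A ^ 2 = A.det := by
  by_cases hdet : A.det = 0
  · rw [hdet]
    obtain ⟨v, hv, hv0⟩ := Matrix.exists_vecMul_eq_zero_iff.2 hdet
    obtain ⟨x0, hx0⟩ := Function.ne_iff.1 hv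
    set B : Matrix (Fin r × Fin 2) (Fin r × Fin 2) ℂ := (1 : Matrix _ _ ℂ).updateRow x0 v with hB
    have hBdet : B.det ≠ 0 := by
      have : B.det = v x0 := by
        rw [hB]
        have h1 : v = ∑ k, v k • (1 : Matrix (Fin r × Fin 2) (Fin r × Fin 2) ℂ) k := by
          ext j
          simp [Matrix.one_apply]
        conv_lhs => rw [h1]
        rw [Matrix.det_updateRow_sum]
        simp
      rwa [this]
    have hrow : ∀ y, (B * A * B.transpose) x0 y = 0 := by
      have h2 : (B * A).row x0 = 0 := by
        ext j
        have := congrFun hv0 j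
        simpa [Matrix.mul_apply, hB, Matrix.vecMul, dotProduct] using this
      intro y
      rw [Matrix.mul_apply]
      refine Finset.sum_eq_zero fun k _ => ?_
      have := congrFun h2 k
      simp only [Matrix.row_apply, Pi.zero_apply] at this
      rw [this, zero_mul]
    have hskew : (B * A * B.transpose).transpose = -(B * A * B.transpose) := by
      simp [Matrix.transpose_mul, hA, Matrix.mul_assoc]
    have hcol : ∀ y, (B * A * B.transpose) y x0 = 0 := by
      intro y
      have := congrFun (congrFun hskew x0) y
      rw [Matrix.transpose_apply, Matrix.neg_apply, hrow, neg_zero] at this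
      exact this
    have hpf : pfaffian (B * A * B.transpose) = 0 := by
      rw [pfaffian, Finset.sum_eq_zero, mul_zero]
      intro σ _
      rw [mul_eq_zero]
      right
      obtain ⟨⟨i, s⟩, hi⟩ := σ.surjective x0
      refine Finset.prod_eq_zero (Finset.mem_univ i) ?_
      fin_cases s
      · simp only [Fin.zero_eta] at hi
        rw [hi, hrow]
      · simp only [Fin.mk_one] at hi
        rw [hi, hcol]
    rw [pfaffian_congr, mul_eq_zero] at hpf
    rw [hpf.resolve_left hBdet]
    simp
  · obtain ⟨B, hB⟩ := exists_symplectic A hA hdet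
    have h1 : B.det * pfaffian A = 1 := by rw [← pfaffian_congr, hB, pfaffian_stdSymplectic]
    have h2 : B.det ^ 2 * A.det = 1 := by
      rw [← det_stdSymplectic r, ← hB, Matrix.det_mul, Matrix.det_mul, Matrix.det_transpose]
      ring
    have h3 : B.det ≠ 0 := left_ne_zero_of_mul_eq_one h1
    have h4 : B.det ^ 2 * (pfaffian A ^ 2 - A.det) = 0 := by
      linear_combination (B.det * pfaffian A + 1) * h1 - h2
    exact sub_eq_zero.1 ((mul_eq_zero.1 h4).resolve_left (pow_ne_zero _ h3))

/-- Needed to number the rows outside a minor by `Fin n × Fin 2`. -/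
theorem even_card_of_skew_det_ne_zero {ι : Type*} [Fintype ι] [DecidableEq ι] (A : Matrix ι ι ℂ)
    (hA : A.transpose = -A) (hdet : A.det ≠ 0) : Even (Fintype.card ι) := by
  by_contra h
  rw [Nat.not_even_iff_odd] at h
  have h1 := Matrix.det_transpose A
  rw [hA, Matrix.det_neg, h.neg_one_pow] at h1
  exact hdet (by linear_combination (-1 / 2 : ℂ) * h1)

end

/-! ### The factorized quadratic form of a tetrahedron -/

section

/-- The coefficients `b` and `g` of two linear functionals factorize the quadratic form of a
tetrahedron with oriented face values `w`, and are distinguished by the square root `K`. -/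
structure IsTetPair (w : Fin 4 → ℂ) (K : ℂ) (b g : Fin 4 → ℂ) : Prop where
  quad : ∀ z : Fin 4 → ℂ, ∑ a, z a = 0 →
    2 * (∑ a, b a * z a) * (∑ a, g a * z a) = ∑ a, z a ^ 2 / w a
  root0 : K * (b 0 - b 1) = -(w 2 * w 3 * (b 2 - b 3))
  root1 : K * (b 1 - b 2) = -(w 0 * w 3 * (b 0 - b 3))
  root2 : K * (b 2 - b 0) = -(w 1 * w 3 * (b 1 - b 3))

namespace IsTetPair

variable {w : Fin 4 → ℂ} {K : ℂ} {b g : Fin 4 → ℂ}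

/-- On the hyperplane of cocycles the coefficients matter only up to a common constant, hence the
differences from the entry 3. The vectors `e_a - e_3` span the hyperplane, so the three diagonal and
three polar values determine the quadratic form. -/
theorem diag0 (h : IsTetPair w K b g) :
    2 * (b 0 - b 3) * (g 0 - g 3) = 1 / w 0 + 1 / w 3 := by
  have := h.quad ![1, 0, 0, -1] (by simp [Fin.sum_univ_four])
  simp [Fin.sum_univ_four] at this
  simp only [one_div]
  linear_combination this

theorem diag1 (h : IsTetPair w K b g) :
    2 * (b 1 - b 3) * (g 1 - g 3) = 1 / w 1 + 1 / w 3 := by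
  have := h.quad ![0, 1, 0, -1] (by simp [Fin.sum_univ_four])
  simp [Fin.sum_univ_four] at this
  simp only [one_div]
  linear_combination this

theorem diag2 (h : IsTetPair w K b g) :
    2 * (b 2 - b 3) * (g 2 - g 3) = 1 / w 2 + 1 / w 3 := by
  have := h.quad ![0, 0, 1, -1] (by simp [Fin.sum_univ_four])
  simp [Fin.sum_univ_four] at this
  simp only [one_div]
  linear_combination this

theorem polar01 (h : IsTetPair w K b g) :
    (b 0 - b 3) * (g 1 - g 3) + (b 1 - b 3) * (g 0 - g 3) = 1 / w 3 := by
  have := h.quad ![1, 1, 0, -2] (by simp [Fin.sum_univ_four]; norm_num)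
  simp [Fin.sum_univ_four] at this
  have e0 := h.diag0
  have e1 := h.diag1
  simp only [div_eq_mul_inv] at *
  linear_combination (1 / 2 : ℂ) * (this - e0 - e1)

theorem polar12 (h : IsTetPair w K b g) :
    (b 1 - b 3) * (g 2 - g 3) + (b 2 - b 3) * (g 1 - g 3) = 1 / w 3 := by
  have := h.quad ![0, 1, 1, -2] (by simp [Fin.sum_univ_four]; norm_num)
  simp [Fin.sum_univ_four] at this
  have e0 := h.diag1
  have e1 := h.diag2
  simp only [div_eq_mul_inv] at *
  linear_combination (1 / 2 : ℂ) * (this - e0 - e1)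

theorem polar20 (h : IsTetPair w K b g) :
    (b 2 - b 3) * (g 0 - g 3) + (b 0 - b 3) * (g 2 - g 3) = 1 / w 3 := by
  have := h.quad ![1, 0, 1, -2] (by simp [Fin.sum_univ_four]; norm_num)
  simp [Fin.sum_univ_four] at this
  have e0 := h.diag0
  have e1 := h.diag2
  simp only [div_eq_mul_inv] at *
  linear_combination (1 / 2 : ℂ) * (this - e0 - e1)

/-- The antisymmetric part of the product, up to a factor which may vanish. -/
theorem wedge_aux {w1 w2 w3 w0 K b0 b1 b2 g0 g1 : ℂ} (h3 : w3 ≠ 0) (h1 : w1 ≠ 0)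
    (hK : K ^ 2 = w0 * w1 * w2 * w3)
    (r0 : K * (b0 - b1) = -(w2 * w3 * b2)) (r1 : K * (b1 - b2) = -(w0 * w3 * b0))
    (d1 : 2 * b1 * g1 = 1 / w1 + 1 / w3) (p : b0 * g1 + b1 * g0 = 1 / w3) (hK0 : K ≠ 0) :
    (w1 + w3) * (K * (b0 * g1 - b1 * g0) + w2) = 0 := by
  have e1 : K * (K * (b0 - b1)) * g1 = -(w2 * w3 * (K * b2)) * g1 := by rw [r0]; ring
  have e2 : K * b2 = K * b1 + w0 * w3 * b0 := by linear_combination -r1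
  rw [e2] at e1
  have hd : b1 * g1 = (w1 + w3) / (2 * w1 * w3) := by
    field_simp at d1 ⊢
    linear_combination d1
  have hp : b1 * g0 = 1 / w3 - b0 * g1 := by linear_combination p
  have e3 : (K ^ 2 + w0 * w2 * w3 ^ 2) * (b0 * g1) = K * (K - w2 * w3) * (b1 * g1) := by
    linear_combination e1
  rw [hK, hd] at e3
  rw [hp]
  have e4 : K * (K * (b0 * g1 * 2 * w3) * (w1 + w3)) =
      K * ((K - w2 * w3) * (w1 + w3)) := by
    have : w0 * w2 * w3 * (w1 + w3) * (b0 * g1) * (2 * w1 * w3) =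
        K * (K - w2 * w3) * (w1 + w3) := by
      field_simp at e3
      linear_combination e3
    linear_combination this + 2 * b0 * g1 * w3 * (w1 + w3) * hK
  have e5 := mul_left_cancel₀ hK0 e4
  field_simp
  linear_combination e5

variable (hw : ∀ a, w a ≠ 0) (hs : ∑ a, w a = 0) (hK : K ^ 2 = ∏ a, w a)

include hw hs hK

/-- The discriminant of the form fixes the antisymmetric product of its linear factors up to sign,
and the root relations fix the sign through `K`. This makes the two functionals independent modulo
constants. -/
theorem wedge (h : IsTetPair w K b g) :
    (b 0 - b 3) * (g 1 - g 3) - (g 0 - g 3) * (b 1 - b 3) = -w 2 / K := by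
  rw [Fin.prod_univ_four] at hK
  rw [Fin.sum_univ_four] at hs
  have hK0 : K ≠ 0 := fun h0 => by
    rw [h0] at hK
    simpa [hw] using hK.symm
  have r0 := h.root0
  have r1 := h.root1
  have r2 := h.root2
  have d0 := h.diag0
  have d1 := h.diag1
  have d2 := h.diag2
  have p01 := h.polar01
  have p12 := h.polar12
  have p20 := h.polar20
  have hb : w 0 * (b 0 - b 3) + w 1 * (b 1 - b 3) + w 2 * (b 2 - b 3) = 0 := by
    have : w 3 * (w 0 * (b 0 - b 3) + w 1 * (b 1 - b 3) + w 2 * (b 2 - b 3)) = 0 := by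
      linear_combination r0 + r1 + r2
    exact (mul_eq_zero.1 this).resolve_left (hw 3)
  set x0 := b 0 - b 3
  set x1 := b 1 - b 3
  set x2 := b 2 - b 3
  set y0 := g 0 - g 3
  set y1 := g 1 - g 3
  set y2 := g 2 - g 3
  rw [show b 0 - b 1 = x0 - x1 by simp only [x0, x1]; ring] at r0
  rw [show b 1 - b 2 = x1 - x2 by simp only [x1, x2]; ring] at r1
  rw [show b 2 - b 0 = x2 - x0 by simp only [x0, x2]; ring] at r2
  -- The vector `w` is in the kernel of the polar form and is killed by the first factor. Hence
  -- every value of the first factor times the value of the second one at `w` vanishes, and the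
  -- first factor is not zero.
  have hg : w 0 * y0 + w 1 * y1 + w 2 * y2 = 0 := by
    have q0 : x0 * (w 0 * y0 + w 1 * y1 + w 2 * y2) = 0 := by
      have e0 : w 0 * (1 / w 0) = 1 := by field_simp [hw 0]
      have e3 : w 3 * (1 / w 3) = 1 := by field_simp [hw 3]
      linear_combination w 0 * d0 + w 1 * p01 + w 2 * p20 - y0 * hb + e0 - e3 + 1 / w 3 * hs
    have q1 : x1 * (w 0 * y0 + w 1 * y1 + w 2 * y2) = 0 := by
      have e0 : w 1 * (1 / w 1) = 1 := by field_simp [hw 1]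
      have e3 : w 3 * (1 / w 3) = 1 := by field_simp [hw 3]
      linear_combination w 1 * d1 + w 0 * p01 + w 2 * p12 - y1 * hb + e0 - e3 + 1 / w 3 * hs
    by_contra hne
    have z0 := (mul_eq_zero.1 q0).resolve_right hne
    have z1 := (mul_eq_zero.1 q1).resolve_right hne
    rw [z0, z1] at p01
    have := hw 3
    simp at p01
    exact this p01.symm
  have D01 := wedge_aux (hw 3) (hw 1) hK r0 r1 d1 p01 hK0
  have D12 := wedge_aux (w1 := w 2) (w2 := w 0) (w0 := w 1) (hw 3) (hw 2)
    (by rw [hK]; ring) r1 r2 d2 p12 hK0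
  have D20 := wedge_aux (w1 := w 0) (w2 := w 1) (w0 := w 2) (hw 3) (hw 0)
    (by rw [hK]; ring) r2 r0 d0 p20 hK0
  have c1 : w 0 * (x0 * y1 - x1 * y0) = w 2 * (x1 * y2 - x2 * y1) := by
    linear_combination y1 * hb - x1 * hg
  have c2 : w 1 * (x0 * y1 - x1 * y0) = w 2 * (x2 * y0 - x0 * y2) := by
    linear_combination -y0 * hb + x0 * hg
  -- The three antisymmetric products are proportional to the `w a`, both factors killing `w`. So a
  -- failure here forces `w 0 + w 3`, `w 1 + w 3` and `w 2 + w 3` all to vanish; their sum is `2 * w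
  -- 3`, a contradiction.
  have key : K * (x0 * y1 - x1 * y0) + w 2 = 0 := by
    by_contra hne
    have m1 := (mul_eq_zero.1 D01).resolve_right hne
    have m2 : w 2 + w 3 = 0 := by
      refine (mul_eq_zero.1 D12).resolve_right fun h0 => hne ?_
      have : w 0 * (K * (x0 * y1 - x1 * y0) + w 2) = 0 := by
        linear_combination K * c1 + w 2 * h0
      exact (mul_eq_zero.1 this).resolve_left (hw 0)
    have m0 : w 0 + w 3 = 0 := by
      refine (mul_eq_zero.1 D20).resolve_right fun h0 => hne ?_
      have : w 1 * (K * (x0 * y1 - x1 * y0) + w 2) = 0 := by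
        linear_combination K * c2 + w 2 * h0
      exact (mul_eq_zero.1 this).resolve_left (hw 1)
    exact hw 3 (by linear_combination (1 / 2 : ℂ) * (m0 + m1 + m2 - hs))
  rw [eq_div_iff hK0]
  linear_combination key

omit hs in
/-- The two functionals are unique up to mutually inverse factors. -/
theorem unique (hs : ∑ a, w a = 0) (h : IsTetPair w K b g) {b' g' : Fin 4 → ℂ}
    (h' : IsTetPair w K b' g') :
    ∃ l : ℂ, l ≠ 0 ∧ (∀ a, b' a - b' 3 = l * (b a - b 3)) ∧
      ∀ a, g' a - g' 3 = l⁻¹ * (g a - g 3) := by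
  have hD := wedge hw hs hK h
  have hD' := wedge hw hs hK h'
  rw [Fin.prod_univ_four] at hK
  have hK0 : K ≠ 0 := fun h0 => by
    rw [h0] at hK
    simpa [hw] using hK.symm
  have r0 := h.root0
  have r1 := h.root1
  have r2 := h.root2
  have s0 := h'.root0
  have s1 := h'.root1
  have s2 := h'.root2
  have d0 := h.diag0
  have d1 := h.diag1
  have d2 := h.diag2
  have p01 := h.polar01
  have p12 := h.polar12
  have p20 := h.polar20
  have d0' := h'.diag0
  have d1' := h'.diag1
  have d2' := h'.diag2
  have p01' := h'.polar01
  have p12' := h'.polar12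
  have p20' := h'.polar20
  have hne : -w 2 / K ≠ 0 := div_ne_zero (neg_ne_zero.2 (hw 2)) hK0
  generalize hx0 : b 0 - b 3 = x0 at *
  generalize hx1 : b 1 - b 3 = x1 at *
  generalize hx2 : b 2 - b 3 = x2 at *
  generalize hy0 : g 0 - g 3 = y0 at *
  generalize hy1 : g 1 - g 3 = y1 at *
  generalize hy2 : g 2 - g 3 = y2 at *
  generalize hx0' : b' 0 - b' 3 = x0' at *
  generalize hx1' : b' 1 - b' 3 = x1' at *
  generalize hx2' : b' 2 - b' 3 = x2' at *
  generalize hy0' : g' 0 - g' 3 = y0' at *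
  generalize hy1' : g' 1 - g' 3 = y1' at *
  generalize hy2' : g' 2 - g' 3 = y2' at *
  rw [show b 0 - b 1 = x0 - x1 by rw [← hx0, ← hx1]; ring] at r0
  rw [show b 1 - b 2 = x1 - x2 by rw [← hx1, ← hx2]; ring] at r1
  rw [show b 2 - b 0 = x2 - x0 by rw [← hx0, ← hx2]; ring] at r2
  rw [show b' 0 - b' 1 = x0' - x1' by rw [← hx0', ← hx1']; ring] at s0
  rw [show b' 1 - b' 2 = x1' - x2' by rw [← hx1', ← hx2']; ring] at s1
  rw [show b' 2 - b' 0 = x2' - x0' by rw [← hx0', ← hx2']; ring] at s2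
  -- Pairing the root relations of the two solutions shows that the 2×2 minors of the two
  -- coefficient vectors have zero pairwise sums, so all of them vanish.
  have e1 : K * ((x1 * x2' - x2 * x1') + (x2 * x0' - x0 * x2')) = 0 := by
    linear_combination x2 * s0 - x2' * r0
  have e2 : K * ((x2 * x0' - x0 * x2') + (x0 * x1' - x1 * x0')) = 0 := by
    linear_combination x0 * s1 - x0' * r1
  have e3 : K * ((x0 * x1' - x1 * x0') + (x1 * x2' - x2 * x1')) = 0 := by
    linear_combination x1 * s2 - x1' * r2
  replace e1 := (mul_eq_zero.1 e1).resolve_left hK0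
  replace e2 := (mul_eq_zero.1 e2).resolve_left hK0
  replace e3 := (mul_eq_zero.1 e3).resolve_left hK0
  have c01 : x0 * x1' = x1 * x0' := by linear_combination (1 / 2 : ℂ) * (e2 + e3 - e1)
  have c12 : x1 * x2' = x2 * x1' := by linear_combination (1 / 2 : ℂ) * (e1 + e3 - e2)
  have c20 : x2 * x0' = x0 * x2' := by linear_combination (1 / 2 : ℂ) * (e1 + e2 - e3)
  have hl : ∃ l : ℂ, l ≠ 0 ∧ x0' = l * x0 ∧ x1' = l * x1 ∧ x2' = l * x2 := by
    by_cases z0 : x0 = 0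
    · have z1 : x1 ≠ 0 := fun z1 => hne (by rw [← hD, z0, z1]; ring)
      refine ⟨x1' / x1, ?_, ?_, ?_, ?_⟩
      · intro hz
        have z1' : x1' = 0 := by
          rcases div_eq_zero_iff.1 hz with h | h
          · exact h
          · exact absurd h z1
        have z0' : x0' = 0 := by
          have : x1 * x0' = 0 := by rw [← c01, z0, zero_mul]
          exact (mul_eq_zero.1 this).resolve_left z1
        exact hne (by rw [← hD', z0', z1']; ring)
      · field_simp
        linear_combination -c01
      · field_simp
      · field_simp
        linear_combination c12
    · refine ⟨x0' / x0, ?_, ?_, ?_, ?_⟩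
      · intro hz
        have z0' : x0' = 0 := by
          rcases div_eq_zero_iff.1 hz with h | h
          · exact h
          · exact absurd h z0
        have z1' : x1' = 0 := by
          have : x0 * x1' = 0 := by rw [c01, z0', mul_zero]
          exact (mul_eq_zero.1 this).resolve_left z0
        exact hne (by rw [← hD', z0', z1']; ring)
      · field_simp
      · field_simp
        linear_combination c01
      · field_simp
        linear_combination -c20
  obtain ⟨l, hl0, rfl, rfl, rfl⟩ := hl
  have q0 : x0 * (l * y0' - y0) = 0 := by linear_combination (1 / 2 : ℂ) * (d0' - d0)
  have q1 : x1 * (l * y1' - y1) = 0 := by linear_combination (1 / 2 : ℂ) * (d1' - d1)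
  have q2 : x2 * (l * y2' - y2) = 0 := by linear_combination (1 / 2 : ℂ) * (d2' - d2)
  have q01 : x0 * (l * y1' - y1) + x1 * (l * y0' - y0) = 0 := by linear_combination p01' - p01
  have q12 : x1 * (l * y2' - y2) + x2 * (l * y1' - y1) = 0 := by linear_combination p12' - p12
  have q20 : x2 * (l * y0' - y0) + x0 * (l * y2' - y2) = 0 := by linear_combination p20' - p20
  -- If the first of the `x` vanishes, the second does not, because of the antisymmetric product; a
  -- non-zero one makes the polar relations solvable for all the `y`.
  have hy : l * y0' - y0 = 0 ∧ l * y1' - y1 = 0 ∧ l * y2' - y2 = 0 := by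
    by_cases z0 : x0 = 0
    · have z1 : x1 ≠ 0 := fun z1 => hne (by rw [← hD, z0, z1]; ring)
      have a1 := (mul_eq_zero.1 q1).resolve_left z1
      rw [a1, mul_zero] at q01 q12
      rw [zero_add] at q01
      rw [add_zero] at q12
      exact ⟨(mul_eq_zero.1 q01).resolve_left z1, a1, (mul_eq_zero.1 q12).resolve_left z1⟩
    · have a0 := (mul_eq_zero.1 q0).resolve_left z0
      rw [a0, mul_zero] at q01 q20
      rw [zero_add] at q20
      rw [add_zero] at q01
      exact ⟨a0, (mul_eq_zero.1 q01).resolve_left z0, (mul_eq_zero.1 q20).resolve_left z0⟩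
  obtain ⟨a0, a1, a2⟩ := hy
  refine ⟨l, hl0, fun a => ?_, fun a => ?_⟩
  · fin_cases a
    · simpa [hx0] using hx0'
    · simpa [hx1] using hx1'
    · simpa [hx2] using hx2'
    · simp
  · rw [eq_inv_mul_iff_mul_eq₀ hl0]
    fin_cases a
    · simp [hy0, hy0']
      linear_combination a0
    · simp [hy1, hy1']
      linear_combination a1
    · simp [hy2, hy2']
      linear_combination a2
    · simp

end IsTetPair

end

/-! ### A pentachoron in dual form -/

section

/-- The data of a pentachoron in dual form: a 2-cocycle is described by the antisymmetric matrix of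
its values on the 2-faces, indexed by the pairs of complementary vertices. -/
structure PentData where
  Om : Fin 5 → Fin 5 → ℂ
  kap : Fin 5 → ℂ
  B : Fin 5 → Fin 5 → ℂ
  G : Fin 5 → Fin 5 → ℂ
  F : Fin 5 → Fin 5 → ℂ
  anti : ∀ a b, Om a b = -Om b a
  ne : ∀ a b, a ≠ b → Om a b ≠ 0
  sum : ∀ m, ∑ a, Om a m = 0
  kap_sq : ∀ σ : Equiv.Perm (Fin 5), kap (σ 4) ^ 2 = ∏ a : Fin 4, Om (σ a.castSucc) (σ 4)
  tet : ∀ σ : Equiv.Perm (Fin 5), Equiv.Perm.sign σ = 1 →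
    IsTetPair (fun a => Om (σ a.castSucc) (σ 4)) (kap (σ 4)) (fun a => B (σ 4) (σ a.castSucc))
      (fun a => G (σ 4) (σ a.castSucc))
  skew : ∀ a b, F a b = -F b a
  ann : ∀ Z : Fin 5 → Fin 5 → ℂ, (∀ a b, Z a b = -Z b a) → (∀ m, ∑ a, Z a m = 0) → ∀ m,
    ∑ a, G m a * Z a m = ∑ t, (∑ a, B t a * Z a t) * F t m

/-- The circulation along a triangle. -/
def triCirc (a b c : Fin 5) : Fin 5 → Fin 5 → ℂ := fun x y =>
  (if x = a ∧ y = b then 1 else 0) + (if x = b ∧ y = c then 1 else 0) +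
    (if x = c ∧ y = a then 1 else 0) - (if x = b ∧ y = a then 1 else 0) -
    (if x = c ∧ y = b then 1 else 0) - (if x = a ∧ y = c then 1 else 0)

theorem triCirc_anti (a b c x y : Fin 5) : triCirc a b c x y = -triCirc a b c y x := by
  simp only [triCirc, and_comm]
  ring

theorem triCirc_sum (a b c y : Fin 5) : ∑ x, triCirc a b c x y = 0 := by
  simp only [triCirc, Finset.sum_add_distrib, Finset.sum_sub_distrib, ite_and]
  simp

theorem sum_triCirc (f : Fin 5 → ℂ) (a b c t : Fin 5) (hab : a ≠ b) (hbc : b ≠ c) (hac : a ≠ c) :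
    ∑ x, f x * triCirc a b c x t = if t = c then f b - f a else if t = a then f c - f b
      else if t = b then f a - f c else 0 := by
  simp only [triCirc, mul_add, mul_sub, Finset.sum_add_distrib, Finset.sum_sub_distrib,
    ite_and, mul_ite, mul_one, mul_zero]
  by_cases h1 : t = c
  · subst h1
    simp [hbc.symm, hac.symm]
  · by_cases h2 : t = a
    · subst h2
      simp [h1, hab]
    · by_cases h3 : t = b
      · subst h3
        simp [h1, h2]
      · simp [h1, h2, h3]

namespace PentData

variable (D : PentData)

/-- The values of the functionals `β` on the cocycle described by `Z`. -/
def beta (Z : Fin 5 → Fin 5 → ℂ) (t : Fin 5) : ℂ := ∑ a, D.B t a * Z a t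

theorem self (a : Fin 5) : D.Om a a = 0 := by
  have := D.anti a a
  linear_combination (1 / 2 : ℂ) * this

theorem sum_perm (σ : Equiv.Perm (Fin 5)) : ∑ a : Fin 4, D.Om (σ a.castSucc) (σ 4) = 0 := by
  have h := D.sum (σ 4)
  rw [← Equiv.sum_comp σ, Fin.sum_univ_castSucc] at h
  have : D.Om (σ (Fin.last 4)) (σ 4) = 0 := D.self _
  rwa [this, add_zero] at h

theorem castSucc_ne (σ : Equiv.Perm (Fin 5)) (a : Fin 4) : σ a.castSucc ≠ σ 4 := by
  intro h
  have := σ.injective h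
  exact (Fin.castSucc_lt_last a).ne this

theorem kap_ne (m : Fin 5) : D.kap m ≠ 0 := by
  obtain ⟨σ, rfl⟩ : ∃ σ : Equiv.Perm (Fin 5), σ 4 = m := ⟨Equiv.swap 4 m, by simp⟩
  intro h
  have h1 := D.kap_sq σ
  rw [h] at h1
  have h2 : ∏ a : Fin 4, D.Om (σ a.castSucc) (σ 4) ≠ 0 :=
    Finset.prod_ne_zero_iff.2 fun a _ => D.ne _ _ (castSucc_ne σ a)
  exact h2 (by rw [← h1]; simp)

theorem wedge (σ : Equiv.Perm (Fin 5)) (hσ : Equiv.Perm.sign σ = 1) :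
    (D.B (σ 4) (σ 0) - D.B (σ 4) (σ 3)) * (D.G (σ 4) (σ 1) - D.G (σ 4) (σ 3)) -
      (D.G (σ 4) (σ 0) - D.G (σ 4) (σ 3)) * (D.B (σ 4) (σ 1) - D.B (σ 4) (σ 3)) =
      -D.Om (σ 2) (σ 4) / D.kap (σ 4) :=
  (IsTetPair.wedge (fun a => D.ne _ _ (castSucc_ne σ a)) (D.sum_perm σ) (D.kap_sq σ)
    (D.tet σ hσ))

theorem root (σ : Equiv.Perm (Fin 5)) (hσ : Equiv.Perm.sign σ = 1) :
    D.kap (σ 4) * (D.B (σ 4) (σ 0) - D.B (σ 4) (σ 1)) =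
      -(D.Om (σ 2) (σ 4) * D.Om (σ 3) (σ 4) * (D.B (σ 4) (σ 2) - D.B (σ 4) (σ 3))) :=
  (D.tet σ hσ).root0

theorem exists_even (m : Fin 5) : ∃ σ : Equiv.Perm (Fin 5), Equiv.Perm.sign σ = 1 ∧ σ 4 = m := by
  by_cases hm : m = 4
  · exact ⟨1, by simp, by simp [hm]⟩
  · by_cases h0 : m = 0
    · subst h0
      exact ⟨Equiv.swap 4 0 * Equiv.swap 1 2, by
        rw [Equiv.Perm.sign_mul, Equiv.Perm.sign_swap (by decide), Equiv.Perm.sign_swap (by decide)]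
        rfl, by decide⟩
    · by_cases h1 : m = 1
      · subst h1
        exact ⟨Equiv.swap 4 1 * Equiv.swap 0 2, by
          rw [Equiv.Perm.sign_mul, Equiv.Perm.sign_swap (by decide),
            Equiv.Perm.sign_swap (by decide)]
          rfl, by decide⟩
      · refine ⟨Equiv.swap 4 m * Equiv.swap 0 1, ?_, ?_⟩
        · rw [Equiv.Perm.sign_mul, Equiv.Perm.sign_swap (Ne.symm hm),
            Equiv.Perm.sign_swap (by decide)]
          rfl
        · change Equiv.swap 4 m (Equiv.swap 0 1 4) = m
          rw [show Equiv.swap (0 : Fin 5) 1 4 = 4 by decide, Equiv.swap_apply_left]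

/-- In each tetrahedron this is the sum of the three root relations, after division by one non-zero
face value. -/
theorem beta_Om : D.beta D.Om = 0 := by
  funext m
  obtain ⟨σ, hσ, rfl⟩ := exists_even m
  have h := D.tet σ hσ
  have r0 := h.root0
  have r1 := h.root1
  have r2 := h.root2
  have hs := D.sum_perm σ
  rw [Fin.sum_univ_four] at hs
  have h3 : D.Om (σ (Fin.castSucc 3)) (σ 4) ≠ 0 := D.ne _ _ (castSucc_ne σ 3)
  simp only [beta, Pi.zero_apply]
  rw [← Equiv.sum_comp σ, Fin.sum_univ_castSucc, Fin.sum_univ_four]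
  rw [show D.Om (σ (Fin.last 4)) (σ 4) = 0 from D.self _, mul_zero, add_zero]
  refine (mul_eq_zero.1 ?_).resolve_left h3
  linear_combination r0 + r1 + r2 + D.Om (σ (Fin.castSucc 3)) (σ 4) *
    D.B (σ 4) (σ (Fin.castSucc 3)) * hs

/-- The cocycles annihilated by all `β` are the multiples of `ω`. -/
theorem kernel (Z : Fin 5 → Fin 5 → ℂ) (hZ : ∀ a b, Z a b = -Z b a) (hs : ∀ m, ∑ a, Z a m = 0)
    (hb : D.beta Z = 0) : ∃ l : ℂ, ∀ a b, Z a b = l * D.Om a b := by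
  have hself : ∀ a, Z a a = 0 := fun a => by
    have := hZ a a
    linear_combination (1 / 2 : ℂ) * this
  -- If all β vanish on `Z`, then by annihilation all γ do. In a tetrahedron these are two
  -- independent functionals on a three-dimensional space, so `Z` is there a multiple of ω.
  have hl : ∀ m, ∃ l : ℂ, ∀ a, Z a m = l * D.Om a m := by
    intro m
    have hg := D.ann Z hZ hs m
    have hb' : ∀ t, ∑ a, D.B t a * Z a t = 0 := fun t => congrFun hb t
    simp only [hb', zero_mul, Finset.sum_const_zero] at hg
    have hbm := hb' m
    obtain ⟨σ, hσ, rfl⟩ := exists_even m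
    have hD := D.wedge σ hσ
    have hsm := hs (σ 4)
    have hO := congrFun D.beta_Om (σ 4)
    have hOs := D.sum (σ 4)
    rw [← Equiv.sum_comp σ, Fin.sum_univ_five] at hsm hbm hg hOs
    simp only [beta, Pi.zero_apply] at hO
    rw [← Equiv.sum_comp σ, Fin.sum_univ_five] at hO
    rw [hself] at hsm hbm hg
    rw [D.self] at hO hOs
    have hk := D.kap_ne (σ 4)
    have h2 : D.Om (σ 2) (σ 4) ≠ 0 := D.ne _ _ (castSucc_ne σ 2)
    have hw : D.kap (σ 4) * ((D.B (σ 4) (σ 0) - D.B (σ 4) (σ 3)) *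
      (D.G (σ 4) (σ 1) - D.G (σ 4) (σ 3)) -
      (D.G (σ 4) (σ 0) - D.G (σ 4) (σ 3)) * (D.B (σ 4) (σ 1) - D.B (σ 4) (σ 3))) =
      -D.Om (σ 2) (σ 4) := by
      rw [hD]
      field_simp
    have hgO : (D.G (σ 4) (σ 0) - D.G (σ 4) (σ 3)) * D.Om (σ 0) (σ 4) +
        (D.G (σ 4) (σ 1) - D.G (σ 4) (σ 3)) * D.Om (σ 1) (σ 4) +
        (D.G (σ 4) (σ 2) - D.G (σ 4) (σ 3)) * D.Om (σ 2) (σ 4) = 0 := by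
      have := D.ann D.Om D.anti D.sum (σ 4)
      have hb' : ∀ t, ∑ a, D.B t a * D.Om a t = 0 := fun t => congrFun D.beta_Om t
      simp only [hb', zero_mul, Finset.sum_const_zero] at this
      rw [← Equiv.sum_comp σ, Fin.sum_univ_five, D.self] at this
      linear_combination this - D.G (σ 4) (σ 3) * hOs
    refine ⟨Z (σ 2) (σ 4) / D.Om (σ 2) (σ 4), fun a => ?_⟩
    obtain ⟨i, rfl⟩ := σ.surjective a
    have hb3 : (D.B (σ 4) (σ 0) - D.B (σ 4) (σ 3)) * Z (σ 0) (σ 4) +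
        (D.B (σ 4) (σ 1) - D.B (σ 4) (σ 3)) * Z (σ 1) (σ 4) +
        (D.B (σ 4) (σ 2) - D.B (σ 4) (σ 3)) * Z (σ 2) (σ 4) = 0 := by
      linear_combination hbm - D.B (σ 4) (σ 3) * hsm
    have hg3 : (D.G (σ 4) (σ 0) - D.G (σ 4) (σ 3)) * Z (σ 0) (σ 4) +
        (D.G (σ 4) (σ 1) - D.G (σ 4) (σ 3)) * Z (σ 1) (σ 4) +
        (D.G (σ 4) (σ 2) - D.G (σ 4) (σ 3)) * Z (σ 2) (σ 4) = 0 := by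
      linear_combination hg - D.G (σ 4) (σ 3) * hsm
    have hbO : (D.B (σ 4) (σ 0) - D.B (σ 4) (σ 3)) * D.Om (σ 0) (σ 4) +
        (D.B (σ 4) (σ 1) - D.B (σ 4) (σ 3)) * D.Om (σ 1) (σ 4) +
        (D.B (σ 4) (σ 2) - D.B (σ 4) (σ 3)) * D.Om (σ 2) (σ 4) = 0 := by
      linear_combination hO - D.B (σ 4) (σ 3) * hOs
    generalize D.B (σ 4) (σ 0) - D.B (σ 4) (σ 3) = b0 at *
    generalize D.B (σ 4) (σ 1) - D.B (σ 4) (σ 3) = b1 at *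
    generalize D.B (σ 4) (σ 2) - D.B (σ 4) (σ 3) = b2 at *
    generalize D.G (σ 4) (σ 0) - D.G (σ 4) (σ 3) = g0 at *
    generalize D.G (σ 4) (σ 1) - D.G (σ 4) (σ 3) = g1 at *
    generalize D.G (σ 4) (σ 2) - D.G (σ 4) (σ 3) = g2 at *
    have hd : b0 * g1 - g0 * b1 ≠ 0 := fun h => h2 (by
      rw [h, mul_zero] at hw
      exact neg_eq_zero.1 hw.symm)
    have z0 : Z (σ 0) (σ 4) * D.Om (σ 2) (σ 4) = Z (σ 2) (σ 4) * D.Om (σ 0) (σ 4) := by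
      refine mul_left_cancel₀ hd ?_
      linear_combination D.Om (σ 2) (σ 4) * (g1 * hb3 - b1 * hg3) -
        Z (σ 2) (σ 4) * (g1 * hbO - b1 * hgO)
    have z1 : Z (σ 1) (σ 4) * D.Om (σ 2) (σ 4) = Z (σ 2) (σ 4) * D.Om (σ 1) (σ 4) := by
      refine mul_left_cancel₀ hd ?_
      linear_combination -D.Om (σ 2) (σ 4) * (g0 * hb3 - b0 * hg3) +
        Z (σ 2) (σ 4) * (g0 * hbO - b0 * hgO)
    rw [div_mul_eq_mul_div, eq_div_iff h2]
    fin_cases i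
    · exact z0
    · exact z1
    · rfl
    · change Z (σ 3) (σ 4) * D.Om (σ 2) (σ 4) = Z (σ 2) (σ 4) * D.Om (σ 3) (σ 4)
      linear_combination D.Om (σ 2) (σ 4) * hsm - Z (σ 2) (σ 4) * hOs - z0 - z1
    · change Z (σ 4) (σ 4) * D.Om (σ 2) (σ 4) = Z (σ 2) (σ 4) * D.Om (σ 4) (σ 4)
      rw [hself, D.self]
      ring
  choose l hl using hl
  -- Two tetrahedra of a pentachoron share a 2-face, where ω does not vanish, so their coefficients
  -- agree.
  have hll : ∀ a b, l a = l b := by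
    intro a b
    by_cases hab : a = b
    · rw [hab]
    · have h1 := hl a b
      have h2 := hl b a
      have h3 := hZ a b
      have h4 := D.anti a b
      rw [h1, h2, h4] at h3
      have : D.Om b a * (l a - l b) = 0 := by linear_combination h3
      exact sub_eq_zero.1 ((mul_eq_zero.1 this).resolve_left (D.ne _ _ (Ne.symm hab)))
  exact ⟨l 0, fun a b => by rw [hl b a, hll b 0]⟩

theorem beta_triCirc (a b c t : Fin 5) (hab : a ≠ b) (hbc : b ≠ c) (hac : a ≠ c) :
    D.beta (triCirc a b c) t = if t = c then D.B c b - D.B c a else if t = a then D.B a c - D.B a b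
      else if t = b then D.B b a - D.B b c else 0 := by
  rw [beta, sum_triCirc _ _ _ _ _ hab hbc hac]
  split_ifs with h1 h2 h3
  · rw [h1]
  · rw [h2]
  · rw [h3]
  · rfl

theorem gamma_triCirc (a b c m : Fin 5) (hab : a ≠ b) (hbc : b ≠ c) (hac : a ≠ c) :
    ∑ t, D.beta (triCirc a b c) t * D.F t m = if m = c then D.G c b - D.G c a else
      if m = a then D.G a c - D.G a b else if m = b then D.G b a - D.G b c else 0 := by
  refine (D.ann _ (triCirc_anti a b c) (triCirc_sum a b c) m).symm.trans ?_
  rw [sum_triCirc _ _ _ _ _ hab hbc hac]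
  split_ifs with h1 h2 h3
  · rw [h1]
  · rw [h2]
  · rw [h3]
  · rfl

end PentData

end

/-! ### The minors of the Gaussian matrix -/

section

namespace PentData

variable (D : PentData)

/-- The same data with the vertices renumbered by an even permutation. -/
def perm (σ : Equiv.Perm (Fin 5)) (hσ : Equiv.Perm.sign σ = 1) : PentData where
  Om a b := D.Om (σ a) (σ b)
  kap a := D.kap (σ a)
  B a b := D.B (σ a) (σ b)
  G a b := D.G (σ a) (σ b)
  F a b := D.F (σ a) (σ b)
  anti a b := D.anti _ _
  ne a b h := D.ne _ _ (σ.injective.ne h)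
  sum m := by rw [← D.sum (σ m), ← Equiv.sum_comp σ (fun a => D.Om a (σ m))]
  kap_sq τ := D.kap_sq (σ * τ)
  tet τ hτ := D.tet (σ * τ) (by rw [Equiv.Perm.sign_mul, hσ, hτ, one_mul])
  skew a b := D.skew _ _
  ann Z hZ hs m := by
    have h := D.ann (fun a b => Z (σ.symm a) (σ.symm b)) (fun a b => hZ _ _)
      (fun m => by rw [← hs (σ.symm m), ← Equiv.sum_comp σ.symm (fun a => Z a (σ.symm m))]) (σ m)
    rw [← Equiv.sum_comp σ, ← Equiv.sum_comp σ (fun t => _ * D.F t (σ m))] at h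
    simp only [Equiv.symm_apply_apply] at h
    rw [h]
    refine Finset.sum_congr rfl fun t _ => ?_
    rw [← Equiv.sum_comp σ]
    simp only [Equiv.symm_apply_apply]

/-- The values of `β` on five independent cocycles. -/
def rows : Matrix (Fin 5) (Fin 5) ℂ :=
  Matrix.of ![D.beta (triCirc 0 1 4), D.beta (triCirc 1 3 4), D.beta (triCirc 0 3 4),
    D.beta (triCirc 1 2 4), D.beta (triCirc 0 2 4)]

/-- The determinant of the functionals `β`, normalized with the help of `ω`. -/
def vol : ℂ := D.rows.det / D.Om 2 3

/-- The annihilation condition turns a column of `F`, multiplied by `rows`, into values of γ. These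
vanish on the triangles missing the corresponding vertex, and the product matrix is so sparse that
its determinant splits into two antisymmetric products and one difference. -/
theorem rows_det_mul :
    D.rows.det * (D.F 0 2 * D.F 1 3 - D.F 0 3 * D.F 1 2) =
      (D.B 4 1 - D.B 4 0) *
      ((D.B 3 1 - D.B 3 4) * (D.G 3 0 - D.G 3 4) - (D.G 3 1 - D.G 3 4) * (D.B 3 0 - D.B 3 4)) *
      ((D.B 2 0 - D.B 2 4) * (D.G 2 1 - D.G 2 4) - (D.G 2 0 - D.G 2 4) * (D.B 2 1 - D.B 2 4)) := by
  -- Columns 2 and 3 of `F` completed by three coordinate vectors, so that the determinant is the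
  -- desired minor in the rows 0 and 1.
  let N : Matrix (Fin 5) (Fin 5) ℂ := Matrix.of fun t s =>
    ![D.F t 2, D.F t 3, if t = 2 then 1 else 0, if t = 3 then 1 else 0, if t = 4 then 1 else 0] s
  have hN : N.det = D.F 0 2 * D.F 1 3 - D.F 0 3 * D.F 1 2 := by
    simp [N, Matrix.det_succ_row_zero, Fin.sum_univ_succ, Fin.succAbove]
    ring
  rw [← hN, ← Matrix.det_mul]
  have hQ : D.rows * N = !![0, 0, 0, 0, D.B 4 1 - D.B 4 0;
      0, D.G 3 1 - D.G 3 4, 0, D.B 3 1 - D.B 3 4, D.B 4 3 - D.B 4 1;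
      0, D.G 3 0 - D.G 3 4, 0, D.B 3 0 - D.B 3 4, D.B 4 3 - D.B 4 0;
      D.G 2 1 - D.G 2 4, 0, D.B 2 1 - D.B 2 4, 0, D.B 4 2 - D.B 4 1;
      D.G 2 0 - D.G 2 4, 0, D.B 2 0 - D.B 2 4, 0, D.B 4 2 - D.B 4 0] := by
    ext r s
    rw [Matrix.mul_apply]
    fin_cases s
    · fin_cases r <;> refine (gamma_triCirc D _ _ _ 2 ?_ ?_ ?_).trans ?_ <;> simp
    · fin_cases r <;> refine (gamma_triCirc D _ _ _ 3 ?_ ?_ ?_).trans ?_ <;> simp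
    · simp only [N, Matrix.of_apply]
      fin_cases r <;> simp [rows, beta_triCirc]
    · simp only [N, Matrix.of_apply]
      fin_cases r <;> simp [rows, beta_triCirc]
    · simp only [N, Matrix.of_apply]
      fin_cases r <;> simp [rows, beta_triCirc]
  rw [hQ]
  simp [Matrix.det_succ_row_zero, Fin.sum_univ_succ, Fin.succAbove]
  ring

theorem wedge_of_eq (σ : Equiv.Perm (Fin 5)) (hσ : Equiv.Perm.sign σ = 1) {i j k l m : Fin 5}
    (h0 : σ 0 = i) (h1 : σ 1 = j) (h2 : σ 2 = k) (h3 : σ 3 = l) (h4 : σ 4 = m) :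
    (D.B m i - D.B m l) * (D.G m j - D.G m l) - (D.G m i - D.G m l) * (D.B m j - D.B m l) =
      -D.Om k m / D.kap m := by
  subst h0 h1 h2 h3 h4
  exact D.wedge σ hσ

/-- The antisymmetric products on the right-hand side of `rows_det_mul` are known from `wedge`, and
a root relation replaces the remaining difference by that of the tetrahedron appearing in `H_u`. -/
theorem minor_formula :
    (D.F 0 2 * D.F 1 3 - D.F 0 3 * D.F 1 2) * D.vol * (D.kap 2 * D.kap 3 * D.kap 4) =
      (D.B 4 3 - D.B 4 2) * (D.Om 2 3 * D.Om 2 4 * D.Om 3 4) := by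
  have h := D.rows_det_mul
  have w3 : (D.B 3 1 - D.B 3 4) * (D.G 3 0 - D.G 3 4) - (D.G 3 1 - D.G 3 4) *
      (D.B 3 0 - D.B 3 4) = -D.Om 2 3 / D.kap 3 :=
    D.wedge_of_eq (Equiv.swap 0 1 * Equiv.swap 3 4) (by decide) (by decide) (by decide) (by decide)
      (by decide) (by decide)
  have w2 : (D.B 2 0 - D.B 2 4) * (D.G 2 1 - D.G 2 4) - (D.G 2 0 - D.G 2 4) *
      (D.B 2 1 - D.B 2 4) = -D.Om 3 2 / D.kap 2 :=
    D.wedge_of_eq (Equiv.swap 2 3 * Equiv.swap 3 4) (by decide) (by decide) (by decide) (by decide)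
      (by decide) (by decide)
  have r := D.root 1 (by simp)
  simp only [Equiv.Perm.coe_one, id_eq] at r
  rw [w3, w2, D.anti 3 2] at h
  have h23 : D.Om 2 3 ≠ 0 := D.ne _ _ (by decide)
  have k2 := D.kap_ne 2
  have k3 := D.kap_ne 3
  rw [vol]
  field_simp at h ⊢
  linear_combination D.kap 4 * h + D.Om 2 3 ^ 2 * r

end PentData

end

/-! ### Invariance of the normalized determinant, and uniqueness of the Gaussian matrix -/

section

namespace PentData

variable (D : PentData)

theorem perm_beta_triCirc (σ : Equiv.Perm (Fin 5)) (hσ : Equiv.Perm.sign σ = 1) (a b c t : Fin 5)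
    (hab : a ≠ b) (hbc : b ≠ c) (hac : a ≠ c) :
    (D.perm σ hσ).beta (triCirc a b c) t = D.beta (triCirc (σ a) (σ b) (σ c)) (σ t) := by
  rw [beta_triCirc _ _ _ _ _ hab hbc hac, beta_triCirc _ _ _ _ _ (σ.injective.ne hab)
    (σ.injective.ne hbc) (σ.injective.ne hac)]
  simp only [σ.injective.eq_iff, perm]

theorem triCirc_swap (a b c : Fin 5) : triCirc b a c = (-1 : ℂ) • triCirc a b c := by
  funext x y
  simp only [triCirc, Pi.smul_apply, smul_eq_mul]
  ring

theorem beta_smul (l : ℂ) (Z : Fin 5 → Fin 5 → ℂ) : D.beta (l • Z) = l • D.beta Z := by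
  funext t
  simp only [beta, Pi.smul_apply, smul_eq_mul, Finset.mul_sum]
  exact Finset.sum_congr rfl fun _ _ => by ring

/-- The circulations along the six triangles through vertex 4 form a basis of the cocycles, and the
coefficient of ω at the triangle `a b 4` is `Om a b`. The relation is β(ω) = 0. It explains the
normalization of `vol`: omitting another triangle replaces the divisor by the coefficient of that
triangle, up to sign. -/
theorem rows_relation : D.Om 0 1 • D.beta (triCirc 0 1 4) + D.Om 1 3 • D.beta (triCirc 1 3 4) +
    D.Om 0 3 • D.beta (triCirc 0 3 4) + D.Om 1 2 • D.beta (triCirc 1 2 4) +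
    D.Om 0 2 • D.beta (triCirc 0 2 4) = -D.Om 2 3 • D.beta (triCirc 2 3 4) := by
  have hO : ∀ t, ∑ a, D.B t a * D.Om a t = 0 := fun t => congrFun D.beta_Om t
  simp only [Fin.sum_univ_five] at hO
  have hs := D.sum
  simp only [Fin.sum_univ_five] at hs
  have hd := D.self
  funext t
  simp only [Pi.add_apply, Pi.smul_apply, smul_eq_mul]
  fin_cases t
  · simp [beta_triCirc]
    linear_combination hO 0 - D.B 0 4 * hs 0 - (D.B 0 0 - D.B 0 4) * hd 0 +
      (D.B 0 4 - D.B 0 1) * D.anti 0 1 + (D.B 0 4 - D.B 0 2) * D.anti 0 2 +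
      (D.B 0 4 - D.B 0 3) * D.anti 0 3
  · simp [beta_triCirc]
    linear_combination hO 1 - D.B 1 4 * hs 1 - (D.B 1 1 - D.B 1 4) * hd 1 +
      (D.B 1 4 - D.B 1 2) * D.anti 1 2 + (D.B 1 4 - D.B 1 3) * D.anti 1 3
  · simp [beta_triCirc]
    linear_combination hO 2 - D.B 2 4 * hs 2 - (D.B 2 2 - D.B 2 4) * hd 2 +
      (D.B 2 4 - D.B 2 3) * D.anti 2 3
  · simp [beta_triCirc]
    linear_combination hO 3 - D.B 3 4 * hs 3 - (D.B 3 3 - D.B 3 4) * hd 3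
  · simp [beta_triCirc]
    linear_combination hO 4 - D.B 4 4 * hd 4 + D.B 4 0 * hs 0 + D.B 4 1 * hs 1 + D.B 4 2 * hs 2 +
      D.B 4 3 * hs 3 - D.B 4 0 * hd 0 - D.B 4 1 * hd 1 - D.B 4 2 * hd 2 - D.B 4 3 * hd 3 -
      D.B 4 0 * (D.anti 0 1 + D.anti 0 2 + D.anti 0 3 + D.anti 0 4) -
      D.B 4 1 * (D.anti 1 2 + D.anti 1 3 + D.anti 1 4) -
      D.B 4 2 * (D.anti 2 3 + D.anti 2 4) - D.B 4 3 * D.anti 3 4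

/-- A dependence among the rows is a cocycle killed by β, hence a multiple of ω. It has no component
along the triangle `2 3 4`, while ω has a non-zero one. -/
theorem det_rows_ne_zero : D.rows.det ≠ 0 := by
  intro h
  obtain ⟨v, hv0, hv⟩ := Matrix.exists_vecMul_eq_zero_iff.2 h
  let Z : Fin 5 → Fin 5 → ℂ := v 0 • triCirc 0 1 4 + v 1 • triCirc 1 3 4 + v 2 • triCirc 0 3 4 +
    v 3 • triCirc 1 2 4 + v 4 • triCirc 0 2 4
  have hanti : ∀ a b, Z a b = -Z b a := by
    intro a b
    simp only [Z, Pi.add_apply, Pi.smul_apply, smul_eq_mul]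
    rw [triCirc_anti 0 1 4, triCirc_anti 1 3 4, triCirc_anti 0 3 4, triCirc_anti 1 2 4,
      triCirc_anti 0 2 4]
    ring
  have hsum : ∀ m, ∑ a, Z a m = 0 := by
    intro m
    simp only [Z, Pi.add_apply, Pi.smul_apply, smul_eq_mul, Finset.sum_add_distrib,
      ← Finset.mul_sum, triCirc_sum]
    ring
  have hbeta : D.beta Z = 0 := by
    funext t
    have h1 := congrFun hv t
    simp only [Matrix.vecMul, dotProduct, Fin.sum_univ_five, rows, Matrix.of_apply,
      Pi.zero_apply] at h1
    rw [Pi.zero_apply, ← h1]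
    simp only [beta, Z, Pi.add_apply, Pi.smul_apply, smul_eq_mul, mul_add,
      Finset.sum_add_distrib, mul_left_comm]
    simp [beta, Finset.mul_sum]
  obtain ⟨l, hl⟩ := D.kernel Z hanti hsum hbeta
  have hl0 : l = 0 := by
    have := hl 2 3
    simp [Z, triCirc] at this
    exact this.resolve_right (D.ne _ _ (by decide))
  simp only [hl0, zero_mul] at hl
  apply hv0
  funext r
  have e01 := hl 0 1
  have e13 := hl 1 3
  have e03 := hl 0 3
  have e12 := hl 1 2
  have e02 := hl 0 2
  simp [Z, triCirc] at e01 e13 e03 e12 e02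
  fin_cases r <;> simp [e01, e13, e03, e12, e02]

theorem vol_ne_zero : D.vol ≠ 0 := div_ne_zero D.det_rows_ne_zero (D.ne _ _ (by decide))

/-- The cyclic renumbering of 1, 2, 3 exchanges the omitted triangle: the row of `1 3 4` becomes
that of `2 3 4`. By `rows_relation` this costs exactly the ratio of the divisors. -/
theorem vol_perm_rot : (D.perm (Equiv.swap 1 2 * Equiv.swap 2 3) (by decide)).vol = D.vol := by
  set σ : Equiv.Perm (Fin 5) := Equiv.swap 1 2 * Equiv.swap 2 3
  let U : Matrix (Fin 5) (Fin 5) ℂ := D.rows.updateRow 1 (D.beta (triCirc 2 3 4))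
  let π : Equiv.Perm (Fin 5) := Equiv.swap 0 4 * Equiv.swap 4 2 * Equiv.swap 1 3
  have e0 : σ 0 = 0 := by decide
  have e1 : σ 1 = 2 := by decide
  have e2 : σ 2 = 3 := by decide
  have e3 : σ 3 = 1 := by decide
  have e4 : σ 4 = 4 := by decide
  have hU : -D.Om 2 3 * U.det = D.Om 1 3 * D.rows.det := by
    have h := Matrix.det_updateRow_sum D.rows 1
      ![D.Om 0 1, D.Om 1 3, D.Om 0 3, D.Om 1 2, D.Om 0 2]
    have h2 : (∑ k, ![D.Om 0 1, D.Om 1 3, D.Om 0 3, D.Om 1 2, D.Om 0 2] k • D.rows k) =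
        -D.Om 2 3 • D.beta (triCirc 2 3 4) := by
      rw [← D.rows_relation, Fin.sum_univ_five]
      rfl
    rw [h2, Matrix.det_updateRow_smul] at h
    simpa [U] using h
  have hrows : (D.perm σ (by decide)).rows =
      ((U.updateRow 3 ((-1 : ℂ) • U 3)).submatrix id σ).submatrix π id := by
    ext r t
    have p0 : π 0 = 4 := by decide
    have p1 : π 1 = 3 := by decide
    have p2 : π 2 = 0 := by decide
    have p3 : π 3 = 1 := by decide
    have p4 : π 4 = 2 := by decide
    fin_cases r <;> refine (perm_beta_triCirc D σ (by decide) _ _ _ t ?_ ?_ ?_).trans ?_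
    any_goals decide
    all_goals simp only [e0, e1, e2, e3, e4]
    all_goals simp [U, rows, Matrix.updateRow_apply, p0, p1, p2, p3, p4]
    rw [triCirc_swap, beta_smul]
    simp
  have hdet : (D.perm σ (by decide)).rows.det = U.det := by
    rw [hrows, Matrix.det_permute, Matrix.det_permute', Matrix.det_updateRow_smul,
      show Equiv.Perm.sign π = -1 by decide, show Equiv.Perm.sign σ = 1 by decide,
      Matrix.updateRow_eq_self]
    simp
  have h23 : D.Om 2 3 ≠ 0 := D.ne _ _ (by decide)
  have h31 : D.Om 3 1 ≠ 0 := D.ne _ _ (by decide)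
  have hO : (D.perm σ (by decide)).Om 2 3 = D.Om 3 1 := by
    change D.Om (σ 2) (σ 3) = _
    rw [e2, e3]
  rw [vol, vol, hdet, hO, div_eq_div_iff h31 h23]
  linear_combination -hU - D.rows.det * D.anti 3 1

theorem vol_perm_flip : (D.perm (Equiv.swap 0 1 * Equiv.swap 2 3) (by decide)).vol = D.vol := by
  set σ : Equiv.Perm (Fin 5) := Equiv.swap 0 1 * Equiv.swap 2 3
  let π : Equiv.Perm (Fin 5) := Equiv.swap 1 4 * Equiv.swap 2 3
  have e0 : σ 0 = 1 := by decide
  have e1 : σ 1 = 0 := by decide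
  have e2 : σ 2 = 3 := by decide
  have e3 : σ 3 = 2 := by decide
  have e4 : σ 4 = 4 := by decide
  have hrows : (D.perm σ (by decide)).rows =
      ((D.rows.updateRow 0 ((-1 : ℂ) • D.rows 0)).submatrix id σ).submatrix π id := by
    ext r t
    have p0 : π 0 = 0 := by decide
    have p1 : π 1 = 4 := by decide
    have p2 : π 2 = 3 := by decide
    have p3 : π 3 = 2 := by decide
    have p4 : π 4 = 1 := by decide
    fin_cases r <;> refine (perm_beta_triCirc D σ (by decide) _ _ _ t ?_ ?_ ?_).trans ?_
    any_goals decide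
    all_goals simp only [e0, e1, e2, e3, e4]
    all_goals simp [rows, Matrix.updateRow_apply, p0, p1, p2, p3, p4]
    rw [triCirc_swap, beta_smul]
    simp
  have hdet : (D.perm σ (by decide)).rows.det = -D.rows.det := by
    rw [hrows, Matrix.det_permute, Matrix.det_permute', Matrix.det_updateRow_smul,
      show Equiv.Perm.sign π = 1 by decide, show Equiv.Perm.sign σ = 1 by decide,
      Matrix.updateRow_eq_self]
    simp
  have hO : (D.perm σ (by decide)).Om 2 3 = D.Om 3 2 := by
    change D.Om (σ 2) (σ 3) = _
    rw [e2, e3]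
  rw [vol, vol, hdet, hO, D.anti 3 2, neg_div_neg_eq]

theorem vol_perm_mul (x y : Equiv.Perm (Fin 5)) (hx : Equiv.Perm.sign x = 1)
    (hy : Equiv.Perm.sign y = 1) :
    (D.perm (x * y) (by rw [Equiv.Perm.sign_mul, hx, hy, one_mul])).vol =
      ((D.perm x hx).perm y hy).vol := rfl

set_option maxRecDepth 100000 in
-- The twelve elements are coset representatives times the powers of a 3-cycle, all written in the
-- two generators for which invariance has been computed.
theorem even_fixing_last : ∀ g : Equiv.Perm (Fin 5), Equiv.Perm.sign g = 1 → g 4 = 4 →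
    ∃ x ∈ [1, Equiv.swap 0 1 * Equiv.swap 2 3,
      (Equiv.swap 1 2 * Equiv.swap 2 3) * (Equiv.swap 0 1 * Equiv.swap 2 3),
      (Equiv.swap 1 2 * Equiv.swap 2 3) * ((Equiv.swap 1 2 * Equiv.swap 2 3) *
        (Equiv.swap 0 1 * Equiv.swap 2 3))],
    ∃ y ∈ [1, Equiv.swap 1 2 * Equiv.swap 2 3,
      (Equiv.swap 1 2 * Equiv.swap 2 3) * (Equiv.swap 1 2 * Equiv.swap 2 3)], g = x * y := by
  decide

set_option maxRecDepth 10000 in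
theorem vol_perm_fixing_last (g : Equiv.Perm (Fin 5)) (hg : Equiv.Perm.sign g = 1) (h4 : g 4 = 4) :
    (D.perm g hg).vol = D.vol := by
  have hr : ∀ D : PentData, (D.perm (Equiv.swap 1 2 * Equiv.swap 2 3) (by decide)).vol = D.vol :=
    vol_perm_rot
  have hf : ∀ D : PentData, (D.perm (Equiv.swap 0 1 * Equiv.swap 2 3) (by decide)).vol = D.vol :=
    vol_perm_flip
  have inv : ∀ y ∈ [1, Equiv.swap 1 2 * Equiv.swap 2 3,
      (Equiv.swap 1 2 * Equiv.swap 2 3) * (Equiv.swap (1 : Fin 5) 2 * Equiv.swap 2 3)],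
      ∀ hy : Equiv.Perm.sign y = 1, ∀ D : PentData, (D.perm y hy).vol = D.vol := by
    intro y hy hy1 D
    simp only [List.mem_cons, List.not_mem_nil, or_false] at hy
    rcases hy with rfl | rfl | rfl
    · rfl
    · exact hr D
    · rw [vol_perm_mul _ _ _ (by decide) (by decide), hr, hr]
  have inv' : ∀ x ∈ [1, Equiv.swap 0 1 * Equiv.swap 2 3,
      (Equiv.swap 1 2 * Equiv.swap 2 3) * (Equiv.swap 0 1 * Equiv.swap 2 3),
      (Equiv.swap 1 2 * Equiv.swap 2 3) * ((Equiv.swap 1 2 * Equiv.swap 2 3) *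
        (Equiv.swap (0 : Fin 5) 1 * Equiv.swap 2 3))],
      ∀ hx : Equiv.Perm.sign x = 1, (D.perm x hx).vol = D.vol := by
    intro y hy hy1
    simp only [List.mem_cons, List.not_mem_nil, or_false] at hy
    rcases hy with rfl | rfl | rfl | rfl
    · rfl
    · exact hf D
    · rw [vol_perm_mul _ _ _ (by decide) (by decide), hf, hr]
    · rw [vol_perm_mul _ _ _ (by decide) (by decide), vol_perm_mul _ _ _ (by decide) (by decide),
        hf, hr, hr]
  have sgn : ∀ y ∈ [1, Equiv.swap 1 2 * Equiv.swap 2 3,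
      (Equiv.swap 1 2 * Equiv.swap 2 3) * (Equiv.swap (1 : Fin 5) 2 * Equiv.swap 2 3)],
      Equiv.Perm.sign y = 1 := by decide
  obtain ⟨x, hx, y, hy, rfl⟩ := even_fixing_last g hg h4
  have hy1 := sgn y hy
  have hx1 : Equiv.Perm.sign x = 1 := by
    rw [Equiv.Perm.sign_mul, hy1, mul_one] at hg
    exact hg
  rw [vol_perm_mul _ _ _ hx1 hy1, inv y hy hy1, inv' x hx hx1]

/-- A renumbering that moves vertex 4 is not visible in `rows`, so the minor formula is compared
with its renumbered form. The two minors of `F` are proportional, because γ of the triangle `2 3 4`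
vanishes on the tetrahedra number 0 and 1; cancellation requires both differences of `B` to be
non-zero. -/
theorem vol_perm_cycle (h4 : D.B 4 3 - D.B 4 2 ≠ 0) (h2 : D.B 2 4 - D.B 2 3 ≠ 0) :
    (D.perm (Equiv.swap 2 3 * Equiv.swap 3 4) (by decide)).vol = D.vol := by
  have f := D.minor_formula
  set σ : Equiv.Perm (Fin 5) := Equiv.swap 2 3 * Equiv.swap 3 4
  have f' := (D.perm σ (by decide)).minor_formula
  have e0 : σ 0 = 0 := by decide
  have e1 : σ 1 = 1 := by decide
  have e2 : σ 2 = 3 := by decide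
  have e3 : σ 3 = 4 := by decide
  have e4 : σ 4 = 2 := by decide
  set P' := (D.perm σ (by decide)).vol
  simp only [perm, e0, e1, e2, e3, e4] at f'
  have g0 := D.gamma_triCirc 2 3 4 0 (by decide) (by decide) (by decide)
  have g1 := D.gamma_triCirc 2 3 4 1 (by decide) (by decide) (by decide)
  simp [beta_triCirc, Fin.sum_univ_five] at g0 g1
  rw [D.skew 0 3, D.skew 1 4, D.skew 0 4, D.skew 1 3] at f'
  rw [D.skew 0 3, D.skew 1 2, D.skew 0 2, D.skew 1 3] at f
  have hk : D.kap 2 * D.kap 3 * D.kap 4 ≠ 0 :=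
    mul_ne_zero (mul_ne_zero (D.kap_ne 2) (D.kap_ne 3)) (D.kap_ne 4)
  have hM : D.F 2 0 * D.F 3 1 - D.F 3 0 * D.F 2 1 ≠ 0 := by
    intro h
    have h1 : (D.B 4 3 - D.B 4 2) * (D.Om 2 3 * D.Om 2 4 * D.Om 3 4) = 0 := by
      linear_combination -f + D.vol * (D.kap 2 * D.kap 3 * D.kap 4) * h
    have n1 : D.Om 2 3 ≠ 0 := D.ne _ _ (by decide)
    have n2 : D.Om 2 4 ≠ 0 := D.ne _ _ (by decide)
    have n3 : D.Om 3 4 ≠ 0 := D.ne _ _ (by decide)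
    exact mul_ne_zero h4 (mul_ne_zero (mul_ne_zero n1 n2) n3) h1
  -- Elimination of the common term containing `F 3` from the two vanishing values of γ.
  have hx : (D.B 2 4 - D.B 2 3) * (D.F 2 0 * D.F 3 1 - D.F 3 0 * D.F 2 1) =
      (D.B 4 3 - D.B 4 2) * (D.F 3 0 * D.F 4 1 - D.F 4 0 * D.F 3 1) := by
    linear_combination D.F 3 1 * g0 - D.F 3 0 * g1
  rw [D.anti 3 2, D.anti 4 2] at f'
  have : (D.B 2 4 - D.B 2 3) * (D.F 2 0 * D.F 3 1 - D.F 3 0 * D.F 2 1) *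
      (D.kap 2 * D.kap 3 * D.kap 4) * (P' - D.vol) = 0 := by
    linear_combination (D.B 4 3 - D.B 4 2) * f' - (D.B 2 4 - D.B 2 3) * f +
      P' * (D.kap 2 * D.kap 3 * D.kap 4) * hx
  exact sub_eq_zero.1 ((mul_eq_zero.1 this).resolve_left
    (mul_ne_zero (mul_ne_zero h2 hM) hk))

theorem exists_fifth : ∀ a b c d : Fin 5, ∃ x, x ≠ a ∧ x ≠ b ∧ x ≠ c ∧ x ≠ d := by decide

/-- Three equal coefficients would make the antisymmetric product of a suitable numbering vanish. -/
theorem B_not_const (m a b c : Fin 5) (hma : m ≠ a) (hmb : m ≠ b) (hmc : m ≠ c) (hab : a ≠ b)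
    (hbc : b ≠ c) (hac : a ≠ c) (h1 : D.B m a = D.B m c) (h2 : D.B m b = D.B m c) : False := by
  obtain ⟨x, xm, xa, xb, xc⟩ := exists_fifth m a b c
  have hinj : Function.Injective ![a, b, x, c, m] := by
    intro i j hij
    fin_cases i <;> fin_cases j <;> simp_all
  have main : ∀ σ : Equiv.Perm (Fin 5), Equiv.Perm.sign σ = 1 → D.B (σ 4) (σ 0) = D.B (σ 4) (σ 3) →
      D.B (σ 4) (σ 1) = D.B (σ 4) (σ 3) → False := by
    intro σ hσ e0 e1
    have := D.wedge σ hσ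
    rw [e0, e1] at this
    have hne : -D.Om (σ 2) (σ 4) / D.kap (σ 4) ≠ 0 :=
      div_ne_zero (neg_ne_zero.2 (D.ne _ _ (castSucc_ne σ 2))) (D.kap_ne _)
    exact hne (by rw [← this]; ring)
  let σ : Equiv.Perm (Fin 5) := Equiv.ofBijective _ (Finite.injective_iff_bijective.1 hinj)
  rcases Int.units_eq_one_or (Equiv.Perm.sign σ) with h | h
  · exact main σ h h1 h2
  · exact main (σ * Equiv.swap 0 1)
      (by rw [Equiv.Perm.sign_mul, h, Equiv.Perm.sign_swap (by decide)]; rfl) h2 h1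

set_option maxRecDepth 100000 in
theorem exists_even_three : ∀ m l : Fin 5, m ≠ 4 → l ≠ 4 → m ≠ l →
    ∃ τ : Equiv.Perm (Fin 5), Equiv.Perm.sign τ = 1 ∧ τ 4 = 4 ∧ τ 2 = m ∧ τ 3 = l := by
  decide

/-- The normalized determinant does not change under even renumberings of the vertices. -/
theorem vol_perm (σ : Equiv.Perm (Fin 5)) (hσ : Equiv.Perm.sign σ = 1) :
    (D.perm σ hσ).vol = D.vol := by
  -- The stabilizer of 4 is already settled, so only the image of 4 matters.
  have same : ∀ ρ : Equiv.Perm (Fin 5), ∀ hρ : Equiv.Perm.sign ρ = 1, ρ 4 = σ 4 →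
      (D.perm σ hσ).vol = (D.perm ρ hρ).vol := by
    intro ρ hρ h4
    have hg : Equiv.Perm.sign (ρ⁻¹ * σ) = 1 := by
      rw [Equiv.Perm.sign_mul, Equiv.Perm.sign_inv, hρ, hσ, one_mul]
    have := vol_perm_fixing_last (D.perm ρ hρ) (ρ⁻¹ * σ) hg
      (by
        rw [Equiv.Perm.mul_apply, ← h4]
        exact ρ.symm_apply_apply 4)
    rw [← this, ← vol_perm_mul _ _ _ hρ hg]
    congr 2
    rw [mul_inv_cancel_left]
  by_cases hm : σ 4 = 4
  · exact vol_perm_fixing_last D σ hσ hm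
  · set m := σ 4 with hmdef
    -- Pigeonhole: of three candidates `l`, each of the two required inequalities fails for at most
    -- one, by `B_not_const`.
    have hl : ∃ l, m ≠ l ∧ l ≠ 4 ∧ D.B 4 l - D.B 4 m ≠ 0 ∧ D.B m 4 - D.B m l ≠ 0 := by
      obtain ⟨l1, l1m, l14, -, -⟩ := exists_fifth m 4 4 4
      obtain ⟨l2, l2m, l24, l21, -⟩ := exists_fifth m 4 l1 4
      obtain ⟨l3, l3m, l34, l31, l32⟩ := exists_fifth m 4 l1 l2
      by_contra hall
      push Not at hall
      have cases : ∀ l, m ≠ l → l ≠ 4 → D.B 4 l = D.B 4 m ∨ D.B m l = D.B m 4 := by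
        intro l h1 h2
        by_cases h : D.B 4 l - D.B 4 m = 0
        · exact Or.inl (sub_eq_zero.1 h)
        · exact Or.inr (sub_eq_zero.1 (hall l h1 h2 h)).symm
      have no1 : ∀ a b, a ≠ b → m ≠ a → a ≠ 4 → m ≠ b → b ≠ 4 → D.B 4 a = D.B 4 m →
          D.B 4 b = D.B 4 m → False := fun a b hab ha ha4 hb hb4 e1 e2 =>
        D.B_not_const 4 a b m ha4.symm hb4.symm (Ne.symm hm) hab hb.symm ha.symm e1 e2
      have no2 : ∀ a b, a ≠ b → m ≠ a → a ≠ 4 → m ≠ b → b ≠ 4 → D.B m a = D.B m 4 →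
          D.B m b = D.B m 4 → False := fun a b hab ha ha4 hb hb4 e1 e2 =>
        D.B_not_const m a b 4 ha hb hm hab hb4 ha4 e1 e2
      rcases cases l1 l1m.symm l14 with c1 | c1 <;> rcases cases l2 l2m.symm l24 with c2 | c2 <;>
        rcases cases l3 l3m.symm l34 with c3 | c3
      · exact no1 l1 l2 l21.symm l1m.symm l14 l2m.symm l24 c1 c2
      · exact no1 l1 l2 l21.symm l1m.symm l14 l2m.symm l24 c1 c2
      · exact no1 l1 l3 l31.symm l1m.symm l14 l3m.symm l34 c1 c3
      · exact no2 l2 l3 l32.symm l2m.symm l24 l3m.symm l34 c2 c3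
      · exact no1 l2 l3 l32.symm l2m.symm l24 l3m.symm l34 c2 c3
      · exact no2 l1 l3 l31.symm l1m.symm l14 l3m.symm l34 c1 c3
      · exact no2 l1 l2 l21.symm l1m.symm l14 l2m.symm l24 c1 c2
      · exact no2 l1 l2 l21.symm l1m.symm l14 l2m.symm l24 c1 c2
    obtain ⟨l, hml, hl4, hB4, hBm⟩ := hl
    obtain ⟨τ, hτ, τ4, τ2, τ3⟩ := exists_even_three m l hm hl4 hml
    have hb : Equiv.Perm.sign (Equiv.swap (2 : Fin 5) 3 * Equiv.swap 3 4) = 1 := by decide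
    rw [same (τ * (Equiv.swap 2 3 * Equiv.swap 3 4))
      (by rw [Equiv.Perm.sign_mul, hτ, hb, one_mul])
      (by
        have : (Equiv.swap 2 3 * Equiv.swap 3 4 : Equiv.Perm (Fin 5)) 4 = 2 := by decide
        rw [Equiv.Perm.mul_apply, this, τ2]), vol_perm_mul _ _ _ hτ hb, vol_perm_cycle _ ?_ ?_,
      vol_perm_fixing_last D τ hτ τ4]
    · simpa only [perm, τ2, τ3, τ4] using hB4
    · simpa only [perm, τ2, τ3, τ4] using hBm

/-- The minors of the matrix of the Gaussian exponent. -/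
theorem minor_formula_perm (σ : Equiv.Perm (Fin 5)) (hσ : Equiv.Perm.sign σ = 1) :
    (D.F (σ 0) (σ 2) * D.F (σ 1) (σ 3) - D.F (σ 0) (σ 3) * D.F (σ 1) (σ 2)) * D.vol *
      (D.kap (σ 2) * D.kap (σ 3) * D.kap (σ 4)) = (D.B (σ 4) (σ 3) - D.B (σ 4) (σ 2)) *
      (D.Om (σ 2) (σ 3) * D.Om (σ 2) (σ 4) * D.Om (σ 3) (σ 4)) := by
  have := (D.perm σ hσ).minor_formula
  rw [D.vol_perm σ hσ] at this
  exact this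

/-- The matrix of the Gaussian exponent is determined by the functionals `β` and `γ`. -/
theorem F_unique (D' : PentData)
    (hB : ∀ m a b, a ≠ m → b ≠ m → D'.B m a - D'.B m b = D.B m a - D.B m b)
    (hG : ∀ m a b, a ≠ m → b ≠ m → D'.G m a - D'.G m b = D.G m a - D.G m b) : D'.F = D.F := by
  have hβ : ∀ a b c, a ≠ b → b ≠ c → a ≠ c → D'.beta (triCirc a b c) = D.beta (triCirc a b c) := by
    intro a b c hab hbc hac
    funext t
    rw [beta_triCirc _ _ _ _ _ hab hbc hac, beta_triCirc _ _ _ _ _ hab hbc hac,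
      hB c b a hbc hac, hB a c b hac.symm hab.symm, hB b a c hab hbc.symm]
  have hrows : D'.rows = D.rows := by
    simp only [rows]
    rw [hβ _ _ _ (by decide) (by decide) (by decide), hβ _ _ _ (by decide) (by decide) (by decide),
      hβ _ _ _ (by decide) (by decide) (by decide), hβ _ _ _ (by decide) (by decide) (by decide),
      hβ _ _ _ (by decide) (by decide) (by decide)]
  have hγ : ∀ a b c m, a ≠ b → b ≠ c → a ≠ c → ∑ t, D'.beta (triCirc a b c) t * D'.F t m =
      ∑ t, D.beta (triCirc a b c) t * D.F t m := by
    intro a b c m hab hbc hac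
    rw [gamma_triCirc _ _ _ _ _ hab hbc hac, gamma_triCirc _ _ _ _ _ hab hbc hac,
      hG c b a hbc hac, hG a c b hac.symm hab.symm, hG b a c hab hbc.symm]
  have hmul : D.rows * Matrix.of D'.F = D.rows * Matrix.of D.F := by
    nth_rewrite 1 [← hrows]
    ext r m
    fin_cases r <;> exact hγ _ _ _ m (by decide) (by decide) (by decide)
  -- The product of `rows` with `F` consists of values of γ, so invertibility of `rows` determines
  -- `F`.
  have hunit : IsUnit D.rows.det := isUnit_iff_ne_zero.2 D.det_rows_ne_zero
  have := congrArg (fun M => D.rows⁻¹ * M) hmul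
  simp only [Matrix.nonsing_inv_mul_cancel_left _ _ hunit] at this
  exact this

end PentData

end

/-! ### From simplices to pentachoron data: vertex orders and signs -/

section

namespace IsTetPair

/-- Absorbs the difference between the orientation of a tetrahedron by its vertex order and its sign
in the dual form. -/
theorem scale {w : Fin 4 → ℂ} {K : ℂ} {b g : Fin 4 → ℂ} (h : IsTetPair w K b g) {s : ℂ}
    (hs : s ^ 2 = 1) : IsTetPair (fun a => s * w a) K (fun a => s * b a) g where
  quad z hz := by
    have hs0 : s ≠ 0 := fun h0 => by simp [h0] at hs
    have h1 : ∑ a, s * b a * z a = s * ∑ a, b a * z a := by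
      rw [Finset.mul_sum]
      exact Finset.sum_congr rfl fun _ _ => by ring
    have h2 : ∑ a, z a ^ 2 / (s * w a) = s * ∑ a, z a ^ 2 / w a := by
      rw [Finset.mul_sum]
      refine Finset.sum_congr rfl fun a _ => ?_
      have : s⁻¹ = s := by
        exact inv_eq_of_mul_eq_one_left (by linear_combination hs)
      rw [div_eq_mul_inv, mul_inv, this, div_eq_mul_inv]
      ring
    rw [h1, h2, ← h.quad z hz]
    ring
  root0 := by linear_combination s * h.root0 + s * w 2 * w 3 * (b 2 - b 3) * hs
  root1 := by linear_combination s * h.root1 + s * w 0 * w 3 * (b 0 - b 3) * hs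
  root2 := by linear_combination s * h.root2 + s * w 1 * w 3 * (b 1 - b 3) * hs

/-- The quadratic form is symmetric in the vertices, but the distinction of its factors by the
square root is only invariant under even permutations: an odd one reverses the sign of `K`. Adjacent
transpositions suffice. -/
theorem comp_perm (τ : Equiv.Perm (Fin 4)) : ∀ (w : Fin 4 → ℂ) (K : ℂ) (b g : Fin 4 → ℂ),
    (∀ a, w a ≠ 0) → K ^ 2 = ∏ a, w a → IsTetPair w K b g →
    IsTetPair (w ∘ τ) ((Equiv.Perm.sign τ : ℤ) * K) (b ∘ τ) (g ∘ τ) := by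
  have hquad : ∀ (τ : Equiv.Perm (Fin 4)) (w : Fin 4 → ℂ) (K : ℂ) (b g : Fin 4 → ℂ),
      IsTetPair w K b g → ∀ z : Fin 4 → ℂ, ∑ a, z a = 0 →
      2 * (∑ a, (b ∘ τ) a * z a) * (∑ a, (g ∘ τ) a * z a) = ∑ a, z a ^ 2 / (w ∘ τ) a := by
    intro τ w K b g h z hz
    have := h.quad (z ∘ τ.symm) (by rw [← hz]; exact Equiv.sum_comp τ.symm z)
    have h1 : ∀ f : Fin 4 → ℂ, ∑ a, (f ∘ τ) a * z a = ∑ a, f a * (z ∘ τ.symm) a := fun f => by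
      rw [← Equiv.sum_comp τ fun a => f a * (z ∘ τ.symm) a]
      simp
    have h2 : ∑ a, z a ^ 2 / (w ∘ τ) a = ∑ a, (z ∘ τ.symm) a ^ 2 / w a := by
      rw [← Equiv.sum_comp τ fun a => (z ∘ τ.symm) a ^ 2 / w a]
      simp
    rw [h1, h1, h2, this]
  have hτ : τ ∈ Submonoid.closure (Set.range fun i : Fin 3 => Equiv.swap i.castSucc i.succ) := by
    rw [Equiv.Perm.mclosure_swap_castSucc_succ]
    trivial
  induction hτ using Submonoid.closure_induction with
  | one =>
    intro w K b g _ _ h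
    simpa using h
  | mul x y _ _ hx hy =>
    intro w K b g hw hK h
    have h1 := hy (w ∘ x) _ (b ∘ x) (g ∘ x) (fun a => hw _) (by
      rw [mul_pow, hK, Function.comp_def, Equiv.prod_comp x w]
      rcases Int.units_eq_one_or (Equiv.Perm.sign x) with e | e <;> simp [e]) (hx w K b g hw hK h)
    have h2 : ((Equiv.Perm.sign (x * y) : ℤ) : ℂ) * K =
        (Equiv.Perm.sign y : ℤ) * ((Equiv.Perm.sign x : ℤ) * K) := by
      rw [Equiv.Perm.sign_mul]
      push_cast
      ring
    rw [h2]
    exact h1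
  | mem x hx =>
    intro w K b g hw hK h
    have r0 := h.root0
    have r1 := h.root1
    have r2 := h.root2
    rw [Fin.prod_univ_four] at hK
    obtain ⟨i, rfl⟩ := hx
    refine ⟨hquad _ _ _ _ _ h, ?_, ?_, ?_⟩
    all_goals
      simp only
      rw [Equiv.Perm.sign_swap (Fin.castSucc_lt_succ).ne]
    · fin_cases i
      · simp [Equiv.swap_apply_def]
        linear_combination -r0
      · simp [Equiv.swap_apply_def]
        linear_combination -r2
      · simp [Equiv.swap_apply_def]
        linear_combination r0
    · fin_cases i
      · simp [Equiv.swap_apply_def]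
        linear_combination -r2
      · simp [Equiv.swap_apply_def]
        linear_combination -r1
      · simp [Equiv.swap_apply_def]
        -- This transposition moves vertex 3, special in the root relations. Solving the old
        -- relation for its other side uses the value of `K ^ 2`.
        refine mul_left_cancel₀ (mul_ne_zero (hw 1) (hw 3)) ?_
        linear_combination K * r2 - (b 2 - b 0) * hK
    · fin_cases i
      · simp [Equiv.swap_apply_def]
        linear_combination -r1
      · simp [Equiv.swap_apply_def]
        linear_combination -r0
      · simp [Equiv.swap_apply_def]
        refine mul_left_cancel₀ (mul_ne_zero (hw 0) (hw 3)) ?_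
        linear_combination -K * r1 + (b 1 - b 2) * hK

end IsTetPair

/-- A renumbering of the pentachoron restricts to the tetrahedron opposite to `σ 4`; bringing the
omitted vertex to the end costs `(-1) ^ (σ 4)`, a sign which must be matched with the one in `kap`.
-/
theorem exists_perm_of_last (σ : Equiv.Perm (Fin 5)) : ∃ τ : Equiv.Perm (Fin 4),
    (∀ a, σ a.castSucc = (σ 4).succAbove (τ a)) ∧
      Equiv.Perm.sign σ = Equiv.Perm.sign τ * (-1) ^ (σ 4 : ℕ) := by
  -- Rotated in the source and in the target so that 0 is fixed; the rest is a permutation of four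
  -- elements.
  let ρ : Equiv.Perm (Fin 5) := (σ 4).cycleRange * σ * (finRotate 5)⁻¹
  have h0 : ρ 0 = 0 := by
    have : (finRotate 5)⁻¹ 0 = (4 : Fin 5) := by decide
    simp only [ρ, Equiv.Perm.mul_apply, this, Fin.cycleRange_self]
  obtain ⟨⟨p, τ⟩, hτ⟩ := Equiv.Perm.decomposeFin.symm.surjective ρ
  have hp : p = 0 := by
    rw [← h0, ← hτ, Equiv.Perm.decomposeFin_symm_apply_zero]
  subst hp
  refine ⟨τ, fun a => ?_, ?_⟩
  · have h1 : ρ a.succ = (τ a).succ := by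
      rw [← hτ, Equiv.Perm.decomposeFin_symm_apply_succ]
      simp
    have h2 : ∀ a : Fin 4, (finRotate 5)⁻¹ a.succ = a.castSucc := by decide
    simp only [ρ, Equiv.Perm.mul_apply, h2] at h1
    rw [← Fin.cycleRange_succAbove (σ 4)] at h1
    exact (σ 4).cycleRange.injective h1
  · have h1 : Equiv.Perm.sign ρ = Equiv.Perm.sign τ := by
      rw [← hτ, Equiv.Perm.decomposeFin.symm_sign]
      simp
    have h2 : Equiv.Perm.sign ρ = (-1) ^ (σ 4 : ℕ) * Equiv.Perm.sign σ := by
      simp only [ρ, Equiv.Perm.sign_mul, Fin.sign_cycleRange, Equiv.Perm.sign_inv, sign_finRotate]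
      simp
      rfl
    rw [← h1, h2, mul_comm, ← mul_assoc, ← mul_pow]
    simp

namespace OrderedComplex

variable (X : OrderedComplex)

/-- The embedding of the vertex number `i`. -/
def vertEmb {n : ℕ} (i : Fin (n + 1)) : Fin (0 + 1) ↪o Fin (n + 1) :=
  OrderEmbedding.ofStrictMono (fun _ => i) fun a b h => absurd (show (a : ℕ) < b from h) (by omega)

variable {X}

theorem res_vert_lt {n : ℕ} (x : X.S n) {i j : Fin (n + 1)} (h : i < j) :
    X.res (vertEmb i) x < X.res (vertEmb j) x := X.vertices_increasing x _ _ h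

theorem res_vert_injective {n : ℕ} (x : X.S n) {i j : Fin (n + 1)}
    (h : X.res (vertEmb i) x = X.res (vertEmb j) x) : i = j := by
  rcases lt_trichotomy i j with h1 | h1 | h1
  · exact absurd h (res_vert_lt x h1).ne
  · exact h1
  · exact absurd h (res_vert_lt x h1).ne'

theorem res_vert_res {m n : ℕ} (g : Fin (m + 1) ↪o Fin (n + 1)) (x : X.S n) (i : Fin (m + 1)) :
    X.res (vertEmb i) (X.res g x) = X.res (vertEmb (g i)) x := by
  rw [X.res_comp]
  congr 1

theorem res_injective {m n : ℕ} {g g' : Fin (m + 1) ↪o Fin (n + 1)} (x : X.S n)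
    (h : X.res g x = X.res g' x) : g = g' := by
  ext i
  have := congrArg (X.res (vertEmb i)) h
  rw [res_vert_res, res_vert_res] at this
  rw [res_vert_injective x this]

theorem d_injective {n : ℕ} (x : X.S (n + 1)) : Function.Injective fun i => X.d i x := by
  intro i j h
  have := res_injective x h
  by_contra hij
  have h2 : i ∈ Set.range (Fin.succAboveOrderEmb i) := by
    rw [this]
    change i ∈ Set.range j.succAbove
    rw [Fin.range_succAbove]
    exact hij
  change i ∈ Set.range i.succAbove at h2
  rw [Fin.range_succAbove] at h2
  exact h2 rfl

theorem res_eq_face {m n : ℕ} (g : Fin (m + 1) ↪o Fin (n + 1)) (x : X.S n)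
    (s : Finset (Fin (n + 1))) (h : s.card = m + 1) (hg : ∀ i, g i ∈ s) :
    X.res g x = X.face x s h := by
  rw [face, ← Finset.orderEmbOfFin_unique' h hg]

theorem face_injective {m n : ℕ} (x : X.S n) {s s' : Finset (Fin (n + 1))} {h : s.card = m + 1}
    {h' : s'.card = m + 1} (hf : X.face x s h = X.face x s' h') : s = s' := by
  have := res_injective x hf
  rw [← Finset.coe_inj, ← Finset.range_orderEmbOfFin s h, ← Finset.range_orderEmbOfFin s' h', this]

theorem face_congr {m n : ℕ} (x : X.S n) {s s' : Finset (Fin (n + 1))} {h : s.card = m + 1}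
    {h' : s'.card = m + 1} (hs : s = s') : X.face x s h = X.face x s' h' := by
  subst hs
  rfl

theorem res_face {k m n : ℕ} (g : Fin (k + 1) ↪o Fin (m + 1)) (x : X.S n)
    (s : Finset (Fin (n + 1))) (h : s.card = m + 1) (s' : Finset (Fin (n + 1)))
    (h' : s'.card = k + 1) (hg : ∀ i, s.orderEmbOfFin h (g i) ∈ s') :
    X.res g (X.face x s h) = X.face x s' h' := by
  rw [face, X.res_comp]
  exact res_eq_face _ x s' h' hg

theorem d_face {m n : ℕ} (x : X.S n) (s : Finset (Fin (n + 1))) (h : s.card = m + 2)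
    (i : Fin (m + 2)) (h' : (s.erase (s.orderEmbOfFin h i)).card = m + 1) :
    X.d i (X.face x s h) = X.face x (s.erase (s.orderEmbOfFin h i)) h' := by
  refine res_face _ x s h _ h' fun j => ?_
  rw [Finset.mem_erase]
  refine ⟨fun he => ?_, Finset.orderEmbOfFin_mem s h _⟩
  exact Fin.succAbove_ne i j ((s.orderEmbOfFin h).injective he)

theorem card_filter_lt_orderEmbOfFin {α : Type*} [LinearOrder α] (s : Finset α) {k : ℕ}
    (h : s.card = k) (i : Fin k) : (s.filter (· < s.orderEmbOfFin h i)).card = i := by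
  have : s.filter (· < s.orderEmbOfFin h i) =
      (Finset.Iio i).map (s.orderEmbOfFin h).toEmbedding := by
    ext y
    simp only [Finset.mem_filter, Finset.mem_map, Finset.mem_Iio, RelEmbedding.coe_toEmbedding]
    constructor
    · rintro ⟨hy, hlt⟩
      have : y ∈ Set.range (s.orderEmbOfFin h) := by
        rw [Finset.range_orderEmbOfFin]
        exact hy
      obtain ⟨j, rfl⟩ := this
      exact ⟨j, (s.orderEmbOfFin h).lt_iff_lt.1 hlt, rfl⟩
    · rintro ⟨j, hj, rfl⟩
      exact ⟨Finset.orderEmbOfFin_mem s h j, (s.orderEmbOfFin h).lt_iff_lt.2 hj⟩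
  rw [this, Finset.card_map, Fin.card_Iio]

theorem card_pair_compl {a b : Fin 5} (h : a ≠ b) : (({a, b} : Finset (Fin 5))ᶜ).card = 2 + 1 := by
  rw [Finset.card_compl, Finset.card_pair h]
  rfl

/-- The 2-face of the pentachoron `u` not containing its vertices number `a` and `b`. -/
def tri (u : X.S 4) (a b : Fin 5) : X.S 2 :=
  -- For `a = b` the value is arbitrary: the factor `theta a a = 0` removes it from `dual`.
  if h : a ≠ b then X.face u {a, b}ᶜ (card_pair_compl h) else X.d 0 (X.d 0 u)

theorem tri_of_ne (u : X.S 4) {a b : Fin 5} (h : a ≠ b) :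
    X.tri u a b = X.face u {a, b}ᶜ (card_pair_compl h) := dif_pos h

theorem tri_comm (u : X.S 4) (a b : Fin 5) : X.tri u a b = X.tri u b a := by
  by_cases h : a = b
  · rw [h]
  · rw [tri_of_ne u h, tri_of_ne u (Ne.symm h)]
    exact face_congr u (by rw [Finset.pair_comm])

theorem tri_injective (u : X.S 4) {a b c e : Fin 5} (h : a ≠ b) (h' : c ≠ e)
    (ht : X.tri u a b = X.tri u c e) : (a = c ∧ b = e) ∨ (a = e ∧ b = c) := by
  rw [tri_of_ne u h, tri_of_ne u h'] at ht
  have := compl_injective (face_injective u ht)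
  have h1 := congrArg (fun s : Finset (Fin 5) => (s : Set (Fin 5))) this
  simp only [Finset.coe_pair] at h1
  rwa [Set.pair_eq_pair_iff] at h1

theorem d_d_eq_tri (u : X.S 4) (m : Fin 5) (a : Fin 4) :
    X.d a (X.d m u) = X.tri u (m.succAbove a) m := by
  rw [tri_of_ne u (Fin.succAbove_ne m a)]
  unfold d
  rw [X.res_comp]
  refine res_eq_face _ u _ _ fun i => ?_
  change m.succAbove (a.succAbove i) ∈ _
  simp only [Finset.mem_compl, Finset.mem_insert, Finset.mem_singleton, not_or]
  exact ⟨fun h => Fin.succAbove_ne a i (Fin.succAbove_right_injective h), Fin.succAbove_ne m _⟩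

end OrderedComplex

/-- The sign relating the vertex orders of a 2-face and of the complementary edge. -/
def theta (a b : Fin 5) : ℤ :=
  if a < b then (-1) ^ (a + b : ℕ) else if b < a then -(-1) ^ (a + b : ℕ) else 0

theorem theta_anti (a b : Fin 5) : theta a b = -theta b a := by
  revert a b
  decide

theorem theta_sq {a b : Fin 5} (h : a ≠ b) : theta a b * theta a b = 1 := by
  revert a b
  decide

theorem theta_sq' {a b : Fin 5} (h : a ≠ b) : (theta a b : ℂ) * theta a b = 1 := by
  exact_mod_cast theta_sq h

theorem theta_succAbove (m : Fin 5) (a : Fin 4) :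
    (-1) ^ (a : ℕ) = (-1) ^ (m : ℕ) * theta (m.succAbove a) m := by
  revert m a
  decide

namespace OrderedComplex

variable {X : OrderedComplex}

/-- The values of a 2-cochain on the 2-faces of a pentachoron, in dual form. -/
def dual (u : X.S 4) (c : X.S 2 → ℂ) (a b : Fin 5) : ℂ := theta a b * c (X.tri u a b)

theorem dual_anti (u : X.S 4) (c : X.S 2 → ℂ) (a b : Fin 5) :
    X.dual u c a b = -X.dual u c b a := by
  rw [dual, dual, theta_anti a b, tri_comm u a b]
  push_cast
  ring

/-- With `theta` the sign of a face in its tetrahedron depends, up to `(-1) ^ m`, on an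
antisymmetric quantity only. The cocycle condition on the tetrahedron number `m` becomes the
vanishing of a column sum. -/
theorem sign_mul_eq_dual (u : X.S 4) (c : X.S 2 → ℂ) (m : Fin 5) (a : Fin 4) :
    (-1) ^ (a : ℕ) * c (X.d a (X.d m u)) = (-1) ^ (m : ℕ) * X.dual u c (m.succAbove a) m := by
  have h : ((-1 : ℂ)) ^ (a : ℕ) = (-1) ^ (m : ℕ) * theta (m.succAbove a) m := by
    exact_mod_cast theta_succAbove m a
  rw [d_d_eq_tri, dual, h]
  ring

theorem dual_self (u : X.S 4) (c : X.S 2 → ℂ) (a : Fin 5) : X.dual u c a a = 0 := by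
  have := dual_anti u c a a
  linear_combination (1 / 2 : ℂ) * this

theorem neg_one_pow_mul_self (m : ℕ) : ((-1 : ℂ)) ^ m * (-1) ^ m = 1 := by
  rw [← mul_pow]
  simp

theorem tetEval_d (u : X.S 4) (m : Fin 5) (f : Fin 4 → ℂ) (c : X.S 2 → ℂ) :
    tetEval (X.d m u) f c = ∑ a, m.insertNth (α := fun _ => ℂ) 0 (fun a' => (-1) ^ (m : ℕ) * f a') a *
      X.dual u c a m := by
  rw [Fin.sum_univ_succAbove _ m, dual_self, mul_zero, zero_add, tetEval]
  refine Finset.sum_congr rfl fun a _ => ?_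
  rw [sign_mul_eq_dual, Fin.insertNth_apply_succAbove]
  ring

theorem cob_d (u : X.S 4) (m : Fin 5) (c : X.S 2 → ℂ) :
    X.cob 2 c (X.d m u) = (-1) ^ (m : ℕ) * ∑ a, X.dual u c a m := by
  change ∑ a : Fin 4, (-1 : ℂ) ^ (a : ℕ) * c (X.d a (X.d m u)) = _
  rw [Fin.sum_univ_succAbove _ m, dual_self, zero_add, Finset.mul_sum]
  exact Finset.sum_congr rfl fun a _ => sign_mul_eq_dual u c m a

theorem sum_dual (u : X.S 4) (c : X.S 2 → ℂ) (m : Fin 5) (h : X.cob 2 c (X.d m u) = 0) :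
    ∑ a, X.dual u c a m = 0 := by
  rw [cob_d] at h
  exact (mul_eq_zero.1 h).resolve_left (pow_ne_zero _ (by norm_num))

/-- The ten 2-faces of a pentachoron are distinct, so prescribed values are consistent. This carries
the annihilation condition from cochains to matrices. -/
theorem exists_dual (u : X.S 4) (Z : Fin 5 → Fin 5 → ℂ) (hZ : ∀ a b, Z a b = -Z b a) :
    ∃ c : X.S 2 → ℂ, X.dual u c = Z := by
  let f : {p : Fin 5 × Fin 5 // p.1 < p.2} → X.S 2 := fun p => X.tri u p.1.1 p.1.2
  have hf : Function.Injective f := by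
    rintro ⟨⟨a, b⟩, h⟩ ⟨⟨c, e⟩, h'⟩ hp
    simp only at h h'
    rcases tri_injective u h.ne h'.ne hp with ⟨rfl, rfl⟩ | ⟨rfl, rfl⟩
    · rfl
    · exact absurd h' (lt_asymm h)
  let c : X.S 2 → ℂ := Function.extend f (fun p => theta p.1.1 p.1.2 * Z p.1.1 p.1.2) 0
  have hlt : ∀ a b, a < b → X.dual u c a b = Z a b := by
    intro a b h
    have : c (X.tri u a b) = theta a b * Z a b := hf.extend_apply _ _ ⟨(a, b), h⟩
    rw [dual, this, ← mul_assoc, theta_sq' h.ne, one_mul]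
  refine ⟨c, ?_⟩
  funext a b
  rcases lt_trichotomy a b with h | rfl | h
  · exact hlt a b h
  · rw [dual_self]
    have := hZ a a
    linear_combination (-1 / 2 : ℂ) * this
  · rw [dual_anti, hlt b a h, hZ a b]

end OrderedComplex

namespace EdgeOperators

variable {X : OrderedComplex} {C : Coloring X} (D : EdgeOperators C)

/-- The anticommutation condition speaks of cochains on the whole complex; since the four faces of
`t` are distinct, any four face values extend to such a cochain. -/
theorem isTetPair (t : X.S 3) : IsTetPair (C.w t) (C.K t) (D.bcoef t) (D.gcoef t) where
  quad z hz := by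
    let c : X.S 2 → ℂ := Function.extend (fun a => X.d a t) (fun a : Fin 4 => (-1) ^ (a : ℕ) * z a) 0
    have hc : ∀ a : Fin 4, c (X.d a t) = (-1 : ℂ) ^ (a : ℕ) * z a := fun a =>
      (OrderedComplex.d_injective t).extend_apply _ _ a
    have hc' : ∀ a : Fin 4, (-1 : ℂ) ^ (a : ℕ) * c (X.d a t) = z a := fun a => by
      rw [hc, ← mul_assoc, OrderedComplex.neg_one_pow_mul_self, one_mul]
    have h := D.anticomm t c (by
      rw [← hz]
      exact Finset.sum_congr (s₁ := (Finset.univ : Finset (Fin 4))) rfl fun a _ => hc' a)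
    simp only [tetEval, hc'] at h
    rw [h]
    refine Finset.sum_congr rfl fun a _ => ?_
    rw [hc, Coloring.w, mul_pow, ← pow_mul, mul_comm (a : ℕ) 2, pow_mul]
    rcases neg_one_pow_eq_or ℂ (a : ℕ) with h | h <;> simp [h, neg_div, div_neg]
  root0 := (D.root t).1
  root1 := (D.root t).2.1
  root2 := (D.root t).2.2

end EdgeOperators

namespace Coloring

variable {X : OrderedComplex} (C : Coloring X)

theorem w_ne_zero (t : X.S 3) (a : Fin 4) : C.w t a ≠ 0 :=
  mul_ne_zero (pow_ne_zero _ (by norm_num)) (C.ne_zero _)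

theorem sum_w (t : X.S 3) : ∑ a, C.w t a = 0 :=
  congrFun (LinearMap.mem_ker.1 C.cocycle) t

theorem K_sq (t : X.S 3) : C.K t ^ 2 = ∏ a, C.w t a := by
  simp only [Coloring.K, Coloring.w, Fin.prod_univ_four, mul_pow, C.sq]
  norm_num

theorem q_ne_zero (s : X.S 2) : C.q s ≠ 0 := fun h => C.ne_zero s (by rw [← C.sq, h]; simp)

end Coloring

namespace System

variable (Y : System)

open OrderedComplex

theorem orient_mul_self (u : Y.T.S 4) : ((Y.T.orient u : ℤ) : ℂ) * (Y.T.orient u : ℤ) = 1 := by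
  rcases Int.units_eq_one_or (Y.T.orient u) with h | h <;> simp [h]

/-- The coefficients of `β` in a pentachoron. -/
def pentB (u : Y.T.S 4) (m : Fin 5) : Fin 5 → ℂ :=
  -- The entry at `m` is arbitrary, as it multiplies a diagonal value of `dual`. The sign `(-1) ^ m`
  -- compensates the one in `sign_mul_eq_dual`.
  m.insertNth (α := fun _ => ℂ) 0 fun a => (-1) ^ (m : ℕ) * Y.D.bcoef (Y.T.d m u) a

/-- The coefficients of `γ` in a pentachoron. -/
def pentG (u : Y.T.S 4) (m : Fin 5) : Fin 5 → ℂ :=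
  m.insertNth (α := fun _ => ℂ) 0 (Y.D.gcoef (Y.T.d m u))

theorem beta_d (u : Y.T.S 4) (m : Fin 5) (c : Y.T.S 2 → ℂ) :
    Y.D.β (Y.T.d m u) c = ∑ a, Y.pentB u m a * Y.T.dual u c a m :=
  tetEval_d u m _ c

theorem gamma_d (u : Y.T.S 4) (m : Fin 5) (c : Y.T.S 2 → ℂ) :
    Y.D.γ (Y.T.d m u) c = (-1) ^ (m : ℕ) * ∑ a, Y.pentG u m a * Y.T.dual u c a m := by
  rw [EdgeOperators.γ, tetEval_d, Finset.mul_sum]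
  refine Finset.sum_congr rfl fun a _ => ?_
  rw [← mul_assoc]
  congr 1
  refine Fin.succAboveCases m ?_ (fun a => ?_) a
  · simp [pentG]
  · simp only [pentG, Fin.insertNth_apply_succAbove]

/-- The data of a pentachoron of a system. -/
def pent (u : Y.T.S 4) : PentData where
  Om := Y.T.dual u Y.C.ω
  kap m := (-1) ^ (m : ℕ) * Y.C.K (Y.T.d m u)
  B := Y.pentB u
  G := Y.pentG u
  -- The orientation sign is moved from γ to `F`. It disappears from the minors, which are quadratic
  -- in `F`.
  F a b := (Y.T.orient u : ℤ) * Y.F u a b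
  anti := dual_anti u _
  ne a b h := mul_ne_zero (fun h0 => by
    have := theta_sq' h
    rw [h0] at this
    simp at this) (Y.C.ne_zero _)
  sum m := sum_dual u _ m (congrFun (LinearMap.mem_ker.1 Y.C.cocycle) _)
  kap_sq σ := by
    obtain ⟨τ, hτ, -⟩ := exists_perm_of_last σ
    have h1 : ∀ a, Y.T.dual u Y.C.ω ((σ 4).succAbove a) (σ 4) =
        (-1) ^ (σ 4 : ℕ) * Y.C.w (Y.T.d (σ 4) u) a := fun a => by
      rw [Coloring.w, sign_mul_eq_dual, ← mul_assoc, neg_one_pow_mul_self, one_mul]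
    simp only [hτ]
    rw [Equiv.prod_comp τ fun a => Y.T.dual u Y.C.ω ((σ 4).succAbove a) (σ 4)]
    simp only [h1, Finset.prod_mul_distrib, ← Y.C.K_sq, mul_pow]
    simp only [Finset.prod_const, Finset.card_univ, Fintype.card_fin, ← pow_mul]
    rw [mul_comm (σ 4 : ℕ) 2, mul_comm (σ 4 : ℕ) 4, pow_mul, pow_mul]
    norm_num
  tet σ hσ := by
    obtain ⟨τ, hτ, hsign⟩ := exists_perm_of_last σ
    have h1 : ∀ a, Y.T.dual u Y.C.ω ((σ 4).succAbove a) (σ 4) =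
        (-1) ^ (σ 4 : ℕ) * Y.C.w (Y.T.d (σ 4) u) a := fun a => by
      rw [Coloring.w, sign_mul_eq_dual, ← mul_assoc, neg_one_pow_mul_self, one_mul]
    have hs : ((Equiv.Perm.sign τ : ℤ) : ℂ) = (-1) ^ (σ 4 : ℕ) := by
      rw [hσ] at hsign
      have : Equiv.Perm.sign τ = (-1) ^ (σ 4 : ℕ) := by
        have h2 := congrArg (· * (-1 : ℤˣ) ^ (σ 4 : ℕ)) hsign
        simp only [one_mul, mul_assoc, ← mul_pow] at h2
        simpa using h2.symm
      rw [this]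
      push_cast
      rfl
    have h2 := ((Y.D.isTetPair (Y.T.d (σ 4) u)).comp_perm τ _ _ _ _ (Y.C.w_ne_zero _)
      (Y.C.K_sq _)).scale (s := (-1) ^ (σ 4 : ℕ)) (by rw [sq, neg_one_pow_mul_self])
    rw [hs] at h2
    simp only [hτ, h1, pentB, pentG, Fin.insertNth_apply_succAbove]
    exact h2
  skew a b := by
    have := congrFun (congrFun (Y.skew u) b) a
    rw [Matrix.transpose_apply, Matrix.neg_apply] at this
    rw [this]
    ring
  ann Z hZ hs m := by
    obtain ⟨c, rfl⟩ := exists_dual u Z hZ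
    have h := Y.annihilate u c (fun i => by rw [cob_d, hs, mul_zero]) m
    rw [gamma_d] at h
    simp only [beta_d] at h
    have h2 : ∑ t, (∑ a, Y.pentB u t a * Y.T.dual u c a t) * ((Y.T.orient u : ℤ) * Y.F u t m) =
        (Y.T.orient u : ℤ) * ∑ t, (∑ a, Y.pentB u t a * Y.T.dual u c a t) * Y.F u t m := by
      rw [Finset.mul_sum]
      exact Finset.sum_congr rfl fun _ _ => by ring
    rw [h2, ← h]
    push_cast
    linear_combination -(∑ a, Y.pentG u m a * Y.T.dual u c a m) *
      ((-1) ^ (m : ℕ) * (-1) ^ (m : ℕ) * Y.orient_mul_self u + neg_one_pow_mul_self (m : ℕ))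

end System

end

/-! ### Edges in dual form and the value of the pentachoron weight -/

section

namespace OrderedComplex

variable {X : OrderedComplex}

open Classical in
theorem edgeCob_face {n : ℕ} (x : X.S n) (s t : Finset (Fin (n + 1))) (hs : s.card = 2 + 1)
    (ht : t.card = 1 + 1) : X.edgeCob (X.face x t ht) (X.face x s hs) =
      ∑ z ∈ s, if s.erase z = t then (-1) ^ (s.filter (· < z)).card else 0 := by
  rw [← Finset.sum_coe_sort, ← Equiv.sum_comp (s.orderIsoOfFin hs).toEquiv]
  change ∑ i : Fin 3, (-1 : ℂ) ^ (i : ℕ) *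
    (Pi.single (X.face x t ht) 1 : X.S 1 → ℂ) (X.d i (X.face x s hs)) = _
  refine Finset.sum_congr rfl fun i _ => ?_
  have hc : (s.erase (s.orderEmbOfFin hs i)).card = 1 + 1 := by
    rw [Finset.card_erase_of_mem (Finset.orderEmbOfFin_mem s hs i), hs]
  rw [d_face (m := 1) x s hs i hc, Pi.single_apply]
  change _ = if s.erase (s.orderEmbOfFin hs i) = t then
    (-1) ^ (s.filter (· < s.orderEmbOfFin hs i)).card else 0
  rw [card_filter_lt_orderEmbOfFin]
  by_cases h : s.erase (s.orderEmbOfFin hs i) = t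
  · rw [if_pos h, if_pos (face_congr x h), mul_one]
  · rw [if_neg h, if_neg (fun hf => h (face_injective x hf)), mul_zero]

end OrderedComplex

/-- The coboundary of the edge `p q` of a pentachoron in dual form. -/
def edgeSign (p q a b : Fin 5) : ℤ :=
  if a = b then 0 else theta a b * ∑ z : Fin 5, if z ≠ a ∧ z ≠ b ∧ z ≠ p ∧ z ≠ q ∧ p ≠ a ∧ p ≠ b ∧
    q ≠ a ∧ q ≠ b then (if p < z then -1 else 1) * (if q < z then -1 else 1) else 0

/-- The circulation along a triangle, with integer values. -/
def triCircInt (a b c x y : Fin 5) : ℤ :=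
  (if x = a ∧ y = b then 1 else 0) + (if x = b ∧ y = c then 1 else 0) +
    (if x = c ∧ y = a then 1 else 0) - (if x = b ∧ y = a then 1 else 0) -
    (if x = c ∧ y = b then 1 else 0) - (if x = a ∧ y = c then 1 else 0)

theorem triCircInt_cast (a b c x y : Fin 5) : (triCircInt a b c x y : ℂ) = triCirc a b c x y := by
  simp only [triCircInt, triCirc]
  push_cast
  rfl

set_option maxRecDepth 100000 in
-- The coboundary of an edge is non-zero only on the 2-faces containing it, whose dual edges form
-- the complementary triangle; the signs are a finite check.
theorem edgeSign_eq (σ : Equiv.Perm (Fin 5)) : Equiv.Perm.sign σ = 1 → σ 0 < σ 1 → ∀ a b,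
    edgeSign (σ 0) (σ 1) a b = -triCircInt (σ 2) (σ 3) (σ 4) a b := by
  revert σ
  decide

set_option maxRecDepth 100000 in
theorem erase_compl_pair (p q a b z : Fin 5) : p ≠ q → (a ≠ b ∧ z ≠ a ∧ z ≠ b) →
    ((({a, b}ᶜ : Finset (Fin 5)).erase z = {p, q}) ↔
      (z ≠ p ∧ z ≠ q ∧ p ≠ a ∧ p ≠ b ∧ q ≠ a ∧ q ≠ b)) := by
  intro h1 h2
  constructor
  · intro h
    have hp : p ∈ ({a, b}ᶜ : Finset (Fin 5)).erase z := by rw [h]; simp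
    have hq : q ∈ ({a, b}ᶜ : Finset (Fin 5)).erase z := by rw [h]; simp
    simp only [Finset.mem_erase, Finset.mem_compl, Finset.mem_insert, Finset.mem_singleton] at hp hq
    grind
  · intro h
    symm
    refine Finset.eq_of_subset_of_card_le ?_ ?_
    · intro x hx
      simp only [Finset.mem_insert, Finset.mem_singleton] at hx
      simp only [Finset.mem_erase, Finset.mem_compl, Finset.mem_insert, Finset.mem_singleton]
      grind
    · rw [Finset.card_pair h1, Finset.card_erase_of_mem (by simp [h2]),
        OrderedComplex.card_pair_compl h2.1]

theorem card_filter_lt_compl (p q a b z : Fin 5) (hpq : p ≠ q)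
    (h : ({a, b}ᶜ : Finset (Fin 5)).erase z = {p, q}) :
    (-1 : ℤ) ^ (({a, b}ᶜ : Finset (Fin 5)).filter (· < z)).card =
      (if p < z then -1 else 1) * (if q < z then -1 else 1) := by
  have h1 : ({a, b}ᶜ : Finset (Fin 5)).filter (· < z) = ({p, q} : Finset (Fin 5)).filter (· < z) := by
    rw [← h]
    ext x
    simp only [Finset.mem_filter, Finset.mem_erase]
    grind
  rw [h1, Finset.filter_insert, Finset.filter_singleton]
  split_ifs <;> simp [hpq]

namespace OrderedComplex

variable {X : OrderedComplex}

theorem dual_edgeCob (u : X.S 4) {p q : Fin 5} (hpq : p ≠ q) (h : ({p, q} : Finset (Fin 5)).card = 1 + 1)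
    (a b : Fin 5) : X.dual u (X.edgeCob (X.face u {p, q} h)) a b = edgeSign p q a b := by
  classical
  by_cases hab : a = b
  · subst hab
    rw [dual_self]
    simp [edgeSign]
  · rw [dual, tri_of_ne u hab, edgeCob_face, edgeSign, if_neg hab]
    push_cast
    congr 1
    rw [← Finset.sum_subset (Finset.subset_univ ({a, b}ᶜ : Finset (Fin 5)))]
    · refine Finset.sum_congr rfl fun z hz => ?_
      simp only [Finset.mem_compl, Finset.mem_insert, Finset.mem_singleton, not_or] at hz
      have e := erase_compl_pair p q a b z hpq ⟨hab, hz.1, hz.2⟩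
      by_cases h1 : ({a, b}ᶜ : Finset (Fin 5)).erase z = {p, q}
      · have h2 := card_filter_lt_compl p q a b z hpq h1
        rw [if_pos h1, if_pos ⟨hz.1, hz.2, e.1 h1⟩]
        exact_mod_cast h2
      · rw [if_neg h1, if_neg fun h3 => h1 (e.2 h3.2.2)]
    · intro z _ hz
      rw [if_neg]
      intro h3
      apply hz
      simp [h3.1, h3.2.1]

theorem dual_edgeCob_perm (u : X.S 4) (σ : Equiv.Perm (Fin 5)) (hσ : Equiv.Perm.sign σ = 1)
    (hlt : σ 0 < σ 1) (h : ({σ 0, σ 1} : Finset (Fin 5)).card = 1 + 1) (a b : Fin 5) :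
    X.dual u (X.edgeCob (X.face u {σ 0, σ 1} h)) a b = -triCirc (σ 2) (σ 3) (σ 4) a b := by
  rw [dual_edgeCob u hlt.ne h, edgeSign_eq σ hσ hlt]
  push_cast
  rw [triCircInt_cast]

end OrderedComplex

theorem map_perm_triple (σ : Equiv.Perm (Fin 5)) (s : Finset (Fin 5)) (x y : Fin 5)
    (h : s = {x, y}ᶜ) : s.map σ.toEmbedding = {σ x, σ y}ᶜ := by
  subst h
  ext z
  obtain ⟨z, rfl⟩ := σ.surjective z
  simp

/-- The product of a symmetric function over all the edges of a pentachoron. -/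
def edgeProd (ρ : Fin 5 → Fin 5 → ℂ) : ℂ :=
  ρ 0 1 * ρ 0 2 * ρ 0 3 * ρ 0 4 * ρ 1 2 * ρ 1 3 * ρ 1 4 * ρ 2 3 * ρ 2 4 * ρ 3 4

theorem edgeProd_perm (τ : Equiv.Perm (Fin 5)) : ∀ ρ : Fin 5 → Fin 5 → ℂ, (∀ a b, ρ a b = ρ b a) →
    edgeProd (fun a b => ρ (τ a) (τ b)) = edgeProd ρ := by
  have hτ : τ ∈ Submonoid.closure (Set.range fun i : Fin 4 => Equiv.swap i.castSucc i.succ) := by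
    rw [Equiv.Perm.mclosure_swap_castSucc_succ]
    trivial
  induction hτ using Submonoid.closure_induction with
  | one => intro ρ _; rfl
  | mul x y _ _ hx hy =>
    intro ρ hρ
    rw [← hx ρ hρ]
    exact hy (fun a b => ρ (x a) (x b)) fun a b => hρ _ _
  | mem x hx =>
    intro ρ hρ
    obtain ⟨i, rfl⟩ := hx
    fin_cases i
    · simp [edgeProd, Equiv.swap_apply_def, -mul_eq_mul_right_iff]
      rw [hρ 1 0]
      ring
    · simp [edgeProd, Equiv.swap_apply_def, -mul_eq_mul_right_iff]
      rw [hρ 2 1]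
      ring
    · simp [edgeProd, Equiv.swap_apply_def, -mul_eq_mul_right_iff]
      rw [hρ 3 2]
      ring
    · simp [edgeProd, Equiv.swap_apply_def, -mul_eq_mul_right_iff]
      rw [hρ 4 3]
      ring

set_option maxRecDepth 100000 in
-- All signs met in rewriting the minor formula through the values q multiply to a constant, so no
-- vertex-dependent sign is left in `H_u`.
theorem sign_constant (σ : Equiv.Perm (Fin 5)) : Equiv.Perm.sign σ = 1 → σ 0 < σ 1 →
    (-1 : ℤ) ^ (σ 2 : ℕ) * (-1) ^ (σ 3 : ℕ) * (-1) ^ (σ 4 : ℕ) * theta (σ 2) (σ 3) *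
      theta (σ 2) (σ 4) * theta (σ 3) (σ 4) = -1 := by
  revert σ
  decide

set_option maxRecDepth 100000 in
theorem exists_even_pair : ∀ p q : Fin 5, p < q →
    ∃ σ : Equiv.Perm (Fin 5), Equiv.Perm.sign σ = 1 ∧ σ 0 = p ∧ σ 1 = q := by
  decide

namespace System

variable (Y : System)

open OrderedComplex

theorem labFace_three (u : Y.T.S 4) (σ : Equiv.Perm (Fin 5)) (s : Finset (Fin 5))
    (hs : s.card = 2 + 1) (x y : Fin 5) (hxy : x ≠ y) (h : s = {x, y}ᶜ) :
    Y.labFace u σ s hs = Y.T.tri u (σ x) (σ y) := by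
  rw [tri_of_ne u (σ.injective.ne hxy)]
  exact face_congr u (map_perm_triple σ s x y h)

theorem labFace_edge (u : Y.T.S 4) (σ : Equiv.Perm (Fin 5))
    (h : ({σ 0, σ 1} : Finset (Fin 5)).card = 1 + 1) :
    Y.labFace u σ {0, 1} rfl = Y.T.face u {σ 0, σ 1} h :=
  face_congr u (by ext; simp)

theorem card_pair_perm (σ : Equiv.Perm (Fin 5)) : ({σ 0, σ 1} : Finset (Fin 5)).card = 1 + 1 :=
  Finset.card_pair (σ.injective.ne (by decide))

theorem beta_d' (u : Y.T.S 4) (m : Fin 5) (c : Y.T.S 2 → ℂ) :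
    Y.D.β (Y.T.d m u) c = (Y.pent u).beta (Y.T.dual u c) m := Y.beta_d u m c

theorem beta_d_edgeCob (u : Y.T.S 4) (σ : Equiv.Perm (Fin 5)) (hσ : Equiv.Perm.sign σ = 1)
    (hlt : σ 0 < σ 1) (m : Fin 5) : Y.D.β (Y.T.d m u) (Y.T.edgeCob (Y.labFace u σ {0, 1} rfl)) =
      -(Y.pent u).beta (triCirc (σ 2) (σ 3) (σ 4)) m := by
  have h : Y.T.dual u (Y.T.edgeCob (Y.labFace u σ {0, 1} rfl)) =
      (-1 : ℂ) • triCirc (σ 2) (σ 3) (σ 4) := by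
    funext a b
    rw [labFace_edge _ _ _ (card_pair_perm σ), dual_edgeCob_perm u σ hσ hlt]
    simp
  rw [beta_d', h, PentData.beta_smul]
  simp

theorem betaEdge_eq (u : Y.T.S 4) (σ : Equiv.Perm (Fin 5)) (hσ : Equiv.Perm.sign σ = 1)
    (hlt : σ 0 < σ 1) :
    Y.betaEdge u σ = -((Y.pent u).B (σ 4) (σ 3) - (Y.pent u).B (σ 4) (σ 2)) := by
  rw [betaEdge, Y.beta_d_edgeCob u σ hσ hlt, PentData.beta_triCirc _ _ _ _ _
    (σ.injective.ne (by decide)) (σ.injective.ne (by decide)) (σ.injective.ne (by decide)),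
    if_pos rfl]

/-- The chosen square roots in a pentachoron, in dual form. -/
def rho (u : Y.T.S 4) (a b : Fin 5) : ℂ := Y.C.q (Y.T.tri u a b)

theorem rho_ne_zero (u : Y.T.S 4) (a b : Fin 5) : Y.rho u a b ≠ 0 := Y.C.q_ne_zero _

theorem rho_comm (u : Y.T.S 4) (a b : Fin 5) : Y.rho u a b = Y.rho u b a := by
  rw [rho, tri_comm, rho]

theorem pent_Om (u : Y.T.S 4) (a b : Fin 5) :
    (Y.pent u).Om a b = theta a b * Y.rho u a b ^ 2 := by
  rw [rho, Y.C.sq]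
  rfl

theorem K_d (u : Y.T.S 4) (σ : Equiv.Perm (Fin 5)) (m : Fin 5) :
    Y.C.K (Y.T.d m u) = ∏ x, if σ x = m then 1 else Y.rho u (σ x) m := by
  rw [Equiv.prod_comp σ fun x => if x = m then 1 else Y.rho u x m, Fin.prod_univ_succAbove _ m,
    if_pos rfl, one_mul, Coloring.K]
  refine Finset.prod_congr rfl fun a _ => ?_
  rw [if_neg (Fin.succAbove_ne m a), d_d_eq_tri, rho]

theorem pent_F_mul (u : Y.T.S 4) (a b c e : Fin 5) :
    (Y.pent u).F a b * (Y.pent u).F c e = Y.F u a b * Y.F u c e := by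
  change (Y.T.orient u : ℤ) * Y.F u a b * ((Y.T.orient u : ℤ) * Y.F u c e) = _
  linear_combination Y.F u a b * Y.F u c e * Y.orient_mul_self u

/-- This is `minor_formula_perm` with every `Om` replaced by a signed square of q and every `kap` by
a signed product of four q. After cancelling three of them, the ten q together appear on the left.
-/
theorem H_denominator (u : Y.T.S 4) (σ : Equiv.Perm (Fin 5)) (hσ : Equiv.Perm.sign σ = 1)
    (hlt : σ 0 < σ 1) :
    (Y.F u (σ 1) (σ 3) * Y.F u (σ 0) (σ 2) - Y.F u (σ 1) (σ 2) * Y.F u (σ 0) (σ 3)) *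
      ((Y.pent u).vol * edgeProd (Y.rho u)) = Y.betaEdge u σ * Y.rho u (σ 3) (σ 4) *
        Y.rho u (σ 2) (σ 4) * Y.rho u (σ 2) (σ 3) * Y.rho u (σ 0) (σ 1) := by
  have key := (Y.pent u).minor_formula_perm σ hσ
  rw [Y.pent_F_mul, Y.pent_F_mul] at key
  have hk : ∀ m, (Y.pent u).kap m = (-1) ^ (m : ℕ) * Y.C.K (Y.T.d m u) := fun _ => rfl
  simp only [pent_Om, hk, Y.K_d u σ, Fin.prod_univ_five, σ.injective.eq_iff] at key
  rw [← edgeProd_perm σ (Y.rho u) (Y.rho_comm u), edgeProd, Y.betaEdge_eq u σ hσ hlt]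
  have hs : ((-1 : ℂ)) ^ (σ 2 : ℕ) * (-1) ^ (σ 3 : ℕ) * (-1) ^ (σ 4 : ℕ) * theta (σ 2) (σ 3) *
      theta (σ 2) (σ 4) * theta (σ 3) (σ 4) = -1 := by
    exact_mod_cast sign_constant σ hσ hlt
  have h23 := theta_sq' (a := σ 2) (b := σ 3) (σ.injective.ne (by decide))
  have h24 := theta_sq' (a := σ 2) (b := σ 4) (σ.injective.ne (by decide))
  have h34 := theta_sq' (a := σ 3) (b := σ 4) (σ.injective.ne (by decide))
  simp at key
  rw [Y.rho_comm u (σ 3) (σ 2), Y.rho_comm u (σ 4) (σ 2), Y.rho_comm u (σ 4) (σ 3)] at key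
  generalize ((-1 : ℂ)) ^ (σ 2 : ℕ) = s2 at *
  generalize ((-1 : ℂ)) ^ (σ 3 : ℕ) = s3 at *
  generalize ((-1 : ℂ)) ^ (σ 4 : ℕ) = s4 at *
  generalize (theta (σ 2) (σ 3) : ℂ) = t23 at *
  generalize (theta (σ 2) (σ 4) : ℂ) = t24 at *
  generalize (theta (σ 3) (σ 4) : ℂ) = t34 at *
  -- Each `theta` is its own inverse.
  have hs' : s2 * s3 * s4 = -(t23 * t24 * t34) := by
    linear_combination t23 * t24 * t34 * hs - s2 * s3 * s4 * (t23 * t23 * t24 * t24) * h34 -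
      s2 * s3 * s4 * (t23 * t23) * h24 - s2 * s3 * s4 * h23
  have ht : t23 * t24 * t34 ≠ 0 := by
    intro h0
    have : (1 : ℂ) = 0 := by
      linear_combination t23 * t24 * t34 * h0 - (t23 * t23 * t24 * t24) * h34 -
        (t23 * t23) * h24 - h23
    exact one_ne_zero this
  have hr : Y.rho u (σ 2) (σ 3) * Y.rho u (σ 2) (σ 4) * Y.rho u (σ 3) (σ 4) ≠ 0 :=
    mul_ne_zero (mul_ne_zero (Y.rho_ne_zero u _ _) (Y.rho_ne_zero u _ _)) (Y.rho_ne_zero u _ _)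
  refine mul_left_cancel₀ (mul_ne_zero ht hr) ?_
  generalize Y.rho u (σ 2) (σ 3) = r23 at *
  generalize Y.rho u (σ 2) (σ 4) = r24 at *
  generalize Y.rho u (σ 3) (σ 4) = r34 at *
  generalize Y.rho u (σ 0) (σ 1) = r01 at *
  generalize Y.rho u (σ 0) (σ 2) = r02 at *
  generalize Y.rho u (σ 0) (σ 3) = r03 at *
  generalize Y.rho u (σ 0) (σ 4) = r04 at *
  generalize Y.rho u (σ 1) (σ 2) = r12 at *
  generalize Y.rho u (σ 1) (σ 3) = r13 at *
  generalize Y.rho u (σ 1) (σ 4) = r14 at *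
  linear_combination (-r01) * key + (Y.F u (σ 0) (σ 2) * Y.F u (σ 1) (σ 3) -
    Y.F u (σ 0) (σ 3) * Y.F u (σ 1) (σ 2)) * (Y.pent u).vol * r01 * r02 * r03 * r04 * r12 * r13 *
    r14 * r23 ^ 2 * r24 ^ 2 * r34 ^ 2 * hs'

theorem edgeProd_rho_ne_zero (u : Y.T.S 4) : edgeProd (Y.rho u) ≠ 0 := by
  simp [edgeProd, Y.rho_ne_zero]

/-- The quantity `H_u` does not depend on the vertices used to calculate it. -/
theorem H_eq (u : Y.T.S 4) (σ : Equiv.Perm (Fin 5)) (hσ : Equiv.Perm.sign σ = 1)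
    (hlt : σ 0 < σ 1) (hb : Y.betaEdge u σ ≠ 0) :
    Y.H u σ = (Y.pent u).vol * edgeProd (Y.rho u) := by
  have h := Y.H_denominator u σ hσ hlt
  have hne : Y.betaEdge u σ * Y.rho u (σ 3) (σ 4) * Y.rho u (σ 2) (σ 4) * Y.rho u (σ 2) (σ 3) *
      Y.rho u (σ 0) (σ 1) ≠ 0 := by
    simp [hb, Y.rho_ne_zero]
  rw [H, Y.labFace_three u σ {0, 1, 2} rfl 3 4 (by decide) (by decide),
    Y.labFace_three u σ {0, 1, 3} rfl 2 4 (by decide) (by decide),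
    Y.labFace_three u σ {0, 1, 4} rfl 2 3 (by decide) (by decide),
    Y.labFace_three u σ {2, 3, 4} rfl 0 1 (by decide) (by decide)]
  change Y.betaEdge u σ * Y.rho u (σ 3) (σ 4) * Y.rho u (σ 2) (σ 4) * Y.rho u (σ 2) (σ 3) *
      Y.rho u (σ 0) (σ 1) / _ = _
  rw [← h] at hne ⊢
  rw [mul_div_cancel_left₀]
  exact left_ne_zero_of_mul hne

theorem H_value_ne_zero (u : Y.T.S 4) : (Y.pent u).vol * edgeProd (Y.rho u) ≠ 0 :=
  mul_ne_zero (PentData.vol_ne_zero _) (Y.edgeProd_rho_ne_zero u)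

/-- Otherwise the coboundary of the edge is killed by all β of the pentachoron, so it is a multiple
of ω; but it vanishes on the 2-faces not containing the edge, and ω does not. -/
theorem exists_betaEdge_ne_zero (u : Y.T.S 4) (p q : Fin 5) (hpq : p < q) :
    ∃ σ : Equiv.Perm (Fin 5), Equiv.Perm.sign σ = 1 ∧ σ 0 = p ∧ σ 1 = q ∧ Y.betaEdge u σ ≠ 0 := by
  obtain ⟨σ, hσ, h0, h1⟩ := exists_even_pair p q hpq
  have hlt : σ 0 < σ 1 := by rwa [h0, h1]
  have n23 : σ 2 ≠ σ 3 := σ.injective.ne (by decide)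
  have n24 : σ 2 ≠ σ 4 := σ.injective.ne (by decide)
  have n34 : σ 3 ≠ σ 4 := σ.injective.ne (by decide)
  have n02 : σ 0 ≠ σ 2 := σ.injective.ne (by decide)
  have n03 : σ 0 ≠ σ 3 := σ.injective.ne (by decide)
  have n04 : σ 0 ≠ σ 4 := σ.injective.ne (by decide)
  by_contra hcon
  push Not at hcon
  have hz : ∀ τ : Equiv.Perm (Fin 5), Equiv.Perm.sign τ = 1 → τ 0 = p → τ 1 = q →
      (Y.pent u).B (τ 4) (τ 3) = (Y.pent u).B (τ 4) (τ 2) := by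
    intro τ hτ t0 t1
    have := hcon τ hτ t0 t1
    rw [Y.betaEdge_eq u τ hτ (by rwa [t0, t1])] at this
    linear_combination -this
  have z4 := hz σ hσ h0 h1
  have hb : (Y.pent u).beta (triCirc (σ 2) (σ 3) (σ 4)) = 0 := by
    funext t
    rw [PentData.beta_triCirc _ _ _ _ _ n23 n34 n24]
    have e1 : Equiv.Perm.sign (σ * (Equiv.swap 2 3 * Equiv.swap 3 4)) = 1 := by
      rw [Equiv.Perm.sign_mul, hσ]
      decide
    have e2 : Equiv.Perm.sign (σ * (Equiv.swap 3 4 * Equiv.swap 2 3)) = 1 := by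
      rw [Equiv.Perm.sign_mul, hσ]
      decide
    have z2 := hz _ e1 h0 h1
    have z3 := hz _ e2 h0 h1
    change (Y.pent u).B (σ 2) (σ 4) = (Y.pent u).B (σ 2) (σ 3) at z2
    change (Y.pent u).B (σ 3) (σ 2) = (Y.pent u).B (σ 3) (σ 4) at z3
    split_ifs
    · rw [z4, sub_self, Pi.zero_apply]
    · rw [z2, sub_self, Pi.zero_apply]
    · rw [z3, sub_self, Pi.zero_apply]
    · rfl
  obtain ⟨l, hl⟩ := (Y.pent u).kernel _ (triCirc_anti _ _ _) (triCirc_sum _ _ _) hb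
  have h02 := hl (σ 0) (σ 2)
  have h23 := hl (σ 2) (σ 3)
  have e02 : triCirc (σ 2) (σ 3) (σ 4) (σ 0) (σ 2) = 0 := by
    simp [triCirc, n02, n03, n04]
  have e23 : triCirc (σ 2) (σ 3) (σ 4) (σ 2) (σ 3) = 1 := by
    simp [triCirc, n23, n24, n34]
  rw [e02] at h02
  rw [e23] at h23
  rw [(mul_eq_zero.1 h02.symm).resolve_right ((Y.pent u).ne _ _ n02), zero_mul] at h23
  exact one_ne_zero h23

/-- The values of η are thus exactly the two square roots of a non-zero number. -/
theorem isEta_iff (u : Y.T.S 4) (η : ℂ) :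
    Y.IsEta u η ↔ η ^ 2 = (Y.pent u).vol * edgeProd (Y.rho u) := by
  constructor
  · rintro ⟨σ, hσ, hlt, hb, h⟩
    rw [h, Y.H_eq u σ hσ hlt hb]
  · intro h
    obtain ⟨σ, hσ, h0, h1, hb⟩ := Y.exists_betaEdge_ne_zero u 0 1 (by decide)
    have hlt : σ 0 < σ 1 := by rw [h0, h1]; decide
    exact ⟨σ, hσ, hlt, hb, by rw [h, Y.H_eq u σ hσ hlt hb]⟩

end System

end

/-! ### Maximal trees, cohomology and distinguished bases -/

section

namespace OrderedComplex

variable {X : OrderedComplex}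

theorem d_d {n : ℕ} (x : X.S (n + 2)) (i j : Fin (n + 2)) (h : j ≤ i) :
    X.d j (X.d i.succ x) = X.d i (X.d j.castSucc x) := by
  unfold d
  rw [X.res_comp, X.res_comp]
  congr 1
  ext k
  change ((i.succ.succAbove (j.succAbove k) : Fin (n + 3)) : ℕ) =
    (j.castSucc.succAbove (i.succAbove k) : Fin (n + 3))
  simp only [Fin.succAbove, Fin.lt_def]
  have hle : (j : ℕ) ≤ i := h
  split_ifs <;> simp_all <;> omega

theorem cob_zero_apply (f : X.S 0 → ℂ) (e : X.S 1) : X.cob 0 f e = f (X.d 0 e) - f (X.d 1 e) := by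
  change ∑ i : Fin 2, (-1 : ℂ) ^ (i : ℕ) * f (X.d i e) = _
  rw [Fin.sum_univ_two]
  simp
  ring

theorem cob_one_apply (f : X.S 1 → ℂ) (s : X.S 2) :
    X.cob 1 f s = f (X.d 0 s) - f (X.d 1 s) + f (X.d 2 s) := by
  change ∑ i : Fin 3, (-1 : ℂ) ^ (i : ℕ) * f (X.d i s) = _
  rw [Fin.sum_univ_three]
  simp
  ring

theorem cob_two_apply (f : X.S 2 → ℂ) (t : X.S 3) :
    X.cob 2 f t = f (X.d 0 t) - f (X.d 1 t) + f (X.d 2 t) - f (X.d 3 t) := by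
  change ∑ i : Fin 4, (-1 : ℂ) ^ (i : ℕ) * f (X.d i t) = _
  rw [Fin.sum_univ_four]
  simp
  ring

theorem cob_one_cob_zero (f : X.S 0 → ℂ) : X.cob 1 (X.cob 0 f) = 0 := by
  funext s
  rw [cob_one_apply, cob_zero_apply, cob_zero_apply, cob_zero_apply]
  have h1 : X.d 0 (X.d 1 s) = X.d 0 (X.d 0 s) := d_d (n := 0) s 0 0 le_rfl
  have h2 : X.d 0 (X.d 2 s) = X.d 1 (X.d 0 s) := d_d (n := 0) s 1 0 (by decide)
  have h3 : X.d 1 (X.d 2 s) = X.d 1 (X.d 1 s) := d_d (n := 0) s 1 1 le_rfl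
  rw [h1, h2, h3, Pi.zero_apply]
  ring

theorem cob_two_cob_one (f : X.S 1 → ℂ) : X.cob 2 (X.cob 1 f) = 0 := by
  funext s
  rw [cob_two_apply, cob_one_apply, cob_one_apply, cob_one_apply, cob_one_apply]
  have h1 : X.d 0 (X.d 1 s) = X.d 0 (X.d 0 s) := d_d (n := 1) s 0 0 le_rfl
  have h2 : X.d 0 (X.d 2 s) = X.d 1 (X.d 0 s) := d_d (n := 1) s 1 0 (by decide)
  have h3 : X.d 0 (X.d 3 s) = X.d 2 (X.d 0 s) := d_d (n := 1) s 2 0 (by decide)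
  have h4 : X.d 1 (X.d 2 s) = X.d 1 (X.d 1 s) := d_d (n := 1) s 1 1 le_rfl
  have h5 : X.d 1 (X.d 3 s) = X.d 2 (X.d 1 s) := d_d (n := 1) s 2 1 (by decide)
  have h6 : X.d 2 (X.d 3 s) = X.d 2 (X.d 2 s) := d_d (n := 1) s 2 2 le_rfl
  rw [h1, h2, h3, h4, h5, h6, Pi.zero_apply]
  ring

theorem cob_one_mem (f : X.S 1 → ℂ) : X.cob 1 f ∈ X.Z2 := LinearMap.mem_ker.2 (cob_two_cob_one f)

theorem edgeCob_mem (b : X.S 1) : X.edgeCob b ∈ X.Z2 := cob_one_mem _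

theorem cob_one_eq_sum (f : X.S 1 → ℂ) : X.cob 1 f = ∑ b, f b • X.edgeCob b := by
  classical
  have : f = ∑ b, f b • (Pi.single b 1 : X.S 1 → ℂ) := by
    funext b
    simp [Finset.sum_apply, Pi.single_apply]
  conv_lhs => rw [this]
  rw [map_sum]
  refine Finset.sum_congr rfl fun b _ => ?_
  rw [map_smul, edgeCob]

variable (X) in
/-- The set of edges `A` connects all the vertices. -/
def Connects (A : Finset (X.S 1)) : Prop := ∀ v w, Relation.EqvGen (X.Joined A) v w

theorem eq_of_eqvGen {A : Finset (X.S 1)} {f : X.S 0 → ℂ} (hf : ∀ e ∈ A, X.cob 0 f e = 0)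
    {v w : X.S 0} (h : Relation.EqvGen (X.Joined A) v w) : f v = f w := by
  induction h with
  | rel x y hxy =>
    obtain ⟨e, he, rfl, rfl⟩ := hxy
    have := hf e he
    rw [cob_zero_apply] at this
    linear_combination -this
  | refl x => rfl
  | symm x y _ ih => exact ih.symm
  | trans x y z _ _ ih1 ih2 => exact ih1.trans ih2

/-- The coboundary of 0-cochains, restricted to a set of edges. -/
def cobOn (A : Finset (X.S 1)) : (X.S 0 → ℂ) →ₗ[ℂ] (A → ℂ) :=
  (LinearMap.funLeft ℂ ℂ (fun e : A => (e : X.S 1))).comp (X.cob 0)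

theorem cobOn_apply (A : Finset (X.S 1)) (f : X.S 0 → ℂ) (e : A) :
    cobOn A f e = X.cob 0 f e := rfl

theorem ker_cobOn {A : Finset (X.S 1)} (hA : X.Connects A) (f : X.S 0 → ℂ)
    (hf : cobOn A f = 0) (v w : X.S 0) : f v = f w :=
  eq_of_eqvGen (fun e he => congrFun hf ⟨e, he⟩) (hA v w)

theorem finrank_ker_cobOn {A : Finset (X.S 1)} (hA : X.Connects A) (v : X.S 0) :
    Module.finrank ℂ (LinearMap.ker (cobOn A)) = 1 := by
  have hone : (fun _ => 1 : X.S 0 → ℂ) ∈ LinearMap.ker (cobOn A) := by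
    rw [LinearMap.mem_ker]
    funext e
    rw [cobOn_apply, cob_zero_apply, sub_self, Pi.zero_apply]
  refine finrank_eq_one (⟨_, hone⟩ : LinearMap.ker (cobOn A)) (fun h => ?_) fun f => ⟨f.1 v, ?_⟩
  · have := congrFun (congrArg Subtype.val h) v
    exact one_ne_zero this
  · ext w
    simp [ker_cobOn hA f.1 f.2 v w]

theorem finrank_range_cobOn {A : Finset (X.S 1)} (hA : X.Connects A) (v : X.S 0) :
    Module.finrank ℂ (LinearMap.range (cobOn A)) + 1 = Fintype.card (X.S 0) := by
  have := LinearMap.finrank_range_add_finrank_ker (cobOn A)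
  rwa [finrank_ker_cobOn hA v, Module.finrank_fintype_fun_eq_card] at this

/-- On a connected graph the coboundary of functions on vertices has rank one less than the number
of vertices, and this rank is at most the number of edges. -/
theorem card_le_of_connects {A : Finset (X.S 1)} (hA : X.Connects A) :
    Fintype.card (X.S 0) ≤ A.card + 1 := by
  rcases isEmpty_or_nonempty (X.S 0) with h | ⟨⟨v⟩⟩
  · simp
  · have h1 := finrank_range_cobOn hA v
    have h2 := Submodule.finrank_le (LinearMap.range (cobOn A))
    rw [Module.finrank_fintype_fun_eq_card, Fintype.card_coe] at h2
    omega

open Classical in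
-- The integer-valued function is the indicator of a component left after removal of `b`.
theorem exists_cut {A : Finset (X.S 1)} (hA : X.Connects A) {b : X.S 1}
    (h : ¬X.Connects (A.erase b)) : ∃ f : X.S 0 → ℤ,
      (X.cob 0 (fun v => (f v : ℂ)) b = 1 ∨ X.cob 0 (fun v => (f v : ℂ)) b = -1) ∧
      ∀ e ∈ A, e ≠ b → X.cob 0 (fun v => (f v : ℂ)) e = 0 := by
  unfold Connects at h
  push Not at h
  obtain ⟨v, w, hvw⟩ := h
  let f : X.S 0 → ℤ := fun x => if Relation.EqvGen (X.Joined (A.erase b)) v x then 1 else 0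
  have hf : ∀ e ∈ A, e ≠ b → X.cob 0 (fun v => (f v : ℂ)) e = 0 := by
    intro e he heb
    have hj : Relation.EqvGen (X.Joined (A.erase b)) (X.d 1 e) (X.d 0 e) :=
      Relation.EqvGen.rel _ _ ⟨e, Finset.mem_erase.2 ⟨heb, he⟩, rfl, rfl⟩
    have : f (X.d 0 e) = f (X.d 1 e) := by
      simp only [f]
      congr 1
      exact propext ⟨fun h => h.trans _ _ _ hj.symm, fun h => h.trans _ _ _ hj⟩
    rw [cob_zero_apply, this, sub_self]
  refine ⟨f, ?_, hf⟩
  have hne : X.cob 0 (fun v => (f v : ℂ)) b ≠ 0 := by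
    intro h0
    have : ((f v : ℤ) : ℂ) = f w := eq_of_eqvGen (f := fun v => (f v : ℂ)) (A := A) (fun e he => by
      by_cases heb : e = b
      · rw [heb, h0]
      · exact hf e he heb) (hA v w)
    have h1 : f v = 1 := if_pos (Relation.EqvGen.refl v)
    have h2 : f w = 0 := if_neg hvw
    rw [h1, h2] at this
    simp at this
  rw [cob_zero_apply] at hne ⊢
  simp only [f] at hne ⊢
  split_ifs at hne ⊢ <;> simp_all

open Classical in
theorem IsMaximalTree.not_connects_erase {A : Finset (X.S 1)} (hA : X.IsMaximalTree A) {b : X.S 1}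
    (hb : b ∈ A) : ¬X.Connects (A.erase b) := fun h => by
  have h1 := card_le_of_connects h
  have h2 := hA.2
  rw [Finset.card_erase_of_mem hb] at h1
  have := Finset.card_pos.2 ⟨b, hb⟩
  omega

theorem IsMaximalTree.exists_cut {A : Finset (X.S 1)} (hA : X.IsMaximalTree A) {b : X.S 1}
    (hb : b ∈ A) : ∃ f : X.S 0 → ℤ,
      (X.cob 0 (fun v => (f v : ℂ)) b = 1 ∨ X.cob 0 (fun v => (f v : ℂ)) b = -1) ∧
      ∀ e ∈ A, e ≠ b → X.cob 0 (fun v => (f v : ℂ)) e = 0 :=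
  OrderedComplex.exists_cut hA.1 (hA.not_connects_erase hb)

/-- In a minimal connecting set of edges every edge has a cut function. These make the coboundary
surjective on the set, and counting ranks gives the number of its edges. -/
theorem exists_maximalTree (h : X.Connects Finset.univ) (v : X.S 0) :
    ∃ A, X.IsMaximalTree A := by
  classical
  obtain ⟨A, -, hA⟩ := exists_minimal_le_of_wellFoundedLT (fun A => X.Connects A) _ h
  refine ⟨A, hA.prop, ?_⟩
  have hsurj : Function.Surjective (cobOn A) := by
    rw [← LinearMap.range_eq_top, eq_top_iff]
    intro g _
    have : g = ∑ b : A, g b • (Pi.single b 1 : A → ℂ) := by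
      funext b
      simp [Finset.sum_apply, Pi.single_apply]
    rw [this]
    refine Submodule.sum_mem _ fun b _ => Submodule.smul_mem _ _ ?_
    obtain ⟨f, hfb, hf⟩ := OrderedComplex.exists_cut hA.prop fun hcon =>
      Finset.notMem_erase b.1 A (hA.le_of_le hcon (Finset.erase_subset _ _) b.2)
    have hf' : ∀ e : A, e ≠ b → cobOn A (fun v => (f v : ℂ)) e = 0 := fun e he =>
      hf e e.2 fun h => he (Subtype.ext h)
    rcases hfb with h1 | h1
    · refine ⟨fun v => (f v : ℂ), ?_⟩
      funext e
      by_cases he : e = b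
      · rw [he, Pi.single_eq_same]
        exact h1
      · rw [hf' e he, Pi.single_eq_of_ne he]
    · refine ⟨-fun v => (f v : ℂ), ?_⟩
      funext e
      rw [map_neg, Pi.neg_apply]
      by_cases he : e = b
      · rw [he, Pi.single_eq_same, cobOn_apply, h1, neg_neg]
      · rw [hf' e he, Pi.single_eq_of_ne he, neg_zero]
  have := finrank_range_cobOn hA.prop v
  rwa [LinearMap.range_eq_top.2 hsurj, finrank_top, Module.finrank_fintype_fun_eq_card,
    Fintype.card_coe] at this

open Classical in
/-- The coboundaries of all edges are integer combinations of those of the edges not belonging to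
a maximal tree. -/
theorem IsMaximalTree.exists_int {A : Finset (X.S 1)} (hA : X.IsMaximalTree A) (b : X.S 1) :
    ∃ n : {b : X.S 1 // b ∉ A} → ℤ, X.edgeCob b = ∑ b', (n b' : ℂ) • X.edgeCob b'.1 := by
  classical
  by_cases hb : b ∈ A
  · obtain ⟨f, hfb, hf⟩ := hA.exists_cut hb
    -- The double coboundary of the cut function is zero. This is an integer relation in which `b`
    -- is the only tree edge, with coefficient ±1.
    have h0 : ∑ e, X.cob 0 (fun v => (f v : ℂ)) e • X.edgeCob e = 0 := by
      rw [← cob_one_eq_sum, cob_one_cob_zero]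
    have hint : ∀ e, X.cob 0 (fun v => (f v : ℂ)) e = ((f (X.d 0 e) - f (X.d 1 e) : ℤ) : ℂ) := by
      intro e
      rw [cob_zero_apply]
      push_cast
      rfl
    have h1 : X.cob 0 (fun v => (f v : ℂ)) b • X.edgeCob b +
        ∑ e : {e : X.S 1 // e ∉ A}, X.cob 0 (fun v => (f v : ℂ)) e • X.edgeCob e.1 = 0 := by
      rw [← h0, ← Finset.sum_subtype Aᶜ (fun e => Finset.mem_compl) fun e =>
        X.cob 0 (fun v => (f v : ℂ)) e • X.edgeCob e, ← Finset.sum_add_sum_compl A,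
        Finset.sum_eq_single_of_mem b hb fun e he heb => by rw [hf e he heb, zero_smul]]
    rcases hfb with h | h
    · refine ⟨fun e => -(f (X.d 0 e.1) - f (X.d 1 e.1)), ?_⟩
      rw [h, one_smul] at h1
      rw [eq_neg_of_add_eq_zero_left h1, ← Finset.sum_neg_distrib]
      refine Finset.sum_congr rfl fun e _ => ?_
      rw [hint, ← neg_smul]
      push_cast
      rfl
    · refine ⟨fun e => f (X.d 0 e.1) - f (X.d 1 e.1), ?_⟩
      rw [h, neg_smul, one_smul, neg_add_eq_zero] at h1
      rw [h1]
      exact Finset.sum_congr rfl fun e _ => by rw [hint]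
  · refine ⟨Pi.single ⟨b, hb⟩ 1, ?_⟩
    rw [Finset.sum_eq_single_of_mem (⟨b, hb⟩ : {b : X.S 1 // b ∉ A}) (Finset.mem_univ _)]
    · simp
    · intro c _ hc
      simp [hc]

/-- Such a cocycle is the coboundary of a function constant along the tree, hence constant. -/
theorem H1Vanishes.eq_zero (hX : X.H1Vanishes) {A : Finset (X.S 1)} (hA : X.IsMaximalTree A)
    {f : X.S 1 → ℂ} (hf : X.cob 1 f = 0) (h0 : ∀ e ∈ A, f e = 0) : f = 0 := by
  have : f ∈ LinearMap.range (X.cob 0) := by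
    rw [← hX]
    exact hf
  obtain ⟨g, rfl⟩ := this
  funext e
  rw [cob_zero_apply, ker_cobOn hA.1 g (funext fun e => h0 e e.2) (X.d 0 e) (X.d 1 e), sub_self,
    Pi.zero_apply]

theorem IsMaximalTree.cobOn_surjective {A : Finset (X.S 1)} (hA : X.IsMaximalTree A) :
    Function.Surjective (cobOn A) := by
  have hv : Nonempty (X.S 0) := by
    rw [← Fintype.card_pos_iff, ← hA.2]
    omega
  obtain ⟨v⟩ := hv
  rw [← LinearMap.range_eq_top]
  refine Submodule.eq_top_of_finrank_eq ?_
  have h1 := finrank_range_cobOn hA.1 v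
  have h2 := hA.2
  rw [Module.finrank_fintype_fun_eq_card, Fintype.card_coe]
  omega

/-- A 1-cocycle can be made to vanish on the tree by subtracting a coboundary; its remaining values
are then a linear relation among the coboundaries of chords. -/
theorem h1Vanishes_of_linearIndependent {A : Finset (X.S 1)} (hA : X.IsMaximalTree A)
    (h : LinearIndependent ℂ fun b : {b : X.S 1 // b ∉ A} => X.edgeCob b.1) : X.H1Vanishes := by
  classical
  refine le_antisymm (fun f hf => ?_) ?_
  · obtain ⟨g, hg⟩ := hA.cobOn_surjective fun e => f e.1
    have h1 : X.cob 1 (f - X.cob 0 g) = 0 := by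
      rw [map_sub, cob_one_cob_zero, LinearMap.mem_ker.1 hf, sub_zero]
    have h2 : ∀ e ∈ A, (f - X.cob 0 g) e = 0 := fun e he => by
      have := congrFun hg ⟨e, he⟩
      rw [cobOn_apply] at this
      rw [Pi.sub_apply, this, sub_self]
    have h3 : ∑ b : {b : X.S 1 // b ∉ A}, (f - X.cob 0 g) b.1 • X.edgeCob b.1 = 0 := by
      rw [← Finset.sum_subtype Aᶜ (fun e => Finset.mem_compl) fun e =>
        (f - X.cob 0 g) e • X.edgeCob e, ← h1, cob_one_eq_sum]
      refine Finset.sum_subset (Finset.subset_univ _) fun e _ he => ?_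
      rw [h2 e (by simpa using he), zero_smul]
    have h4 := Fintype.linearIndependent_iff.1 h _ h3
    refine ⟨g, ?_⟩
    funext e
    by_cases he : e ∈ A
    · have := h2 e he
      rw [Pi.sub_apply] at this
      linear_combination -this
    · have := h4 ⟨e, he⟩
      rw [Pi.sub_apply] at this
      linear_combination -this
  · rintro _ ⟨g, rfl⟩
    exact cob_one_cob_zero g

variable (X) in
/-- The coboundary of an edge as an element of the space of 2-cocycles. -/
def edgeCocycle (b : X.S 1) : X.Z2 := ⟨X.edgeCob b, edgeCob_mem b⟩

theorem edgeCocycle_mem (b : X.S 1) : X.edgeCocycle b ∈ X.B2 := ⟨_, rfl⟩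

open Classical in
theorem mem_B2_iff {A : Finset (X.S 1)} (hA : X.IsMaximalTree A) (z : X.Z2) : z ∈ X.B2 ↔
    ∃ x : {b : X.S 1 // b ∉ A} → ℂ, z = ∑ b, x b • X.edgeCocycle b.1 := by
  constructor
  · rintro ⟨f, hf⟩
    choose n hn using hA.exists_int
    refine ⟨fun b => ∑ e, f e * n e b, ?_⟩
    apply Subtype.ext
    change X.cob 1 f = z.1 at hf
    rw [← hf, cob_one_eq_sum]
    simp only [Submodule.coe_sum, Submodule.coe_smul, edgeCocycle, Finset.sum_smul]
    rw [Finset.sum_comm]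
    refine Finset.sum_congr rfl fun e _ => ?_
    conv_lhs => rw [hn e, Finset.smul_sum]
    exact Finset.sum_congr rfl fun b _ => smul_smul _ _ _
  · rintro ⟨x, rfl⟩
    exact Submodule.sum_mem _ fun b _ => Submodule.smul_mem _ _ (edgeCocycle_mem _)

/-- The distinguished basis of the space of 2-cocycles with given representatives of the basis of
the cohomology space. -/
theorem H1Vanishes.exists_basis (hX : X.H1Vanishes) {A : Finset (X.S 1)} (hA : X.IsMaximalTree A)
    {κ : Type} [Fintype κ] (h : Module.Basis κ ℂ X.H2) (z : κ → X.Z2)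
    (hz : ∀ k, X.B2.mkQ (z k) = h k) :
    ∃ e : Module.Basis ({b : X.S 1 // b ∉ A} ⊕ κ) ℂ X.Z2,
      ⇑e = Sum.elim (fun b => X.edgeCocycle b.1) z := by
  classical
  have hq : ∀ b, X.B2.mkQ (X.edgeCocycle b) = 0 := fun b =>
    (Submodule.Quotient.mk_eq_zero _).2 (edgeCocycle_mem b)
  have hli : LinearIndependent ℂ (Sum.elim (fun b : {b : X.S 1 // b ∉ A} => X.edgeCocycle b.1) z) := by
    rw [Fintype.linearIndependent_iff]
    intro g hg
    rw [Fintype.sum_sum_type] at hg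
    simp only [Sum.elim_inl, Sum.elim_inr] at hg
    have h1 : ∑ k, g (Sum.inr k) • h k = 0 := by
      have := congrArg X.B2.mkQ hg
      simpa only [map_add, map_sum, map_smul, hq, smul_zero, Finset.sum_const_zero, zero_add, hz,
        map_zero] using this
    have h2 := Fintype.linearIndependent_iff.1 h.linearIndependent _ h1
    simp only [h2, zero_smul, Finset.sum_const_zero, add_zero] at hg
    -- The coefficients of the chords, extended by zero to the tree, form a 1-cocycle to which
    -- `H1Vanishes.eq_zero` applies.
    let f : X.S 1 → ℂ := fun b => if hb : b ∈ A then 0 else g (Sum.inl ⟨b, hb⟩)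
    have hf : X.cob 1 f = 0 := by
      have h3 := congrArg Subtype.val hg
      simp only [Submodule.coe_sum, Submodule.coe_smul, edgeCocycle, ZeroMemClass.coe_zero] at h3
      rw [← h3, cob_one_eq_sum]
      have h4 : ∀ b : {b : X.S 1 // b ∉ A}, g (Sum.inl b) = f b.1 := fun b => by
        simp only [f, dif_neg b.2]
      simp only [h4]
      rw [← Finset.sum_subtype Aᶜ (fun e => Finset.mem_compl) fun e => f e • X.edgeCob e]
      refine (Finset.sum_subset (Finset.subset_univ _) fun e _ he => ?_).symm
      have : e ∈ A := by simpa using he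
      simp only [f, dif_pos this, zero_smul]
    have h5 := hX.eq_zero hA hf fun e he => dif_pos he
    rintro (b | k)
    · have := congrFun h5 b.1
      rw [Pi.zero_apply] at this
      simpa only [f, dif_neg b.2] using this
    · exact h2 k
  have hsp : ⊤ ≤ Submodule.span ℂ
      (Set.range (Sum.elim (fun b : {b : X.S 1 // b ∉ A} => X.edgeCocycle b.1) z)) := by
    intro w _
    have h1 : w - ∑ k, h.repr (X.B2.mkQ w) k • z k ∈ X.B2 := by
      rw [← Submodule.Quotient.mk_eq_zero, ← Submodule.mkQ_apply, map_sub, map_sum]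
      simp only [map_smul, hz]
      rw [h.sum_repr, sub_self]
    obtain ⟨x, hx⟩ := (mem_B2_iff hA _).1 h1
    rw [sub_eq_iff_eq_add.1 hx]
    refine Submodule.add_mem _ (Submodule.sum_mem _ fun b _ => Submodule.smul_mem _ _ ?_)
      (Submodule.sum_mem _ fun k _ => Submodule.smul_mem _ _ ?_)
    · exact Submodule.subset_span ⟨Sum.inl b, rfl⟩
    · exact Submodule.subset_span ⟨Sum.inr k, rfl⟩
  exact ⟨Module.Basis.mk hli hsp, Module.Basis.coe_mk hli hsp⟩

end OrderedComplex

namespace System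

variable {Y : System}

open OrderedComplex

/-- A value of the torsion therefore already implies the vanishing of the first cohomology, under
which distinguished bases exist on the other triangulation as well. -/
theorem IsDistinguished.h1Vanishes {κ : Type} {h : Module.Basis κ ℂ Y.T.H2} {A : Finset (Y.T.S 1)}
    {e : Module.Basis ({b : Y.T.S 1 // b ∉ A} ⊕ κ) ℂ Y.T.Z2} (he : Y.IsDistinguished h A e) :
    Y.T.H1Vanishes := by
  refine h1Vanishes_of_linearIndependent he.1 ?_
  have h1 := (e.linearIndependent.comp _ Sum.inl_injective).map' Y.T.Z2.subtype
    (Submodule.ker_subtype _)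
  have h2 : (fun b : {b : Y.T.S 1 // b ∉ A} => Y.T.edgeCob b.1) =
      ⇑Y.T.Z2.subtype ∘ ⇑e ∘ Sum.inl := funext fun b => (he.2.1 b).symm
  rw [h2]
  exact h1

theorem exists_distinguished (hX : Y.T.H1Vanishes) (v : Y.T.S 0) {κ : Type} [Fintype κ]
    (h : Module.Basis κ ℂ Y.T.H2) : ∃ A e, Y.IsDistinguished h A e := by
  obtain ⟨A, hA⟩ := exists_maximalTree Y.T.connected v
  choose z hz using fun k => Submodule.mkQ_surjective Y.T.B2 (h k)
  obtain ⟨e, he⟩ := hX.exists_basis hA h z hz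
  exact ⟨A, e, hA, fun b => by rw [he]; rfl, fun k => by rw [he]; exact hz k⟩

/-- The transition matrix between two distinguished bases. -/
theorem IsDistinguished.toMatrix {κ : Type} [Fintype κ] [DecidableEq κ]
    {h : Module.Basis κ ℂ Y.T.H2} {A A' : Finset (Y.T.S 1)}
    {e : Module.Basis ({b : Y.T.S 1 // b ∉ A} ⊕ κ) ℂ Y.T.Z2}
    {e' : Module.Basis ({b : Y.T.S 1 // b ∉ A'} ⊕ κ) ℂ Y.T.Z2}
    (he : Y.IsDistinguished h A e) (he' : Y.IsDistinguished h A' e') :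
    ∃ (n : Matrix {b : Y.T.S 1 // b ∉ A} {b : Y.T.S 1 // b ∉ A'} ℤ)
      (x : Matrix {b : Y.T.S 1 // b ∉ A} κ ℂ),
      e.toMatrix e' = Matrix.fromBlocks (n.map (Int.cast : ℤ → ℂ)) x 0 1 := by
  classical
  have hin : ∀ b, e (Sum.inl b) = Y.T.edgeCocycle b.1 := fun b => Subtype.ext (he.2.1 b)
  have hin' : ∀ b, e' (Sum.inl b) = Y.T.edgeCocycle b.1 := fun b => Subtype.ext (he'.2.1 b)
  choose n hn using fun b : {b : Y.T.S 1 // b ∉ A'} => he.1.exists_int b.1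
  have hd : ∀ k, e' (Sum.inr k) - e (Sum.inr k) ∈ Y.T.B2 := fun k => by
    rw [← Submodule.Quotient.mk_eq_zero, ← Submodule.mkQ_apply, map_sub, he.2.2, he'.2.2, sub_self]
  choose x hx using fun k => (mem_B2_iff he.1 _).1 (hd k)
  have h1 : ∀ b, e' (Sum.inl b) = ∑ b', (n b b' : ℂ) • e (Sum.inl b') := fun b => by
    apply Subtype.ext
    rw [hin']
    simp only [hin, Submodule.coe_sum, Submodule.coe_smul, edgeCocycle]
    exact hn b
  have h2 : ∀ k, e' (Sum.inr k) = ∑ b, x k b • e (Sum.inl b) + e (Sum.inr k) := fun k => by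
    simp only [hin]
    exact sub_eq_iff_eq_add.1 (hx k)
  refine ⟨Matrix.of fun b' b => n b b', Matrix.of fun b k => x k b, ?_⟩
  ext i j
  rw [Module.Basis.toMatrix_apply]
  rcases j with b | k
  · rw [h1]
    rcases i with i | i
    · simp [Finsupp.single_apply]
    · simp
  · rw [h2]
    rcases i with i | i
    · simp [Finsupp.single_apply]
    · simp [Finsupp.single_apply, Matrix.one_apply, eq_comm]

open Classical in
-- The integer blocks of the two mutually inverse transition matrices are inverse over the integers,
-- so their determinants are ±1; the block of cohomology representatives is unitriangular over them.
theorem IsDistinguished.det_sq {κ : Type} [Fintype κ]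
    {h : Module.Basis κ ℂ Y.T.H2} {A A' : Finset (Y.T.S 1)}
    {e : Module.Basis ({b : Y.T.S 1 // b ∉ A} ⊕ κ) ℂ Y.T.Z2}
    {e' : Module.Basis ({b : Y.T.S 1 // b ∉ A'} ⊕ κ) ℂ Y.T.Z2}
    (he : Y.IsDistinguished h A e) (he' : Y.IsDistinguished h A' e') :
    ∃ ι : {b : Y.T.S 1 // b ∉ A} ⊕ κ ≃ {b : Y.T.S 1 // b ∉ A'} ⊕ κ,
      (e.toMatrix (e' ∘ ι)).det ^ 2 = 1 := by
  classical
  obtain ⟨n, x, hn⟩ := he.toMatrix he'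
  obtain ⟨n', x', hn'⟩ := he'.toMatrix he
  have hcard : Fintype.card {b : Y.T.S 1 // b ∉ A} = Fintype.card {b : Y.T.S 1 // b ∉ A'} := by
    have := Fintype.card_congr (e.indexEquiv e')
    simpa using this
  let ι := Fintype.equivOfCardEq hcard
  refine ⟨Equiv.sumCongr ι (Equiv.refl κ), ?_⟩
  have hmul : n * n' = 1 := by
    have h1 : e.toMatrix e' * e'.toMatrix e = 1 := by
      rw [Module.Basis.toMatrix_mul_toMatrix, Module.Basis.toMatrix_self]
    rw [hn, hn', Matrix.fromBlocks_multiply] at h1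
    ext i j
    have := congrFun (congrFun h1 (Sum.inl i)) (Sum.inl j)
    have hc : (((n * n') i j : ℤ) : ℂ) =
        (n.map (Int.cast : ℤ → ℂ) * n'.map (Int.cast : ℤ → ℂ)) i j := by
      simp [Matrix.mul_apply]
    rw [Matrix.fromBlocks_apply₁₁, Matrix.mul_zero, add_zero, ← hc] at this
    by_cases hij : i = j
    · subst hij
      rw [Matrix.one_apply_eq] at this ⊢
      exact_mod_cast this
    · rw [Matrix.one_apply_ne (fun h => hij (Sum.inl_injective h))] at this
      rw [Matrix.one_apply_ne hij]
      exact_mod_cast this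
  have hdet : (n.submatrix id ι).det * (n'.submatrix ι id).det = 1 := by
    rw [← Matrix.det_mul, Matrix.submatrix_mul_equiv, hmul, Matrix.submatrix_id_id, Matrix.det_one]
  have hsq : (n.submatrix id ι).det ^ 2 = 1 := by
    rcases Int.isUnit_iff.1 (IsUnit.of_mul_eq_one _ hdet) with h | h <;> rw [h] <;> norm_num
  have hmat : e.toMatrix (e' ∘ Equiv.sumCongr ι (Equiv.refl κ)) =
      Matrix.fromBlocks ((n.submatrix id ι).map (Int.cast : ℤ → ℂ)) x 0 1 := by
    ext i j
    have := congrFun (congrFun hn i) (Equiv.sumCongr ι (Equiv.refl κ) j)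
    rw [Module.Basis.toMatrix_apply] at this ⊢
    rw [Function.comp_apply, this]
    rcases i with i | i <;> rcases j with j | j <;> rfl
  have hdd : (e.toMatrix (e' ∘ Equiv.sumCongr ι (Equiv.refl κ))).det =
      ((n.submatrix id ι).det : ℂ) := by
    rw [hmat]
    have := Matrix.det_fromBlocks_zero₂₁ ((n.submatrix id ι).map (Int.cast : ℤ → ℂ)) x 1
    rw [Matrix.det_one, mul_one] at this
    rw [Int.cast_det, ← this]
  rw [hdd]
  exact_mod_cast hsq

end System

end

/-! ### Bordered determinants and the independence of minors -/

section

set_option linter.unusedSectionVars false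

section Frame

open Matrix

variable {N I J P Q : Type} [Fintype N] [Fintype I] [Fintype J] [Fintype P] [Fintype Q]
  [DecidableEq N] [DecidableEq I] [DecidableEq J] [DecidableEq P] [DecidableEq Q]

/-- The matrix of the mapping `V`, bordered by a functional `φ` and by the columns `E`. -/
def frame (V : Matrix N I ℂ) (φ : I → ℂ) (E : Matrix N P ℂ) : Matrix (N ⊕ Unit) (I ⊕ P) ℂ :=
  Matrix.fromBlocks V E (Matrix.of fun _ i => φ i) 0

/-- The determinant of the bordered matrix, for a given numbering of its rows. -/
def frameDet (k : I ⊕ P ≃ N ⊕ Unit) (V : Matrix N I ℂ) (φ : I → ℂ) (E : Matrix N P ℂ) : ℂ :=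
  ((frame V φ E).submatrix k id).det

/-- The numbering `k` only makes the matrix square; the squared determinant is free of this choice.
-/
theorem frameDet_sq (k k' : I ⊕ P ≃ N ⊕ Unit) (V : Matrix N I ℂ) (φ : I → ℂ) (E : Matrix N P ℂ) :
    frameDet k V φ E ^ 2 = frameDet k' V φ E ^ 2 := by
  have h : (frame V φ E).submatrix k id =
      ((frame V φ E).submatrix k' id).submatrix (k.trans k'.symm) id := by
    ext i j
    simp
  rw [frameDet, h, Matrix.det_permute, mul_pow, frameDet]
  rcases Int.units_eq_one_or (Equiv.Perm.sign (k.trans k'.symm)) with h | h <;> simp [h]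

theorem frame_mulVec (V : Matrix N I ℂ) (φ : I → ℂ) (E : Matrix N P ℂ) (x : I → ℂ) (p : P → ℂ) :
    frame V φ E *ᵥ Sum.elim x p = Sum.elim (V *ᵥ x + E *ᵥ p) fun _ => φ ⬝ᵥ x := by
  rw [frame, Matrix.fromBlocks_mulVec]
  simp only [Sum.elim_comp_inl, Sum.elim_comp_inr, Matrix.zero_mulVec, add_zero]
  rfl

theorem frame_submatrix_mulVec (k : I ⊕ P ≃ N ⊕ Unit) (V : Matrix N I ℂ) (φ : I → ℂ)
    (E : Matrix N P ℂ) (v : I ⊕ P → ℂ) :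
    (frame V φ E).submatrix k id *ᵥ v = (frame V φ E *ᵥ v) ∘ k := rfl

variable {V : Matrix N I ℂ} {φ : I → ℂ} {E : Matrix N P ℂ} {k : I ⊕ P ≃ N ⊕ Unit}

theorem frame_injective (h : frameDet k V φ E ≠ 0) {x : I → ℂ} {p : P → ℂ}
    (h1 : V *ᵥ x + E *ᵥ p = 0) (h2 : φ ⬝ᵥ x = 0) : x = 0 ∧ p = 0 := by
  have h3 : (frame V φ E).submatrix k id *ᵥ Sum.elim x p = 0 := by
    rw [frame_submatrix_mulVec, frame_mulVec, h1, h2]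
    funext i
    rw [Function.comp_apply]
    rcases k i with i | i <;> rfl
  have h4 := Matrix.eq_zero_of_mulVec_eq_zero h h3
  exact ⟨funext fun i => congrFun h4 (Sum.inl i), funext fun i => congrFun h4 (Sum.inr i)⟩

theorem frame_surjective (h : frameDet k V φ E ≠ 0) (y : N → ℂ) (l : ℂ) :
    ∃ (x : I → ℂ) (p : P → ℂ), V *ᵥ x + E *ᵥ p = y ∧ φ ⬝ᵥ x = l := by
  have hs := Matrix.mulVec_surjective_iff_isUnit.2
    ((Matrix.isUnit_iff_isUnit_det _).2 (isUnit_iff_ne_zero.2 h))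
  obtain ⟨v, hv⟩ := hs (Sum.elim y (fun _ => l) ∘ k)
  rw [frame_submatrix_mulVec] at hv
  have hv' := k.surjective.injective_comp_right hv
  rw [← Sum.elim_comp_inl_inr v, frame_mulVec] at hv'
  exact ⟨v ∘ Sum.inl, v ∘ Sum.inr, funext fun i => congrFun hv' (Sum.inl i),
    congrFun hv' (Sum.inr ())⟩

/-- A nondegenerate frame solves for any other columns modulo the image of `V`, with the solution
normalized by φ. -/
theorem frame_eq_mul (h : frameDet k V φ E ≠ 0) (E' : Matrix N Q ℂ) :
    ∃ (X : Matrix I Q ℂ) (G : Matrix P Q ℂ), E' = V * X + E * G ∧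
      frame V φ E' = frame V φ E * Matrix.fromBlocks 1 X 0 G := by
  choose x p h1 h2 using fun q => frame_surjective h (fun n => E' n q) 0
  refine ⟨Matrix.of fun i q => x q i, Matrix.of fun i q => p q i, ?_, ?_⟩
  · ext n q
    exact (congrFun (h1 q) n).symm
  · rw [frame, frame, Matrix.fromBlocks_multiply]
    congr 1
    · simp
    · ext n q
      exact (congrFun (h1 q) n).symm
    · simp
    · ext n q
      rw [Matrix.zero_mul, add_zero]
      exact (h2 q).symm

/-- The independence of the torsion of the choice of the minors. -/
theorem frame_exchange (h : frameDet k V φ E ≠ 0) {A : Matrix N N ℂ} (hA : A * V = 0)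
    (hA' : V.transpose * A = 0) (E' : Matrix N P ℂ) :
    (E'.transpose * A * E').det * frameDet k V φ E ^ 2 =
      (E.transpose * A * E).det * frameDet k V φ E' ^ 2 := by
  obtain ⟨X, G, h1, h2⟩ := frame_eq_mul h E'
  have h3 : frameDet k V φ E' = frameDet k V φ E * G.det := by
    rw [frameDet, h2, ← Matrix.submatrix_mul_equiv (frame V φ E) _ k (Equiv.refl _) id,
      Matrix.det_mul]
    simp only [Equiv.coe_refl, Matrix.submatrix_id_id]
    rw [Matrix.det_fromBlocks_zero₂₁, Matrix.det_one, one_mul]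
    rfl
  -- `A` kills the image of `V` from both sides, so only the part along `E` contributes.
  have h4 : E'.transpose * A * E' = G.transpose * (E.transpose * A * E) * G := by
    rw [h1, Matrix.mul_add, Matrix.mul_assoc _ A (V * X), ← Matrix.mul_assoc A V X, hA,
      Matrix.zero_mul, Matrix.mul_zero, zero_add, Matrix.transpose_add, Matrix.transpose_mul,
      Matrix.add_mul, Matrix.mul_assoc _ V.transpose A, hA', Matrix.mul_zero, zero_add,
      Matrix.transpose_mul]
    simp only [Matrix.mul_assoc]
  rw [h3, h4, Matrix.det_mul, Matrix.det_mul, Matrix.det_transpose]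
  ring

theorem frameDet_basis (S : Matrix I I ℂ) : frameDet k (V * S) (φ ᵥ* S) E =
    frameDet k V φ E * S.det := by
  have : frame (V * S) (φ ᵥ* S) E = frame V φ E *
      (Matrix.fromBlocks S 0 0 1 : Matrix (I ⊕ P) (I ⊕ P) ℂ) := by
    rw [frame, frame, Matrix.fromBlocks_multiply]
    congr 1
    · simp
    · simp
    · rw [Matrix.zero_mul, add_zero]
      rfl
    · simp
  rw [frameDet, this, ← Matrix.submatrix_mul_equiv (frame V φ E) _ k (Equiv.refl _) id,
    Matrix.det_mul]
  simp only [Equiv.coe_refl, Matrix.submatrix_id_id]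
  rw [Matrix.det_fromBlocks_zero₂₁, Matrix.det_one, mul_one]
  rfl

theorem frameDet_reindex (ι : J ≃ I) (π : Q ≃ P) :
    frameDet ((Equiv.sumCongr ι π).trans k) (V.submatrix id ι) (φ ∘ ι) (E.submatrix id π) =
      frameDet k V φ E := by
  have : (frame (V.submatrix id ι) (φ ∘ ι) (E.submatrix id π)).submatrix
      ((Equiv.sumCongr ι π).trans k) id =
      ((frame V φ E).submatrix k id).submatrix (Equiv.sumCongr ι π) (Equiv.sumCongr ι π) := by
    ext i j
    rw [Matrix.submatrix_apply, Matrix.submatrix_apply, Matrix.submatrix_apply]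
    change frame _ _ _ (k (Equiv.sumCongr ι π i)) j = frame V φ E (k (Equiv.sumCongr ι π i)) _
    rcases k (Equiv.sumCongr ι π i) with i' | i' <;> rcases j with j | j <;> rfl
  rw [frameDet, this, Matrix.det_submatrix_equiv_self]
  rfl

theorem frameDet_sq_diag (l : N → ℂ) :
    frameDet k (Matrix.diagonal l * V) φ (Matrix.diagonal l * E) ^ 2 =
      (∏ n, l n) ^ 2 * frameDet k V φ E ^ 2 := by
  have : frame (Matrix.diagonal l * V) φ (Matrix.diagonal l * E) =
      (Matrix.fromBlocks (Matrix.diagonal l) 0 0 1 : Matrix (N ⊕ Unit) (N ⊕ Unit) ℂ) *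
        frame V φ E := by
    rw [frame, frame, Matrix.fromBlocks_multiply]
    congr 1 <;> simp
  rw [frameDet, this, ← Matrix.submatrix_mul_equiv _ (frame V φ E) k k id, Matrix.det_mul,
    Matrix.det_submatrix_equiv_self, Matrix.det_fromBlocks_zero₂₁, Matrix.det_diagonal,
    Matrix.det_one, mul_one, mul_pow]
  rfl

/-- The coordinate columns numbered by the complement of `R`. -/
def coordCols (R : Finset N) : Matrix N {t : N // t ∉ R} ℂ :=
  Matrix.of fun n t => if n = t.1 then 1 else 0


theorem coordCols_congruence (A : Matrix N N ℂ) (R : Finset N) :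
    (coordCols R).transpose * A * coordCols R = A.submatrix Subtype.val Subtype.val := by
  ext t t'
  simp [Matrix.mul_apply, coordCols, ite_mul, mul_ite]

theorem det_eq_of_column (W : Matrix I I ℂ) (j : I) (h : ∀ i, i ≠ j → W i j = 0) :
    W.det = W j j * (Matrix.of fun i i' : {i : I // i ≠ j} => W i.1 i'.1).det := by
  rw [Matrix.twoBlockTriangular_det W (fun i => i = j) fun i hi i' hi' => by rw [hi', h i hi]]
  congr 1
  have hs : Subsingleton {i // i = j} := ⟨fun a b => Subtype.ext (a.2.trans b.2.symm)⟩
  have h1 := Matrix.det_eq_elem_of_subsingleton (W.toSquareBlockProp fun i => i = j) ⟨j, rfl⟩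
  rw [Matrix.toSquareBlockProp_def, Matrix.of_apply] at h1
  convert h1
  rfl

/-- The determinant bordered by coordinate columns in terms of a minor. -/
theorem exists_frameDet_coordCols (V : Matrix N I ℂ) (φ c : I → ℂ) (hc : V *ᵥ c = 0) (j : I)
    (R : Finset N) (r : {i : I // i ≠ j} ≃ {t : N // t ∈ R}) :
    ∃ k : I ⊕ {t : N // t ∉ R} ≃ N ⊕ Unit, c j * frameDet k V φ (coordCols R) =
      (φ ⬝ᵥ c) * (Matrix.of fun i i' : {i : I // i ≠ j} => V (r i).1 i'.1).det := by
  -- The columns other than `j` are matched with the rows in `R`, the added columns with the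
  -- remaining rows, and `j` with the bordering row.
  let f : I ⊕ {t : N // t ∉ R} → N ⊕ Unit :=
    Sum.elim (fun i => if h : i = j then Sum.inr () else Sum.inl (r ⟨i, h⟩).1) fun t => Sum.inl t.1
  have fj : f (Sum.inl j) = Sum.inr () := dif_pos rfl
  have fi : ∀ i : {i : I // i ≠ j}, f (Sum.inl i.1) = Sum.inl (r i).1 := fun i => dif_neg i.2
  have fr : ∀ t, f (Sum.inr t) = Sum.inl t.1 := fun t => rfl
  have hinj : Function.Injective f := by
    have key : ∀ i : I, i = j ∨ ∃ i' : {i : I // i ≠ j}, i = i'.1 := fun i => by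
      by_cases h : i = j
      · exact Or.inl h
      · exact Or.inr ⟨⟨i, h⟩, rfl⟩
    rintro (i | t) (i' | t') h
    · rcases key i with rfl | ⟨i, rfl⟩ <;> rcases key i' with h1 | ⟨i', rfl⟩
      · rw [h1]
      · rw [fj, fi] at h
        exact absurd h (by simp)
      · rw [h1, fj, fi] at h
        exact absurd h (by simp)
      · rw [fi, fi] at h
        rw [r.injective (Subtype.ext (Sum.inl_injective h))]
    · rcases key i with rfl | ⟨i, rfl⟩
      · rw [fj, fr] at h
        exact absurd h (by simp)
      · rw [fi, fr] at h
        exact absurd (r i).2 (Sum.inl_injective h ▸ t'.2)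
    · rcases key i' with rfl | ⟨i', rfl⟩
      · rw [fj, fr] at h
        exact absurd h (by simp)
      · rw [fi, fr] at h
        exact absurd (r i').2 (Sum.inl_injective h ▸ t.2)
    · rw [fr, fr] at h
      rw [Subtype.ext (Sum.inl_injective h)]
  have hsurj : Function.Surjective f := by
    rintro (t | u)
    · by_cases ht : t ∈ R
      · exact ⟨Sum.inl (r.symm ⟨t, ht⟩).1, by rw [fi, Equiv.apply_symm_apply]⟩
      · exact ⟨Sum.inr ⟨t, ht⟩, fr _⟩
    · exact ⟨Sum.inl j, fj⟩
  refine ⟨Equiv.ofBijective f ⟨hinj, hsurj⟩, ?_⟩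
  -- The basis vector `j` is replaced by the kernel vector `c`: column `j` then has only the
  -- bordering entry, and the determinant acquires the factor `c j`.
  let S : Matrix I I ℂ := (1 : Matrix I I ℂ).updateCol j c
  have hS : S.det = c j := by
    have := Matrix.cramer_apply (1 : Matrix I I ℂ) c j
    rw [Matrix.cramer_one] at this
    exact this.symm
  have hSj : ∀ x, S x j = c x := fun x => by simp [S]
  have hSi : ∀ x i, i ≠ j → S x i = if x = i then 1 else 0 := fun x i hi => by
    simp [S, Matrix.updateCol_ne hi, Matrix.one_apply]
  have hVS : ∀ t i, (V * S) t i = if i = j then 0 else V t i := by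
    intro t i
    by_cases hi : i = j
    · rw [if_pos hi, hi]
      have : (V * S) t j = (V *ᵥ c) t := by
        rw [Matrix.mul_apply]
        exact Finset.sum_congr rfl fun x _ => by rw [hSj]
      rw [this, hc, Pi.zero_apply]
    · rw [if_neg hi, Matrix.mul_apply]
      simp [hSi _ _ hi]
  have hφS : ∀ i, (φ ᵥ* S) i = if i = j then φ ⬝ᵥ c else φ i := by
    intro i
    by_cases hi : i = j
    · rw [if_pos hi, hi]
      exact Finset.sum_congr rfl fun x _ => congrArg (φ x * ·) (hSj x)
    · rw [if_neg hi]
      change ∑ x, φ x * S x i = _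
      simp [hSi _ _ hi]
  rw [mul_comm (c j), ← hS, ← frameDet_basis, frameDet]
  set M : Matrix (I ⊕ {t : N // t ∉ R}) (I ⊕ {t : N // t ∉ R}) ℂ :=
    (frame (V * S) (φ ᵥ* S) (coordCols R)).submatrix (Equiv.ofBijective f ⟨hinj, hsurj⟩) id with hM
  have m1 : ∀ a x, f a = Sum.inl x → ∀ i, M a (Sum.inl i) = if i = j then 0 else V x i := by
    intro a x h i
    rw [← hVS]
    change frame (V * S) (φ ᵥ* S) (coordCols R) (f a) (Sum.inl i) = _
    rw [h]
    rfl
  have m2 : ∀ a x, f a = Sum.inl x → ∀ t, M a (Sum.inr t) = if x = t.1 then 1 else 0 := by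
    intro a x h t
    change frame (V * S) (φ ᵥ* S) (coordCols R) (f a) (Sum.inr t) = _
    rw [h]
    rfl
  have m3 : ∀ i, M (Sum.inl j) (Sum.inl i) = if i = j then φ ⬝ᵥ c else φ i := by
    intro i
    rw [← hφS]
    change frame (V * S) (φ ᵥ* S) (coordCols R) (f (Sum.inl j)) (Sum.inl i) = _
    rw [fj]
    rfl
  have m4 : ∀ t, M (Sum.inl j) (Sum.inr t) = 0 := by
    intro t
    change frame (V * S) (φ ᵥ* S) (coordCols R) (f (Sum.inl j)) (Sum.inr t) = 0
    rw [fj]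
    rfl
  have hblocks : M = Matrix.fromBlocks M.toBlocks₁₁ 0 M.toBlocks₂₁ 1 := by
    ext a b
    rcases a with i | t <;> rcases b with i' | t'
    · rfl
    · rw [Matrix.fromBlocks_apply₁₂, Matrix.zero_apply]
      by_cases hi : i = j
      · rw [hi, m4]
      · rw [m2 _ _ (fi ⟨i, hi⟩), if_neg]
        intro h
        exact t'.2 (h ▸ (r ⟨i, hi⟩).2)
    · rfl
    · rw [Matrix.fromBlocks_apply₂₂, m2 _ _ (fr t), Matrix.one_apply]
      simp only [Subtype.ext_iff]
  rw [hblocks, Matrix.det_fromBlocks_zero₁₂, Matrix.det_one, mul_one, det_eq_of_column _ j]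
  · congr 1
    · refine (m3 j).trans (if_pos rfl)
    · congr 1
      ext i i'
      exact (m1 _ _ (fi i) i').trans (if_neg i'.2)
  · intro i hi
    exact (m1 _ _ (fi ⟨i, hi⟩) j).trans (if_pos rfl)

/-- A matrix with independent columns has a nondegenerate square submatrix. -/
theorem exists_rows (W : Matrix N J ℂ) (hW : ∀ x, W *ᵥ x = 0 → x = 0) :
    ∃ (R : Finset N) (r : J ≃ {t : N // t ∈ R}),
      (Matrix.of fun i i' : J => W (r i).1 i').det ≠ 0 := by
  obtain ⟨κ, a, ha, hspan, hli⟩ := exists_linearIndependent' ℂ W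
  -- A functional vanishing on all the rows is a vector in the kernel of `W`, so the rows span and
  -- contain a basis.
  have htop : Submodule.span ℂ (Set.range W) = ⊤ := by
    by_contra hne
    obtain ⟨f, hf, hker⟩ := Submodule.exists_le_ker_of_lt_top _ (lt_top_iff_ne_top.2 hne)
    apply hf
    let x : J → ℂ := fun j => f (Pi.single j 1)
    have hfx : ∀ v : J → ℂ, f v = v ⬝ᵥ x := by
      intro v
      have hv : v = ∑ j, v j • (Pi.single j 1 : J → ℂ) := by
        funext j
        simp [Finset.sum_apply, Pi.single_apply]
      conv_lhs => rw [hv, map_sum]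
      exact Finset.sum_congr rfl fun j _ => by rw [map_smul, smul_eq_mul]
    have hx : x = 0 := hW x (funext fun n => by
      rw [Pi.zero_apply, ← LinearMap.mem_ker.1 (hker (Submodule.subset_span ⟨n, rfl⟩)), hfx]
      rfl)
    ext v
    simp [hfx, hx]
  rw [htop] at hspan
  let b := Module.Basis.mk hli hspan.ge
  have : Finite κ := Finite.of_injective a ha
  have : Fintype κ := Fintype.ofFinite κ
  let ε : J ≃ κ := (Pi.basisFun ℂ J).indexEquiv b
  classical
  let R : Finset N := Finset.univ.image fun i => a (ε i)
  have hR : ∀ i, a (ε i) ∈ R := fun i => Finset.mem_image_of_mem _ (Finset.mem_univ i)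
  let r : J ≃ {t : N // t ∈ R} := Equiv.ofBijective (fun i => ⟨a (ε i), hR i⟩)
    ⟨fun i i' h => ε.injective (ha (congrArg Subtype.val h)), fun t => by
      obtain ⟨i, -, hi⟩ := Finset.mem_image.1 t.2
      exact ⟨i, Subtype.ext hi⟩⟩
  refine ⟨R, r, ?_⟩
  have hli' : LinearIndependent ℂ (Matrix.of fun i i' : J => W (r i).1 i').row :=
    hli.comp ε ε.injective
  exact (Matrix.isUnit_iff_isUnit_det _).1 (Matrix.linearIndependent_rows_iff_isUnit.1 hli') |>.ne_zero

/-- The minors used in the definition of the torsion exist. -/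
theorem exists_minor (V : Matrix N I ℂ) (c : I → ℂ) (j : I) (hj : c j ≠ 0)
    (hV : ∀ x, V *ᵥ x = 0 → ∃ l : ℂ, x = l • c) :
    ∃ (R : Finset N) (r : {i : I // i ≠ j} ≃ {t : N // t ∈ R}),
      (Matrix.of fun i i' : {i : I // i ≠ j} => V (r i).1 i'.1).det ≠ 0 := by
  refine exists_rows (Matrix.of fun t (i : {i : I // i ≠ j}) => V t i.1) fun x hx => ?_
  let y : I → ℂ := fun i => if h : i = j then 0 else x ⟨i, h⟩
  have hy : V *ᵥ y = 0 := by
    rw [← hx]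
    funext t
    change ∑ i, V t i * y i = ∑ i : {i : I // i ≠ j}, V t i.1 * x i
    have hyj : y j = 0 := dif_pos rfl
    rw [← Finset.add_sum_erase _ _ (Finset.mem_univ j), hyj, mul_zero, zero_add,
      Finset.sum_subtype (p := fun i => i ≠ j) (Finset.univ.erase j) (by simp)]
    exact Finset.sum_congr rfl fun i _ => by rw [show y i = x i from dif_neg i.2]
  obtain ⟨l, hl⟩ := hV y hy
  have hl0 : l = 0 := by
    have := congrFun hl j
    simp only [y, dif_pos, Pi.smul_apply, smul_eq_mul] at this
    exact (mul_eq_zero.1 this.symm).resolve_right hj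
  funext i
  have := congrFun hl i.1
  rw [hl0, zero_smul, Pi.zero_apply] at this
  rw [Pi.zero_apply, ← this]
  have hyi : y i = x i := dif_neg i.2
  exact hyi.symm

/-- If the torsion is defined, the kernel of `V` is as small as possible. -/
theorem frame_ker (h : frameDet k V φ E ≠ 0) {c : I → ℂ} (hc : V *ᵥ c = 0) (hφ : φ ⬝ᵥ c ≠ 0)
    {x : I → ℂ} (hx : V *ᵥ x = 0) : ∃ l : ℂ, x = l • c := by
  refine ⟨φ ⬝ᵥ x / φ ⬝ᵥ c, ?_⟩
  have := frame_injective (x := x - (φ ⬝ᵥ x / φ ⬝ᵥ c) • c) (p := 0) h (by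
    rw [Matrix.mulVec_sub, Matrix.mulVec_smul, hx, hc, Matrix.mulVec_zero]
    simp) (by
    rw [dotProduct_sub, dotProduct_smul, smul_eq_mul, div_mul_cancel₀ _ hφ, sub_self])
  exact sub_eq_zero.1 this.1

/-- The submatrix of the middle mapping is nondegenerate if and only if the complex is exact. -/
theorem frame_det_ne_zero_iff (h : frameDet k V φ E ≠ 0) {c : I → ℂ} (hc : V *ᵥ c = 0)
    (hφ : φ ⬝ᵥ c ≠ 0) {A : Matrix N N ℂ} (hA : A * V = 0) (hA' : V.transpose * A = 0) :
    (E.transpose * A * E).det ≠ 0 ↔ ∀ y, A *ᵥ y = 0 → ∃ x, y = V *ᵥ x := by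
  constructor
  · intro hdet y hy
    obtain ⟨x, p, hxp, -⟩ := frame_surjective h y 0
    have hp : (E.transpose * A * E) *ᵥ p = 0 := by
      have h1 : A *ᵥ (E *ᵥ p) = 0 := by
        rw [← hxp, Matrix.mulVec_add, Matrix.mulVec_mulVec, hA, Matrix.zero_mulVec, zero_add] at hy
        exact hy
      rw [Matrix.mul_assoc, ← Matrix.mulVec_mulVec, ← Matrix.mulVec_mulVec, h1, Matrix.mulVec_zero]
    have hp0 := Matrix.eq_zero_of_mulVec_eq_zero hdet hp
    exact ⟨x, by rw [← hxp, hp0, Matrix.mulVec_zero, add_zero]⟩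
  · intro hex hdet
    obtain ⟨p, hp0, hp⟩ := Matrix.exists_mulVec_eq_zero_iff.2 hdet
    apply hp0
    set y := A *ᵥ (E *ᵥ p) with hy
    have h1 : E.transpose *ᵥ y = 0 := by
      rw [hy, Matrix.mulVec_mulVec, Matrix.mulVec_mulVec, hp]
    have h2 : V.transpose *ᵥ y = 0 := by
      rw [hy, Matrix.mulVec_mulVec, hA', Matrix.zero_mulVec]
    -- The columns of `V` and `E` span, and `y` is orthogonal to all of them. Exactness then puts `E
    -- *ᵥ p` into the image of `V`, whence `p = 0` by independence.
    have h3 : y = 0 := by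
      refine dotProduct_eq_zero _ fun w => ?_
      obtain ⟨x, q, hxq, -⟩ := frame_surjective h w 0
      rw [← hxq, dotProduct_add, Matrix.dotProduct_mulVec, Matrix.dotProduct_mulVec,
        ← Matrix.mulVec_transpose, ← Matrix.mulVec_transpose, h1, h2, zero_dotProduct,
        zero_dotProduct, add_zero]
    obtain ⟨x, hx⟩ := hex _ h3
    have := frame_injective (x := x - (φ ⬝ᵥ x / φ ⬝ᵥ c) • c) (p := -p) h (by
      rw [Matrix.mulVec_sub, Matrix.mulVec_smul, ← hx, hc, Matrix.mulVec_neg]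
      simp) (by
      rw [dotProduct_sub, dotProduct_smul, smul_eq_mul, div_mul_cancel₀ _ hφ, sub_self])
    exact neg_eq_zero.1 this.2

end Frame

end

/-! ### The complex and its squared torsion -/

section

open Matrix OrderedComplex

set_option linter.unusedSectionVars false

theorem exists_dotProduct {N : Type} [Fintype N] (f : Module.Dual ℂ (N → ℂ)) :
    ∃ w : N → ℂ, ∀ v, f v = w ⬝ᵥ v := by
  classical
  refine ⟨(dotProductEquiv ℂ N).symm f, fun v => ?_⟩
  conv_lhs => rw [← (dotProductEquiv ℂ N).apply_symm_apply f]
  rfl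

namespace System

variable (Y : System)

open Classical in
/-- The sum over the two positions of a tetrahedron in the pentachora. -/
theorem exists_sum_closed (t : Y.T.S 3) : ∃ (u v : Y.T.S 4) (i j : Fin 5), Y.T.d i u = t ∧
    Y.T.d j v = t ∧ ((Y.T.orient u * (-1) ^ (i : ℕ) : ℤˣ) : ℤ) =
      -((Y.T.orient v * (-1) ^ (j : ℕ) : ℤˣ) : ℤ) ∧ ∀ f : Y.T.S 4 → Fin 5 → ℂ,
      ∑ w, ∑ k, (if Y.T.d k w = t then f w k else 0) = f u i + f v j := by
  obtain ⟨u, v, i, j, hne, hu, hv, h, ho⟩ := Y.T.closed t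
  refine ⟨u, v, i, j, hu, hv, by rw [ho]; rfl, fun f => ?_⟩
  rw [← Finset.sum_product', ← Finset.sum_filter]
  have : (Finset.univ ×ˢ Finset.univ : Finset (Y.T.S 4 × Fin 5)).filter
      (fun p => Y.T.d p.2 p.1 = t) = {(u, i), (v, j)} := by
    ext ⟨w, k⟩
    simp only [Finset.mem_filter, Finset.mem_product, Finset.mem_univ, true_and,
      Finset.mem_insert, Finset.mem_singleton]
    constructor
    · exact h w k
    · rintro (h | h)
      · rw [Prod.mk.injEq] at h
        rw [h.1, h.2, hu]
      · rw [Prod.mk.injEq] at h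
        rw [h.1, h.2, hv]
  rw [this, Finset.sum_pair hne]

theorem f3Matrix_skew : Y.f3Matrix.transpose = -Y.f3Matrix := by
  ext t t'
  rw [Matrix.transpose_apply, Matrix.neg_apply, f3Matrix, f3Matrix, ← Finset.sum_neg_distrib]
  refine Finset.sum_congr rfl fun u _ => ?_
  rw [Finset.sum_comm, ← Finset.sum_neg_distrib]
  refine Finset.sum_congr rfl fun i _ => ?_
  rw [← Finset.sum_neg_distrib]
  refine Finset.sum_congr rfl fun j _ => ?_
  have : Y.F u j i = -Y.F u i j := congrFun (congrFun (Y.skew u) i) j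
  rw [this]
  by_cases h : Y.T.d i u = t ∧ Y.T.d j u = t'
  · rw [if_pos h, if_pos h.symm]
  · rw [if_neg h, if_neg (fun h' => h h'.symm), neg_zero]

open Classical in
theorem f3Matrix_mulVec (z : Y.T.S 3 → ℂ) (t : Y.T.S 3) : (Y.f3Matrix *ᵥ z) t =
    ∑ u, ∑ i, if Y.T.d i u = t then ∑ j, Y.F u i j * z (Y.T.d j u) else 0 := by
  change ∑ t', Y.f3Matrix t t' * z t' = _
  simp only [f3Matrix, Finset.sum_mul]
  rw [Finset.sum_comm]
  refine Finset.sum_congr rfl fun u _ => ?_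
  rw [Finset.sum_comm]
  refine Finset.sum_congr rfl fun i _ => ?_
  rw [Finset.sum_comm]
  by_cases h : Y.T.d i u = t
  · rw [if_pos h]
    refine Finset.sum_congr rfl fun j _ => ?_
    rw [Finset.sum_eq_single_of_mem (Y.T.d j u) (Finset.mem_univ _)]
    · rw [if_pos ⟨h, rfl⟩]
    · intro t' _ ht'
      rw [if_neg (fun hh => ht' hh.2.symm), zero_mul]
  · rw [if_neg h]
    refine Finset.sum_eq_zero fun j _ => Finset.sum_eq_zero fun t' _ => ?_
    rw [if_neg (fun hh => h hh.1), zero_mul]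

/-- The bilinear form of the third mapping. -/
theorem dotProduct_f3Matrix_mulVec (y z : Y.T.S 3 → ℂ) : y ⬝ᵥ Y.f3Matrix *ᵥ z =
    ∑ u, ∑ i, ∑ j, y (Y.T.d i u) * Y.F u i j * z (Y.T.d j u) := by
  classical
  change ∑ t, y t * (Y.f3Matrix *ᵥ z) t = _
  simp only [f3Matrix_mulVec, Finset.mul_sum]
  rw [Finset.sum_comm]
  refine Finset.sum_congr rfl fun u _ => ?_
  rw [Finset.sum_comm]
  refine Finset.sum_congr rfl fun i _ => ?_
  rw [Finset.sum_eq_single_of_mem (Y.T.d i u) (Finset.mem_univ _)]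
  · rw [if_pos rfl, Finset.mul_sum]
    exact Finset.sum_congr rfl fun j _ => by ring
  · intro t _ ht
    rw [if_neg (Ne.symm ht), mul_zero]

/-- By annihilation, each pentachoron at `t` contributes γ of `t` with its orientation sign. The two
pentachora induce opposite orientations, so the contributions cancel. -/
theorem f3Matrix_mulVec_f2 (c : Y.T.Z2) : Y.f3Matrix *ᵥ Y.f2 c = 0 := by
  classical
  funext t
  have hc : ∀ t, Y.T.cob 2 c.1 t = 0 := fun t => congrFun (LinearMap.mem_ker.1 c.2) t
  obtain ⟨u, v, i, j, hu, hv, ho, hsum⟩ := Y.exists_sum_closed t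
  have key : ∀ w k, ∑ j, Y.F w k j * Y.f2 c (Y.T.d j w) =
      -(((Y.T.orient w * (-1) ^ (k : ℕ) : ℤˣ) : ℤ) * Y.D.γ (Y.T.d k w) c.1) := by
    intro w k
    rw [Y.annihilate w c.1 (fun i => hc _) k, ← Finset.sum_neg_distrib]
    refine Finset.sum_congr rfl fun j _ => ?_
    have : Y.F w k j = -Y.F w j k := congrFun (congrFun (Y.skew w) j) k
    rw [this]
    change -Y.F w j k * Y.D.β (Y.T.d j w) c.1 = _
    ring
  rw [f3Matrix_mulVec, hsum, key, key, hu, hv, ho, Pi.zero_apply]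
  push_cast
  ring

theorem f2_ω : Y.f2 ⟨Y.C.ω, Y.C.cocycle⟩ = 0 := by
  funext t
  obtain ⟨u, i, rfl⟩ := Y.T.pure 3 (by decide) t
  exact (Y.beta_d' u i Y.C.ω).trans (congrFun (Y.pent u).beta_Om i)

theorem ω_ne_zero (s : Y.T.S 2) : (⟨Y.C.ω, Y.C.cocycle⟩ : Y.T.Z2) ≠ 0 := fun h =>
  Y.C.ne_zero s (congrFun (congrArg Subtype.val h) s)

theorem f2_dotProduct_f3 (c : Y.T.Z2) (y : Y.T.S 3 → ℂ) : Y.f2 c ⬝ᵥ Y.f3Matrix *ᵥ y = 0 := by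
  rw [Matrix.dotProduct_mulVec, ← Matrix.mulVec_transpose, f3Matrix_skew, Matrix.neg_mulVec,
    f3Matrix_mulVec_f2, neg_zero, zero_dotProduct]

/-- The middle mapping is skew-symmetric and the last two are transposes of the first two, so the
right half of the complex is dual to the left. The 2-face serves to see that ω is not zero. -/
theorem acyclic_iff (s : Y.T.S 2) : Y.Acyclic ↔
    (∀ z : Y.T.Z2, Y.f2 z = 0 → ∃ l : ℂ, z = l • ⟨Y.C.ω, Y.C.cocycle⟩) ∧
      ∀ y, Y.f3Matrix *ᵥ y = 0 → ∃ z, Y.f2 z = y := by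
  constructor
  · rintro ⟨-, h1, h2, -⟩
    refine ⟨fun z hz => ?_, fun y hy => (h2 y).1 hy⟩
    obtain ⟨l, rfl⟩ := (h1 z).1 hz
    exact ⟨l, rfl⟩
  · rintro ⟨h1, h2⟩
    have hω := Y.ω_ne_zero s
    refine ⟨?_, ?_, ?_, ?_, ?_, ?_⟩
    · intro l l' h
      exact smul_left_injective ℂ hω h
    · intro z
      constructor
      · intro hz
        obtain ⟨l, rfl⟩ := h1 z hz
        exact ⟨l, rfl⟩
      · rintro ⟨l, rfl⟩
        change Y.f2 (l • _) = 0
        rw [map_smul, f2_ω, smul_zero]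
    · intro y
      constructor
      · exact h2 y
      · rintro ⟨z, rfl⟩
        exact Y.f3Matrix_mulVec_f2 z
    · intro y
      constructor
      · intro hy
        by_contra hcon
        -- A functional separating `y` from the image of f₃ lies in the kernel of f₃ by skewness, so
        -- it is in the image of f₂, on which `y` vanishes.
        obtain ⟨f, hf, hmap⟩ := Submodule.exists_dual_map_eq_bot_of_notMem
          (p := LinearMap.range Y.f3) hcon inferInstance
        obtain ⟨w, hw⟩ := exists_dotProduct f
        have h3 : Y.f3Matrix *ᵥ w = 0 := by
          refine dotProduct_eq_zero _ fun x => ?_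
          have h4 : f (Y.f3 x) = 0 := by
            rw [← Submodule.mem_bot (R := ℂ), ← hmap]
            exact Submodule.mem_map_of_mem (LinearMap.mem_range_self _ _)
          rw [hw] at h4
          rw [← neg_neg Y.f3Matrix, ← Y.f3Matrix_skew, Matrix.neg_mulVec, Matrix.mulVec_transpose,
            neg_dotProduct, ← Matrix.dotProduct_mulVec]
          exact neg_eq_zero.2 h4
        obtain ⟨z, rfl⟩ := h2 w h3
        apply hf
        rw [hw, dotProduct_comm]
        exact LinearMap.congr_fun hy z
      · rintro ⟨x, rfl⟩
        ext z
        exact (dotProduct_comm _ _).trans (Y.f2_dotProduct_f3 z x)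
    · intro ψ
      constructor
      · intro hψ
        have hmem : ψ ∈ (LinearMap.ker Y.f2).dualAnnihilator := by
          rw [Submodule.mem_dualAnnihilator]
          intro z hz
          obtain ⟨l, rfl⟩ := h1 z hz
          rw [map_smul]
          change l • Y.f5 ψ = 0
          rw [hψ, smul_zero]
        rw [← LinearMap.range_dualMap_eq_dualAnnihilator_ker] at hmem
        obtain ⟨f, rfl⟩ := hmem
        obtain ⟨w, hw⟩ := exists_dotProduct f
        exact ⟨w, LinearMap.ext fun z => (hw _).symm⟩
      · rintro ⟨y, rfl⟩
        change y ⬝ᵥ Y.f2 _ = 0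
        rw [f2_ω, dotProduct_zero]
    · intro l
      obtain ⟨ψ, hψ⟩ := Module.Projective.exists_dual_eq_one ℂ hω
      refine ⟨l • ψ, ?_⟩
      change l • ψ _ = l
      rw [hψ, smul_eq_mul, mul_one]

/-- The matrix of the second mapping with respect to a family of cocycles. -/
def cocMat {I : Type} (z : I → Y.T.Z2) : Matrix (Y.T.S 3) I ℂ := Matrix.of fun t i => Y.f2 (z i) t

/-- The values of a family of cocycles on a 2-face. -/
def valuesAt {I : Type} (s : Y.T.S 2) (z : I → Y.T.Z2) (i : I) : ℂ := (z i).1 s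

theorem cocMat_mulVec {I : Type} [Fintype I] (z : I → Y.T.Z2) (x : I → ℂ) :
    Y.cocMat z *ᵥ x = Y.f2 (∑ i, x i • z i) := by
  funext t
  rw [map_sum, Finset.sum_apply]
  refine Finset.sum_congr rfl fun i _ => ?_
  rw [map_smul, Pi.smul_apply, smul_eq_mul, mul_comm]
  rfl

theorem f3Matrix_mul_cocMat {I : Type} (z : I → Y.T.Z2) : Y.f3Matrix * Y.cocMat z = 0 := by
  ext t i
  exact congrFun (Y.f3Matrix_mulVec_f2 (z i)) t

theorem cocMat_transpose_mul {I : Type} (z : I → Y.T.Z2) :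
    (Y.cocMat z).transpose * Y.f3Matrix = 0 := by
  have := congrArg Matrix.transpose (Y.f3Matrix_mul_cocMat z)
  rw [Matrix.transpose_mul, f3Matrix_skew, Matrix.mul_neg, Matrix.transpose_zero] at this
  exact neg_eq_zero.1 this

section Basis

variable {I P Q : Type} [Fintype I] [Fintype P] [Fintype Q] [DecidableEq I] [DecidableEq P]
  [DecidableEq Q] [DecidableEq (Y.T.S 3)]

theorem cocMat_repr (e : Module.Basis I ℂ Y.T.Z2) (z : Y.T.Z2) :
    Y.cocMat e *ᵥ e.repr z = Y.f2 z := by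
  rw [cocMat_mulVec, e.sum_repr]

theorem valuesAt_repr (s : Y.T.S 2) (e : Module.Basis I ℂ Y.T.Z2) (z : Y.T.Z2) :
    Y.valuesAt s e ⬝ᵥ e.repr z = z.1 s := by
  conv_rhs => rw [← e.sum_repr z]
  rw [Submodule.coe_sum, Finset.sum_apply]
  refine Finset.sum_congr rfl fun i _ => ?_
  rw [mul_comm]
  rfl

theorem cocMat_repr_ω (e : Module.Basis I ℂ Y.T.Z2) :
    Y.cocMat e *ᵥ e.repr ⟨Y.C.ω, Y.C.cocycle⟩ = 0 := by
  rw [cocMat_repr, f2_ω]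

theorem valuesAt_repr_ω (s : Y.T.S 2) (e : Module.Basis I ℂ Y.T.Z2) :
    Y.valuesAt s e ⬝ᵥ e.repr ⟨Y.C.ω, Y.C.cocycle⟩ ≠ 0 := by
  rw [valuesAt_repr]
  exact Y.C.ne_zero s

/-- The square of the torsion, calculated in the basis `e` with the help of the columns `E`. -/
def torsionSq (s : Y.T.S 2) (e : Module.Basis I ℂ Y.T.Z2) (E : Matrix (Y.T.S 3) P ℂ)
    (k : I ⊕ P ≃ Y.T.S 3 ⊕ Unit) : ℂ :=
  Y.C.ω s ^ 2 * (E.transpose * Y.f3Matrix * E).det / frameDet k (Y.cocMat e) (Y.valuesAt s e) E ^ 2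

variable {Y} {s : Y.T.S 2} {e : Module.Basis I ℂ Y.T.Z2} {E : Matrix (Y.T.S 3) P ℂ}
  {k : I ⊕ P ≃ Y.T.S 3 ⊕ Unit}

theorem acyclic_of_frame (h : frameDet k (Y.cocMat e) (Y.valuesAt s e) E ≠ 0)
    (h' : (E.transpose * Y.f3Matrix * E).det ≠ 0) : Y.Acyclic := by
  rw [Y.acyclic_iff s]
  constructor
  · intro z hz
    obtain ⟨l, hl⟩ := frame_ker h (Y.cocMat_repr_ω e) (Y.valuesAt_repr_ω s e) (x := e.repr z)
      (by rw [cocMat_repr, hz])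
    refine ⟨l, e.repr.injective (Finsupp.ext fun i => ?_)⟩
    rw [map_smul]
    exact congrFun hl i
  · intro y hy
    obtain ⟨x, hx⟩ := (frame_det_ne_zero_iff h (Y.cocMat_repr_ω e) (Y.valuesAt_repr_ω s e)
      (Y.f3Matrix_mul_cocMat e) (Y.cocMat_transpose_mul e)).1 h' y hy
    exact ⟨_, by rw [hx, cocMat_mulVec]⟩

theorem Acyclic.det_ne_zero (hY : Y.Acyclic)
    (h : frameDet k (Y.cocMat e) (Y.valuesAt s e) E ≠ 0) :
    (E.transpose * Y.f3Matrix * E).det ≠ 0 := by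
  rw [frame_det_ne_zero_iff h (Y.cocMat_repr_ω e) (Y.valuesAt_repr_ω s e)
    (Y.f3Matrix_mul_cocMat e) (Y.cocMat_transpose_mul e)]
  intro y hy
  obtain ⟨z, rfl⟩ := ((Y.acyclic_iff s).1 hY).2 y hy
  exact ⟨e.repr z, (Y.cocMat_repr e z).symm⟩

theorem torsionSq_ne_zero (h : frameDet k (Y.cocMat e) (Y.valuesAt s e) E ≠ 0)
    (h' : (E.transpose * Y.f3Matrix * E).det ≠ 0) : Y.torsionSq s e E k ≠ 0 :=
  div_ne_zero (mul_ne_zero (pow_ne_zero _ (Y.C.ne_zero s)) h') (pow_ne_zero _ h)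

/-- Here the freedom of the columns pays off: new columns coming from the pillow can be compared
with coordinate columns. -/
theorem torsionSq_columns (h : frameDet k (Y.cocMat e) (Y.valuesAt s e) E ≠ 0)
    {E' : Matrix (Y.T.S 3) Q ℂ} {k' : I ⊕ Q ≃ Y.T.S 3 ⊕ Unit}
    (h' : frameDet k' (Y.cocMat e) (Y.valuesAt s e) E' ≠ 0) :
    Y.torsionSq s e E' k' = Y.torsionSq s e E k := by
  have hcard : Fintype.card P = Fintype.card Q := by
    have := Fintype.card_congr (k.trans k'.symm)
    simpa using this
  let π := Fintype.equivOfCardEq hcard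
  have h1 := frameDet_reindex (V := Y.cocMat e) (φ := Y.valuesAt s e) (E := E') (k := k')
    (Equiv.refl I) π
  rw [Equiv.coe_refl, Matrix.submatrix_id_id, Function.comp_id] at h1
  have h2 := frame_exchange h (Y.f3Matrix_mul_cocMat e) (Y.cocMat_transpose_mul e)
    (E'.submatrix id π)
  rw [frameDet_sq k ((Equiv.sumCongr (Equiv.refl I) π).trans k') _ _ (E'.submatrix id π), h1] at h2
  have h3 : (E'.submatrix id π).transpose * Y.f3Matrix * E'.submatrix id π =
      (E'.transpose * Y.f3Matrix * E').submatrix π π := rfl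
  rw [h3, Matrix.det_submatrix_equiv_self] at h2
  rw [torsionSq, torsionSq, div_eq_div_iff (pow_ne_zero _ h') (pow_ne_zero _ h)]
  linear_combination Y.C.ω s ^ 2 * h2

/-- The basis enters only through the bordered determinant, which is multiplied by the determinant
of the transition matrix. -/
theorem torsionSq_basis (e' : Module.Basis Q ℂ Y.T.Z2) (ι : I ≃ Q)
    (hdet : (e.toMatrix (e' ∘ ι)).det ^ 2 = 1) (k' : Q ⊕ P ≃ Y.T.S 3 ⊕ Unit) :
    Y.torsionSq s e' E k' = Y.torsionSq s e E k ∧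
      frameDet k' (Y.cocMat e') (Y.valuesAt s e') E ^ 2 =
        frameDet k (Y.cocMat e) (Y.valuesAt s e) E ^ 2 := by
  have h1 := frameDet_reindex (V := Y.cocMat e') (φ := Y.valuesAt s e') (E := E) (k := k')
    ι (Equiv.refl P)
  rw [Equiv.coe_refl, Matrix.submatrix_id_id] at h1
  have h2 : (Y.cocMat e').submatrix id ι = Y.cocMat e * e.toMatrix (e' ∘ ι) := by
    ext t i
    have := congrFun (Y.cocMat_mulVec e fun j => e.toMatrix (e' ∘ ι) j i) t
    rw [Module.Basis.sum_toMatrix_smul_self] at this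
    exact this.symm
  have h3 : Y.valuesAt s e' ∘ ι = Y.valuesAt s e ᵥ* e.toMatrix (e' ∘ ι) := by
    funext i
    have := Y.valuesAt_repr s e (e' (ι i))
    exact this.symm
  rw [h2, h3, frameDet_basis] at h1
  have h4 : frameDet k' (Y.cocMat e') (Y.valuesAt s e') E ^ 2 =
        frameDet k (Y.cocMat e) (Y.valuesAt s e) E ^ 2 := by
    rw [← h1, mul_pow, hdet, mul_one]
    exact frameDet_sq _ _ _ _ _
  exact ⟨by rw [torsionSq, torsionSq, h4], h4⟩

/-- Bordering by the values on a 2-face `s` expresses the minor of f₂, divided by the coordinate of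
ω number `j`, as the bordered determinant divided by `ω s`. The factor `ω s ^ 2` in `torsionSq`
compensates this. -/
theorem exists_torsionSq_eq (s : Y.T.S 2) (e : Module.Basis I ℂ Y.T.Z2) (j : I)
    (R : Finset (Y.T.S 3)) (r : {i : I // i ≠ j} ≃ {t : Y.T.S 3 // t ∈ R})
    {n : ℕ} (p : Fin n × Fin 2 ≃ {t : Y.T.S 3 // t ∉ R})
    (hm : (Matrix.of fun i i' : {i : I // i ≠ j} => Y.f2 (e i'.1) (r i).1).det ≠ 0)
    (hpf : pfaffian (Y.f3Matrix.submatrix (fun i => (p i).1) (fun i => (p i).1)) ≠ 0) :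
    ∃ k : I ⊕ {t : Y.T.S 3 // t ∉ R} ≃ Y.T.S 3 ⊕ Unit,
      frameDet k (Y.cocMat e) (Y.valuesAt s e) (coordCols R) ≠ 0 ∧
      ((coordCols R).transpose * Y.f3Matrix * coordCols R).det ≠ 0 ∧
      (e.repr ⟨Y.C.ω, Y.C.cocycle⟩ j *
        pfaffian (Y.f3Matrix.submatrix (fun i => (p i).1) (fun i => (p i).1)) /
        (Matrix.of fun i i' : {i : I // i ≠ j} => Y.f2 (e i'.1) (r i).1).det) ^ 2 =
      Y.torsionSq s e (coordCols R) k := by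
  obtain ⟨k, hk⟩ := exists_frameDet_coordCols (Y.cocMat e) (Y.valuesAt s e) _
    (Y.cocMat_repr_ω e) j R r
  change _ = _ * (Matrix.of fun i i' : {i : I // i ≠ j} => Y.f2 (e i'.1) (r i).1).det at hk
  rw [valuesAt_repr] at hk
  have hpf2 : pfaffian (Y.f3Matrix.submatrix (fun i => (p i).1) (fun i => (p i).1)) ^ 2 =
      ((coordCols R).transpose * Y.f3Matrix * coordCols R).det := by
    rw [pfaffian_sq, coordCols_congruence, ← Matrix.det_submatrix_equiv_self p]
    · rfl
    · rw [Matrix.transpose_submatrix, Y.f3Matrix_skew]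
      rfl
  have hk0 : frameDet k (Y.cocMat e) (Y.valuesAt s e) (coordCols R) ≠ 0 := by
    intro h0
    rw [h0, mul_zero] at hk
    exact mul_ne_zero (Y.C.ne_zero s) hm hk.symm
  refine ⟨k, hk0, ?_, ?_⟩
  · rw [← hpf2]
    exact pow_ne_zero _ hpf
  · rw [torsionSq, ← hpf2, div_pow, div_eq_div_iff (pow_ne_zero _ hm) (pow_ne_zero _ hk0), mul_pow]
    have hk2 := congrArg (· ^ 2) hk
    simp only [mul_pow] at hk2
    linear_combination pfaffian (Y.f3Matrix.submatrix (fun i => (p i).1) (fun i => (p i).1)) ^ 2 * hk2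

end Basis

open Classical in
/-- `y` is a value of the square of the torsion. -/
def IsTorsionSq (s : Y.T.S 2) {κ : Type} [Fintype κ] (h : Module.Basis κ ℂ Y.T.H2) (y : ℂ) : Prop :=
  ∃ (A : Finset (Y.T.S 1)) (e : Module.Basis ({b : Y.T.S 1 // b ∉ A} ⊕ κ) ℂ Y.T.Z2) (P : Type)
    (_ : Fintype P) (E : Matrix (Y.T.S 3) P ℂ)
    (k : ({b : Y.T.S 1 // b ∉ A} ⊕ κ) ⊕ P ≃ Y.T.S 3 ⊕ Unit),
    Y.IsDistinguished h A e ∧ frameDet k (Y.cocMat e) (Y.valuesAt s e) E ≠ 0 ∧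
      (E.transpose * Y.f3Matrix * E).det ≠ 0 ∧ y = Y.torsionSq s e E k

variable {Y} {s : Y.T.S 2} {κ : Type} [Fintype κ] {h : Module.Basis κ ℂ Y.T.H2}

/-- Bases are compared by `det_sq` and columns by `frame_exchange`; no choice is left in the square.
-/
theorem IsTorsionSq.unique {y y' : ℂ} (hy : Y.IsTorsionSq s h y) (hy' : Y.IsTorsionSq s h y') :
    y' = y := by
  classical
  obtain ⟨A, e, P, _, E, k, he, h1, h2, rfl⟩ := hy
  obtain ⟨A', e', P', _, E', k', he', h1', h2', rfl⟩ := hy'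
  obtain ⟨ι, hι⟩ := he.det_sq he'
  have hb := torsionSq_basis (E := E') (s := s) (k := (Equiv.sumCongr ι (Equiv.refl P')).trans k') e' ι
    (by convert hι) k'
  rw [← torsionSq_columns (E := E) (k := k) (E' := E')
    (k' := (Equiv.sumCongr ι (Equiv.refl P')).trans k') h1]
  · exact hb.1
  · intro h0
    have := hb.2
    rw [h0] at this
    exact h1' (pow_eq_zero_iff two_ne_zero |>.1 (by rw [this]; ring))

theorem IsTorsionSq.acyclic {y : ℂ} (hy : Y.IsTorsionSq s h y) : Y.Acyclic := by
  classical
  obtain ⟨A, e, P, _, E, k, he, h1, h2, rfl⟩ := hy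
  exact acyclic_of_frame h1 h2

theorem IsTorsionSq.h1Vanishes {y : ℂ} (hy : Y.IsTorsionSq s h y) : Y.T.H1Vanishes := by
  obtain ⟨A, e, P, _, E, k, he, h1, h2, rfl⟩ := hy
  exact he.h1Vanishes

theorem IsTorsionSq.ne_zero {y : ℂ} (hy : Y.IsTorsionSq s h y) : y ≠ 0 := by
  classical
  obtain ⟨A, e, P, _, E, k, he, h1, h2, rfl⟩ := hy
  exact torsionSq_ne_zero h1 h2

theorem IsSqrtTorsion.isTorsionSq {x : ℂ} (hx : Y.IsSqrtTorsion h x) (s : Y.T.S 2) :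
    Y.IsTorsionSq s h (x ^ 2) := by
  classical
  obtain ⟨A, e, j, R, r, n, p, he, hx⟩ := hx
  have h2 : (Matrix.of fun i i' : {i : {b : Y.T.S 1 // b ∉ A} ⊕ κ // i ≠ j} =>
      Y.f2 (e i'.1) (r i).1).det ≠ 0 := by
    convert hx.2.1
  have h3 := hx.2.2.1
  have h4 := hx.2.2.2
  have hf1 : Y.f1 1 = ⟨Y.C.ω, Y.C.cocycle⟩ := one_smul _ _
  obtain ⟨k, hk0, hk1, hk⟩ := exists_torsionSq_eq s e j R r p h2 h3
  refine ⟨A, e, {t : Y.T.S 3 // t ∉ R}, inferInstance, coordCols R, k, he, by convert hk0,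
    by convert hk1, ?_⟩
  have h5 := hf1 ▸ h4
  rw [h5]
  convert hk

/-- A coordinate `j` with a non-zero component of ω makes the other columns of f₂ independent, which
gives `R`. Acyclicity makes the complementary submatrix of f₃ nondegenerate, hence of even size. -/
theorem Acyclic.exists_isSqrtTorsion (hY : Y.Acyclic) (hX : Y.T.H1Vanishes) (s : Y.T.S 2)
    (h : Module.Basis κ ℂ Y.T.H2) : ∃ x, Y.IsSqrtTorsion h x := by
  classical
  obtain ⟨A, e, he⟩ := exists_distinguished hX (Y.T.res (vertEmb 0) s) h
  set c := e.repr ⟨Y.C.ω, Y.C.cocycle⟩ with hc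
  have hc0 : c ≠ 0 := fun h0 => Y.ω_ne_zero s (e.repr.injective (by rw [← hc, h0, map_zero]))
  obtain ⟨j, hj⟩ := Finsupp.ne_iff.1 hc0
  have hker : ∀ x, Y.cocMat e *ᵥ x = 0 → ∃ l : ℂ, x = l • ⇑c := by
    intro x hx
    rw [cocMat_mulVec] at hx
    obtain ⟨l, hl⟩ := ((Y.acyclic_iff s).1 hY).1 _ hx
    refine ⟨l, funext fun i => ?_⟩
    have := congrArg (fun z => e.repr z i) hl
    rw [e.repr_sum_self, map_smul, ← hc] at this
    exact this
  obtain ⟨R, r, hr⟩ := exists_minor (Y.cocMat e) c j hj hker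
  obtain ⟨k, hk⟩ := exists_frameDet_coordCols (Y.cocMat e) (Y.valuesAt s e) _
    (Y.cocMat_repr_ω e) j R r
  have hk0 : frameDet k (Y.cocMat e) (Y.valuesAt s e) (coordCols R) ≠ 0 := by
    intro h0
    rw [h0, mul_zero] at hk
    exact mul_ne_zero (Y.valuesAt_repr_ω s e) hr hk.symm
  have hdet := hY.det_ne_zero hk0
  rw [coordCols_congruence] at hdet
  set B : Matrix {t : Y.T.S 3 // t ∉ R} {t : Y.T.S 3 // t ∉ R} ℂ :=
    Y.f3Matrix.submatrix Subtype.val Subtype.val with hB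
  have hskew : B.transpose = -B := by
    rw [hB, Matrix.transpose_submatrix, Y.f3Matrix_skew]
    rfl
  obtain ⟨n, hn⟩ := even_card_of_skew_det_ne_zero B hskew hdet
  let p : Fin n × Fin 2 ≃ {t : Y.T.S 3 // t ∉ R} := Fintype.equivOfCardEq (by
    rw [hn, Fintype.card_prod, Fintype.card_fin, Fintype.card_fin, mul_two])
  have hpf : pfaffian (Y.f3Matrix.submatrix (fun i => (p i).1) (fun i => (p i).1)) ≠ 0 := by
    intro h0
    apply hdet
    rw [← Matrix.det_submatrix_equiv_self p]
    have := pfaffian_sq (Y.f3Matrix.submatrix (fun i => (p i).1) (fun i => (p i).1)) (by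
      rw [Matrix.transpose_submatrix, Y.f3Matrix_skew]
      rfl)
    rw [h0] at this
    exact this.symm.trans (by ring)
  have hf1 : Y.f1 1 = ⟨Y.C.ω, Y.C.cocycle⟩ := one_smul _ _
  refine ⟨_, A, e, j, R, r, n, p, he, ?_, hr, hpf, rfl⟩
  rw [hf1]
  exact hj

end System

end

/-! ### The square of the invariant and the rescaling of Grassmann generators -/

section

open Matrix OrderedComplex

namespace System

variable (Y : System)

/-- The value of `H_u`. -/
def Hval (u : Y.T.S 4) : ℂ := (Y.pent u).vol * edgeProd (Y.rho u)

/-- The square of the factor of the invariant which is not the torsion. -/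
def factorSq : ℂ := (∏ s, (Y.C.q s)⁻¹) ^ 2 * ∏ u, Y.Hval u

theorem factorSq_ne_zero : Y.factorSq ≠ 0 :=
  mul_ne_zero (pow_ne_zero _ (Finset.prod_ne_zero_iff.2 fun s _ => inv_ne_zero (Y.C.q_ne_zero s)))
    (Finset.prod_ne_zero_iff.2 fun u _ => Y.H_value_ne_zero u)

theorem nonempty_pentachora (s : Y.T.S 2) : Nonempty (Y.T.S 4) := by
  obtain ⟨t, -, -⟩ := Y.T.pure 2 (by decide) s
  obtain ⟨u, -, -⟩ := Y.T.pure 3 (by decide) t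
  exact ⟨u⟩

/-- Every choice in `I` affects it by a sign at most, and conversely both square roots are attained.
Thus sets of values may be compared through squares. -/
theorem isInvariantValue_iff (s : Y.T.S 2) {κ : Type} [Fintype κ] (h : Module.Basis κ ℂ Y.T.H2)
    (x : ℂ) : Y.IsInvariantValue h x ↔ ∃ y, Y.IsTorsionSq s h y ∧ x ^ 2 = Y.factorSq * y := by
  classical
  have hη : ∀ η : Y.T.S 4 → ℂ, (∀ u, Y.IsEta u (η u)) → (∏ u, η u) ^ 2 = ∏ u, Y.Hval u := by
    intro η hη
    rw [← Finset.prod_pow]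
    exact Finset.prod_congr rfl fun u _ => (Y.isEta_iff u _).1 (hη u)
  constructor
  · rintro ⟨η, rt, h1, h2, rfl⟩
    refine ⟨rt ^ 2, h2.isTorsionSq s, ?_⟩
    rw [factorSq, ← hη η h1]
    ring
  · rintro ⟨y, hy, hx⟩
    obtain ⟨rt, hrt⟩ := hy.acyclic.exists_isSqrtTorsion hy.h1Vanishes s h
    have hrt2 := hy.unique (hrt.isTorsionSq s)
    choose η hη0 using fun u => IsAlgClosed.exists_pow_nat_eq (Y.Hval u) (n := 2) (by norm_num)
    have hη1 : ∀ u, Y.IsEta u (η u) := fun u => (Y.isEta_iff u _).2 (hη0 u)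
    have hsq : x ^ 2 = ((∏ s, (Y.C.q s)⁻¹) * (∏ u, η u) * rt) ^ 2 := by
      rw [hx, factorSq, ← hη η hη1, ← hrt2]
      ring
    rcases sq_eq_sq_iff_eq_or_eq_neg.1 hsq with h0 | h0
    · exact ⟨η, rt, hη1, hrt, h0⟩
    · obtain ⟨u0⟩ := Y.nonempty_pentachora s
      refine ⟨fun u => (if u = u0 then -1 else 1) * η u, rt, fun u => ?_, hrt, ?_⟩
      · rw [isEta_iff, ← (Y.isEta_iff u _).1 (hη1 u)]
        dsimp only
        split_ifs <;> ring
      · rw [h0, Finset.prod_mul_distrib, Finset.prod_ite_eq' Finset.univ u0,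
          if_pos (Finset.mem_univ _)]
        ring

section Gauge

variable {Y} (l : Y.T.S 3 → ℂ) (hl : ∀ t, l t ≠ 0)

theorem tetEval_mul {X : OrderedComplex} (t : X.S 3) (a : ℂ) (b : Fin 4 → ℂ) (c : X.S 2 → ℂ) :
    tetEval t (fun i => a * b i) c = a * tetEval t b c := by
  rw [tetEval, tetEval, Finset.mul_sum]
  exact Finset.sum_congr rfl fun _ _ => by ring

/-- The rescaling of the Grassmann generators. -/
abbrev gauge : System where
  T := Y.T
  C := Y.C
  D :=
    { bcoef := fun t a => l t * Y.D.bcoef t a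
      gcoef := fun t a => (l t)⁻¹ * Y.D.gcoef t a
      anticomm := fun t c hc => by
        rw [tetEval_mul, tetEval_mul, ← Y.D.anticomm t c hc]
        have := hl t
        field_simp
      root := fun t => by
        obtain ⟨h1, h2, h3⟩ := Y.D.root t
        exact ⟨by linear_combination l t * h1, by linear_combination l t * h2,
          by linear_combination l t * h3⟩ }
  F u := Matrix.of fun i j => (l (Y.T.d i u))⁻¹ * (l (Y.T.d j u))⁻¹ * Y.F u i j
  skew u := by
    ext i j
    have : Y.F u j i = -Y.F u i j := congrFun (congrFun (Y.skew u) i) j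
    rw [Matrix.transpose_apply, Matrix.neg_apply, Matrix.of_apply, Matrix.of_apply, this]
    ring
  annihilate u c hc j := by
    have h := Y.annihilate u c hc j
    have h1 : ∀ i, tetEval (Y.T.d i u) (fun a => l (Y.T.d i u) * Y.D.bcoef (Y.T.d i u) a) c *
        ((l (Y.T.d i u))⁻¹ * (l (Y.T.d j u))⁻¹ * Y.F u i j) =
        (l (Y.T.d j u))⁻¹ * (Y.D.β (Y.T.d i u) c * Y.F u i j) := fun i => by
      rw [tetEval_mul, EdgeOperators.β]
      have := hl (Y.T.d i u)
      field_simp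
    change _ * tetEval (Y.T.d j u) (fun a => (l (Y.T.d j u))⁻¹ * Y.D.gcoef (Y.T.d j u) a) c =
      ∑ i, tetEval (Y.T.d i u) (fun a => l (Y.T.d i u) * Y.D.bcoef (Y.T.d i u) a) c *
        ((l (Y.T.d i u))⁻¹ * (l (Y.T.d j u))⁻¹ * Y.F u i j)
    simp only [h1]
    rw [← Finset.mul_sum, ← h, tetEval_mul, EdgeOperators.γ]
    ring

theorem gauge_f2 (z : Y.T.Z2) (t : Y.T.S 3) : (gauge l hl).f2 z t = l t * Y.f2 z t :=
  tetEval_mul _ _ _ _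

theorem gauge_cocMat [DecidableEq (Y.T.S 3)] {I : Type} (z : I → Y.T.Z2) :
    (gauge l hl).cocMat z = Matrix.diagonal l * Y.cocMat z := by
  ext t i
  rw [Matrix.diagonal_mul]
  exact gauge_f2 l hl (z i) t

theorem gauge_f3Matrix [DecidableEq (Y.T.S 3)] : (gauge l hl).f3Matrix =
    Matrix.diagonal (fun t => (l t)⁻¹) * Y.f3Matrix * Matrix.diagonal (fun t => (l t)⁻¹) := by
  ext t t'
  rw [Matrix.mul_diagonal, Matrix.diagonal_mul, f3Matrix, f3Matrix]
  simp only [Finset.mul_sum, Finset.sum_mul]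
  refine Finset.sum_congr rfl fun u _ => Finset.sum_congr rfl fun i _ =>
    Finset.sum_congr rfl fun j _ => ?_
  by_cases h : Y.T.d i u = t ∧ Y.T.d j u = t'
  · rw [if_pos h, if_pos h, Matrix.of_apply, h.1, h.2]
    ring
  · rw [if_neg h, if_neg h]
    ring

theorem gauge_acyclic (s : Y.T.S 2) : (gauge l hl).Acyclic ↔ Y.Acyclic := by
  classical
  rw [acyclic_iff (gauge l hl) s, Y.acyclic_iff s]
  have h2 : ∀ z, (gauge l hl).f2 z = 0 ↔ Y.f2 z = 0 := by
    intro z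
    rw [funext_iff, funext_iff]
    refine forall_congr' fun t => ?_
    rw [gauge_f2]
    exact mul_eq_zero_iff_left (hl t)
  have h3 : ∀ y, (gauge l hl).f3Matrix *ᵥ y = 0 ↔ Y.f3Matrix *ᵥ (fun t => (l t)⁻¹ * y t) = 0 := by
    intro y
    rw [gauge_f3Matrix, ← Matrix.mulVec_mulVec, ← Matrix.mulVec_mulVec]
    have h4 : Matrix.diagonal (fun t => (l t)⁻¹) *ᵥ y = fun t => (l t)⁻¹ * y t :=
      funext fun t => Matrix.mulVec_diagonal _ _ t
    rw [h4]
    simp only [funext_iff, Matrix.mulVec_diagonal, Pi.zero_apply, mul_eq_zero, inv_eq_zero, hl,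
      false_or]
  refine and_congr ?_ ?_
  · exact forall_congr' fun z => by rw [h2]
  · constructor
    · intro h y hy
      obtain ⟨z, hz⟩ := h (fun t => l t * y t) (by
        rw [h3]
        simpa only [inv_mul_cancel_left₀ (hl _)] using hy)
      refine ⟨z, funext fun t => ?_⟩
      have := congrFun hz t
      rw [gauge_f2] at this
      exact mul_left_cancel₀ (hl t) this
    · intro h y hy
      obtain ⟨z, hz⟩ := h _ ((h3 y).1 hy)
      refine ⟨z, funext fun t => ?_⟩
      rw [gauge_f2, hz, mul_inv_cancel_left₀ (hl t)]

theorem gauge_torsionSq [DecidableEq (Y.T.S 3)] {I P : Type} [Fintype I] [Fintype P]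
    [DecidableEq I] [DecidableEq P] (s : Y.T.S 2) (e : Module.Basis I ℂ Y.T.Z2)
    (E : Matrix (Y.T.S 3) P ℂ) (k : I ⊕ P ≃ Y.T.S 3 ⊕ Unit) :
    frameDet k ((gauge l hl).cocMat e) ((gauge l hl).valuesAt s e) (Matrix.diagonal l * E) ^ 2 =
      (∏ t, l t) ^ 2 * frameDet k (Y.cocMat e) (Y.valuesAt s e) E ^ 2 ∧
    ((Matrix.diagonal l * E).transpose * (gauge l hl).f3Matrix * (Matrix.diagonal l * E)).det =
      (E.transpose * Y.f3Matrix * E).det := by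
  constructor
  · rw [gauge_cocMat, frameDet_sq_diag]
    rfl
  · have h1 : Matrix.diagonal l * Matrix.diagonal (fun t => (l t)⁻¹) = 1 := by
      rw [Matrix.diagonal_mul_diagonal, ← Matrix.diagonal_one]
      congr 1
      exact funext fun t => mul_inv_cancel₀ (hl t)
    have h2 : Matrix.diagonal (fun t => (l t)⁻¹) * Matrix.diagonal l = 1 := by
      rw [Matrix.diagonal_mul_diagonal, ← Matrix.diagonal_one]
      congr 1
      exact funext fun t => inv_mul_cancel₀ (hl t)
    have h3 : (Matrix.diagonal l * E).transpose * (gauge l hl).f3Matrix * (Matrix.diagonal l * E) =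
        E.transpose * (Matrix.diagonal l * Matrix.diagonal (fun t => (l t)⁻¹)) * Y.f3Matrix *
          ((Matrix.diagonal (fun t => (l t)⁻¹) * Matrix.diagonal l) * E) := by
      rw [gauge_f3Matrix, Matrix.transpose_mul, Matrix.diagonal_transpose]
      simp only [Matrix.mul_assoc]
    rw [h3, h1, h2, Matrix.mul_one, Matrix.one_mul]

/-- Scaling the columns together with the rows of f₂ leaves the determinant of f₃ unchanged and
multiplies the bordered determinant by the product of the scales, up to sign. -/
theorem gauge_isTorsionSq (s : Y.T.S 2) {κ : Type} [Fintype κ] {h : Module.Basis κ ℂ Y.T.H2}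
    {y : ℂ} (hy : Y.IsTorsionSq s h y) :
    (gauge l hl).IsTorsionSq s h (y / (∏ t, l t) ^ 2) := by
  classical
  obtain ⟨A, e, P, _, E, k, he, h1, h2, rfl⟩ := hy
  have hp : ∏ t, l t ≠ 0 := Finset.prod_ne_zero_iff.2 fun t _ => hl t
  obtain ⟨g1, g2⟩ := gauge_torsionSq l hl s e E k
  refine ⟨A, e, P, inferInstance, Matrix.diagonal l * E, k, he, ?_, ?_, ?_⟩
  · intro h0
    have h0' : frameDet k ((gauge l hl).cocMat e) ((gauge l hl).valuesAt s e) (Matrix.diagonal l * E) = 0 := by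
      convert h0
    rw [h0'] at g1
    exact mul_ne_zero (pow_ne_zero 2 hp) (pow_ne_zero 2 (by convert h1)) (by rw [← g1]; ring)
  · intro h0
    exact h2 (by rw [← h0]; convert g2.symm)
  · have e1 : (gauge l hl).torsionSq s e (Matrix.diagonal l * E) k =
        Y.C.ω s ^ 2 * (E.transpose * Y.f3Matrix * E).det /
          ((∏ t, l t) ^ 2 * frameDet k (Y.cocMat e) (Y.valuesAt s e) E ^ 2) := by
      rw [torsionSq, g2]
      congr 1
    rw [div_eq_iff (pow_ne_zero 2 hp)]
    have e2 : Y.torsionSq s e E k = (gauge l hl).torsionSq s e (Matrix.diagonal l * E) k *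
        (∏ t, l t) ^ 2 := by
      rw [e1, torsionSq]
      have := pow_ne_zero 2 h1
      field_simp
    convert e2

/-- Each tetrahedron occurs exactly twice as a face, the complex being closed. This balances the
scaling of the weights against that of the torsion. -/
theorem prod_faces (f : Y.T.S 3 → ℂ) : ∏ u, ∏ i, f (Y.T.d i u) = (∏ t, f t) ^ 2 := by
  classical
  rw [← Finset.prod_product', ← Finset.prod_pow, ← Finset.prod_fiberwise
    (Finset.univ ×ˢ Finset.univ : Finset (Y.T.S 4 × Fin 5)) (fun p => Y.T.d p.2 p.1)]
  refine Finset.prod_congr rfl fun t _ => ?_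
  obtain ⟨u, v, i, j, hu, hv, -, hsum⟩ := Y.exists_sum_closed t
  have hcard : ((Finset.univ ×ˢ Finset.univ : Finset (Y.T.S 4 × Fin 5)).filter
      (fun p => Y.T.d p.2 p.1 = t)).card = 2 := by
    have := hsum fun _ _ => 1
    rw [← Finset.sum_product', ← Finset.sum_filter, Finset.sum_const, nsmul_eq_mul, mul_one] at this
    have h2 : (1 + 1 : ℂ) = (2 : ℕ) := by norm_num
    rw [h2] at this
    exact_mod_cast this
  rw [Finset.prod_eq_pow_card (b := f t) fun p hp => by rw [(Finset.mem_filter.1 hp).2], hcard]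

theorem Hval_eq (u : Y.T.S 4) (σ : Equiv.Perm (Fin 5)) (hσ : Equiv.Perm.sign σ = 1)
    (hlt : σ 0 < σ 1) (hb : Y.betaEdge u σ ≠ 0) : Y.Hval u = Y.H u σ :=
  (Y.H_eq u σ hσ hlt hb).symm

/-- The numerator of `H_u` scales by one tetrahedron, and the minor in the denominator inversely by
the other four. -/
theorem gauge_Hval (u : Y.T.S 4) : (gauge l hl).Hval u = Y.Hval u * ∏ i, l (Y.T.d i u) := by
  obtain ⟨σ, hσ, h0, h1, hb⟩ := Y.exists_betaEdge_ne_zero u 0 1 (by decide)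
  have hlt : σ 0 < σ 1 := by rw [h0, h1]; decide
  have hbg : (gauge l hl).betaEdge u σ = l (Y.T.d (σ 4) u) * Y.betaEdge u σ := tetEval_mul _ _ _ _
  have hbg0 : (gauge l hl).betaEdge u σ ≠ 0 := by
    rw [hbg]
    exact mul_ne_zero (hl _) hb
  rw [Y.Hval_eq u σ hσ hlt hb, Hval_eq (Y := gauge l hl) u σ hσ hlt hbg0, H, H, hbg,
    ← Equiv.prod_comp σ, Fin.prod_univ_five]
  have hden : ((gauge l hl).F u (σ 1) (σ 3) * (gauge l hl).F u (σ 0) (σ 2) -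
      (gauge l hl).F u (σ 1) (σ 2) * (gauge l hl).F u (σ 0) (σ 3)) =
      (l (Y.T.d (σ 0) u) * l (Y.T.d (σ 1) u) * l (Y.T.d (σ 2) u) * l (Y.T.d (σ 3) u))⁻¹ *
      (Y.F u (σ 1) (σ 3) * Y.F u (σ 0) (σ 2) - Y.F u (σ 1) (σ 2) * Y.F u (σ 0) (σ 3)) := by
    simp only [Matrix.of_apply, mul_inv]
    ring
  rw [hden, div_eq_mul_inv, mul_inv, inv_inv, div_eq_mul_inv]
  change l (Y.T.d (σ 4) u) * Y.betaEdge u σ * Y.C.q (Y.labFace u σ {0, 1, 2} rfl) *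
    Y.C.q (Y.labFace u σ {0, 1, 3} rfl) * Y.C.q (Y.labFace u σ {0, 1, 4} rfl) *
    Y.C.q (Y.labFace u σ {2, 3, 4} rfl) * _ = _
  ring

theorem gauge_factorSq : (gauge l hl).factorSq = Y.factorSq * (∏ t, l t) ^ 2 := by
  rw [factorSq, factorSq, ← prod_faces, mul_assoc, ← Finset.prod_mul_distrib]
  congr 1
  exact Finset.prod_congr rfl fun u _ => gauge_Hval l hl u

theorem gauge_isInvariantValue (s : Y.T.S 2) {κ : Type} [Fintype κ] (h : Module.Basis κ ℂ Y.T.H2)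
    (x : ℂ) : (gauge l hl).IsInvariantValue h x ↔ Y.IsInvariantValue h x := by
  have hp : ∏ t, l t ≠ 0 := Finset.prod_ne_zero_iff.2 fun t _ => hl t
  rw [isInvariantValue_iff (gauge l hl) s, Y.isInvariantValue_iff s, gauge_factorSq]
  constructor
  · rintro ⟨y, hy, hx⟩
    obtain ⟨rt, hrt⟩ := ((gauge_acyclic l hl s).1 hy.acyclic).exists_isSqrtTorsion hy.h1Vanishes s h
    have h1 := hrt.isTorsionSq s
    have h2 := hy.unique (gauge_isTorsionSq l hl s h1)
    refine ⟨_, h1, ?_⟩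
    rw [hx, ← h2]
    field_simp
  · rintro ⟨y, hy, hx⟩
    refine ⟨_, gauge_isTorsionSq l hl s hy, ?_⟩
    rw [hx]
    field_simp

end Gauge

end System

end

/-! ### Simplices under the first move -/

section

open OrderedComplex

theorem orderEmb_three (g : Fin (3 + 1) ↪o Fin (4 + 1)) : ∃ c, g = Fin.succAboveOrderEmb c := by
  have h : ∃ c, c ∉ Set.range g := by
    by_contra hcon
    push Not at hcon
    have := Fintype.card_le_of_surjective g hcon
    simp at this
  obtain ⟨c, hc⟩ := h
  refine ⟨c, OrderEmbedding.range_inj.1 ?_⟩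
  have h2 : Set.range (Fin.succAboveOrderEmb c) = {c}ᶜ := Fin.range_succAbove c
  rw [h2]
  refine Set.eq_of_subset_of_ncard_le (fun x hx h => hc (h ▸ hx)) ?_
  rw [Set.ncard_compl, Set.ncard_singleton, ← Set.image_univ,
    Set.ncard_image_of_injective _ g.injective]
  simp

theorem orderEmb_four (g : Fin (4 + 1) ↪o Fin (4 + 1)) : g = RelEmbedding.refl (· ≤ ·) := by
  refine OrderEmbedding.range_inj.1 ?_
  have h1 : Function.Surjective g := Finite.surjective_of_injective g.injective
  rw [h1.range_eq]
  exact (Set.range_id).symm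

theorem orderEmb_two (g : Fin (2 + 1) ↪o Fin (4 + 1)) : ∃ p q, p ≠ q ∧ (∀ i, g i ≠ p ∧ g i ≠ q) ∧
    ∀ c, c ≠ p → c ≠ q → c ∈ Set.range g := by
  let s : Finset (Fin 5) := Finset.univ.map g.toEmbedding
  have hs : s.card = 3 := by simp [s]
  have hc : sᶜ.card = 2 := by
    rw [Finset.card_compl, hs]
    rfl
  obtain ⟨p, q, hpq, h⟩ := Finset.card_eq_two.1 hc
  refine ⟨p, q, hpq, fun i => ?_, fun c hp hq => ?_⟩
  · have hi : g i ∉ sᶜ := by simp [s]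
    rw [h] at hi
    simpa using hi
  · have : c ∉ sᶜ := by
      rw [h]
      simp [hp, hq]
    simpa [s] using this

theorem orderEmb_one (g : Fin (1 + 1) ↪o Fin (4 + 1)) {a b : Fin (4 + 1)} (ha : a ∈ Set.range g)
    (hb : b ∈ Set.range g) (hab : a ≠ b) (i : Fin (1 + 1)) : g i ∈ ({a, b} : Finset (Fin 5)) := by
  obtain ⟨x, rfl⟩ := ha
  obtain ⟨y, rfl⟩ := hb
  have hxy : x ≠ y := fun h => hab (by rw [h])
  have : i = x ∨ i = y := by
    have h1 := i.2
    have h2 := x.2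
    have h3 := y.2
    simp only [Fin.ext_iff, ne_eq] at hxy ⊢
    omega
  rcases this with rfl | rfl <;> simp

theorem exists_fifth_notMem {m : ℕ} (hm : m ≤ 1) (g : Fin (m + 1) ↪o Fin (4 + 1)) (a b : Fin 5) :
    ∃ c, c ≠ a ∧ c ≠ b ∧ c ∉ Set.range g := by
  let s : Finset (Fin 5) := Finset.univ.map g.toEmbedding ∪ {a, b}
  have hs : s.card < 5 := by
    refine lt_of_le_of_lt (Finset.card_union_le _ _) ?_
    have h2 : (Finset.univ.map g.toEmbedding).card = m + 1 := by simp
    have h3 := Finset.card_le_two (a := a) (b := b)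
    omega
  obtain ⟨c, hc⟩ : ∃ c, c ∉ s := by
    by_contra hcon
    push Not at hcon
    rw [Finset.eq_univ_of_forall hcon] at hs
    simp at hs
  simp only [s, Finset.mem_union, Finset.mem_map, Finset.mem_univ, true_and, Finset.mem_insert,
    Finset.mem_singleton, not_or, RelEmbedding.coe_toEmbedding] at hc
  exact ⟨c, hc.2.1, hc.2.2, fun ⟨i, hi⟩ => hc.1 ⟨i, hi⟩⟩

theorem OrderedComplex.res_eq_tri {X : OrderedComplex} (x : X.S 4) (g : Fin (2 + 1) ↪o Fin (4 + 1))
    {p q : Fin 5} (hpq : p ≠ q) (h : ∀ i, g i ≠ p ∧ g i ≠ q) : X.res g x = X.tri x p q := by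
  rw [tri_of_ne x hpq]
  exact res_eq_face g x _ _ fun i => by simp [h i]

theorem OrderedComplex.exists_tri {p q : Fin 5} (hpq : p ≠ q) :
    ∃ g : Fin (2 + 1) ↪o Fin (4 + 1), (∀ i, g i ≠ p ∧ g i ≠ q) ∧
      (∀ c, c ≠ p → c ≠ q → c ∈ Set.range g) ∧
      ∀ (X : OrderedComplex) (x : X.S 4), X.tri x p q = X.res g x := by
  refine ⟨({p, q}ᶜ : Finset (Fin 5)).orderEmbOfFin (card_pair_compl hpq), fun i => ?_,
    fun c hp hq => ?_, fun X x => tri_of_ne x hpq⟩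
  · have := Finset.orderEmbOfFin_mem ({p, q}ᶜ : Finset (Fin 5)) (card_pair_compl hpq) i
    rw [Finset.mem_compl, Finset.mem_insert, Finset.mem_singleton, not_or] at this
    exact this
  · rw [Finset.range_orderEmbOfFin]
    simp [hp, hq]

namespace FirstMove

variable {T T' : Triangulation} (M : FirstMove T T')

/-- The simplex lies inside the pillow. -/
def Inner {n : ℕ} (x : T'.S n) : Prop := x ∈ pillowInner T'.toOrderedComplex M.u M.v M.a M.b n

/-- The simplex is the copy, belonging to the pentachoron `v`, of a doubled simplex. -/
def Second {n : ℕ} (x : T'.S n) : Prop :=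
  ∃ g : Fin (n + 1) ↪o Fin (4 + 1), x = T'.res g M.v ∧ T'.res g M.u ≠ T'.res g M.v

theorem a_ne_b : M.a ≠ M.b := M.lt.ne

/-- Each vertex belongs to one of the three glued tetrahedra. -/
theorem vert_eq (i : Fin (4 + 1)) : T'.res (vertEmb i) M.u = T'.res (vertEmb i) M.v := by
  obtain ⟨c, ca, cb, ci, -⟩ := PentData.exists_fifth M.a M.b i i
  obtain ⟨i', rfl⟩ := Fin.exists_succAbove_eq ci.symm
  have h := congrArg (T'.res (vertEmb i')) (M.glued c ca cb)
  unfold OrderedComplex.d at h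
  rw [res_vert_res, res_vert_res] at h
  exact h

variable {M}

/-- The two pentachora have the same, pairwise distinct vertices, so coinciding faces have the same
vertex numbers. -/
theorem eq_of_res_eq {m : ℕ} {g g' : Fin (m + 1) ↪o Fin (4 + 1)}
    (h : T'.res g M.u = T'.res g' M.v) : g = g' := by
  ext i
  have := congrArg (T'.res (vertEmb i)) h
  rw [res_vert_res, res_vert_res, ← M.vert_eq] at this
  rw [res_vert_injective _ this]

theorem res_eq {m : ℕ} (g : Fin (m + 1) ↪o Fin (4 + 1)) {c : Fin 5} (ha : c ≠ M.a) (hb : c ≠ M.b)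
    (hc : c ∉ Set.range g) : T'.res g M.u = T'.res g M.v := by
  have h1 : ∀ i, ∃ j, c.succAbove j = g i := fun i => Fin.exists_succAbove_eq fun h => hc ⟨i, h⟩
  choose f hf using h1
  let g' : Fin (m + 1) ↪o Fin (3 + 1) := OrderEmbedding.ofStrictMono f fun i j hij => by
    rw [← (Fin.succAboveOrderEmb c).lt_iff_lt]
    change c.succAbove (f i) < c.succAbove (f j)
    rw [hf, hf]
    exact g.lt_iff_lt.2 hij
  have hg : g = g'.trans (Fin.succAboveOrderEmb c) := by
    ext i
    exact congrArg Fin.val (hf i).symm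
  rw [hg, ← T'.res_comp, ← T'.res_comp]
  exact congrArg _ (M.glued c ha hb)

theorem inner_res_u {m : ℕ} (g : Fin (m + 1) ↪o Fin (4 + 1)) :
    M.Inner (T'.res g M.u) ↔ M.a ∈ Set.range g ∧ M.b ∈ Set.range g := by
  constructor
  · rintro ⟨g', h1, h2, h | h⟩
    · rw [res_injective _ h]
      exact ⟨h1, h2⟩
    · rw [eq_of_res_eq h]
      exact ⟨h1, h2⟩
  · intro h
    exact ⟨g, h.1, h.2, Or.inl rfl⟩

theorem inner_res_v {m : ℕ} (g : Fin (m + 1) ↪o Fin (4 + 1)) :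
    M.Inner (T'.res g M.v) ↔ M.a ∈ Set.range g ∧ M.b ∈ Set.range g := by
  constructor
  · rintro ⟨g', h1, h2, h | h⟩
    · rw [← eq_of_res_eq h.symm]
      exact ⟨h1, h2⟩
    · rw [res_injective _ h]
      exact ⟨h1, h2⟩
  · intro h
    exact ⟨g, h.1, h.2, Or.inr rfl⟩

/-- The projection of simplices not lying inside the pillow. -/
def proj {n : ℕ} (x : T'.S n) (hx : ¬M.Inner x) : T.S n := M.collapse n ⟨x, hx⟩

theorem not_inner_res {m n : ℕ} (g : Fin (m + 1) ↪o Fin (n + 1)) {x : T'.S n} (hx : ¬M.Inner x) :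
    ¬M.Inner (T'.res g x) := (M.collapse_res g x hx).1

theorem proj_res {m n : ℕ} (g : Fin (m + 1) ↪o Fin (n + 1)) {x : T'.S n} (hx : ¬M.Inner x) :
    proj (T'.res g x) (not_inner_res g hx) = T.res g (proj x hx) := (M.collapse_res g x hx).2

theorem not_inner_d {n : ℕ} (i : Fin (n + 2)) {x : T'.S (n + 1)} (hx : ¬M.Inner x) :
    ¬M.Inner (T'.d i x) := not_inner_res _ hx

theorem proj_d {n : ℕ} (i : Fin (n + 2)) {x : T'.S (n + 1)} (hx : ¬M.Inner x) :
    proj (T'.d i x) (not_inner_d i hx) = T.d i (proj x hx) := proj_res _ hx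

theorem proj_eq {n : ℕ} {x y : T'.S n} {hx : ¬M.Inner x} {hy : ¬M.Inner y}
    (h : proj x hx = proj y hy) : x = y ∨ ∃ g : Fin (n + 1) ↪o Fin (4 + 1),
      (x = T'.res g M.u ∧ y = T'.res g M.v) ∨ (x = T'.res g M.v ∧ y = T'.res g M.u) := by
  rcases (M.collapse_eq_iff n ⟨x, hx⟩ ⟨y, hy⟩).1 h with h | h
  · exact Or.inl (congrArg Subtype.val h)
  · exact Or.inr h

theorem proj_res_u_v {n : ℕ} (g : Fin (n + 1) ↪o Fin (4 + 1)) (hu : ¬M.Inner (T'.res g M.u))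
    (hv : ¬M.Inner (T'.res g M.v)) : proj (T'.res g M.u) hu = proj (T'.res g M.v) hv :=
  (M.collapse_eq_iff n ⟨_, hu⟩ ⟨_, hv⟩).2 (Or.inr ⟨g, Or.inl ⟨rfl, rfl⟩⟩)

variable (M)

/-- Of two identified copies the one in `u` is taken; the new simplices to be counted are then the
inner ones and the copies in `v`. -/
theorem exists_lift {n : ℕ} (x : T.S n) :
    ∃ (y : T'.S n) (hy : ¬M.Inner y), proj y hy = x ∧ ¬M.Second y := by
  obtain ⟨⟨y, hy⟩, rfl⟩ := M.collapse_surjective n x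
  by_cases h : M.Second y
  · obtain ⟨g, rfl, hne⟩ := h
    have hu : ¬M.Inner (T'.res g M.u) := by
      rw [inner_res_u, ← inner_res_v]
      exact hy
    refine ⟨T'.res g M.u, hu, proj_res_u_v g hu hy, ?_⟩
    rintro ⟨g', h1, h2⟩
    obtain rfl := eq_of_res_eq h1
    exact h2 h1
  · exact ⟨y, hy, rfl, h⟩

/-- The simplex of the new triangulation corresponding to a simplex of the old one; for a doubled
simplex, its copy belonging to the pentachoron `u`. -/
def lift {n : ℕ} (x : T.S n) : T'.S n := (M.exists_lift x).choose

variable {M}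

theorem not_inner_lift {n : ℕ} (x : T.S n) : ¬M.Inner (M.lift x) :=
  (M.exists_lift x).choose_spec.choose

theorem proj_lift {n : ℕ} (x : T.S n) : proj (M.lift x) (not_inner_lift x) = x :=
  (M.exists_lift x).choose_spec.choose_spec.1

theorem not_second_lift {n : ℕ} (x : T.S n) : ¬M.Second (M.lift x) :=
  (M.exists_lift x).choose_spec.choose_spec.2

theorem lift_injective (n : ℕ) : Function.Injective (M.lift : T.S n → T'.S n) := by
  intro x y h
  rw [← proj_lift (M := M) x, ← proj_lift (M := M) y]
  simp only [h]

theorem lift_proj {n : ℕ} {y : T'.S n} (hy : ¬M.Inner y) (h : ¬M.Second y) :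
    M.lift (proj y hy) = y := by
  rcases proj_eq (proj_lift (M := M) (proj y hy)) with h1 | ⟨g, ⟨h1, h2⟩ | ⟨h1, h2⟩⟩
  · exact h1
  · by_contra hne
    exact h ⟨g, h2, fun h3 => hne (by rw [h1, h2, h3])⟩
  · by_contra hne
    exact not_second_lift _ ⟨g, h1, fun h3 => hne (by rw [h1, h2, h3])⟩

theorem Second.notMem {n : ℕ} {g : Fin (n + 1) ↪o Fin (4 + 1)}
    (h : T'.res g M.u ≠ T'.res g M.v) {c : Fin 5} (hc : c ∉ Set.range g) : c = M.a ∨ c = M.b := by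
  by_contra hcon
  push Not at hcon
  exact h (res_eq g hcon.1 hcon.2 hc)

theorem not_second_of_le_one {n : ℕ} (hn : n ≤ 1) (x : T'.S n) : ¬M.Second x := by
  rintro ⟨g, -, h⟩
  obtain ⟨c, ha, hb, hc⟩ := exists_fifth_notMem hn g M.a M.b
  exact h (res_eq g ha hb hc)

variable (M)

/-- A numbering of the simplices of the new triangulation. -/
def liftEquiv {n : ℕ} {ι : Type} (D : ι → T'.S n) (hD : Function.Injective D)
    (h1 : ∀ i, M.Inner (D i) ∨ M.Second (D i))
    (h2 : ∀ y, M.Inner y ∨ M.Second y → ∃ i, D i = y) : T.S n ⊕ ι ≃ T'.S n :=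
  Equiv.ofBijective (Sum.elim M.lift D) (by
    constructor
    · rintro (x | i) (y | j) h
      · exact congrArg Sum.inl (lift_injective n h)
      · change M.lift x = D j at h
        rcases h1 j with h3 | h3
        · exact absurd (h ▸ h3) (not_inner_lift x)
        · exact absurd (h ▸ h3) (not_second_lift x)
      · change D i = M.lift y at h
        rcases h1 i with h3 | h3
        · exact absurd (h ▸ h3) (not_inner_lift y)
        · exact absurd (h ▸ h3) (not_second_lift y)
      · exact congrArg Sum.inr (hD h)
    · intro y
      by_cases hy : M.Inner y ∨ M.Second y
      · obtain ⟨i, rfl⟩ := h2 y hy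
        exact ⟨Sum.inr i, rfl⟩
      · push Not at hy
        exact ⟨Sum.inl (proj y hy.1), lift_proj hy.1 hy.2⟩)

/-- A numbering of the vertices of the pillow, the edge of its new simplices having numbers 0
and 1. -/
structure Numbering where
  σ : Equiv.Perm (Fin 5)
  even : Equiv.Perm.sign σ = 1
  zero : σ 0 = M.a
  one : σ 1 = M.b

namespace Numbering

variable {M} (N : M.Numbering)

theorem lt : N.σ 0 < N.σ 1 := by
  rw [N.zero, N.one]
  exact M.lt

theorem cases (c : Fin 5) : c = M.a ∨ c = M.b ∨ c = N.σ 2 ∨ c = N.σ 3 ∨ c = N.σ 4 := by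
  obtain ⟨i, rfl⟩ := N.σ.surjective c
  rw [← N.zero, ← N.one]
  fin_cases i <;> simp

theorem ne_a {i : Fin 5} (h : i ≠ 0) : N.σ i ≠ M.a := by
  rw [← N.zero]
  exact N.σ.injective.ne h

theorem ne_b {i : Fin 5} (h : i ≠ 1) : N.σ i ≠ M.b := by
  rw [← N.one]
  exact N.σ.injective.ne h

theorem ne {i j : Fin 5} (h : i ≠ j) : N.σ i ≠ N.σ j := N.σ.injective.ne h

end Numbering

variable {M}

theorem inner_d_u {c : Fin 5} (ha : c ≠ M.a) (hb : c ≠ M.b) : M.Inner (T'.d c M.u) := by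
  change M.Inner (T'.res _ _)
  rw [inner_res_u]
  change M.a ∈ Set.range c.succAbove ∧ M.b ∈ Set.range c.succAbove
  rw [Fin.range_succAbove]
  exact ⟨ha.symm, hb.symm⟩

theorem not_inner_d_u {c : Fin 5} (h : c = M.a ∨ c = M.b) : ¬M.Inner (T'.d c M.u) := by
  change ¬M.Inner (T'.res _ _)
  rw [inner_res_u]
  change ¬(M.a ∈ Set.range c.succAbove ∧ M.b ∈ Set.range c.succAbove)
  rw [Fin.range_succAbove]
  rintro ⟨h1, h2⟩
  rcases h with h | h
  · exact h1 h.symm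
  · exact h2 h.symm

theorem not_inner_d_v {c : Fin 5} (h : c = M.a ∨ c = M.b) : ¬M.Inner (T'.d c M.v) := by
  change ¬M.Inner (T'.res _ _)
  rw [inner_res_v]
  change ¬(M.a ∈ Set.range c.succAbove ∧ M.b ∈ Set.range c.succAbove)
  rw [Fin.range_succAbove]
  rintro ⟨h1, h2⟩
  rcases h with h | h
  · exact h1 h.symm
  · exact h2 h.symm

theorem d_u_ne_d_v {c : Fin 5} (h : c = M.a ∨ c = M.b) : T'.d c M.u ≠ T'.d c M.v := by
  rcases h with rfl | rfl
  · exact M.doubled_a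
  · exact M.doubled_b

theorem eq_of_d_eq {c c' : Fin 5} (h : T'.d c M.u = T'.d c' M.v) : c = c' := by
  have h1 := eq_of_res_eq h
  have h2 : c ∉ Set.range (Fin.succAboveOrderEmb c') := by
    rw [← h1]
    change c ∉ Set.range c.succAbove
    rw [Fin.range_succAbove]
    simp
  change c ∉ Set.range c'.succAbove at h2
  rw [Fin.range_succAbove] at h2
  simpa using h2

theorem inner_or_second_three {y : T'.S 3} (hy : M.Inner y ∨ M.Second y) :
    (∃ c, c ≠ M.a ∧ c ≠ M.b ∧ y = T'.d c M.u) ∨ y = T'.d M.a M.v ∨ y = T'.d M.b M.v := by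
  have hr : ∀ c : Fin 5, Set.range (Fin.succAboveOrderEmb c) = {c}ᶜ := fun c => Fin.range_succAbove c
  rcases hy with ⟨g, h1, h2, h⟩ | ⟨g, h1, h2⟩
  · obtain ⟨c, rfl⟩ := orderEmb_three g
    rw [hr] at h1 h2
    refine Or.inl ⟨c, fun h => h1 h.symm, fun h => h2 h.symm, ?_⟩
    rcases h with h | h
    · exact h
    · exact h.trans (M.glued c (fun h => h1 h.symm) fun h => h2 h.symm).symm
  · obtain ⟨c, rfl⟩ := orderEmb_three g
    right
    rcases Second.notMem h2 (c := c) (by rw [hr]; simp) with rfl | rfl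
    · exact Or.inl h1
    · exact Or.inr h1

namespace Numbering

variable (N : M.Numbering)

/-- The new tetrahedra. -/
def newTet : Unit ⊕ (Fin 2 ⊕ Fin 2) → T'.S 3 :=
  -- The grouping follows the torsion: the single tetrahedron is the new row of the minor of f₂, the
  -- other four are the new rows of the submatrix of f₃, namely the two copies in `v` and two inner
  -- tetrahedra.
  Sum.elim (fun _ => T'.d (N.σ 4) M.u) (Sum.elim ![T'.d (N.σ 0) M.v, T'.d (N.σ 1) M.v]
    ![T'.d (N.σ 2) M.u, T'.d (N.σ 3) M.u])

theorem newTet_injective : Function.Injective N.newTet := by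
  have h1 : ∀ i j, T'.d (N.σ i) M.u = T'.d (N.σ j) M.u → i = j := fun i j h =>
    N.σ.injective (d_injective M.u h)
  have h2 : ∀ i j, T'.d (N.σ i) M.v = T'.d (N.σ j) M.v → i = j := fun i j h =>
    N.σ.injective (d_injective M.v h)
  have h3 : ∀ i j, T'.d (N.σ i) M.u = T'.d (N.σ j) M.v → i = j := fun i j h =>
    N.σ.injective (eq_of_d_eq h)
  have h4 : ∀ i j, T'.d (N.σ i) M.v = T'.d (N.σ j) M.u → i = j := fun i j h =>
    (h3 j i h.symm).symm
  rintro (i | i | i) (j | j | j) h <;> try fin_cases i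
  all_goals try fin_cases j
  all_goals first
    | rfl
    | exact absurd (h1 _ _ h) (by decide)
    | exact absurd (h2 _ _ h) (by decide)
    | exact absurd (h3 _ _ h) (by decide)
    | exact absurd (h4 _ _ h) (by decide)

theorem second_d (c : Fin 5) (h : c = M.a ∨ c = M.b) : M.Second (T'.d c M.v) :=
  ⟨_, rfl, d_u_ne_d_v h⟩

/-- The numbering of the tetrahedra of the new triangulation. -/
def tetEquiv : T.S 3 ⊕ (Unit ⊕ (Fin 2 ⊕ Fin 2)) ≃ T'.S 3 :=
  M.liftEquiv N.newTet N.newTet_injective (by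
    rintro (i | i | i)
    · exact Or.inl (inner_d_u (N.ne_a (by decide)) (N.ne_b (by decide)))
    · right
      fin_cases i
      · exact second_d _ (Or.inl N.zero)
      · exact second_d _ (Or.inr N.one)
    · left
      fin_cases i
      · exact inner_d_u (N.ne_a (by decide)) (N.ne_b (by decide))
      · exact inner_d_u (N.ne_a (by decide)) (N.ne_b (by decide))) (by
    intro y hy
    rcases inner_or_second_three hy with ⟨c, ha, hb, rfl⟩ | rfl | rfl
    · rcases N.cases c with h | h | rfl | rfl | rfl
      · exact absurd h ha
      · exact absurd h hb
      · exact ⟨Sum.inr (Sum.inr 0), rfl⟩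
      · exact ⟨Sum.inr (Sum.inr 1), rfl⟩
      · exact ⟨Sum.inl (), rfl⟩
    · exact ⟨Sum.inr (Sum.inl 0), by rw [← N.zero]; rfl⟩
    · exact ⟨Sum.inr (Sum.inl 1), by rw [← N.one]; rfl⟩)

theorem inner_tri {p q : Fin 5} (hpq : p ≠ q) (h : M.a ≠ p ∧ M.a ≠ q ∧ M.b ≠ p ∧ M.b ≠ q) :
    M.Inner (T'.tri M.u p q) := by
  obtain ⟨g, -, h2, h3⟩ := exists_tri hpq
  rw [h3, inner_res_u]
  exact ⟨h2 _ h.1 h.2.1, h2 _ h.2.2.1 h.2.2.2⟩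

theorem tri_a_b_ne : T'.tri M.u M.a M.b ≠ T'.tri M.v M.a M.b := by
  obtain ⟨g, h1, h2, h3⟩ := exists_tri M.a_ne_b
  rw [h3, h3]
  exact M.doubled_face g (fun ⟨i, hi⟩ => (h1 i).1 hi) fun ⟨i, hi⟩ => (h1 i).2 hi

theorem not_inner_tri_u {p q : Fin 5} (hpq : p ≠ q) (h : p = M.a ∨ p = M.b ∨ q = M.a ∨ q = M.b) :
    ¬M.Inner (T'.tri M.u p q) := by
  obtain ⟨g, h1, -, h3⟩ := exists_tri hpq
  rw [h3, inner_res_u]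
  rintro ⟨⟨i, hi⟩, ⟨j, hj⟩⟩
  rcases h with rfl | rfl | rfl | rfl
  · exact (h1 i).1 hi
  · exact (h1 j).1 hj
  · exact (h1 i).2 hi
  · exact (h1 j).2 hj

/-- The new 2-faces. -/
def newTri : Unit ⊕ Fin 3 → T'.S 2 :=
  Sum.elim (fun _ => T'.tri M.v M.a M.b) ![T'.tri M.u (N.σ 3) (N.σ 4), T'.tri M.u (N.σ 2) (N.σ 4),
    T'.tri M.u (N.σ 2) (N.σ 3)]

theorem newTri_inner (i : Fin 3) : M.Inner (N.newTri (Sum.inr i)) := by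
  have h : ∀ i j, i ≠ j → 0 ≠ i → 0 ≠ j → 1 ≠ i → 1 ≠ j → M.Inner (T'.tri M.u (N.σ i) (N.σ j)) :=
    fun i j h h1 h2 h3 h4 => inner_tri (N.ne h) ⟨(N.ne_a h1.symm).symm, (N.ne_a h2.symm).symm,
      (N.ne_b h3.symm).symm, (N.ne_b h4.symm).symm⟩
  fin_cases i
  · exact h 3 4 (by decide) (by decide) (by decide) (by decide) (by decide)
  · exact h 2 4 (by decide) (by decide) (by decide) (by decide) (by decide)
  · exact h 2 3 (by decide) (by decide) (by decide) (by decide) (by decide)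

theorem not_inner_tri_v : ¬M.Inner (T'.tri M.v M.a M.b) := by
  obtain ⟨g, h1, -, h3⟩ := exists_tri M.a_ne_b
  rw [h3, inner_res_v]
  rintro ⟨⟨i, hi⟩, -⟩
  exact (h1 i).1 hi

theorem exists_newTri {y : T'.S 2} (hy : M.Inner y) : ∃ i, N.newTri (Sum.inr i) = y := by
  obtain ⟨g, h1, h2, h⟩ := hy
  obtain ⟨p, q, hpq, h3, h4⟩ := orderEmb_two g
  have hap : p ≠ M.a ∧ q ≠ M.a := by
    obtain ⟨i, hi⟩ := h1
    exact ⟨fun h => (h3 i).1 (hi.trans h.symm), fun h => (h3 i).2 (hi.trans h.symm)⟩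
  have hbp : p ≠ M.b ∧ q ≠ M.b := by
    obtain ⟨i, hi⟩ := h2
    exact ⟨fun h => (h3 i).1 (hi.trans h.symm), fun h => (h3 i).2 (hi.trans h.symm)⟩
  have hy : y = T'.tri M.u p q := by
    rcases h with h | h
    · rw [h, res_eq_tri _ g hpq h3]
    · rw [h, ← res_eq g hap.1 hbp.1 (fun ⟨i, hi⟩ => (h3 i).1 hi), res_eq_tri _ g hpq h3]
  rw [hy]
  rcases N.cases p with h | h | rfl | rfl | rfl
  · exact absurd h hap.1
  · exact absurd h hbp.1
  all_goals
    rcases N.cases q with h | h | rfl | rfl | rfl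
    · exact absurd h hap.2
    · exact absurd h hbp.2
    all_goals first
      | exact absurd rfl hpq
      | exact ⟨0, rfl⟩
      | exact ⟨1, rfl⟩
      | exact ⟨2, rfl⟩
      | exact ⟨0, tri_comm _ _ _⟩
      | exact ⟨1, tri_comm _ _ _⟩
      | exact ⟨2, tri_comm _ _ _⟩

theorem newTri_injective : Function.Injective N.newTri := by
  have key : ∀ i j k l : Fin 5, i ≠ j → k ≠ l →
      T'.tri M.u (N.σ i) (N.σ j) = T'.tri M.u (N.σ k) (N.σ l) → (i = k ∧ j = l) ∨ (i = l ∧ j = k) := by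
    intro i j k l h1 h2 h
    rcases tri_injective M.u (N.ne h1) (N.ne h2) h with ⟨h3, h4⟩ | ⟨h3, h4⟩
    · exact Or.inl ⟨N.σ.injective h3, N.σ.injective h4⟩
    · exact Or.inr ⟨N.σ.injective h3, N.σ.injective h4⟩
  rintro (i | i) (j | j) h
  · rfl
  · exact absurd (h ▸ N.newTri_inner j) not_inner_tri_v
  · exact absurd (h ▸ N.newTri_inner i) not_inner_tri_v
  · fin_cases i <;> fin_cases j
    all_goals first
      | rfl
      | exact absurd (key _ _ _ _ (by decide) (by decide) h) (by decide)

/-- The numbering of the 2-faces of the new triangulation. -/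
def triEquiv : T.S 2 ⊕ (Unit ⊕ Fin 3) ≃ T'.S 2 :=
  M.liftEquiv N.newTri N.newTri_injective (by
    rintro (i | i)
    · right
      obtain ⟨g, h1, h2, h3⟩ := exists_tri M.a_ne_b
      refine ⟨g, h3 _ _, ?_⟩
      rw [← h3, ← h3]
      exact tri_a_b_ne
    · exact Or.inl (N.newTri_inner i)) (by
    rintro y (hy | ⟨g, rfl, h⟩)
    · obtain ⟨i, hi⟩ := N.exists_newTri hy
      exact ⟨Sum.inr i, hi⟩
    · obtain ⟨p, q, hpq, h3, h4⟩ := orderEmb_two g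
      have hp := Second.notMem h (c := p) fun ⟨i, hi⟩ => (h3 i).1 hi
      have hq := Second.notMem h (c := q) fun ⟨i, hi⟩ => (h3 i).2 hi
      rw [res_eq_tri _ g hpq h3]
      rcases hp with rfl | rfl <;> rcases hq with rfl | rfl
      · exact absurd rfl hpq
      · exact ⟨Sum.inl (), rfl⟩
      · exact ⟨Sum.inl (), tri_comm _ _ _⟩
      · exact absurd rfl hpq)

end Numbering

theorem u_ne_v : M.u ≠ M.v := fun h => M.doubled_a (by rw [h])

theorem inner_u : M.Inner M.u :=
  ⟨RelEmbedding.refl _, ⟨M.a, rfl⟩, ⟨M.b, rfl⟩, Or.inl (T'.res_id _).symm⟩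

theorem inner_v : M.Inner M.v :=
  ⟨RelEmbedding.refl _, ⟨M.a, rfl⟩, ⟨M.b, rfl⟩, Or.inr (T'.res_id _).symm⟩

theorem eq_u_or_v {y : T'.S 4} (hy : M.Inner y ∨ M.Second y) : y = M.u ∨ y = M.v := by
  rcases hy with ⟨g, -, -, h⟩ | ⟨g, h, -⟩
  · rw [orderEmb_four g, T'.res_id, T'.res_id] at h
    exact h
  · rw [orderEmb_four g, T'.res_id] at h
    exact Or.inr h

variable (M)

/-- The numbering of the pentachora of the new triangulation. -/
def pentEquiv : T.S 4 ⊕ Bool ≃ T'.S 4 :=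
  M.liftEquiv (fun i => if i then M.u else M.v)
    (by
      intro i j h
      cases i <;> cases j
      · rfl
      · exact absurd h.symm u_ne_v
      · exact absurd h u_ne_v
      · rfl)
    (by
      intro i
      cases i
      · exact Or.inl inner_v
      · exact Or.inl inner_u) (by
    intro y hy
    rcases eq_u_or_v hy with rfl | rfl
    · exact ⟨true, rfl⟩
    · exact ⟨false, rfl⟩)

/-- The new edge. -/
def newEdge : T'.S 1 := T'.face M.u {M.a, M.b} (Finset.card_pair M.a_ne_b)

variable {M}

theorem inner_newEdge : M.Inner M.newEdge := by
  change M.Inner (T'.res _ _)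
  rw [inner_res_u, Finset.range_orderEmbOfFin]
  simp

theorem eq_newEdge {y : T'.S 1} (hy : M.Inner y) : y = M.newEdge := by
  obtain ⟨g, h1, h2, h⟩ := hy
  have hu : T'.res g M.u = M.newEdge :=
    res_eq_face g M.u _ _ (orderEmb_one g h1 h2 M.a_ne_b)
  rcases h with h | h
  · rw [h, hu]
  · obtain ⟨c, ha, hb, hc⟩ := exists_fifth_notMem le_rfl g M.a M.b
    rw [h, ← res_eq g ha hb hc, hu]

theorem not_inner_vertex (x : T'.S 0) : ¬M.Inner x := by
  rintro ⟨g, ⟨i, hi⟩, ⟨j, hj⟩, -⟩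
  have : i = j := Subsingleton.elim (α := Fin 1) i j
  exact M.a_ne_b (by rw [← hi, ← hj, this])

variable (M)

/-- The correspondence between the vertices of the two triangulations. -/
def vertexEquiv : T.S 0 ≃ T'.S 0 :=
  Equiv.ofBijective M.lift ⟨lift_injective 0, fun y =>
    ⟨proj y (not_inner_vertex y), lift_proj _ (not_second_of_le_one zero_le_one y)⟩⟩

end FirstMove

end

/-! ### Restriction and extension of cocycles -/

section

set_option linter.unusedSimpArgs false

open OrderedComplex

theorem OrderedComplex.eq_of_dual_eq {X X' : OrderedComplex} {x : X.S 4} {x' : X'.S 4}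
    {c : X.S 2 → ℂ} {c' : X'.S 2 → ℂ} {p q : Fin 5} (hpq : p ≠ q)
    (h : X.dual x c p q = X'.dual x' c' p q) : c (X.tri x p q) = c' (X'.tri x' p q) := by
  refine mul_left_cancel₀ (a := (theta p q : ℂ)) (fun h0 => ?_) h
  have := theta_sq' hpq
  rw [h0] at this
  simp at this

theorem OrderedComplex.edgeCocycle_ne_zero_iff {X : OrderedComplex} (b : X.S 1) :
    X.edgeCocycle b ≠ 0 ↔ X.edgeCob b ≠ 0 := by
  rw [Ne, Ne, ← Subtype.coe_inj]
  rfl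

namespace FirstMove

variable {T T' : Triangulation} {M : FirstMove T T'}

theorem Extends.apply {c : T.S 2 → ℂ} {c' : T'.S 2 → ℂ} (h : M.Extends c c') {x : T'.S 2}
    (hx : ¬M.Inner x) : c' x = c (proj x hx) := h ⟨x, hx⟩

theorem extends_iff {c : T.S 2 → ℂ} {c' : T'.S 2 → ℂ} :
    M.Extends c c' ↔ ∀ (x : T'.S 2) (hx : ¬M.Inner x), c' x = c (proj x hx) :=
  ⟨fun h x hx => h ⟨x, hx⟩, fun h x => h x.1 x.2⟩

theorem Extends.cob {c : T.S 2 → ℂ} {c' : T'.S 2 → ℂ} (h : M.Extends c c') {t : T'.S 3}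
    (ht : ¬M.Inner t) : T'.cob 2 c' t = T.cob 2 c (proj t ht) := by
  change ∑ i : Fin 4, (-1 : ℂ) ^ (i : ℕ) * c' (T'.d i t) =
    ∑ i : Fin 4, (-1 : ℂ) ^ (i : ℕ) * c (T.d i (proj t ht))
  refine Finset.sum_congr rfl fun i _ => ?_
  rw [h.apply (not_inner_d i ht), proj_d]

theorem Extends.tetEval {c : T.S 2 → ℂ} {c' : T'.S 2 → ℂ} (h : M.Extends c c') {t : T'.S 3}
    (ht : ¬M.Inner t) (f : Fin 4 → ℂ) : tetEval t f c' = FreeFermion.tetEval (proj t ht) f c := by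
  unfold FreeFermion.tetEval
  refine Finset.sum_congr rfl fun i _ => ?_
  rw [h.apply (not_inner_d i ht), proj_d]

variable (M) in
-- The cocycle conditions on the two copies of a doubled tetrahedron differ only in the doubled
-- 2-face; all other faces are common.
theorem apply_tri_a_b {c' : T'.S 2 → ℂ} (hc : c' ∈ T'.Z2) :
    c' (T'.tri M.u M.a M.b) = c' (T'.tri M.v M.a M.b) := by
  have hu := sum_dual M.u c' M.a (congrFun (LinearMap.mem_ker.1 hc) _)
  have hv := sum_dual M.v c' M.a (congrFun (LinearMap.mem_ker.1 hc) _)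
  rw [← Finset.add_sum_erase _ _ (Finset.mem_univ M.b)] at hu hv
  have h : ∑ x ∈ Finset.univ.erase M.b, T'.dual M.u c' x M.a =
      ∑ x ∈ Finset.univ.erase M.b, T'.dual M.v c' x M.a := by
    refine Finset.sum_congr rfl fun x hx => ?_
    have hxb := (Finset.mem_erase.1 hx).1
    by_cases hxa : x = M.a
    · rw [hxa, dual_self, dual_self]
    · obtain ⟨g, h1, -, h3⟩ := exists_tri hxa
      rw [dual, dual, h3, h3, res_eq g hxa hxb fun ⟨i, hi⟩ => (h1 i).1 hi]
  have h2 : T'.dual M.u c' M.b M.a = T'.dual M.v c' M.b M.a := by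
    linear_combination hu - hv - h
  rw [tri_comm, eq_of_dual_eq M.a_ne_b.symm h2, tri_comm]

theorem apply_res {c' : T'.S 2 → ℂ} (hc : c' ∈ T'.Z2) (g : Fin (2 + 1) ↪o Fin (4 + 1)) :
    c' (T'.res g M.u) = c' (T'.res g M.v) := by
  by_cases h : T'.res g M.u = T'.res g M.v
  · rw [h]
  obtain ⟨p, q, hpq, h3, h4⟩ := orderEmb_two g
  have hp := Second.notMem h (c := p) fun ⟨i, hi⟩ => (h3 i).1 hi
  have hq := Second.notMem h (c := q) fun ⟨i, hi⟩ => (h3 i).2 hi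
  rw [res_eq_tri _ g hpq h3, res_eq_tri _ g hpq h3]
  rcases hp with rfl | rfl <;> rcases hq with rfl | rfl
  · exact absurd rfl hpq
  · exact apply_tri_a_b M hc
  · rw [tri_comm, apply_tri_a_b M hc, tri_comm]
  · exact absurd rfl hpq

/-- A cocycle takes equal values on the copies of a doubled face, so it descends; every old
tetrahedron has an outer preimage on which the condition is known. -/
theorem exists_restriction {c' : T'.S 2 → ℂ} (hc : c' ∈ T'.Z2) : ∃ c ∈ T.Z2, M.Extends c c' := by
  have h : M.Extends (fun x => c' (M.lift x)) c' := by
    rw [extends_iff]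
    intro x hx
    rcases proj_eq (proj_lift (M := M) (proj x hx)) with h1 | ⟨g, ⟨h1, h2⟩ | ⟨h1, h2⟩⟩
    · rw [h1]
    · rw [h1, h2, apply_res hc]
    · rw [h1, h2, apply_res hc]
  refine ⟨_, ?_, h⟩
  rw [OrderedComplex.Z2, LinearMap.mem_ker]
  funext t
  have h1 := h.cob (not_inner_lift t)
  rw [proj_lift] at h1
  rw [← h1]
  exact congrFun (LinearMap.mem_ker.1 hc) _

theorem Extends.eq_of_extends {c₁ c₂ : T.S 2 → ℂ} {c' : T'.S 2 → ℂ} (h₁ : M.Extends c₁ c')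
    (h₂ : M.Extends c₂ c') : c₁ = c₂ := by
  funext x
  have h := (h₁.apply (not_inner_lift x)).symm.trans (h₂.apply (not_inner_lift x))
  rwa [proj_lift] at h

theorem Extends.sub {c₁ c₂ : T.S 2 → ℂ} {c₁' c₂' : T'.S 2 → ℂ} (h₁ : M.Extends c₁ c₁')
    (h₂ : M.Extends c₂ c₂') : M.Extends (c₁ - c₂) (c₁' - c₂') := fun x => by
  rw [Pi.sub_apply, Pi.sub_apply, h₁, h₂]

theorem Extends.smul (r : ℂ) {c : T.S 2 → ℂ} {c' : T'.S 2 → ℂ} (h : M.Extends c c') :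
    M.Extends (r • c) (r • c') := fun x => by
  rw [Pi.smul_apply, Pi.smul_apply, h]

open Classical in
/-- The 2-cochain on the new triangulation with the given values outside the pillow and inside it. -/
def glue (c : T.S 2 → ℂ) (c' : T'.S 2 → ℂ) (x : T'.S 2) : ℂ :=
  if hx : M.Inner x then c' x else c (proj x hx)

theorem glue_extends (c : T.S 2 → ℂ) (c' : T'.S 2 → ℂ) : M.Extends c (glue (M := M) c c') :=
  extends_iff.2 fun _ hx => dif_neg hx

theorem glue_inner (c : T.S 2 → ℂ) (c' : T'.S 2 → ℂ) {x : T'.S 2} (hx : M.Inner x) :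
    glue (M := M) c c' x = c' x := dif_pos hx

theorem sum_dual_of_extends {c : T.S 2 → ℂ} {c' : T'.S 2 → ℂ} (h : M.Extends c c') (hc : c ∈ T.Z2)
    {m : Fin 5} (hm : m = M.a ∨ m = M.b) : ∑ x, T'.dual M.u c' x m = 0 := by
  refine sum_dual M.u c' m ?_
  rw [h.cob (not_inner_d_u hm)]
  exact congrFun (LinearMap.mem_ker.1 hc) _

theorem mem_Z2_of_extends (N : M.Numbering) {c : T.S 2 → ℂ} {c' : T'.S 2 → ℂ}
    (h : M.Extends c c') (hc : c ∈ T.Z2) (h' : ∀ i : Fin 5, i ≠ 0 → i ≠ 1 →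
      ∑ x, T'.dual M.u c' x (N.σ i) = 0) : c' ∈ T'.Z2 := by
  rw [OrderedComplex.Z2, LinearMap.mem_ker]
  funext t
  change T'.cob 2 c' t = 0
  by_cases ht : M.Inner t
  · rcases inner_or_second_three (Or.inl ht) with ⟨x, ha, hb, rfl⟩ | rfl | rfl
    · obtain ⟨i, rfl⟩ := N.σ.surjective x
      rw [cob_d, h' i (fun h => ha (by rw [h, N.zero])) (fun h => hb (by rw [h, N.one])), mul_zero]
    · exact absurd ht (not_inner_d_v (Or.inl rfl))
    · exact absurd ht (not_inner_d_v (Or.inr rfl))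
  · rw [h.cob ht]
    exact congrFun (LinearMap.mem_ker.1 hc) _

/-- Only the three inner 2-faces are free, and the conditions of the three inner tetrahedra are
consistent, because the column sums of an antisymmetric matrix add up to zero. -/
theorem exists_extension (N : M.Numbering) {c : T.S 2 → ℂ} (hc : c ∈ T.Z2) :
    ∃ c' ∈ T'.Z2, M.Extends c c' := by
  let D₁ := T'.dual M.u (glue (M := M) c 0)
  let p : ℂ := D₁ (N.σ 0) (N.σ 2) + D₁ (N.σ 1) (N.σ 2)
  let r : ℂ := -(D₁ (N.σ 0) (N.σ 4) + D₁ (N.σ 1) (N.σ 4))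
  -- The one-parameter freedom, the coboundary of the new edge, is used to set the value at 2, 4 to
  -- zero; `p` and `r` then solve the conditions in columns 2 and 4.
  let E : Matrix (Fin 5) (Fin 5) ℂ := Matrix.of fun i j =>
    if i = 2 ∧ j = 3 then p else if i = 3 ∧ j = 2 then -p else
      if i = 3 ∧ j = 4 then r else if i = 4 ∧ j = 3 then -r else 0
  obtain ⟨c₂, h₂⟩ := exists_dual M.u (fun x y => E (N.σ.symm x) (N.σ.symm y)) (by
    have : ∀ i j, E i j = -E j i := by
      intro i j
      fin_cases i <;> fin_cases j <;> simp [E]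
    exact fun _ _ => this _ _)
  have hext := glue_extends (M := M) c c₂
  let D := T'.dual M.u (glue (M := M) c c₂)
  have hD : ∀ i j, D (N.σ i) (N.σ j) = -D (N.σ j) (N.σ i) := fun i j => dual_anti _ _ _ _
  have hself : ∀ i, D (N.σ i) (N.σ i) = 0 := fun i => dual_self _ _ _
  have hout : ∀ p q, p ≠ q → p = M.a ∨ p = M.b → D p q = D₁ p q := by
    intro p q hpq h
    have hn : ¬M.Inner (T'.tri M.u p q) := Numbering.not_inner_tri_u hpq (by tauto)
    change _ * _ = _ * _
    rw [hext.apply hn, (glue_extends (M := M) c 0).apply hn]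
  have hin : ∀ i j, i ≠ j → i ≠ 0 → i ≠ 1 → j ≠ 0 → j ≠ 1 → D (N.σ i) (N.σ j) = E i j := by
    intro i j hij hi0 hi1 hj0 hj1
    have h3 := congrFun (congrFun h₂ (N.σ i)) (N.σ j)
    rw [Equiv.symm_apply_apply, Equiv.symm_apply_apply] at h3
    rw [← h3]
    change _ * _ = _ * _
    rw [glue_inner _ _ (Numbering.inner_tri (N.ne hij) ⟨(N.ne_a hi0).symm, (N.ne_a hj0).symm,
      (N.ne_b hi1).symm, (N.ne_b hj1).symm⟩)]
  have hs : ∀ m, ∑ x, D x m = D (N.σ 0) m + D (N.σ 1) m + D (N.σ 2) m + D (N.σ 3) m +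
      D (N.σ 4) m := fun m => by
    rw [← Equiv.sum_comp N.σ, Fin.sum_univ_five]
  have c0 : ∑ x, D x (N.σ 0) = 0 := sum_dual_of_extends hext hc (Or.inl N.zero)
  have c1 : ∑ x, D x (N.σ 1) = 0 := sum_dual_of_extends hext hc (Or.inr N.one)
  have e02 := hout (N.σ 0) (N.σ 2) (N.ne (by decide)) (Or.inl N.zero)
  have e12 := hout (N.σ 1) (N.σ 2) (N.ne (by decide)) (Or.inr N.one)
  have e04 := hout (N.σ 0) (N.σ 4) (N.ne (by decide)) (Or.inl N.zero)
  have e14 := hout (N.σ 1) (N.σ 4) (N.ne (by decide)) (Or.inr N.one)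
  have e23 : D (N.σ 2) (N.σ 3) = p := by
    rw [hin 2 3 (by decide) (by decide) (by decide) (by decide) (by decide)]
    simp [E]
  have e34 : D (N.σ 3) (N.σ 4) = r := by
    rw [hin 3 4 (by decide) (by decide) (by decide) (by decide) (by decide)]
    simp [E]
  have e24 : D (N.σ 2) (N.σ 4) = 0 := by
    rw [hin 2 4 (by decide) (by decide) (by decide) (by decide) (by decide)]
    simp [E]
  rw [hs] at c0 c1
  refine ⟨_, mem_Z2_of_extends N hext hc fun i hi0 hi1 => ?_, hext⟩
  change ∑ x, D x (N.σ i) = 0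
  rw [hs]
  fin_cases i
  · exact absurd rfl hi0
  · exact absurd rfl hi1
  · change D (N.σ 0) (N.σ 2) + D (N.σ 1) (N.σ 2) + D (N.σ 2) (N.σ 2) + D (N.σ 3) (N.σ 2) +
      D (N.σ 4) (N.σ 2) = 0
    rw [hself, hD 3 2, hD 4 2, e23, e24, e02, e12]
    simp only [p]
    ring
  · change D (N.σ 0) (N.σ 3) + D (N.σ 1) (N.σ 3) + D (N.σ 2) (N.σ 3) + D (N.σ 3) (N.σ 3) +
      D (N.σ 4) (N.σ 3) = 0
    rw [hself, hD 4 3, e23, e34]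
    have hp : p = D (N.σ 0) (N.σ 2) + D (N.σ 1) (N.σ 2) := by rw [e02, e12]
    have hr : r = -(D (N.σ 0) (N.σ 4) + D (N.σ 1) (N.σ 4)) := by rw [e04, e14]
    rw [hp, hr]
    -- The last column sum follows from the other four by antisymmetry.
    linear_combination -c0 - c1 + hself 0 + hself 1 + hD 1 0 + hD 2 0 + hD 2 1 + hD 3 0 + hD 3 1 +
      hD 4 0 + hD 4 1
  · change D (N.σ 0) (N.σ 4) + D (N.σ 1) (N.σ 4) + D (N.σ 2) (N.σ 4) + D (N.σ 3) (N.σ 4) +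
      D (N.σ 4) (N.σ 4) = 0
    rw [hself, e24, e34, e04, e14]
    simp only [r]
    ring

theorem edgeCob_newEdge_extends : M.Extends 0 (T'.edgeCob M.newEdge) := by
  classical
  refine extends_iff.2 fun x hx => ?_
  have h : ∀ i, T'.d i x ≠ M.newEdge := fun i h => not_inner_d i hx (h ▸ inner_newEdge)
  rw [OrderedComplex.edgeCob, cob_one_apply]
  simp [h]

theorem dual_edgeCob_newEdge (N : M.Numbering) (x y : Fin 5) :
    T'.dual M.u (T'.edgeCob M.newEdge) x y = -triCirc (N.σ 2) (N.σ 3) (N.σ 4) x y := by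
  have hc : ({N.σ 0, N.σ 1} : Finset (Fin 5)).card = 1 + 1 := Finset.card_pair (N.ne (by decide))
  have : M.newEdge = T'.face M.u {N.σ 0, N.σ 1} hc :=
    face_congr M.u (by rw [N.zero, N.one])
  rw [this, dual_edgeCob_perm M.u N.σ N.even N.lt]

theorem edgeCob_newEdge_ne_zero (N : M.Numbering) : T'.edgeCob M.newEdge ≠ 0 := by
  intro h
  have h1 := dual_edgeCob_newEdge N (N.σ 2) (N.σ 3)
  rw [h, dual] at h1
  have h2 : N.σ 3 ≠ N.σ 2 := N.ne (by decide)
  have h3 : N.σ 3 ≠ N.σ 4 := N.ne (by decide)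
  have h4 : N.σ 2 ≠ N.σ 4 := N.ne (by decide)
  simp [triCirc, h2, h3, h4, h2.symm, h3.symm, h4.symm] at h1

/-- With zero outer values the column sums force the three inner values to form a circulation along
one triangle, the dual of the new edge. Restriction of cocycles thus has a one-dimensional kernel.
-/
theorem exists_smul_edgeCob (N : M.Numbering) {c' : T'.S 2 → ℂ} (hc : c' ∈ T'.Z2)
    (h : M.Extends 0 c') : ∃ r : ℂ, c' = r • T'.edgeCob M.newEdge := by
  let D := T'.dual M.u c'
  have hD : ∀ i j, D (N.σ i) (N.σ j) = -D (N.σ j) (N.σ i) := fun i j => dual_anti _ _ _ _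
  have hself : ∀ i, D (N.σ i) (N.σ i) = 0 := fun i => dual_self _ _ _
  have hout : ∀ p q, p ≠ q → p = M.a ∨ p = M.b → D p q = 0 := by
    intro p q hpq h1
    have hn : ¬M.Inner (T'.tri M.u p q) := Numbering.not_inner_tri_u hpq (by tauto)
    change _ * _ = _
    rw [h.apply hn, Pi.zero_apply, mul_zero]
  have hs : ∀ m, D (N.σ 0) m + D (N.σ 1) m + D (N.σ 2) m + D (N.σ 3) m + D (N.σ 4) m = 0 :=
    fun m => by
    have := sum_dual M.u c' m (congrFun (LinearMap.mem_ker.1 hc) _)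
    rwa [← Equiv.sum_comp N.σ, Fin.sum_univ_five] at this
  have h2 := hs (N.σ 2)
  have h3 := hs (N.σ 3)
  rw [hself, hout (N.σ 0) _ (N.ne (by decide)) (Or.inl N.zero),
    hout (N.σ 1) _ (N.ne (by decide)) (Or.inr N.one)] at h2 h3
  have key : ∀ i j, i ≠ j → (i = 2 ∨ i = 3 ∨ i = 4) → (j = 2 ∨ j = 3 ∨ j = 4) →
      c' (T'.tri M.u (N.σ i) (N.σ j)) =
        (-D (N.σ 2) (N.σ 3) • T'.edgeCob M.newEdge) (T'.tri M.u (N.σ i) (N.σ j)) := by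
    intro i j hij hi hj
    refine eq_of_dual_eq (N.ne hij) ?_
    have e1 : T'.dual M.u (-D (N.σ 2) (N.σ 3) • T'.edgeCob M.newEdge) (N.σ i) (N.σ j) =
        -D (N.σ 2) (N.σ 3) * T'.dual M.u (T'.edgeCob M.newEdge) (N.σ i) (N.σ j) := by
      simp only [dual, Pi.smul_apply, smul_eq_mul]
      ring
    have s23 : N.σ 2 ≠ N.σ 3 := N.ne (by decide)
    have s24 : N.σ 2 ≠ N.σ 4 := N.ne (by decide)
    have s34 : N.σ 3 ≠ N.σ 4 := N.ne (by decide)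
    rw [e1, dual_edgeCob_newEdge N]
    change D (N.σ i) (N.σ j) = _
    rcases hi with rfl | rfl | rfl <;> rcases hj with rfl | rfl | rfl
    · exact absurd rfl hij
    · simp [triCirc, s23, s24, s34, s23.symm, s24.symm, s34.symm]
    · simp [triCirc, s23, s24, s34, s23.symm, s24.symm, s34.symm]
      linear_combination -h2 + hD 2 4 + hD 2 3
    · simp [triCirc, s23, s24, s34, s23.symm, s24.symm, s34.symm]
      linear_combination hD 3 2
    · exact absurd rfl hij
    · simp [triCirc, s23, s24, s34, s23.symm, s24.symm, s34.symm]
      linear_combination -h3 + hD 3 4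
    · simp [triCirc, s23, s24, s34, s23.symm, s24.symm, s34.symm]
      linear_combination h2 - hD 2 3
    · simp [triCirc, s23, s24, s34, s23.symm, s24.symm, s34.symm]
      linear_combination h3
    · exact absurd rfl hij
  refine ⟨-D (N.σ 2) (N.σ 3), ?_⟩
  funext x
  by_cases hx : M.Inner x
  · obtain ⟨i, rfl⟩ := N.exists_newTri hx
    fin_cases i
    · exact key 3 4 (by decide) (by decide) (by decide)
    · exact key 2 4 (by decide) (by decide) (by decide)
    · exact key 2 3 (by decide) (by decide) (by decide)
  · rw [h.apply hx, Pi.smul_apply, edgeCob_newEdge_extends.apply hx]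
    simp

end FirstMove

end

/-! ### Trees, first cohomology and distinguished bases under the move -/

section

open OrderedComplex

namespace FirstMove

variable {T T' : Triangulation} {M : FirstMove T T'}

theorem lift_eq_iff {e : T.S 1} {y : T'.S 1} (hy : ¬M.Inner y) : y = M.lift e ↔ proj y hy = e := by
  constructor
  · rintro rfl
    exact proj_lift e
  · rintro rfl
    exact (lift_proj hy (not_second_of_le_one le_rfl y)).symm

theorem lift_ne_newEdge (e : T.S 1) : M.lift e ≠ M.newEdge := fun h =>
  not_inner_lift e (h ▸ inner_newEdge)

variable (M) in
theorem d_lift (i : Fin 2) (e : T.S 1) : T'.d i (M.lift e) = M.lift (T.d i e) := by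
  have h := proj_d i (not_inner_lift (M := M) e)
  rw [proj_lift] at h
  rw [← h, lift_proj _ (not_second_of_le_one zero_le_one _)]

theorem cob_zero_lift (g' : T'.S 0 → ℂ) (e : T.S 1) :
    T'.cob 0 g' (M.lift e) = T.cob 0 (fun x => g' (M.lift x)) e := by
  rw [cob_zero_apply, cob_zero_apply, d_lift, d_lift]

theorem extends_cob {f : T.S 1 → ℂ} {f' : T'.S 1 → ℂ} (h : ∀ e, f' (M.lift e) = f e) :
    M.Extends (T.cob 1 f) (T'.cob 1 f') := by
  have h1 : ∀ (y : T'.S 1) (hy : ¬M.Inner y), f' y = f (proj y hy) := fun y hy => by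
    rw [← h, lift_proj hy (not_second_of_le_one le_rfl y)]
  refine extends_iff.2 fun x hx => ?_
  rw [cob_one_apply, cob_one_apply, h1 _ (not_inner_d 0 hx), h1 _ (not_inner_d 1 hx),
    h1 _ (not_inner_d 2 hx), proj_d 0 hx, proj_d 1 hx, proj_d 2 hx]

theorem edgeCob_extends (e : T.S 1) : M.Extends (T.edgeCob e) (T'.edgeCob (M.lift e)) := by
  classical
  refine extends_cob fun e' => ?_
  rw [Pi.single_apply, Pi.single_apply]
  simp only [(lift_injective (M := M) 1).eq_iff]

theorem eq_zero_of_extends {c : T.S 2 → ℂ} (h : M.Extends c 0) : c = 0 := by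
  funext x
  have := h.apply (not_inner_lift x)
  rw [proj_lift] at this
  exact this.symm

variable (M) in
/-- The image of a set of edges in the new triangulation. -/
def mapEdges (A : Finset (T.S 1)) : Finset (T'.S 1) := A.map ⟨M.lift, lift_injective 1⟩

theorem lift_mem_mapEdges {A : Finset (T.S 1)} {e : T.S 1} : M.lift e ∈ M.mapEdges A ↔ e ∈ A :=
  Finset.mem_map' ⟨M.lift, lift_injective 1⟩

theorem newEdge_notMem (A : Finset (T.S 1)) : M.newEdge ∉ M.mapEdges A := by
  intro h
  obtain ⟨e, -, he⟩ := Finset.mem_map.1 h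
  exact lift_ne_newEdge e he

/-- The move creates no vertices, so the old tree remains maximal and the new edge is a chord. -/
theorem isMaximalTree_mapEdges {A : Finset (T.S 1)} (hA : T.IsMaximalTree A) :
    T'.IsMaximalTree (M.mapEdges A) := by
  constructor
  · intro v w
    obtain ⟨v, rfl⟩ := M.vertexEquiv.surjective v
    obtain ⟨w, rfl⟩ := M.vertexEquiv.surjective w
    change Relation.EqvGen _ (M.lift v) (M.lift w)
    induction hA.1 v w with
    | rel x y h =>
      obtain ⟨e, he, rfl, rfl⟩ := h
      exact .rel _ _ ⟨M.lift e, lift_mem_mapEdges.2 he, M.d_lift 1 e, M.d_lift 0 e⟩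
    | refl x => exact .refl _
    | symm x y _ ih => exact .symm _ _ ih
    | trans x y z _ _ h1 h2 => exact .trans _ _ _ h1 h2
  · rw [mapEdges, Finset.card_map, hA.2]
    exact Fintype.card_congr M.vertexEquiv

variable (M) in
/-- The edges not belonging to a tree. -/
def chordEquiv (A : Finset (T.S 1)) :
    {b : T.S 1 // b ∉ A} ⊕ Unit ≃ {b : T'.S 1 // b ∉ M.mapEdges A} :=
  Equiv.ofBijective (Sum.elim (fun b => ⟨M.lift b.1, fun h => b.2 (lift_mem_mapEdges.1 h)⟩)
    fun _ => ⟨M.newEdge, newEdge_notMem A⟩) (by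
    constructor
    · rintro (⟨x, hx⟩ | i) (⟨y, hy⟩ | j) h
      · have h1 : M.lift x = M.lift y := congrArg Subtype.val h
        exact congrArg Sum.inl (Subtype.ext (lift_injective 1 h1))
      · exact absurd (congrArg Subtype.val h) (lift_ne_newEdge x)
      · exact absurd (congrArg Subtype.val h).symm (lift_ne_newEdge y)
      · rfl
    · rintro ⟨y, hy⟩
      by_cases h : M.Inner y
      · exact ⟨Sum.inr (), Subtype.ext (eq_newEdge h).symm⟩
      · have h1 := lift_proj h (not_second_of_le_one le_rfl y)
        exact ⟨Sum.inl ⟨proj y h, fun h2 => hy (by rw [← h1]; exact lift_mem_mapEdges.2 h2)⟩,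
          Subtype.ext h1⟩)

theorem eq_single_newEdge [DecidableEq (T'.S 1)] {f : T'.S 1 → ℂ} (h : ∀ e, f (M.lift e) = 0) :
    f = f M.newEdge • Pi.single M.newEdge 1 := by
  funext y
  by_cases hy : M.Inner y
  · rw [eq_newEdge hy]
    simp
  · rw [← lift_proj hy (not_second_of_le_one le_rfl y), h]
    simp [lift_ne_newEdge]

/-- The only new edge lies inside the pillow and its coboundary is not zero, so a 1-cocycle is
determined by the old edges and extends uniquely from them. -/
theorem h1Vanishes_iff (N : M.Numbering) : T.H1Vanishes ↔ T'.H1Vanishes := by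
  classical
  have hle : ∀ X : OrderedComplex, LinearMap.range (X.cob 0) ≤ LinearMap.ker (X.cob 1) := by
    rintro X _ ⟨g, rfl⟩
    exact cob_one_cob_zero g
  constructor
  · intro h
    refine le_antisymm (fun f' hf' => ?_) (hle _)
    have h1 : M.Extends (T.cob 1 fun e => f' (M.lift e)) (T'.cob 1 f') := extends_cob fun _ => rfl
    rw [LinearMap.mem_ker.1 hf'] at h1
    have h2 : (fun e => f' (M.lift e)) ∈ LinearMap.ker (T.cob 1) := eq_zero_of_extends h1
    rw [h] at h2
    obtain ⟨g, hg⟩ := h2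
    let g' : T'.S 0 → ℂ := fun x => g (M.vertexEquiv.symm x)
    have h3 : ∀ e, (f' - T'.cob 0 g') (M.lift e) = 0 := fun e => by
      have h4 : (fun x => g' (M.lift x)) = g := by
        funext x
        exact congrArg g (M.vertexEquiv.symm_apply_apply x)
      rw [Pi.sub_apply, cob_zero_lift, h4, hg, sub_self]
    have h5 := eq_single_newEdge h3
    have h6 : T'.cob 1 (f' - T'.cob 0 g') = 0 := by
      rw [map_sub, cob_one_cob_zero, LinearMap.mem_ker.1 hf', sub_zero]
    rw [h5, map_smul] at h6
    have h7 : (f' - T'.cob 0 g') M.newEdge = 0 := by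
      refine (smul_eq_zero.1 h6).resolve_right fun h8 => edgeCob_newEdge_ne_zero N ?_
      unfold OrderedComplex.edgeCob
      convert h8
    rw [h7, zero_smul] at h5
    exact ⟨g', (sub_eq_zero.1 h5).symm⟩
  · intro h
    refine le_antisymm (fun f hf => ?_) (hle _)
    let f₁ : T'.S 1 → ℂ := fun y => if hy : M.Inner y then 0 else f (proj y hy)
    have h1 : ∀ e, f₁ (M.lift e) = f e := fun e => by
      simp only [f₁]
      rw [dif_neg (not_inner_lift e), proj_lift]
    -- The coboundary of the extension by zero has no outer values, so it is a multiple of the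
    -- coboundary of the new edge and is removed by correcting the value there.
    have h2 := extends_cob h1
    rw [LinearMap.mem_ker.1 hf] at h2
    obtain ⟨r, hr⟩ := exists_smul_edgeCob N (cob_one_mem f₁) h2
    have h3 : f₁ - r • Pi.single M.newEdge 1 ∈ LinearMap.ker (T'.cob 1) := by
      rw [LinearMap.mem_ker, map_sub, map_smul, hr, sub_eq_zero]
      unfold OrderedComplex.edgeCob
      congr!
    rw [h] at h3
    obtain ⟨g', hg⟩ := h3
    refine ⟨fun x => g' (M.lift x), ?_⟩
    funext e
    rw [← cob_zero_lift, hg, Pi.sub_apply, h1]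
    simp [lift_ne_newEdge]

theorem SameBasis.mkQ_eq {κ : Type} {h : Module.Basis κ ℂ T.H2} {h' : Module.Basis κ ℂ T'.H2}
    (hh : M.SameBasis h h') {c : T.Z2} {c' : T'.Z2} (hc : M.Extends c c') {k : κ}
    (hk : T.B2.mkQ c = h k) : T'.B2.mkQ c' = h' k := by
  apply h'.repr.injective
  rw [← hh c c' hc, hk, h.repr_self, h'.repr_self]

end FirstMove

/-- The basis consists of extensions of the old basis elements and one more element, the coboundary
of the new edge; this is where `SameBasis` is used. -/
theorem exists_distinguished_extension {Y Y' : System} {M : FirstMove Y.T Y'.T} (N : M.Numbering)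
    {κ : Type} [Fintype κ] {h : Module.Basis κ ℂ Y.T.H2} {h' : Module.Basis κ ℂ Y'.T.H2}
    (hh : M.SameBasis h h') {A : Finset (Y.T.S 1)}
    {e : Module.Basis ({b : Y.T.S 1 // b ∉ A} ⊕ κ) ℂ Y.T.Z2} (he : Y.IsDistinguished h A e) :
    ∃ (A' : Finset (Y'.T.S 1)) (e' : Module.Basis ({b : Y'.T.S 1 // b ∉ A'} ⊕ κ) ℂ Y'.T.Z2)
      (ι : ({b : Y.T.S 1 // b ∉ A} ⊕ κ) ⊕ Unit ≃ {b : Y'.T.S 1 // b ∉ A'} ⊕ κ),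
      Y'.IsDistinguished h' A' e' ∧ (∀ i, M.Extends (e i) (e' (ι (Sum.inl i)))) ∧
      e' (ι (Sum.inr ())) = Y'.T.edgeCocycle M.newEdge := by
  have hX := (FirstMove.h1Vanishes_iff N).1 he.h1Vanishes
  choose z hz hext using fun k => FirstMove.exists_extension N (e (Sum.inr k)).2
  have hz' : ∀ k, Y'.T.B2.mkQ (⟨z k, hz k⟩ : Y'.T.Z2) = h' k := fun k =>
    hh.mkQ_eq (c := e (Sum.inr k)) (hext k) (he.2.2 k)
  have hA := FirstMove.isMaximalTree_mapEdges (M := M) he.1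
  obtain ⟨e', he'⟩ := hX.exists_basis hA h' _ hz'
  let ι : ({b : Y.T.S 1 // b ∉ A} ⊕ κ) ⊕ Unit ≃ {b : Y'.T.S 1 // b ∉ M.mapEdges A} ⊕ κ :=
    ((Equiv.sumAssoc _ _ _).trans ((Equiv.refl _).sumCongr (Equiv.sumComm _ _))).trans
      ((Equiv.sumAssoc _ _ _).symm.trans ((M.chordEquiv A).sumCongr (Equiv.refl _)))
  refine ⟨_, e', ι, ⟨hA, fun b => by rw [he']; rfl, fun k => by rw [he']; exact hz' k⟩, ?_, ?_⟩
  · rintro (b | k)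
    · rw [he.2.1]
      have : e' (ι (Sum.inl (Sum.inl b))) = Y'.T.edgeCocycle (M.lift b.1) := by
        rw [he']
        rfl
      rw [this]
      exact FirstMove.edgeCob_extends b.1
    · have : e' (ι (Sum.inl (Sum.inr k))) = ⟨z k, hz k⟩ := by
        rw [he']
        rfl
      rw [this]
      exact hext k
  · rw [he']
    rfl

end

/-! ### Structures agreeing outside the pillow -/

section

open Matrix OrderedComplex

/-- Adding one constant to all the coefficients adds a multiple of the cocycle condition. -/
theorem tetEval_congr {X : OrderedComplex} {t : X.S 3} {b b' : Fin 4 → ℂ}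
    (h : ∀ a, b' a - b' 3 = b a - b 3) {c : X.S 2 → ℂ} (hc : X.cob 2 c t = 0) :
    tetEval t b' c = tetEval t b c := by
  have h0 : ∑ a : Fin 4, (-1 : ℂ) ^ (a : ℕ) * c (X.d a t) = 0 := hc
  have h1 : ∀ a : Fin 4, b' a * ((-1 : ℂ) ^ (a : ℕ) * c (X.d a t)) =
      b a * ((-1) ^ (a : ℕ) * c (X.d a t)) + (b' 3 - b 3) * ((-1) ^ (a : ℕ) * c (X.d a t)) :=
    fun a => by linear_combination ((-1 : ℂ) ^ (a : ℕ) * c (X.d a t)) * h a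
  unfold tetEval
  rw [Finset.sum_congr rfl fun a _ => h1 a, Finset.sum_add_distrib, ← Finset.mul_sum, h0, mul_zero,
    add_zero]

namespace System

/-- By `F_unique` the Gaussian matrix needs no matching hypothesis of its own: matching β and γ is
enough. -/
theorem pent_F_eq {Y Y' : System} {u : Y.T.S 4} {u' : Y'.T.S 4}
    (hb : ∀ m a, Y'.D.bcoef (Y'.T.d m u') a - Y'.D.bcoef (Y'.T.d m u') 3 =
      Y.D.bcoef (Y.T.d m u) a - Y.D.bcoef (Y.T.d m u) 3)
    (hg : ∀ m a, Y'.D.gcoef (Y'.T.d m u') a - Y'.D.gcoef (Y'.T.d m u') 3 =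
      Y.D.gcoef (Y.T.d m u) a - Y.D.gcoef (Y.T.d m u) 3) :
    (Y'.pent u').F = (Y.pent u).F := by
  refine (Y.pent u).F_unique (Y'.pent u') ?_ ?_
  · intro m a b ha hb'
    obtain ⟨a, rfl⟩ := Fin.exists_succAbove_eq ha
    obtain ⟨b, rfl⟩ := Fin.exists_succAbove_eq hb'
    change Y'.pentB u' m _ - Y'.pentB u' m _ = Y.pentB u m _ - Y.pentB u m _
    simp only [pentB, Fin.insertNth_apply_succAbove]
    linear_combination (-1 : ℂ) ^ (m : ℕ) * (hb m a - hb m b)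
  · intro m a b ha hb'
    obtain ⟨a, rfl⟩ := Fin.exists_succAbove_eq ha
    obtain ⟨b, rfl⟩ := Fin.exists_succAbove_eq hb'
    change Y'.pentG u' m _ - Y'.pentG u' m _ = Y.pentG u m _ - Y.pentG u m _
    simp only [pentG, Fin.insertNth_apply_succAbove]
    linear_combination hg m a - hg m b

theorem f3Matrix_dot_anti (Y : System) (y z : Y.T.S 3 → ℂ) :
    y ⬝ᵥ Y.f3Matrix *ᵥ z = -(z ⬝ᵥ Y.f3Matrix *ᵥ y) := by
  rw [Matrix.dotProduct_mulVec, ← Matrix.mulVec_transpose, f3Matrix_skew, Matrix.neg_mulVec,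
    neg_dotProduct, dotProduct_comm]

end System

/-- The structures of two systems related by the first move are the same outside the pillow. -/
structure Matched {Y Y' : System} (M : FirstMove Y.T Y'.T) : Prop where
  ω : M.Extends Y.C.ω Y'.C.ω
  q : M.Extends Y.C.q Y'.C.q
  b : ∀ (t : Y'.T.S 3) (ht : ¬M.Inner t) a, Y'.D.bcoef t a - Y'.D.bcoef t 3 =
    Y.D.bcoef (FirstMove.proj t ht) a - Y.D.bcoef (FirstMove.proj t ht) 3
  g : ∀ (t : Y'.T.S 3) (ht : ¬M.Inner t) a, Y'.D.gcoef t a - Y'.D.gcoef t 3 =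
    Y.D.gcoef (FirstMove.proj t ht) a - Y.D.gcoef (FirstMove.proj t ht) 3

namespace Matched

open FirstMove

variable {Y Y' : System} {M : FirstMove Y.T Y'.T}

theorem beta (hM : Matched M) {c : Y.T.S 2 → ℂ} (hc : c ∈ Y.T.Z2) {c' : Y'.T.S 2 → ℂ} (h : M.Extends c c')
    {t : Y'.T.S 3} (ht : ¬M.Inner t) : Y'.D.β t c' = Y.D.β (proj t ht) c := by
  rw [EdgeOperators.β, EdgeOperators.β, h.tetEval ht]
  exact tetEval_congr (hM.b t ht) (congrFun (LinearMap.mem_ker.1 hc) _)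

theorem F_outer (hM : Matched M) {u : Y'.T.S 4} (hu : ¬M.Inner u) : Y'.F u = Y.F (proj u hu) := by
  have h := System.pent_F_eq (Y := Y) (Y' := Y') (u := proj u hu) (u' := u)
    (fun m a => by rw [← proj_d m hu]; exact hM.b _ _ a)
    (fun m a => by rw [← proj_d m hu]; exact hM.g _ _ a)
  have ho : Y.T.orient (proj u hu) = Y'.T.orient u := M.collapse_orient ⟨u, hu⟩
  ext i j
  have h1 : (Y'.T.orient u : ℤ) * Y'.F u i j = (Y.T.orient (proj u hu) : ℤ) * Y.F (proj u hu) i j :=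
    congrFun (congrFun h i) j
  rw [ho] at h1
  exact mul_left_cancel₀ (left_ne_zero_of_mul_eq_one (Y'.orient_mul_self u)) h1

theorem coef_u_v (f : Y'.T.S 3 → Fin 4 → ℂ) (f₀ : Y.T.S 3 → Fin 4 → ℂ)
    (h : ∀ (t : Y'.T.S 3) (ht : ¬M.Inner t) a, f t a - f t 3 = f₀ (proj t ht) a - f₀ (proj t ht) 3)
    (m : Fin 5) (a : Fin 4) : f (Y'.T.d m M.v) a - f (Y'.T.d m M.v) 3 =
      f (Y'.T.d m M.u) a - f (Y'.T.d m M.u) 3 := by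
  by_cases hm : m = M.a ∨ m = M.b
  · rw [h _ (not_inner_d_v hm), h _ (not_inner_d_u hm)]
    have : proj (Y'.T.d m M.u) (not_inner_d_u hm) = proj (Y'.T.d m M.v) (not_inner_d_v hm) :=
      proj_res_u_v _ _ _
    rw [this]
  · push Not at hm
    rw [M.glued m hm.1 hm.2]

/-- The two pillow pentachora carry the same β and γ on corresponding faces, hence the same
orientation-normalized matrix, and their orientations are opposite. -/
theorem F_v (hM : Matched M) : Y'.F M.v = -Y'.F M.u := by
  have h := System.pent_F_eq (Y := Y') (Y' := Y') (u := M.u) (u' := M.v)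
    (coef_u_v _ _ hM.b) (coef_u_v _ _ hM.g)
  ext i j
  have h1 : (Y'.T.orient M.v : ℤ) * Y'.F M.v i j = (Y'.T.orient M.u : ℤ) * Y'.F M.u i j :=
    congrFun (congrFun h i) j
  rw [M.opposite] at h1
  refine mul_left_cancel₀ (left_ne_zero_of_mul_eq_one (Y'.orient_mul_self M.u)) ?_
  rw [Matrix.neg_apply]
  push_cast at h1
  linear_combination -h1

theorem sum_pentachora (f : Y'.T.S 4 → ℂ) :
    ∑ w, f w = ∑ w, f (M.lift w) + (f M.u + f M.v) := by
  rw [← Equiv.sum_comp M.pentEquiv, Fintype.sum_sum_type]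
  congr 1
  rw [Fintype.sum_bool]
  rfl

end Matched

end

/-! ### The middle mapping on the new triangulation -/

section

open Matrix OrderedComplex FirstMove

set_option linter.unusedSectionVars false

namespace FirstMove

variable {T T' : Triangulation} {M : FirstMove T T'}

open Classical in
/-- The function on the tetrahedra of the new triangulation corresponding to a function on the
tetrahedra of the old one, and vanishing inside the pillow. -/
def pull (y : T.S 3 → ℂ) (t : T'.S 3) : ℂ := if h : M.Inner t then 0 else y (proj t h)

theorem pull_outer (y : T.S 3 → ℂ) {t : T'.S 3} (h : ¬M.Inner t) :
    pull (M := M) y t = y (proj t h) := dif_neg h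

theorem pull_lift (y : T.S 3 → ℂ) (t : T.S 3) : pull (M := M) y (M.lift t) = y t := by
  rw [pull_outer y (not_inner_lift t), proj_lift]

theorem pull_d_u_v (y : T.S 3 → ℂ) (m : Fin 5) :
    pull (M := M) y (T'.d m M.u) = pull (M := M) y (T'.d m M.v) := by
  by_cases hm : m = M.a ∨ m = M.b
  · rw [pull_outer y (not_inner_d_u hm), pull_outer y (not_inner_d_v hm)]
    congr 1
    exact proj_res_u_v _ _ _
  · push Not at hm
    rw [M.glued m hm.1 hm.2]

theorem sum_tetrahedra (N : M.Numbering) (f : T'.S 3 → ℂ) : ∑ t, f t = ∑ t, f (M.lift t) +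
    (f (T'.d (N.σ 4) M.u) + (f (T'.d (N.σ 0) M.v) + f (T'.d (N.σ 1) M.v) +
      (f (T'.d (N.σ 2) M.u) + f (T'.d (N.σ 3) M.u)))) := by
  rw [← Equiv.sum_comp N.tetEquiv, Fintype.sum_sum_type, Fintype.sum_sum_type, Fintype.sum_sum_type,
    Fin.sum_univ_two, Fin.sum_univ_two]
  simp only [Finset.univ_unique, Finset.sum_singleton]
  rfl

end FirstMove

namespace Matched

variable {Y Y' : System} {M : FirstMove Y.T Y'.T}

/-- Only `u` and `v` meet an inner tetrahedron. As their matrices are opposite, contributions of the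
glued faces cancel and only differences between doubled faces remain. -/
theorem mulVec_inner (hM : Matched M) (z : Y'.T.S 3 → ℂ) {c : Fin 5} (ha : c ≠ M.a) (hb : c ≠ M.b) :
    (Y'.f3Matrix *ᵥ z) (Y'.T.d c M.u) =
      Y'.F M.u c M.a * (z (Y'.T.d M.a M.u) - z (Y'.T.d M.a M.v)) +
      Y'.F M.u c M.b * (z (Y'.T.d M.b M.u) - z (Y'.T.d M.b M.v)) := by
  classical
  rw [System.f3Matrix_mulVec, sum_pentachora (M := M)]
  have h0 : ∀ w : Y.T.S 4, ∀ i, Y'.T.d i (M.lift w) ≠ Y'.T.d c M.u := fun w i h =>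
    not_inner_d i (not_inner_lift w) (h ▸ inner_d_u ha hb)
  have hu : ∀ i, Y'.T.d i M.u = Y'.T.d c M.u ↔ i = c := fun i => (d_injective M.u).eq_iff
  have hv : ∀ i, Y'.T.d i M.v = Y'.T.d c M.u ↔ i = c := fun i =>
    ⟨fun h => (eq_of_d_eq h.symm).symm, fun h => by rw [h, M.glued c ha hb]⟩
  simp only [h0, hu, hv, if_false, Finset.sum_const_zero, zero_add, Finset.sum_ite_eq',
    Finset.mem_univ, if_true]
  rw [hM.F_v, ← Finset.sum_add_distrib, Finset.sum_eq_add M.a M.b M.a_ne_b]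
  · simp only [Matrix.neg_apply]
    ring
  · intro j _ hj
    rw [M.glued j hj.1 hj.2, Matrix.neg_apply]
    ring
  · exact fun h => absurd (Finset.mem_univ _) h
  · exact fun h => absurd (Finset.mem_univ _) h

/-- A pulled-back function agrees on corresponding faces of `u` and `v`, so the pillow contributes
nothing to the bilinear form. -/
theorem pull_dot_pull (hM : Matched M) (y z : Y.T.S 3 → ℂ) :
    pull (M := M) y ⬝ᵥ Y'.f3Matrix *ᵥ pull (M := M) z = y ⬝ᵥ Y.f3Matrix *ᵥ z := by
  rw [System.dotProduct_f3Matrix_mulVec, System.dotProduct_f3Matrix_mulVec,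
    sum_pentachora (M := M)]
  have h1 : ∑ i, ∑ j, pull (M := M) y (Y'.T.d i M.u) * Y'.F M.u i j *
      pull (M := M) z (Y'.T.d j M.u) + ∑ i, ∑ j, pull (M := M) y (Y'.T.d i M.v) * Y'.F M.v i j *
      pull (M := M) z (Y'.T.d j M.v) = 0 := by
    rw [← Finset.sum_add_distrib]
    refine Finset.sum_eq_zero fun i _ => ?_
    rw [← Finset.sum_add_distrib]
    refine Finset.sum_eq_zero fun j _ => ?_
    rw [pull_d_u_v, pull_d_u_v, hM.F_v, Matrix.neg_apply]
    ring
  rw [h1, add_zero]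
  refine Finset.sum_congr rfl fun w _ => Finset.sum_congr rfl fun i _ =>
    Finset.sum_congr rfl fun j _ => ?_
  have hw := not_inner_lift (M := M) w
  rw [pull_outer y (not_inner_d i hw), pull_outer z (not_inner_d j hw), proj_d i hw, proj_d j hw,
    hM.F_outer hw, proj_lift]

end Matched

section Basis

variable {Y Y' : System} {M : FirstMove Y.T Y'.T}

theorem FirstMove.Extends.sum {I : Type} [Fintype I] {z : I → Y.T.Z2} {z' : I → Y'.T.Z2}
    (h : ∀ i, M.Extends (z i) (z' i)) (x : I → ℂ) :
    M.Extends ((∑ i, x i • z i : Y.T.Z2) : Y.T.S 2 → ℂ)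
      ((∑ i, x i • z' i : Y'.T.Z2) : Y'.T.S 2 → ℂ) := by
  intro s
  rw [Submodule.coe_sum, Submodule.coe_sum, Finset.sum_apply, Finset.sum_apply]
  refine Finset.sum_congr rfl fun i _ => ?_
  change x i * _ = x i * _
  rw [h i s]

/-- The version for an arbitrary basis: acyclicity must be compared without assuming that the first
cohomology vanishes. -/
theorem exists_basis_extension (N : M.Numbering) {I : Type} [Fintype I]
    (e : Module.Basis I ℂ Y.T.Z2) : ∃ e' : Module.Basis (I ⊕ Unit) ℂ Y'.T.Z2,
      (∀ i, M.Extends (e i) (e' (Sum.inl i))) ∧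
      e' (Sum.inr ()) = Y'.T.edgeCocycle M.newEdge := by
  choose z hz hext using fun i => exists_extension N (e i).2
  let z' : I → Y'.T.Z2 := fun i => ⟨z i, hz i⟩
  have hne : Y'.T.edgeCocycle M.newEdge ≠ 0 :=
    (edgeCocycle_ne_zero_iff _).2 (edgeCob_newEdge_ne_zero N)
  have hli : LinearIndependent ℂ (Sum.elim z' fun _ : Unit => Y'.T.edgeCocycle M.newEdge) := by
    rw [Fintype.linearIndependent_iff]
    intro x hx
    rw [Fintype.sum_sum_type] at hx
    simp only [Sum.elim_inl, Sum.elim_inr, Finset.univ_unique, Finset.sum_singleton] at hx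
    have h1 := Extends.sum (z' := z') hext fun i => x (Sum.inl i)
    have h2 := (edgeCob_newEdge_extends (M := M)).smul (x (Sum.inr default))
    have h3 := h1.sub (c₂' := -(x (Sum.inr default) • Y'.T.edgeCob M.newEdge)) (c₂ := 0) (by
      intro s
      rw [Pi.neg_apply, h2 s]
      simp)
    have h4 : ((∑ i, x (Sum.inl i) • z' i : Y'.T.Z2) : Y'.T.S 2 → ℂ) -
        -(x (Sum.inr default) • Y'.T.edgeCob M.newEdge) = 0 := by
      rw [sub_neg_eq_add]
      exact congrArg Subtype.val hx
    rw [h4] at h3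
    have h5 := eq_zero_of_extends h3
    rw [sub_zero] at h5
    have h6 : ∑ i, x (Sum.inl i) • e i = 0 := Subtype.ext h5
    have h7 := Fintype.linearIndependent_iff.1 e.linearIndependent _ h6
    simp only [h7, zero_smul, Finset.sum_const_zero, zero_add] at hx
    have h8 := (smul_eq_zero.1 hx).resolve_right hne
    rintro (i | i)
    · exact h7 i
    · exact h8
  have hspan : ⊤ ≤ Submodule.span ℂ
      (Set.range (Sum.elim z' fun _ : Unit => Y'.T.edgeCocycle M.newEdge)) := by
    rintro c' -
    obtain ⟨c, hc, hcc⟩ := exists_restriction (M := M) c'.2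
    have h1 := Extends.sum (z' := z') hext fun i => e.repr ⟨c, hc⟩ i
    rw [e.sum_repr] at h1
    have h2 := hcc.sub h1
    rw [sub_self] at h2
    obtain ⟨r, hr⟩ := exists_smul_edgeCob N
      (c' := ((c' - ∑ i, e.repr ⟨c, hc⟩ i • z' i : Y'.T.Z2) : Y'.T.S 2 → ℂ)) (Submodule.coe_mem _) h2
    have h3 : c' - ∑ i, e.repr ⟨c, hc⟩ i • z' i = r • Y'.T.edgeCocycle M.newEdge := Subtype.ext hr
    rw [sub_eq_iff_eq_add] at h3
    rw [h3]
    refine Submodule.add_mem _ (Submodule.smul_mem _ _ (Submodule.subset_span ⟨Sum.inr (), rfl⟩))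
      (Submodule.sum_mem _ fun i _ => Submodule.smul_mem _ _
        (Submodule.subset_span ⟨Sum.inl i, rfl⟩))
  refine ⟨Module.Basis.mk hli hspan, fun i => ?_, ?_⟩
  · rw [Module.Basis.mk_apply]
    exact hext i
  · rw [Module.Basis.mk_apply]
    rfl

end Basis

end

/-! ### Determinants under the move -/

section

open Matrix OrderedComplex FirstMove

set_option linter.unusedSectionVars false

namespace FirstMove

variable {T T' : Triangulation} {M : FirstMove T T'} (N : M.Numbering)

/-- The columns on the tetrahedra of the new triangulation corresponding to given columns on the
tetrahedra of the old one. -/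
def extendCols {P : Type} [DecidableEq (T'.S 3)] (E : Matrix (T.S 3) P ℂ) :
    Matrix (T'.S 3) (P ⊕ (Fin 2 ⊕ Fin 2)) ℂ :=
  Matrix.of fun t => Sum.elim (fun p => pull (M := M) (fun t => E t p) t)
    fun i => if t = N.newTet (Sum.inr i) then 1 else 0

/-- The numbering of the rows of the bordered matrix of the new triangulation. -/
def rowEquiv : (T.S 3 ⊕ Unit) ⊕ (Unit ⊕ (Fin 2 ⊕ Fin 2)) ≃ T'.S 3 ⊕ Unit :=
  ((Equiv.sumAssoc _ _ _).trans ((Equiv.refl _).sumCongr (Equiv.sumComm _ _))).trans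
    ((Equiv.sumAssoc _ _ _).symm.trans (N.tetEquiv.sumCongr (Equiv.refl _)))

theorem lift_ne_newTet (t : T.S 3) (i : Unit ⊕ (Fin 2 ⊕ Fin 2)) : M.lift t ≠ N.newTet i := by
  intro h
  have : N.tetEquiv (Sum.inl t) = N.tetEquiv (Sum.inr i) := h
  exact absurd (N.tetEquiv.injective this) Sum.inl_ne_inr

theorem newTet_inner (i : Fin 2) : ∃ c, c ≠ M.a ∧ c ≠ M.b ∧
    N.newTet (Sum.inr (Sum.inr i)) = T'.d c M.u ∧ c = ![N.σ 2, N.σ 3] i := by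
  fin_cases i
  · exact ⟨N.σ 2, N.ne_a (by decide), N.ne_b (by decide), rfl, rfl⟩
  · exact ⟨N.σ 3, N.ne_a (by decide), N.ne_b (by decide), rfl, rfl⟩

end FirstMove

section Frame

variable {Y Y' : System} {M : FirstMove Y.T Y'.T}

/-- The coboundary of the new edge and the four added coordinate columns vanish on all old rows, so
the matrix is block triangular. The new diagonal part has the value β of the new edge and an
identity block. -/
theorem frameDet_extension (hM : Matched M) (N : M.Numbering) {I P : Type} [Fintype I] [Fintype P]
    [DecidableEq I] [DecidableEq P] [DecidableEq (Y.T.S 3)] [DecidableEq (Y'.T.S 3)]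
    (e : I → Y.T.Z2) (e' : I ⊕ Unit → Y'.T.Z2) (hext : ∀ i, M.Extends (e i) (e' (Sum.inl i)))
    (hnew : e' (Sum.inr ()) = Y'.T.edgeCocycle M.newEdge) (E : Matrix (Y.T.S 3) P ℂ)
    (k : I ⊕ P ≃ Y.T.S 3 ⊕ Unit) {s : Y'.T.S 2} (hs : ¬M.Inner s) :
    frameDet (((Equiv.sumSumSumComm I Unit P (Fin 2 ⊕ Fin 2)).trans
        (k.sumCongr (Equiv.refl _))).trans (rowEquiv N))
      (Y'.cocMat e') (Y'.valuesAt s e') (extendCols N E) =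
      frameDet k (Y.cocMat e) (Y.valuesAt (proj s hs) e) E *
        Y'.D.β (Y'.T.d (N.σ 4) M.u) (Y'.T.edgeCob M.newEdge) := by
  set W := frame (Y'.cocMat e') (Y'.valuesAt s e') (extendCols N E) with hW
  -- Rows and columns are regrouped into the old ones and the five new ones.
  set B : Matrix ((I ⊕ P) ⊕ (Unit ⊕ (Fin 2 ⊕ Fin 2))) ((I ⊕ P) ⊕ (Unit ⊕ (Fin 2 ⊕ Fin 2))) ℂ :=
    W.submatrix ((k.sumCongr (Equiv.refl _)).trans (rowEquiv N))
      (Equiv.sumSumSumComm I Unit P (Fin 2 ⊕ Fin 2)).symm with hB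
  have hnewβ : ∀ t, Y'.cocMat e' t (Sum.inr ()) = Y'.D.β t (Y'.T.edgeCob M.newEdge) := fun t => by
    change Y'.f2 (e' (Sum.inr ())) t = _
    rw [hnew]
    rfl
  have hnew0 : ∀ t, ¬M.Inner t → Y'.cocMat e' t (Sum.inr ()) = 0 := fun t ht => by
    rw [hnewβ, hM.beta (Submodule.zero_mem _) edgeCob_newEdge_extends ht]
    simp [EdgeOperators.β, tetEval]
  have h1 : frameDet (((Equiv.sumSumSumComm I Unit P (Fin 2 ⊕ Fin 2)).trans
        (k.sumCongr (Equiv.refl _))).trans (rowEquiv N))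
      (Y'.cocMat e') (Y'.valuesAt s e') (extendCols N E) = B.det := by
    rw [frameDet, ← Matrix.det_submatrix_equiv_self
      (Equiv.sumSumSumComm I Unit P (Fin 2 ⊕ Fin 2)) B]
    congr 1
    ext i j
    simp only [hB, Matrix.submatrix_apply, Equiv.symm_apply_apply, id_eq, Equiv.trans_apply]
    rfl
  have hrow : ∀ (x : Y.T.S 3 ⊕ Unit) (c : Unit ⊕ (Fin 2 ⊕ Fin 2)), W (rowEquiv N (Sum.inl x))
      ((Equiv.sumSumSumComm I Unit P (Fin 2 ⊕ Fin 2)).symm (Sum.inr c)) = 0 := by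
    rintro (t | r) (i | i)
    · exact hnew0 _ (not_inner_lift t)
    · exact if_neg (lift_ne_newTet N t _)
    · change ((e' (Sum.inr ())).1) s = 0
      rw [hnew]
      exact edgeCob_newEdge_extends.apply hs
    · rfl
  have hrow' : ∀ (x : Y.T.S 3 ⊕ Unit) (c : I ⊕ P), W (rowEquiv N (Sum.inl x))
      ((Equiv.sumSumSumComm I Unit P (Fin 2 ⊕ Fin 2)).symm (Sum.inl c)) =
      frame (Y.cocMat e) (Y.valuesAt (proj s hs) e) E x c := by
    rintro (t | r) (i | p)
    · change Y'.D.β (M.lift t) (e' (Sum.inl i)).1 = Y.D.β t (e i).1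
      rw [hM.beta (e i).2 (hext i) (not_inner_lift t), proj_lift]
    · exact pull_lift (M := M) (fun t => E t p) t
    · exact (hext i).apply hs
    · rfl
  have hblock : B = Matrix.fromBlocks ((frame (Y.cocMat e) (Y.valuesAt (proj s hs) e) E).submatrix k id)
      0 B.toBlocks₂₁ B.toBlocks₂₂ := by
    rw [← Matrix.fromBlocks_toBlocks B]
    congr 1
    · ext i j
      exact hrow' (k i) j
    · ext i j
      exact hrow (k i) j
  have h22 : B.toBlocks₂₂ = Matrix.fromBlocks
      (Matrix.of fun _ _ => Y'.D.β (Y'.T.d (N.σ 4) M.u) (Y'.T.edgeCob M.newEdge)) 0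
      B.toBlocks₂₂.toBlocks₂₁ (1 : Matrix (Fin 2 ⊕ Fin 2) (Fin 2 ⊕ Fin 2) ℂ) := by
    rw [← Matrix.fromBlocks_toBlocks B.toBlocks₂₂]
    congr 1
    · ext i j
      exact hnewβ _
    · ext i j
      have h2 : N.newTet (Sum.inl i) ≠ N.newTet (Sum.inr j) := fun h =>
        absurd (N.newTet_injective h) Sum.inl_ne_inr
      exact if_neg h2
    · ext i j
      have h2 : N.newTet (Sum.inr i) = N.newTet (Sum.inr j) ↔ i = j := by
        rw [N.newTet_injective.eq_iff, Sum.inr_injective.eq_iff]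
      rw [Matrix.one_apply]
      change (if N.newTet (Sum.inr i) = N.newTet (Sum.inr j) then (1 : ℂ) else 0) = _
      simp only [h2]
  rw [h1, hblock, Matrix.det_fromBlocks_zero₁₂, h22, Matrix.det_fromBlocks_zero₁₂, Matrix.det_one,
    mul_one, Matrix.det_unique (n := Unit)]
  rfl

/-- The minor of the matrix of the pentachoron which enters in its weight. -/
def pillowMinor (N : M.Numbering) : ℂ :=
  Y'.F M.u (N.σ 1) (N.σ 3) * Y'.F M.u (N.σ 0) (N.σ 2) -
    Y'.F M.u (N.σ 1) (N.σ 2) * Y'.F M.u (N.σ 0) (N.σ 3)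

/-- Let P be the old columns, X the copies of tetrahedra in `v`, and C the two inner tetrahedra. The
blocks PC and CC vanish, since the rows of C see only differences between doubled faces; the block
PP is the old matrix, and the blocks XC and CX have the pillow minor as determinant. -/
theorem det_extension (hM : Matched M) (N : M.Numbering) {P : Type} [Fintype P] [DecidableEq P]
    [DecidableEq (Y'.T.S 3)] (E : Matrix (Y.T.S 3) P ℂ) :
    ((extendCols N E).transpose * Y'.f3Matrix * extendCols N E).det =
      (E.transpose * Y.f3Matrix * E).det * pillowMinor N ^ 2 := by
  set E' := extendCols N E with hE
  set A := E'.transpose * Y'.f3Matrix * E' with hA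
  let col : P ⊕ (Fin 2 ⊕ Fin 2) → Y'.T.S 3 → ℂ := fun p t => E' t p
  have hA1 : ∀ p q, A p q = col p ⬝ᵥ Y'.f3Matrix *ᵥ col q := by
    intro p q
    rw [hA, Matrix.mul_assoc]
    rfl
  have hanti : ∀ p q, A p q = -A q p := fun p q => by
    rw [hA1, hA1]
    exact Y'.f3Matrix_dot_anti _ _
  have hcolP : ∀ p, col (Sum.inl p) = pull (M := M) fun t => E t p := fun p => rfl
  have hdot : ∀ (i : Fin 2 ⊕ Fin 2) (y : Y'.T.S 3 → ℂ),
      col (Sum.inr i) ⬝ᵥ y = y (N.newTet (Sum.inr i)) := by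
    intro i y
    have : col (Sum.inr i) = Pi.single (N.newTet (Sum.inr i)) 1 := by
      funext t
      rw [Pi.single_apply]
      rfl
    rw [this, single_dotProduct, one_mul]
  have hval : ∀ (i j : Unit ⊕ (Fin 2 ⊕ Fin 2)) , N.newTet i = N.newTet j ↔ i = j := fun i j =>
    N.newTet_injective.eq_iff
  have hlow : ∀ (j : Fin 2) q, A (Sum.inr (Sum.inr j)) q =
      Y'.F M.u (![N.σ 2, N.σ 3] j) M.a * (col q (Y'.T.d M.a M.u) - col q (Y'.T.d M.a M.v)) +
      Y'.F M.u (![N.σ 2, N.σ 3] j) M.b * (col q (Y'.T.d M.b M.u) - col q (Y'.T.d M.b M.v)) := by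
    intro j q
    obtain ⟨c, ha, hb, hc, hcj⟩ := newTet_inner N j
    rw [hA1, hdot, hc, hM.mulVec_inner _ ha hb, hcj]
  have hPC : ∀ j p, A (Sum.inr (Sum.inr j)) (Sum.inl p) = 0 := by
    intro j p
    rw [hlow, hcolP, pull_d_u_v, pull_d_u_v]
    ring
  have hu : ∀ (i : Fin 2 ⊕ Fin 2) {c : Fin 5} (h : c = M.a ∨ c = M.b),
      col (Sum.inr i) (Y'.T.d c M.u) = 0 := by
    intro i c h
    refine if_neg fun h1 => ?_
    rcases i with i | i
    · have h2 : M.Second (Y'.T.d c M.u) := by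
        rw [h1]
        fin_cases i
        · exact Numbering.second_d _ (Or.inl N.zero)
        · exact Numbering.second_d _ (Or.inr N.one)
      obtain ⟨g, h3, h4⟩ := h2
      have h5 := eq_of_res_eq h3
      rw [← h5] at h3
      exact d_u_ne_d_v h h3
    · obtain ⟨x, ha, hb, hc, -⟩ := newTet_inner N i
      exact not_inner_d_u h (by rw [h1, hc]; exact inner_d_u ha hb)
  have hav : Y'.T.d M.a M.v = N.newTet (Sum.inr (Sum.inl 0)) := by
    rw [← N.zero]
    rfl
  have hbv : Y'.T.d M.b M.v = N.newTet (Sum.inr (Sum.inl 1)) := by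
    rw [← N.one]
    rfl
  have hv : ∀ (i j : Fin 2 ⊕ Fin 2), col (Sum.inr i) (N.newTet (Sum.inr j)) =
      if j = i then 1 else 0 := by
    intro i j
    change (if N.newTet (Sum.inr j) = N.newTet (Sum.inr i) then (1 : ℂ) else 0) = _
    simp only [hval, Sum.inr.injEq]
  have hCC : ∀ j j', A (Sum.inr (Sum.inr j)) (Sum.inr (Sum.inr j')) = 0 := by
    intro j j'
    rw [hlow, hu _ (Or.inl rfl), hu _ (Or.inr rfl), hav, hbv, hv, hv]
    simp
  have hCX : ∀ j i, A (Sum.inr (Sum.inr j)) (Sum.inr (Sum.inl i)) =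
      -Y'.F M.u (![N.σ 2, N.σ 3] j) (![M.a, M.b] i) := by
    intro j i
    rw [hlow, hu _ (Or.inl rfl), hu _ (Or.inr rfl), hav, hbv, hv, hv]
    fin_cases i <;> simp
  -- Exchanging the columns X and C makes the matrix block triangular; the permutation is a product
  -- of two transpositions, so it is even.
  let π : Equiv.Perm (P ⊕ (Fin 2 ⊕ Fin 2)) :=
    (Equiv.refl P).sumCongr (Equiv.sumComm (Fin 2) (Fin 2))
  have hsign : Equiv.Perm.sign π = 1 := by
    have h1 : π = Equiv.Perm.sumCongr (1 : Equiv.Perm P) (Equiv.sumComm (Fin 2) (Fin 2)) := rfl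
    rw [h1, Equiv.Perm.sign_sumCongr, Equiv.Perm.sign_one, one_mul]
    decide
  have hdet : A.det = (A.submatrix id π).det := by
    rw [Matrix.det_permute', hsign]
    simp
  let ρ := Equiv.sumAssoc P (Fin 2) (Fin 2)
  rw [hdet, ← Matrix.det_submatrix_equiv_self ρ]
  set B := (A.submatrix id π).submatrix ρ ρ with hB
  have hB1 : B = Matrix.fromBlocks B.toBlocks₁₁ B.toBlocks₁₂ 0 B.toBlocks₂₂ := by
    rw [← Matrix.fromBlocks_toBlocks B]
    congr 1
    ext j q
    rcases q with p | q
    · exact hPC j p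
    · exact hCC j q
  have hB2 : B.toBlocks₁₁ = Matrix.fromBlocks (E.transpose * Y.f3Matrix * E) 0
      B.toBlocks₁₁.toBlocks₂₁ B.toBlocks₁₁.toBlocks₂₂ := by
    rw [← Matrix.fromBlocks_toBlocks B.toBlocks₁₁]
    congr 1
    · ext p q
      have h1 := hA1 (Sum.inl p) (Sum.inl q)
      rw [hcolP, hcolP, hM.pull_dot_pull] at h1
      refine Eq.trans h1 ?_
      rw [Matrix.mul_assoc]
      rfl
    · ext p j
      change A (Sum.inl p) (Sum.inr (Sum.inr j)) = 0
      rw [hanti, hPC, neg_zero]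
  have hG : B.toBlocks₁₁.toBlocks₂₂.det = pillowMinor N := by
    have h1 : ∀ i j, B.toBlocks₁₁.toBlocks₂₂ i j = Y'.F M.u (![N.σ 2, N.σ 3] j) (![M.a, M.b] i) := by
      intro i j
      change A (Sum.inr (Sum.inl i)) (Sum.inr (Sum.inr j)) = _
      rw [hanti, hCX, neg_neg]
    have hs : ∀ i j, Y'.F M.u i j = -Y'.F M.u j i := fun i j =>
      congrFun (congrFun (Y'.skew M.u) j) i
    rw [Matrix.det_fin_two, h1, h1, h1, h1, pillowMinor, N.zero, N.one]
    simp only [Matrix.cons_val_zero, Matrix.cons_val_one]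
    rw [hs (N.σ 2), hs (N.σ 3), hs (N.σ 2), hs (N.σ 3)]
    ring
  have hG' : B.toBlocks₂₂.det = pillowMinor N := by
    have h1 : ∀ i j, B.toBlocks₂₂ i j = -Y'.F M.u (![N.σ 2, N.σ 3] i) (![M.a, M.b] j) := by
      intro i j
      exact hCX i j
    have hs : ∀ i j, Y'.F M.u i j = -Y'.F M.u j i := fun i j =>
      congrFun (congrFun (Y'.skew M.u) j) i
    rw [Matrix.det_fin_two, h1, h1, h1, h1, pillowMinor, N.zero, N.one]
    simp only [Matrix.cons_val_zero, Matrix.cons_val_one]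
    rw [hs (N.σ 2), hs (N.σ 3), hs (N.σ 2), hs (N.σ 3)]
    ring
  rw [hB1, Matrix.det_fromBlocks_zero₂₁, hB2, Matrix.det_fromBlocks_zero₁₂, hG, hG']
  ring

end Frame

end

/-! ### Acyclicity and torsion under the move -/

section

open Matrix OrderedComplex FirstMove

namespace System

variable (Y : System)

theorem exists_frame (s : Y.T.S 2) {I : Type} [Fintype I] [DecidableEq I] [DecidableEq (Y.T.S 3)]
    (hker : ∀ z : Y.T.Z2, Y.f2 z = 0 → ∃ l : ℂ, z = l • ⟨Y.C.ω, Y.C.cocycle⟩)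
    (e : Module.Basis I ℂ Y.T.Z2) :
    ∃ (R : Finset (Y.T.S 3)) (k : I ⊕ {t : Y.T.S 3 // t ∉ R} ≃ Y.T.S 3 ⊕ Unit),
      frameDet k (Y.cocMat e) (Y.valuesAt s e) (coordCols R) ≠ 0 := by
  set c := e.repr ⟨Y.C.ω, Y.C.cocycle⟩ with hc
  have hc0 : c ≠ 0 := fun h0 => Y.ω_ne_zero s (e.repr.injective (by rw [← hc, h0, map_zero]))
  obtain ⟨j, hj⟩ := Finsupp.ne_iff.1 hc0
  have hker' : ∀ x, Y.cocMat e *ᵥ x = 0 → ∃ l : ℂ, x = l • ⇑c := by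
    intro x hx
    rw [cocMat_mulVec] at hx
    obtain ⟨l, hl⟩ := hker _ hx
    refine ⟨l, funext fun i => ?_⟩
    have := congrArg (fun z => e.repr z i) hl
    rw [e.repr_sum_self, map_smul, ← hc] at this
    exact this
  obtain ⟨R, r, hr⟩ := exists_minor (Y.cocMat e) c j hj hker'
  obtain ⟨k, hk⟩ := exists_frameDet_coordCols (Y.cocMat e) (Y.valuesAt s e) _
    (Y.cocMat_repr_ω e) j R r
  refine ⟨R, k, fun h0 => ?_⟩
  rw [h0, mul_zero] at hk
  exact mul_ne_zero (Y.valuesAt_repr_ω s e) hr hk.symm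

end System

section Pillow

variable {Y Y' : System} {M : FirstMove Y.T Y'.T}

theorem labFace_eq_newEdge (N : M.Numbering) : Y'.labFace M.u N.σ {0, 1} rfl = M.newEdge := by
  have hc : ({N.σ 0, N.σ 1} : Finset (Fin 5)).card = 1 + 1 := Finset.card_pair (N.ne (by decide))
  rw [Y'.labFace_edge M.u N.σ hc]
  exact face_congr M.u (by rw [N.zero, N.one])

theorem labFace_v_eq_newEdge (N : M.Numbering) : Y'.labFace M.v N.σ {0, 1} rfl = M.newEdge := by
  have hc : ({N.σ 0, N.σ 1} : Finset (Fin 5)).card = 1 + 1 := Finset.card_pair (N.ne (by decide))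
  rw [Y'.labFace_edge M.v N.σ hc]
  refine eq_newEdge ?_
  change M.Inner (Y'.T.res _ _)
  rw [inner_res_v, Finset.range_orderEmbOfFin, N.zero, N.one]
  simp

theorem betaEdge_u (N : M.Numbering) :
    Y'.betaEdge M.u N.σ = Y'.D.β (Y'.T.d (N.σ 4) M.u) (Y'.T.edgeCob M.newEdge) := by
  rw [System.betaEdge, labFace_eq_newEdge]

theorem betaEdge_v (N : M.Numbering) : Y'.betaEdge M.v N.σ = Y'.betaEdge M.u N.σ := by
  rw [System.betaEdge, System.betaEdge, labFace_eq_newEdge, labFace_v_eq_newEdge,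
    M.glued _ (N.ne_a (by decide)) (N.ne_b (by decide))]

theorem pillowMinor_ne_zero (N : M.Numbering) (hβ : Y'.betaEdge M.u N.σ ≠ 0) :
    pillowMinor (Y := Y) (Y' := Y') N ≠ 0 := by
  intro h0
  have h := Y'.H_denominator M.u N.σ N.even N.lt
  change pillowMinor (Y := Y) (Y' := Y') N * _ = _ at h
  rw [h0, zero_mul] at h
  have : Y'.betaEdge M.u N.σ * Y'.rho M.u (N.σ 3) (N.σ 4) * Y'.rho M.u (N.σ 2) (N.σ 4) *
      Y'.rho M.u (N.σ 2) (N.σ 3) * Y'.rho M.u (N.σ 0) (N.σ 1) ≠ 0 := by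
    simp [hβ, Y'.rho_ne_zero]
  exact this h.symm

/-- A kernel vector supported on two inner tetrahedra is paired with the rows of these tetrahedra;
the coefficients form the pillow minor, which is non-zero. -/
theorem Matched.eq_zero_of_mulVec (hM : Matched M) (N : M.Numbering)
    (hβ : Y'.betaEdge M.u N.σ ≠ 0) {y : Y'.T.S 3 → ℂ} (hy : Y'.f3Matrix *ᵥ y = 0)
    (hout : ∀ t, ¬M.Inner t → y t = 0) (h4 : y (Y'.T.d (N.σ 4) M.u) = 0) : y = 0 := by
  classical
  have hdot : ∀ x, y (Y'.T.d (N.σ 2) M.u) * (Y'.f3Matrix *ᵥ x) (Y'.T.d (N.σ 2) M.u) +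
      y (Y'.T.d (N.σ 3) M.u) * (Y'.f3Matrix *ᵥ x) (Y'.T.d (N.σ 3) M.u) = 0 := by
    intro x
    have h1 := Y'.f3Matrix_dot_anti y x
    rw [hy, dotProduct_zero, neg_zero] at h1
    change ∑ t, y t * (Y'.f3Matrix *ᵥ x) t = 0 at h1
    rw [sum_tetrahedra N, h4, hout _ (not_inner_d_v (Or.inl N.zero)),
      hout _ (not_inner_d_v (Or.inr N.one)), Finset.sum_eq_zero fun t _ => by
        rw [hout _ (not_inner_lift t), zero_mul]] at h1
    linear_combination h1
  have hval : ∀ x : Y'.T.S 3 → ℂ, y (Y'.T.d (N.σ 2) M.u) *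
      (Y'.F M.u (N.σ 2) M.a * (x (Y'.T.d M.a M.u) - x (Y'.T.d M.a M.v)) +
      Y'.F M.u (N.σ 2) M.b * (x (Y'.T.d M.b M.u) - x (Y'.T.d M.b M.v))) +
      y (Y'.T.d (N.σ 3) M.u) *
      (Y'.F M.u (N.σ 3) M.a * (x (Y'.T.d M.a M.u) - x (Y'.T.d M.a M.v)) +
      Y'.F M.u (N.σ 3) M.b * (x (Y'.T.d M.b M.u) - x (Y'.T.d M.b M.v))) = 0 := by
    intro x
    rw [← hM.mulVec_inner x (N.ne_a (by decide)) (N.ne_b (by decide)),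
      ← hM.mulVec_inner x (N.ne_a (by decide)) (N.ne_b (by decide))]
    exact hdot x
  have n1 : Y'.T.d M.a M.v ≠ Y'.T.d M.a M.u := M.doubled_a.symm
  have n2 : Y'.T.d M.b M.v ≠ Y'.T.d M.b M.u := M.doubled_b.symm
  have n3 : Y'.T.d M.a M.v ≠ Y'.T.d M.b M.u := fun h => M.a_ne_b (eq_of_d_eq h.symm).symm
  have n4 : Y'.T.d M.b M.v ≠ Y'.T.d M.a M.u := fun h => M.a_ne_b (eq_of_d_eq h.symm)
  have n5 : Y'.T.d M.a M.v ≠ Y'.T.d M.b M.v := fun h => M.a_ne_b (d_injective M.v h)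
  -- The indicators of the two doubled tetrahedra in `v` give two equations for the two unknown
  -- values.
  have ha := hval (Pi.single (Y'.T.d M.a M.v) 1)
  have hb := hval (Pi.single (Y'.T.d M.b M.v) 1)
  simp only [Pi.single_apply, n1.symm, n2.symm, n3.symm, n4.symm, n5, n5.symm, if_true, if_false,
    sub_zero, mul_zero, zero_add, add_zero, zero_sub] at ha hb
  have hs : ∀ i j, Y'.F M.u i j = -Y'.F M.u j i := fun i j =>
    congrFun (congrFun (Y'.skew M.u) j) i
  rw [hs (N.σ 2), hs (N.σ 3), ← N.zero] at ha
  rw [hs (N.σ 2), hs (N.σ 3), ← N.one] at hb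
  have hm := pillowMinor_ne_zero (Y := Y) N hβ
  have y2 : y (Y'.T.d (N.σ 2) M.u) = 0 := by
    refine mul_left_cancel₀ hm ?_
    rw [pillowMinor]
    linear_combination Y'.F M.u (N.σ 1) (N.σ 3) * ha - Y'.F M.u (N.σ 0) (N.σ 3) * hb
  have y3 : y (Y'.T.d (N.σ 3) M.u) = 0 := by
    refine mul_left_cancel₀ hm ?_
    rw [pillowMinor]
    linear_combination Y'.F M.u (N.σ 0) (N.σ 2) * hb - Y'.F M.u (N.σ 1) (N.σ 2) * ha
  funext t
  by_cases ht : M.Inner t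
  · rcases inner_or_second_three (Or.inl ht) with ⟨c, hca, hcb, rfl⟩ | rfl | rfl
    · rcases N.cases c with h | h | rfl | rfl | rfl
      · exact absurd h hca
      · exact absurd h hcb
      · exact y2
      · exact y3
      · exact h4
    · exact absurd ht (not_inner_d_v (Or.inl rfl))
    · exact absurd ht (not_inner_d_v (Or.inr rfl))
  · exact hout t ht

theorem Matched.beta_newEdge_outer (hM : Matched M) {t : Y'.T.S 3} (ht : ¬M.Inner t) :
    Y'.D.β t (Y'.T.edgeCob M.newEdge) = 0 := by
  rw [hM.beta (Submodule.zero_mem _) edgeCob_newEdge_extends ht]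
  simp [EdgeOperators.β, tetEval]

/-- The part of acyclicity of the old complex needed before any bordered determinant for it is known
to be non-zero. -/
theorem Matched.ker_f2 (hM : Matched M) (N : M.Numbering) (hβ : Y'.betaEdge M.u N.σ ≠ 0)
    (hker : ∀ z : Y'.T.Z2, Y'.f2 z = 0 → ∃ l : ℂ, z = l • ⟨Y'.C.ω, Y'.C.cocycle⟩) (z : Y.T.Z2)
    (hz : Y.f2 z = 0) : ∃ l : ℂ, z = l • ⟨Y.C.ω, Y.C.cocycle⟩ := by
  obtain ⟨c', hc', hext⟩ := exists_extension N z.2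
  rw [betaEdge_u] at hβ
  let z' : Y'.T.Z2 := ⟨c', hc'⟩
  -- A multiple of the coboundary of the new edge is subtracted so that the image under f₂ vanishes
  -- on one inner tetrahedron. That image lies in the kernel of f₃, so it is zero by
  -- `eq_zero_of_mulVec`.
  let r : ℂ := Y'.f2 z' (Y'.T.d (N.σ 4) M.u) /
    Y'.D.β (Y'.T.d (N.σ 4) M.u) (Y'.T.edgeCob M.newEdge)
  let z'' : Y'.T.Z2 := z' - r • Y'.T.edgeCocycle M.newEdge
  have hval : ∀ t, Y'.f2 z'' t = Y'.f2 z' t - r * Y'.D.β t (Y'.T.edgeCob M.newEdge) := fun t => by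
    simp only [z'']
    rw [map_sub, map_smul]
    rfl
  have h0 : Y'.f2 z'' = 0 := by
    refine hM.eq_zero_of_mulVec N (by rwa [betaEdge_u]) (Y'.f3Matrix_mulVec_f2 z'')
      (fun t ht => ?_) ?_
    · rw [hval, hM.beta_newEdge_outer ht, mul_zero, sub_zero]
      exact (hM.beta z.2 hext ht).trans (congrFun hz _)
    · rw [hval]
      simp only [r]
      rw [div_mul_cancel₀ _ hβ, sub_self]
  obtain ⟨l, hl⟩ := hker z'' h0
  have h1 : M.Extends z.1 z''.1 := by
    have := hext.sub ((edgeCob_newEdge_extends (M := M)).smul r)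
    rwa [smul_zero, sub_zero] at this
  have h2 := hM.ω.smul l
  rw [hl] at h1
  exact ⟨l, Subtype.ext (h1.eq_of_extends h2)⟩

/-- Both the bordered determinant and the middle determinant change by non-zero factors, so their
non-vanishing is common to the two complexes. -/
theorem Matched.acyclic_iff (hM : Matched M) (N : M.Numbering) (hβ : Y'.betaEdge M.u N.σ ≠ 0)
    {s : Y'.T.S 2} (hs : ¬M.Inner s) : Y.Acyclic ↔ Y'.Acyclic := by
  classical
  let e := Module.finBasis ℂ Y.T.Z2
  obtain ⟨e', hext, hnew⟩ := exists_basis_extension (Y' := Y') N e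
  have hframe : ∀ (R : Finset (Y.T.S 3)) k, frameDet k (Y.cocMat e)
      (Y.valuesAt (proj s hs) e) (coordCols R) ≠ 0 → (Y.Acyclic ↔ Y'.Acyclic) := by
    intro R k hk
    have h1 := frameDet_extension hM N e e' hext hnew (coordCols R) k hs
    have h2 := det_extension hM N (coordCols R)
    have h3 : frameDet k (Y.cocMat e) (Y.valuesAt (proj s hs) e) (coordCols R) *
        Y'.D.β (Y'.T.d (N.σ 4) M.u) (Y'.T.edgeCob M.newEdge) ≠ 0 :=
      mul_ne_zero hk (by rwa [← betaEdge_u])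
    rw [← h1] at h3
    have hm := pow_ne_zero 2 (pillowMinor_ne_zero (Y := Y) N hβ)
    constructor
    · intro hY
      exact System.acyclic_of_frame h3 (by
        rw [h2]
        exact mul_ne_zero (hY.det_ne_zero hk) hm)
    · intro hY'
      have h4 := hY'.det_ne_zero h3
      rw [h2] at h4
      exact System.acyclic_of_frame hk (left_ne_zero_of_mul h4)
  constructor
  · intro hY
    obtain ⟨R, k, hk⟩ := Y.exists_frame (proj s hs) ((Y.acyclic_iff (proj s hs)).1 hY).1 e
    exact (hframe R k hk).1 hY
  · intro hY'
    obtain ⟨R, k, hk⟩ := Y.exists_frame (proj s hs)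
      (hM.ker_f2 N hβ ((Y'.acyclic_iff s).1 hY').1) e
    exact (hframe R k hk).2 hY'

/-- The ratio is the square of the middle factor over the bordered factor. The 2-face used for
bordering lies outside the pillow, so `ω s` is unchanged. -/
theorem Matched.isTorsionSq (hM : Matched M) (N : M.Numbering) (hβ : Y'.betaEdge M.u N.σ ≠ 0)
    {κ : Type} [Fintype κ] {h : Module.Basis κ ℂ Y.T.H2} {h' : Module.Basis κ ℂ Y'.T.H2}
    (hh : M.SameBasis h h') {s : Y'.T.S 2} (hs : ¬M.Inner s) {y : ℂ}
    (hy : Y.IsTorsionSq (proj s hs) h y) :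
    Y'.IsTorsionSq s h' (y * (pillowMinor (Y := Y) (Y' := Y') N / Y'.betaEdge M.u N.σ) ^ 2) := by
  classical
  obtain ⟨A, e, P, _, E, k, he, h1, h2, rfl⟩ := hy
  obtain ⟨A', e', ι, he', hext, hnew⟩ := exists_distinguished_extension N hh he
  -- The same basis numbered as old elements followed by the new edge, the form required by
  -- `frameDet_extension`.
  let e₁ := e'.reindex ι.symm
  have he₁ : ∀ i, e₁ i = e' (ι i) := fun i => by
    simp only [e₁]
    rw [Module.Basis.reindex_apply, Equiv.symm_symm]
  have f1 := frameDet_extension hM N e e₁ (fun i => by rw [he₁]; exact hext i)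
    (by rw [he₁]; exact hnew) E k hs
  have f2 := det_extension hM N E
  rw [← betaEdge_u] at f1
  set k₁ := ((Equiv.sumSumSumComm ({b : Y.T.S 1 // b ∉ A} ⊕ κ) Unit P (Fin 2 ⊕ Fin 2)).trans
        (k.sumCongr (Equiv.refl _))).trans (rowEquiv N) with hk₁
  have hdet : (e₁.toMatrix (e' ∘ ι)).det ^ 2 = 1 := by
    have : e' ∘ ι = e₁ := funext fun i => (he₁ i).symm
    rw [this, Module.Basis.toMatrix_self, Matrix.det_one, one_pow]
  let k' := (ι.symm.sumCongr (Equiv.refl (P ⊕ (Fin 2 ⊕ Fin 2)))).trans k₁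
  obtain ⟨g1, g2⟩ := System.torsionSq_basis (s := s) (e := e₁) (E := extendCols N E) (k := k₁) e' ι
    hdet k'
  have h1' : frameDet k₁ (Y'.cocMat e₁) (Y'.valuesAt s e₁) (extendCols N E) ≠ 0 := by
    rw [f1]
    exact mul_ne_zero (by convert h1) hβ
  refine ⟨A', e', P ⊕ (Fin 2 ⊕ Fin 2), inferInstance, extendCols N E, k', he', ?_, ?_, ?_⟩
  · intro h0
    have h0' : frameDet k' (Y'.cocMat e') (Y'.valuesAt s e') (extendCols N E) = 0 := by
      convert h0
    rw [h0', zero_pow two_ne_zero] at g2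
    exact pow_ne_zero 2 h1' g2.symm
  · have h3 : ((extendCols N E).transpose * Y'.f3Matrix * extendCols N E).det ≠ 0 := by
      rw [f2]
      exact mul_ne_zero (by convert h2) (pow_ne_zero 2 (pillowMinor_ne_zero N hβ))
    convert h3
  · have h3 : Y.torsionSq (proj s hs) e E k *
        (pillowMinor (Y := Y) (Y' := Y') N / Y'.betaEdge M.u N.σ) ^ 2 =
        Y'.torsionSq s e' (extendCols N E) k' := by
      rw [g1, System.torsionSq, System.torsionSq, f1, f2, hM.ω.apply hs]
      have h4 : frameDet k (Y.cocMat e) (Y.valuesAt (proj s hs) e) E ≠ 0 := by convert h1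
      field_simp
    convert h3

end Pillow

end

/-! ### The local factors, and matching of the structures -/

section

open Matrix OrderedComplex FirstMove

section Factor

variable {Y Y' : System} {M : FirstMove Y.T Y'.T}

namespace Matched

theorem q_tri (hM : Matched M) {u : Y'.T.S 4} (hu : ¬M.Inner u) (σ : Equiv.Perm (Fin 5))
    (s : Finset (Fin 5)) (hs : s.card = 2 + 1) :
    Y'.C.q (Y'.labFace u σ s hs) = Y.C.q (Y.labFace (proj u hu) σ s hs) := by
  have h := hM.q.apply (x := Y'.labFace u σ s hs) (not_inner_res _ hu)
  rw [h]
  congr 1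
  exact proj_res _ hu

theorem betaEdge_outer (hM : Matched M) {u : Y'.T.S 4} (hu : ¬M.Inner u)
    (σ : Equiv.Perm (Fin 5)) : Y'.betaEdge u σ = Y.betaEdge (proj u hu) σ := by
  have h1 : Y'.labFace u σ {0, 1} rfl = M.lift (Y.labFace (proj u hu) σ {0, 1} rfl) :=
    (lift_eq_iff (not_inner_res _ hu)).2 (proj_res _ hu)
  rw [System.betaEdge, System.betaEdge, h1,
    hM.beta (edgeCob_mem _) (edgeCob_extends _) (not_inner_d _ hu), proj_d (σ 4) hu]

theorem Hval_outer (hM : Matched M) {u : Y'.T.S 4} (hu : ¬M.Inner u) :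
    Y'.Hval u = Y.Hval (proj u hu) := by
  obtain ⟨σ, hσ, h0, h1, hb⟩ := Y.exists_betaEdge_ne_zero (proj u hu) 0 1 (by decide)
  have hlt : σ 0 < σ 1 := by rw [h0, h1]; decide
  rw [System.Hval_eq (proj u hu) σ hσ hlt hb,
    System.Hval_eq u σ hσ hlt (by rwa [hM.betaEdge_outer hu]), System.H, System.H,
    hM.betaEdge_outer hu, hM.F_outer hu, hM.q_tri hu σ {0, 1, 2} rfl,
    hM.q_tri hu σ {0, 1, 3} rfl, hM.q_tri hu σ {0, 1, 4} rfl, hM.q_tri hu σ {2, 3, 4} rfl]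

end Matched

theorem tri_u_eq_tri_v {p q : Fin 5} (hpq : p ≠ q) (ha : p ≠ M.a) (hb : p ≠ M.b) :
    Y'.T.tri M.u p q = Y'.T.tri M.v p q := by
  obtain ⟨g, h1, -, h3⟩ := exists_tri hpq
  rw [h3, h3, res_eq g ha hb fun ⟨i, hi⟩ => (h1 i).1 hi]

theorem Hval_u (N : M.Numbering) (hβ : Y'.betaEdge M.u N.σ ≠ 0) : Y'.Hval M.u =
    Y'.betaEdge M.u N.σ * Y'.C.q (Y'.T.tri M.u (N.σ 3) (N.σ 4)) *
      Y'.C.q (Y'.T.tri M.u (N.σ 2) (N.σ 4)) * Y'.C.q (Y'.T.tri M.u (N.σ 2) (N.σ 3)) *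
      Y'.C.q (Y'.T.tri M.u M.a M.b) / pillowMinor (Y := Y) (Y' := Y') N := by
  rw [System.Hval_eq M.u N.σ N.even N.lt hβ, System.H,
    Y'.labFace_three M.u N.σ {0, 1, 2} rfl 3 4 (by decide) (by decide),
    Y'.labFace_three M.u N.σ {0, 1, 3} rfl 2 4 (by decide) (by decide),
    Y'.labFace_three M.u N.σ {0, 1, 4} rfl 2 3 (by decide) (by decide),
    Y'.labFace_three M.u N.σ {2, 3, 4} rfl 0 1 (by decide) (by decide), N.zero, N.one,
    pillowMinor, N.zero, N.one]

theorem Matched.q_tri_a_b (hM : Matched M) :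
    Y'.C.q (Y'.T.tri M.u M.a M.b) = Y'.C.q (Y'.T.tri M.v M.a M.b) := by
  have hu : ¬M.Inner (Y'.T.tri M.u M.a M.b) :=
    Numbering.not_inner_tri_u M.a_ne_b (Or.inl rfl)
  have hv : ¬M.Inner (Y'.T.tri M.v M.a M.b) := Numbering.not_inner_tri_v
  rw [hM.q.apply hu, hM.q.apply hv]
  obtain ⟨g, -, -, h3⟩ := exists_tri M.a_ne_b
  congr 1
  simp only [h3] at hu hv ⊢
  exact proj_res_u_v g hu hv

/-- The minor is quadratic in `F`, so the opposite sign of the matrix is not seen; all the q agree,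
the two copies of the doubled face carrying the same old value. -/
theorem Matched.Hval_v (hM : Matched M) (N : M.Numbering) (hβ : Y'.betaEdge M.u N.σ ≠ 0) :
    Y'.Hval M.v = Y'.Hval M.u := by
  have h : ∀ i j, i ≠ j → i ≠ 0 → i ≠ 1 →
      Y'.T.tri M.v (N.σ i) (N.σ j) = Y'.T.tri M.u (N.σ i) (N.σ j) := fun i j hij h0 h1 =>
    (tri_u_eq_tri_v (N.ne hij) (N.ne_a h0) (N.ne_b h1)).symm
  rw [Hval_u (Y := Y) N hβ, System.Hval_eq M.v N.σ N.even N.lt (by rwa [betaEdge_v]), System.H,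
    Y'.labFace_three M.v N.σ {0, 1, 2} rfl 3 4 (by decide) (by decide),
    Y'.labFace_three M.v N.σ {0, 1, 3} rfl 2 4 (by decide) (by decide),
    Y'.labFace_three M.v N.σ {0, 1, 4} rfl 2 3 (by decide) (by decide),
    Y'.labFace_three M.v N.σ {2, 3, 4} rfl 0 1 (by decide) (by decide),
    h 3 4 (by decide) (by decide) (by decide), h 2 4 (by decide) (by decide) (by decide),
    h 2 3 (by decide) (by decide) (by decide), N.zero, N.one, ← hM.q_tri_a_b, betaEdge_v, hM.F_v,
    pillowMinor, N.zero, N.one]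
  simp only [Matrix.neg_apply, neg_mul_neg]

theorem Matched.prod_q (hM : Matched M) (N : M.Numbering) : ∏ s, (Y'.C.q s)⁻¹ =
    (∏ s, (Y.C.q s)⁻¹) * (Y'.C.q (Y'.T.tri M.u M.a M.b) *
      (Y'.C.q (Y'.T.tri M.u (N.σ 3) (N.σ 4)) * Y'.C.q (Y'.T.tri M.u (N.σ 2) (N.σ 4)) *
        Y'.C.q (Y'.T.tri M.u (N.σ 2) (N.σ 3))))⁻¹ := by
  rw [← Equiv.prod_comp N.triEquiv, Fintype.prod_sum_type, Fintype.prod_sum_type,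
    Fin.prod_univ_three]
  simp only [Finset.univ_unique, Finset.prod_singleton]
  rw [hM.q_tri_a_b]
  have h1 : ∀ s, (Y'.C.q (N.triEquiv (Sum.inl s)))⁻¹ = (Y.C.q s)⁻¹ := fun s => by
    change (Y'.C.q (M.lift s))⁻¹ = _
    rw [hM.q.apply (not_inner_lift s), proj_lift]
  simp only [h1, mul_inv]
  rfl

/-- The square of the new q⁻¹ contains each of four q twice, and the two pillow weights contain the
same four q once each. Only the ratio of β to the minor remains, squared. -/
theorem Matched.factorSq (hM : Matched M) (N : M.Numbering) (hβ : Y'.betaEdge M.u N.σ ≠ 0) :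
    Y'.factorSq * (pillowMinor (Y := Y) (Y' := Y') N / Y'.betaEdge M.u N.σ) ^ 2 = Y.factorSq := by
  have h1 : ∏ w, Y'.Hval w = (∏ w, Y.Hval w) * (Y'.Hval M.u * Y'.Hval M.u) := by
    rw [← Equiv.prod_comp M.pentEquiv, Fintype.prod_sum_type, Fintype.prod_bool]
    have h2 : ∀ w, Y'.Hval (M.pentEquiv (Sum.inl w)) = Y.Hval w := fun w => by
      change Y'.Hval (M.lift w) = _
      rw [hM.Hval_outer (not_inner_lift w), proj_lift]
    have h3 : Y'.Hval (M.pentEquiv (Sum.inr false)) = Y'.Hval M.u := hM.Hval_v N hβ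
    simp only [h2, h3]
    rfl
  have hm := pillowMinor_ne_zero (Y := Y) N hβ
  rw [System.factorSq, System.factorSq, h1, hM.prod_q N, Hval_u (Y := Y) N hβ]
  have q1 := Y'.C.q_ne_zero (Y'.T.tri M.u M.a M.b)
  have q2 := Y'.C.q_ne_zero (Y'.T.tri M.u (N.σ 3) (N.σ 4))
  have q3 := Y'.C.q_ne_zero (Y'.T.tri M.u (N.σ 2) (N.σ 4))
  have q4 := Y'.C.q_ne_zero (Y'.T.tri M.u (N.σ 2) (N.σ 3))
  generalize ∏ s, (Y.C.q s)⁻¹ = a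
  generalize ∏ w, Y.Hval w = b
  field_simp

theorem Matched.exists_numbering (M : FirstMove Y.T Y'.T) :
    ∃ N : M.Numbering, Y'.betaEdge M.u N.σ ≠ 0 := by
  obtain ⟨σ, hσ, h0, h1, hb⟩ := Y'.exists_betaEdge_ne_zero M.u M.a M.b M.lt
  exact ⟨⟨σ, hσ, h0, h1⟩, hb⟩

theorem Matched.isInvariantValue_iff (hM : Matched M) {κ : Type} [Fintype κ]
    {h : Module.Basis κ ℂ Y.T.H2} {h' : Module.Basis κ ℂ Y'.T.H2} (hh : M.SameBasis h h') (x : ℂ) :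
    Y.IsInvariantValue h x ↔ Y'.IsInvariantValue h' x := by
  obtain ⟨N, hβ⟩ := exists_numbering (Y := Y) M
  have hs : ¬M.Inner (Y'.T.tri M.v M.a M.b) := Numbering.not_inner_tri_v
  set s := Y'.T.tri M.v M.a M.b
  rw [Y.isInvariantValue_iff (proj s hs), Y'.isInvariantValue_iff s, ← hM.factorSq N hβ]
  constructor
  · rintro ⟨y, hy, hx⟩
    exact ⟨_, hM.isTorsionSq N hβ hh hs hy, by rw [hx]; ring⟩
  · rintro ⟨y', hy', hx⟩
    -- Going back, a torsion of the old complex exists by acyclicity and vanishing of the first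
    -- cohomology. Its value is then forced by uniqueness on the new side.
    have hY := (hM.acyclic_iff N hβ hs).2 hy'.acyclic
    have hX := (h1Vanishes_iff N).2 hy'.h1Vanishes
    obtain ⟨rt, hrt⟩ := hY.exists_isSqrtTorsion hX (proj s hs) h
    have h1 := hrt.isTorsionSq (proj s hs)
    refine ⟨_, h1, ?_⟩
    rw [hx, (hM.isTorsionSq N hβ hh hs h1).unique hy']
    ring

end Factor

/-- Outside the pillow both systems factorize the same quadratic form with the same square root, so
their functionals differ by scales, which are gauged away. On inner tetrahedra any non-zero scale
will do. -/
theorem exists_matched_gauge {Y Y' : System} (M : FirstMove Y.T Y'.T)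
    (hω : M.Extends Y.C.ω Y'.C.ω) (hq : M.Extends Y.C.q Y'.C.q) :
    ∃ (l : Y'.T.S 3 → ℂ) (hl : ∀ t, l t ≠ 0),
      Matched (Y := Y) (Y' := System.gauge l hl) M := by
  have h : ∀ t : Y'.T.S 3, ∃ l : ℂ, l ≠ 0 ∧ ∀ ht : ¬M.Inner t,
      (∀ a, Y.D.bcoef (proj t ht) a - Y.D.bcoef (proj t ht) 3 =
        l * (Y'.D.bcoef t a - Y'.D.bcoef t 3)) ∧
      ∀ a, Y.D.gcoef (proj t ht) a - Y.D.gcoef (proj t ht) 3 =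
        l⁻¹ * (Y'.D.gcoef t a - Y'.D.gcoef t 3) := by
    intro t
    by_cases ht : M.Inner t
    · exact ⟨1, one_ne_zero, fun h => absurd ht h⟩
    · have hw : Y'.C.w t = Y.C.w (proj t ht) := by
        funext a
        rw [Coloring.w, Coloring.w, hω.apply (not_inner_d a ht), proj_d a ht]
      have hK : Y'.C.K t = Y.C.K (proj t ht) := by
        rw [Coloring.K, Coloring.K]
        refine Finset.prod_congr rfl fun a _ => ?_
        rw [hq.apply (not_inner_d a ht), proj_d a ht]
      have h1 := Y.D.isTetPair (proj t ht)
      rw [← hw, ← hK] at h1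
      obtain ⟨l, hl, hb, hg⟩ := IsTetPair.unique (Y'.C.w_ne_zero t) (Y'.C.K_sq t) (Y'.C.sum_w t)
        (Y'.D.isTetPair t) h1
      exact ⟨l, hl, fun _ => ⟨hb, hg⟩⟩
  choose l hl h using h
  refine ⟨l, hl, hω, hq, fun t ht a => ?_, fun t ht a => ?_⟩
  · rw [(h t ht).1 a]
    exact (mul_sub _ _ _).symm
  · rw [(h t ht).2 a]
    exact (mul_sub _ _ _).symm

end

end FreeFermion

end

theorem theorem6p3 (Y Y' : FreeFermion.System) (M : FreeFermion.FirstMove Y.T Y'.T)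
    (hω : M.Extends Y.C.ω Y'.C.ω) (hq : M.Extends Y.C.q Y'.C.q)
    {κ : Type} [Fintype κ] (h : Module.Basis κ ℂ Y.T.H2) (h' : Module.Basis κ ℂ Y'.T.H2)
    (hh : M.SameBasis h h') :
    (Y.Acyclic ↔ Y'.Acyclic) ∧
    (∀ x, Y.IsInvariantValue h x ↔ Y'.IsInvariantValue h' x) ∧
    (∀ x y, Y.IsInvariantValue h x → Y.IsInvariantValue h y → y = x ∨ y = -x) ∧
    (Y.Acyclic → Y.T.H1Vanishes → ∃ x, x ≠ 0 ∧ Y.IsInvariantValue h x) := by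
  -- After rescaling, the structures of the new system match the old ones; neither acyclicity nor
  -- the set of values of `I` notices the rescaling.
  obtain ⟨l, hl, hM⟩ := FreeFermion.exists_matched_gauge M hω hq
  obtain ⟨N, hβ⟩ := FreeFermion.Matched.exists_numbering (Y := Y)
    (Y' := FreeFermion.System.gauge l hl) M
  have hs : ¬M.Inner (Y'.T.tri M.v M.a M.b) := FreeFermion.FirstMove.Numbering.not_inner_tri_v
  set s := Y'.T.tri M.v M.a M.b
  set s₀ := FreeFermion.FirstMove.proj s hs
  refine ⟨?_, ?_, ?_, ?_⟩
  · rw [← FreeFermion.System.gauge_acyclic l hl s]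
    exact hM.acyclic_iff N hβ hs
  · intro x
    rw [← FreeFermion.System.gauge_isInvariantValue l hl s h' x]
    exact hM.isInvariantValue_iff hh x
  · intro x y hx hy
    obtain ⟨z, hz, hxz⟩ := (Y.isInvariantValue_iff s₀ h x).1 hx
    obtain ⟨z', hz', hyz⟩ := (Y.isInvariantValue_iff s₀ h y).1 hy
    rw [hz.unique hz', ← hxz] at hyz
    exact sq_eq_sq_iff_eq_or_eq_neg.1 hyz
  · intro hY hX
    obtain ⟨rt, hrt⟩ := hY.exists_isSqrtTorsion hX s₀ h
    have h1 := hrt.isTorsionSq s₀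
    obtain ⟨x, hx⟩ := IsAlgClosed.exists_pow_nat_eq (Y.factorSq * rt ^ 2) (n := 2) (by norm_num)
    refine ⟨x, ?_, (Y.isInvariantValue_iff s₀ h x).2 ⟨_, h1, hx⟩⟩
    rintro rfl
    rw [zero_pow two_ne_zero] at hx
    exact mul_ne_zero Y.factorSq_ne_zero h1.ne_zero hx.symm
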